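/- All manifolds are smooth, Hausdorff, second countable and without boundary. Let $(M^{2n+1},\xi=\ker\alpha)$ be a contact manifold with contact form $\alpha$, and let $\iota\colon Y^{n+1}\hookrightarrow M$ be a closed (compact, non-empty) embedded coisotropic submanifold (i.e. each $T_yY\cap\xi_y$ is a coisotropic subspace of $(\xi_y,d\alpha)$) with nonsingular Legendrian foliation: $\lambda:=\iota^*\alpha$ vanishes nowhere, and $\mathcal F=\ker\lambda$. Fix a smooth line field $L$ on $Y$ transverse to $\mathcal F$. Foliations are identified with their tangent distributions (integrable hyperplane fields). Use $L$ to identify $T^*\mathcal F\xrightarrow{\ \pi\ }Y$ with the bundle of covectors on $Y$ that vanish on $L$, and put $\eta_{(y,s)}=s\circ d\pi$. A *standard neighbourhood* of $Y$ is a relatively compact open set $N\supset Y$ in $M$ with a contactomorphism $\Theta$ from $(N,\xi)$ onto an open neighbourhood of the zero section in $(T^*\mathcal F,\ker(\pi^*\lambda-\eta))$ that maps each $y\in Y$ to $0\in T_y^*\mathcal F$. For a section $s$ of $T^*\mathcal F$ with graph in $\Theta(N)$ (regarded also as a one-form on $Y$ vanishing on $L$), let $Y_s\subset N$ be the preimage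 of its graph. Let $\mathcal C_N$ be the set of the coisotropic submanifolds of $M$ of the form $Y_s$, and $\mathcal D_N$ the set of the codimension-one foliations of $Y$ of the form $\ker(\lambda-s)$, with such $s$. Given a $C^1$-neighbourhood $\mathcal W$ of $\mathrm{id}_M$, *gauge equivalence* on $\mathcal C_N$ is the equivalence relation generated by: $Y_0\sim Y_1$ if there is a smooth contact isotopy $\phi_t$ of $M$, $t\in[0,1]$, with compact support in $N$, $\phi_0=\mathrm{id}$, $\phi_t\in\mathcal W$ and $\phi_t(Y_0)\in\mathcal C_N$ for all $t$, and $\phi_1(Y_0)=Y_1$. Given a $C^1$-neighbourhood $\mathcal W'$ of $\mathrm{id}_Y$, *gauge equivalence* on $\mathcal D_N$ is the equivalence relation generated by: $\mathcal G_0\sim\mathcal G_1$ if there is a smooth isotopy $\psi_t$ of $Y$, $t\in[0,1]$, with $\psi_0=\mathrm{id}$, $\psi_t\in\mathcal W'$ and $\psi_t(\mathcal G_0)\in\mathcal D_N$ for all $t$, and $\psi_1(\mathcal G_0)=\mathcal G_1$. Then $Y$ has standard neighbourhoods inside every open set containing $Y$, and for every standard neighbourhood $N$ the following hold. 1. Every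 coisotropic submanifold sufficiently $C^1$-close to $Y$ (i.e. the image of a coisotropic embedding $Y\to M$ that is $C^1$-close to $\iota$) belongs to $\mathcal C_N$, and so does its image under any contactomorphism of $M$ that is sufficiently $C^1$-close to the identity. Every codimension-one foliation sufficiently $C^1$-close to $\mathcal F$ (i.e. the kernel of a one-form $C^1$-close to $\lambda$) belongs to $\mathcal D_N$, and so does its image under any diffeomorphism of $Y$ that is sufficiently $C^1$-close to the identity. (So for such submanifolds, foliations and small isotopies the conditions $\phi_t(Y_0)\in\mathcal C_N$ and $\psi_t(\mathcal G_0)\in\mathcal D_N$ are automatic.) 2. There is a bijection $e\colon\mathcal C_N\to\mathcal D_N$ with $e(Y_s)=\ker(\lambda-s)$. A subset $\mathcal U\subset\mathcal C_N$ contains all coisotropic submanifolds sufficiently $C^1$-close to $Y$ if and only if $e(\mathcal U)$ contains all codimension-one foliations sufficiently $C^1$-close to $\mathcal F$. 3. For every $\mathcal U\subset\mathcal C_N$ (in particular for every $C^1$-neighbourhood $\mathcal U$ of $Y$ as in 2) and all $C^1$-neighbourhoods $\mathcal W$ of $\mathrm{id}_M$ and $\mathcal W'$ of $\mathrm{id}_Y$,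 the map $e$ induces a bijection from the set of gauge equivalence classes in $\mathcal U$ onto the set of gauge equivalence classes in $e(\mathcal U)$. -/

import Mathlib

open scoped Manifold ContDiff Topology
open Set

noncomputable section

/-! ### One-forms, plane fields and the `C¹` topology

All manifolds are smooth, without boundary, and modelled on `ℝ^d`. -/

section Forms

variable (d : ℕ) (X : Type*) [TopologicalSpace X] [ChartedSpace (EuclideanSpace ℝ (Fin d)) X]
  [IsManifold (𝓡 d) ∞ X]

/-- The cotangent space `T*_x X`. -/
abbrev CotangentFiber (x : X) : Type :=
  TangentSpace (𝓡 d) x →L[ℝ] Bundle.Trivial X ℝ x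

/-- The (total space of the) cotangent bundle `T*X`. -/
abbrev CotangentTotal : Type _ :=
  Bundle.TotalSpace (EuclideanSpace ℝ (Fin d) →L[ℝ] ℝ) (CotangentFiber d X)

/-- The model with corners of the manifold `T*X`. -/
abbrev cotangentModel :=
  (𝓡 d).prod 𝓘(ℝ, EuclideanSpace ℝ (Fin d) →L[ℝ] ℝ)

/-- Smooth one-forms on `X`. -/
abbrev OneForm : Type _ :=
  ContMDiffSection (𝓡 d) (EuclideanSpace ℝ (Fin d) →L[ℝ] ℝ) ∞ (CotangentFiber d X)

/-- Smooth vector fields on `X`. -/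
abbrev SmoothVectorField : Type _ :=
  ContMDiffSection (𝓡 d) (EuclideanSpace ℝ (Fin d)) ∞ (fun x : X => TangentSpace (𝓡 d) x)

/-- A field of linear subspaces of the tangent spaces of `X` (no regularity imposed). -/
abbrev PlaneField : Type _ := ∀ x : X, Submodule ℝ (TangentSpace (𝓡 d) x)

end Forms

section C1Topology

variable {E F : Type*} [NormedAddCommGroup E] [NormedSpace ℝ E]
  [NormedAddCommGroup F] [NormedSpace ℝ F] {H H' : Type*} [TopologicalSpace H] [TopologicalSpace H']

variable {I : ModelWithCorners ℝ E H} {I' : ModelWithCorners ℝ F H'}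
  {X X' : Type*} [TopologicalSpace X] [ChartedSpace H X] [IsManifold I ∞ X]
  [TopologicalSpace X'] [ChartedSpace H' X'] [IsManifold I' ∞ X']

/-- The tangent map `Tf : TX → TX'` of a smooth map, as a continuous map. -/
def tangentC (f : ContMDiffMap I I' X X' ∞) : C(TangentBundle I X, TangentBundle I' X') :=
  ⟨tangentMap I I' f, f.contMDiff.continuous_tangentMap (by simp)⟩

/-- The neighbourhoods of `f` in the `C¹` topology on the smooth maps `X → X'`, i.e. in the topology
induced by `f ↦ Tf` from the compact-open topology on the continuous maps `TX → TX'` (uniform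
convergence on compact sets of the map and of its first derivatives). -/
def c1Nhds (f : ContMDiffMap I I' X X' ∞) : Filter (ContMDiffMap I I' X X' ∞) :=
  Filter.comap tangentC (𝓝 (tangentC f))

end C1Topology

section OneForms

variable {d k : ℕ}
  {X : Type*} [TopologicalSpace X] [ChartedSpace (EuclideanSpace ℝ (Fin d)) X]
  [IsManifold (𝓡 d) ∞ X]
  {Y : Type*} [TopologicalSpace Y] [ChartedSpace (EuclideanSpace ℝ (Fin k)) Y]
  [IsManifold (𝓡 k) ∞ Y]

/-- A one-form as a smooth map `X → T*X`. -/
def OneForm.toMap (μ : OneForm d X) :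
    ContMDiffMap (𝓡 d) (cotangentModel d) X (CotangentTotal d X) ∞ :=
  ⟨fun x => ⟨x, μ x⟩, μ.contMDiff⟩

/-- The neighbourhoods of a one-form in the `C¹` topology on one-forms. -/
def OneForm.c1Nhds (μ : OneForm d X) : Filter (OneForm d X) :=
  Filter.comap OneForm.toMap (_root_.c1Nhds μ.toMap)

/-- The field `x ↦ ker μ_x`. -/
def OneForm.kerField (μ : OneForm d X) : PlaneField d X :=
  fun x => LinearMap.ker (μ x).toLinearMap

/-- The exterior derivative `(dμ)_x(v, w)`. It is computed in the preferred chart at `x` (in which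
`T_x X` is literally `ℝ^d`): with `β` the coordinate expression of `μ` in this chart,
`dβ(v, w) = (D_v β)(w) - (D_w β)(v)`. -/
def OneForm.extDerivAt (μ : OneForm d X) (x : X) (v w : TangentSpace (𝓡 d) x) : ℝ :=
  let β : EuclideanSpace ℝ (Fin d) → (EuclideanSpace ℝ (Fin d) →L[ℝ] ℝ) := fun e =>
    ContinuousLinearMap.comp (μ ((extChartAt (𝓡 d) x).symm e))
      (mfderiv 𝓘(ℝ, EuclideanSpace ℝ (Fin d)) (𝓡 d) (extChartAt (𝓡 d) x).symm e)
  let D := fderiv ℝ β (extChartAt (𝓡 d) x x)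
  (D v) w - (D w) v

/-- The pullback `f^*μ`, `(f^*μ)_y(v) = μ_{f y}(df_y v)`, is a smooth one-form. -/
theorem contMDiff_pullbackForm (f : ContMDiffMap (𝓡 k) (𝓡 d) Y X ∞) (μ : OneForm d X) :
    ContMDiff (𝓡 k) (cotangentModel k) ∞
      (fun y : Y => (⟨y, (μ (f y)).comp (mfderiv (𝓡 k) (𝓡 d) f y)⟩ : CotangentTotal k Y)) := by
  intro y₀
  rw [contMDiffAt_hom_bundle]
  refine ⟨contMDiffAt_id, ?_⟩
  have h1 : ContMDiffAt (𝓡 k) (cotangentModel d) ∞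
      (fun y : Y => (⟨f y, μ (f y)⟩ : CotangentTotal d X)) y₀ :=
    (μ.contMDiff.comp f.contMDiff) y₀
  rw [contMDiffAt_hom_bundle] at h1
  have h2 := ContMDiffAt.mfderiv_const (m := ∞) (f.contMDiff y₀) (by simp)
  refine (h1.2.clm_comp h2).congr_of_eventuallyEq ?_
  have hb : ∀ᶠ y in 𝓝 y₀, f y ∈ (trivializationAt (EuclideanSpace ℝ (Fin d))
      (fun x : X => TangentSpace (𝓡 d) x) (f y₀)).baseSet :=
    f.contMDiff.continuous.continuousAt.preimage_mem_nhds
      ((trivializationAt (EuclideanSpace ℝ (Fin d))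
        (fun x : X => TangentSpace (𝓡 d) x) (f y₀)).open_baseSet.mem_nhds
        (FiberBundle.mem_baseSet_trivializationAt' _))
  filter_upwards [hb] with y hy
  ext v
  simp only [inTangentCoordinates, ContinuousLinearMap.inCoordinates,
    ContinuousLinearMap.comp_apply]
  rw [Bundle.Trivialization.symmL_continuousLinearMapAt _ hy]
  rfl

/-- The pullback of a one-form by a smooth map. -/
def OneForm.pullback (μ : OneForm d X) (f : ContMDiffMap (𝓡 k) (𝓡 d) Y X ∞) : OneForm k Y :=
  ⟨fun y => (μ (f y)).comp (mfderiv (𝓡 k) (𝓡 d) f y), contMDiff_pullbackForm f μ⟩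

end OneForms

/-! ### Contact forms, foliations, coisotropic submanifolds, isotopies -/

section Geometry

variable {d k : ℕ}
  {X : Type*} [TopologicalSpace X] [ChartedSpace (EuclideanSpace ℝ (Fin d)) X]
  [IsManifold (𝓡 d) ∞ X]
  {Y : Type*} [TopologicalSpace Y] [ChartedSpace (EuclideanSpace ℝ (Fin k)) Y]
  [IsManifold (𝓡 k) ∞ Y]

/-- `α` is a contact form: it vanishes nowhere and `dα` is nondegenerate on `ξ = ker α`. -/
def IsContactForm (α : OneForm d X) : Prop :=
  ∀ x : X, α x ≠ 0 ∧ ∀ v ∈ α.kerField x, (∀ w ∈ α.kerField x, α.extDerivAt x v w = 0) → v = 0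

/-- A smooth line field: locally spanned by a nowhere vanishing smooth vector field. -/
def IsLineField (L : PlaneField d X) : Prop :=
  ∀ x : X, ∃ V : SmoothVectorField d X, ∀ᶠ x' in 𝓝 x, V x' ≠ 0 ∧ L x' = Submodule.span ℝ {V x'}

/-- A smooth nonsingular codimension one foliation, given by its tangent distribution: a hyperplane
field which is locally the kernel of a nowhere vanishing smooth one-form and which is
integrable, i.e. `dμ` vanishes on `ker μ` (equivalently `μ ∧ dμ = 0`) for these one-forms. -/
def IsFoliation (G : PlaneField d X) : Prop :=
  ∀ x : X, ∃ μ : OneForm d X, ∀ᶠ x' in 𝓝 x, μ x' ≠ 0 ∧ G x' = μ.kerField x' ∧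
    ∀ v ∈ μ.kerField x', ∀ w ∈ μ.kerField x', μ.extDerivAt x' v w = 0

/-- `j : Y → X` is a smooth embedding onto a coisotropic submanifold: with `ξ = ker α`,
the `dα`-orthogonal in `ξ_x` of `T ∩ ξ_x` is contained in `T ∩ ξ_x`, for each tangent space `T`
of the image. -/
def IsCoisotropicEmbedding (α : OneForm d X) (j : ContMDiffMap (𝓡 k) (𝓡 d) Y X ∞) : Prop :=
  Manifold.IsSmoothEmbedding (𝓡 k) (𝓡 d) ∞ j ∧
    ∀ y : Y, ∀ v ∈ α.kerField (j y),
      (∀ u : TangentSpace (𝓡 k) y, mfderiv (𝓡 k) (𝓡 d) j y u ∈ α.kerField (j y) →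
        α.extDerivAt (j y) v (mfderiv (𝓡 k) (𝓡 d) j y u) = 0) →
      ∃ u : TangentSpace (𝓡 k) y, mfderiv (𝓡 k) (𝓡 d) j y u = v

/-- A set `𝒰` of subsets of `X` contains all coisotropic submanifolds that are sufficiently
`C¹`-close to the embedded submanifold `ι : Y → X`. -/
def ContainsC1CloseCoisotropics (α : OneForm d X) (ι : ContMDiffMap (𝓡 k) (𝓡 d) Y X ∞)
    (𝒰 : Set (Set X)) : Prop :=
  ∀ᶠ j in c1Nhds ι, IsCoisotropicEmbedding α j → range j ∈ 𝒰

/-- A set `𝒱` of plane fields contains all codimension one foliations that are sufficiently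
`C¹`-close to the foliation `ker μ`. -/
def ContainsC1CloseFoliations (μ : OneForm d X) (𝒱 : Set (PlaneField d X)) : Prop :=
  ∀ᶠ ν in μ.c1Nhds, IsFoliation ν.kerField → ν.kerField ∈ 𝒱

/-- The family `φ_t`, `t ∈ [0, 1]`, of diffeomorphisms is a smooth isotopy starting at the identity
(the values of `φ` outside of `[0, 1]` are irrelevant). -/
def IsIsotopy (φ : ℝ → Diffeomorph (𝓡 d) (𝓡 d) X X ∞) : Prop :=
  ContMDiffOn (𝓘(ℝ, ℝ).prod (𝓡 d)) (𝓡 d) ∞ (fun p : ℝ × X => φ p.1 p.2) (Icc 0 1 ×ˢ univ) ∧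
    ∀ x, φ 0 x = x

/-- `f` is a contactomorphism of `(X, ker α)`. -/
def IsContacto (α : OneForm d X) (f : Diffeomorph (𝓡 d) (𝓡 d) X X ∞) : Prop :=
  ∀ (x : X) (v : TangentSpace (𝓡 d) x),
    mfderiv (𝓡 d) (𝓡 d) f x v ∈ α.kerField (f x) ↔ v ∈ α.kerField x

/-- The diffeomorphism `f` carries the plane field `G` to the plane field `G'`. -/
def CarriesTo (f : Diffeomorph (𝓡 d) (𝓡 d) X X ∞) (G G' : PlaneField d X) : Prop :=
  ∀ x : X, G' (f x) = (G x).map (mfderiv (𝓡 d) (𝓡 d) f x).toLinearMap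

end Geometry

/-! ### Standard neighbourhoods and gauge equivalence -/

section Standard

variable {d k : ℕ}
  {M : Type*} [TopologicalSpace M] [ChartedSpace (EuclideanSpace ℝ (Fin d)) M]
  [IsManifold (𝓡 d) ∞ M]
  {Y : Type*} [TopologicalSpace Y] [ChartedSpace (EuclideanSpace ℝ (Fin k)) Y]
  [IsManifold (𝓡 k) ∞ Y]

/-- A standard neighbourhood of the coisotropic submanifold `ι : Y → (M, ker α)` with respect to
the transverse line field `L`. Put `λ = ι^*α` and `ℱ = ker λ`. As `TY = T ℱ ⊕ L`, the bundle
`T*ℱ` is the subbundle of `T*Y` of the covectors that vanish on `L`; the tautological form `η` on it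
is `η_{(y, s)} = s ∘ dπ`. A standard neighbourhood is a contactomorphism `Θ` from a relatively
compact open neighbourhood `N` of `ι(Y)` onto an open neighbourhood of the zero section of `T*ℱ`
with the contact form `π^*λ - η`, that extends the identification of `Y` with the zero section.
(Values of `Θ` outside of `N` are irrelevant.) -/
structure StandardNbhd (α : OneForm d M) (ι : ContMDiffMap (𝓡 k) (𝓡 d) Y M ∞)
    (L : PlaneField k Y) where
  /-- the neighbourhood `N` -/
  N : Set M
  isOpen_N : IsOpen N
  isCompact_closure_N : IsCompact (closure N)
  /-- the contactomorphism `Θ` -/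
  Θ : M → CotangentTotal k Y
  contMDiffOn_Θ : ContMDiffOn (𝓡 d) (cotangentModel k) ∞ Θ N
  injOn_Θ : InjOn Θ N
  immersion_Θ : ∀ z ∈ N, Function.Injective (mfderiv (𝓡 d) (cotangentModel k) Θ z)
  image_Θ : ∃ W : Set (CotangentTotal k Y), IsOpen W ∧
    Θ '' N = {p | p ∈ W ∧ ∀ v ∈ L p.proj, p.snd v = 0}
  mem_N : ∀ y, ι y ∈ N
  Θ_zero : ∀ y, Θ (ι y) = ⟨y, 0⟩
  contact_Θ : ∀ z ∈ N, ∀ v : TangentSpace (𝓡 d) z, v ∈ α.kerField z ↔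
    ((α.pullback ι) (Θ z).proj - (Θ z).snd)
      (mfderiv (𝓡 d) (𝓡 k) (fun z' => (Θ z').proj) z v) = 0

namespace StandardNbhd

variable {α : OneForm d M} {ι : ContMDiffMap (𝓡 k) (𝓡 d) Y M ∞} {L : PlaneField k Y}
  (𝒩 : StandardNbhd α ι L)

/-- `s` is a smooth section of `T*ℱ` (a one-form on `Y` vanishing on `L`) whose graph lies in the
standard neighbourhood. -/
def IsSection (s : OneForm k Y) : Prop :=
  (∀ y, ∀ v ∈ L y, s y v = 0) ∧ ∀ y, s.toMap y ∈ 𝒩.Θ '' 𝒩.N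

/-- The graph `Y_s` of a section `s`, as a subset of `M`. -/
def graph (s : OneForm k Y) : Set M := {z | z ∈ 𝒩.N ∧ 𝒩.Θ z ∈ range s.toMap}

/-- The coisotropic submanifolds of `M` that are graphs in the standard neighbourhood. -/
def coisotropics : Set (Set M) :=
  {S | (∃ s, 𝒩.IsSection s ∧ S = 𝒩.graph s) ∧
    ∃ j : ContMDiffMap (𝓡 k) (𝓡 d) Y M ∞, IsCoisotropicEmbedding α j ∧ range j = S}

/-- The foliations of `Y` of the form `ker (λ - s)` with `s` a section in the standard
neighbourhood, i.e. those which are transverse to `L` and `C⁰`-close to `ℱ = ker λ`, as measured by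
the standard neighbourhood. -/
def foliations : Set (PlaneField k Y) :=
  {G | IsFoliation G ∧ ∃ s, 𝒩.IsSection s ∧ G = (α.pullback ι - s).kerField}

/-- `S₀` is moved to `S₁` by a contact isotopy of `M` with compact support in the standard
neighbourhood, whose maps belong to `𝒲` (a `C¹`-neighbourhood of the identity), through
coisotropic graphs. -/
def CoisotropicMove (𝒲 : Set (ContMDiffMap (𝓡 d) (𝓡 d) M M ∞)) (S₀ S₁ : Set M) : Prop :=
  ∃ φ : ℝ → Diffeomorph (𝓡 d) (𝓡 d) M M ∞, IsIsotopy φ ∧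
    (∃ K ⊆ 𝒩.N, IsCompact K ∧ ∀ t ∈ Icc (0 : ℝ) 1, ∀ z ∉ K, φ t z = z) ∧
    (∀ t ∈ Icc (0 : ℝ) 1, IsContacto α (φ t) ∧
      (φ t : ContMDiffMap (𝓡 d) (𝓡 d) M M ∞) ∈ 𝒲 ∧ φ t '' S₀ ∈ 𝒩.coisotropics) ∧
    φ 1 '' S₀ = S₁

/-- `G₀` is carried to `G₁` by an isotopy of `Y`, whose maps belong to `𝒲` (a `C¹`-neighbourhood of
the identity), through foliations `C⁰`-close to `ℱ`. -/
def FoliationMove (𝒲 : Set (ContMDiffMap (𝓡 k) (𝓡 k) Y Y ∞)) (G₀ G₁ : PlaneField k Y) : Prop :=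
  ∃ ψ : ℝ → Diffeomorph (𝓡 k) (𝓡 k) Y Y ∞, IsIsotopy ψ ∧
    (∀ t ∈ Icc (0 : ℝ) 1, (ψ t : ContMDiffMap (𝓡 k) (𝓡 k) Y Y ∞) ∈ 𝒲 ∧
      ∃ G ∈ 𝒩.foliations, CarriesTo (ψ t) G₀ G) ∧
    CarriesTo (ψ 1) G₀ G₁

/-- Gauge equivalence of nearby coisotropic submanifolds: the equivalence relation generated by
`C¹`-small contact isotopies. -/
def coisotropicGauge (𝒲 : Set (ContMDiffMap (𝓡 d) (𝓡 d) M M ∞)) : Setoid 𝒩.coisotropics :=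
  Relation.EqvGen.setoid fun S₀ S₁ => 𝒩.CoisotropicMove 𝒲 S₀ S₁

/-- Gauge equivalence of nearby foliations: the equivalence relation generated by `C¹`-small
isotopies. -/
def foliationGauge (𝒲 : Set (ContMDiffMap (𝓡 k) (𝓡 k) Y Y ∞)) : Setoid 𝒩.foliations :=
  Relation.EqvGen.setoid fun G₀ G₁ => 𝒩.FoliationMove 𝒲 G₀ G₁

end StandardNbhd

end Standard

end

noncomputable section

set_option linter.unusedSectionVars false

local notation:max "ℰ" d:max => EuclideanSpace ℝ (Fin d)

local notation:max "ℰ*" d:max => EuclideanSpace ℝ (Fin d) →L[ℝ] ℝ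

/-! The correspondence. In a standard neighbourhood the contact plane at a covector `s` over `y` is
the preimage, under the differential of the projection to `Y`, of the kernel of `λ - s`. Pulling `α`
back to `Y` by the graph of `s` therefore gives a form with the same kernel as `λ - s`
(`IsSection.cov_pullback_eq_zero_iff`). The graph has dimension `n + 1` in `2n + 1` and is
transverse to `ξ`, so its tangent spaces meet `ξ` in half the dimension, where coisotropic and
isotropic coincide (`ContactPair.coisotropic_iff_isotropic`). As `d` commutes with pullbacks,
isotropic means that `d(λ - s)` vanishes on `ker (λ - s)`, which is integrability. Let `R` be the
section of `L` with `λ(R) = 1`. Since `s(R) = 0`, the form `λ - s` takes the value 1 on `R` and is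
determined by its kernel; this makes `e` bijective.

Closeness. If an embedding is `C¹`-close to `ι`, its projection to `Y` is `C¹`-close to the
identity, hence a diffeomorphism, and the image is the graph of a small section
(`exists_graph_of_tendsto`). In the other direction a form `ν` near `λ` is replaced by `ν / ν(R) = λ
- s`. Both constructions preserve `C¹` convergence (`containsC1Close_iff`).

Gauge equivalence. A path of maps `φ_t` breaks up into the maps `φ_r φ_t⁻¹` with `r` near `t`, which
are as `C¹`-small as desired. So the relation generated by small moves is the one generated by all
moves (`CoisotropicMove.gauge`, `FoliationMove.gauge`), the neighbourhoods `𝒲` and `𝒲'` disappear,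
and it suffices that `e` matches unrestricted moves. A contact isotopy that moves a graph through
graphs induces, by projection, an isotopy of `Y`; it carries the foliations along because the
contact planes are preserved (`CoisotropicMove.foliationMove`). Conversely a diffeomorphism `f` of
`Y` lifts to a local contactomorphism covering `f`: transport the covector `λ - s` by `f`, then
rescale it to have the value 1 on `R`. Lifting an isotopy of `Y` that carries foliations gives a
family defined near the moving graphs. Its Hamiltonian is cut off away from them and integrated, and
the resulting contact flow still follows the graphs (`FoliationMove.coisotropicMove`).

Existence of standard neighbourhoods. Composing flows of fields in `ξ` gives a map from `T*Y` to `M`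
that extends `ι` and whose fibre derivatives are dual, with respect to `dα`, to the pairing of
covectors with vectors of `Y` (`exists_fiberExp`). On the covectors annihilating `R` it is a
diffeomorphism near the zero section. The model form `λ - η`, moved to `M`, agrees with `α` along
`Y`, and all forms interpolating between the two are contact there. Moser's method then provides a
diffeomorphism that fixes `Y` and matches the kernels near it (`exists_diffeomorph_of_contactPair`).

The analytic groundwork consists of smooth flows (from the implicit function theorem on a space of
curves), inverse functions on manifolds, a chart description of the `C¹` topology, and the unique
smooth solvability of the equations of a contact vector field. -/

theorem ContMDiffAt.mdiff {E E' H H' X X' : Type*} [NormedAddCommGroup E] [NormedSpace ℝ E]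
    [NormedAddCommGroup E'] [NormedSpace ℝ E'] [TopologicalSpace H] [TopologicalSpace H']
    [TopologicalSpace X] [TopologicalSpace X'] [ChartedSpace H X] [ChartedSpace H' X']
    {I : ModelWithCorners ℝ E H} {I' : ModelWithCorners ℝ E' H'} {f : X → X'} {x : X}
    (hf : ContMDiffAt I I' ∞ f x) : MDifferentiableAt I I' f x := hf.mdifferentiableAt (by simp)

/-! ### Derivatives in preferred charts -/

section ChartDerivative

variable {E : Type*} [NormedAddCommGroup E] [NormedSpace ℝ E] {H : Type*} [TopologicalSpace H]
  {I : ModelWithCorners ℝ E H} [I.Boundaryless]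
  {X : Type*} [TopologicalSpace X] [ChartedSpace H X] [IsManifold I ∞ X]
  {E' : Type*} [NormedAddCommGroup E'] [NormedSpace ℝ E'] {H' : Type*} [TopologicalSpace H']
  {I' : ModelWithCorners ℝ E' H'} [I'.Boundaryless]
  {X' : Type*} [TopologicalSpace X'] [ChartedSpace H' X'] [IsManifold I' ∞ X']

variable (I) in
/-- The derivative at `x` of the preferred chart at `x₀`, an endomorphism of the model space. -/
def chartD (x₀ x : X) : E →L[ℝ] E := mfderiv I 𝓘(ℝ, E) (extChartAt I x₀) x

variable (I) in
/-- The derivative of the inverse of the preferred chart at `x₀`, at the image of `x`. -/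
def chartDInv (x₀ x : X) : E →L[ℝ] E :=
  mfderiv 𝓘(ℝ, E) I (extChartAt I x₀).symm (extChartAt I x₀ x)

theorem isManifold_one (I : ModelWithCorners ℝ E H) (X : Type*) [TopologicalSpace X]
    [ChartedSpace H X] [IsManifold I ∞ X] : IsManifold I 1 X := inferInstance

theorem chartD_comp_chartDInv {x₀ x : X} (hx : x ∈ (chartAt H x₀).source) :
    (chartD I x₀ x).comp (chartDInv I x₀ x) = ContinuousLinearMap.id ℝ E := by
  have h := mfderiv_extChartAt_comp_mfderivWithin_extChartAt_symm' (I := I)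
    (x := x₀) (y := x) (by rwa [extChartAt_source])
  rw [I.range_eq_univ, mfderivWithin_univ] at h
  exact h

theorem chartDInv_comp_chartD {x₀ x : X} (hx : x ∈ (chartAt H x₀).source) :
    (chartDInv I x₀ x).comp (chartD I x₀ x) = ContinuousLinearMap.id ℝ E := by
  have h := mfderivWithin_extChartAt_symm_comp_mfderiv_extChartAt' (I := I)
    (x := x₀) (y := x) (by rwa [extChartAt_source])
  rw [I.range_eq_univ, mfderivWithin_univ] at h
  exact h

@[simp] theorem chartD_chartDInv_apply {x₀ x : X} (hx : x ∈ (chartAt H x₀).source) (v : E) :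
    chartD I x₀ x (chartDInv I x₀ x v) = v :=
  DFunLike.congr_fun (chartD_comp_chartDInv (I := I) hx) v

@[simp] theorem chartDInv_chartD_apply {x₀ x : X} (hx : x ∈ (chartAt H x₀).source) (v : E) :
    chartDInv I x₀ x (chartD I x₀ x v) = v :=
  DFunLike.congr_fun (chartDInv_comp_chartD (I := I) hx) v

theorem chartD_self (x : X) : chartD I x x = ContinuousLinearMap.id ℝ E :=
  mfderiv_extChartAt_self (I := I)

theorem chartDInv_self (x : X) : chartDInv I x x = ContinuousLinearMap.id ℝ E := by
  have := chartD_comp_chartDInv (I := I) (mem_chart_source H x)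
  rwa [chartD_self, ContinuousLinearMap.id_comp] at this

theorem extChartAt_target_nhds {x₀ x : X} (hx : x ∈ (chartAt H x₀).source) :
    (extChartAt I x₀).target ∈ 𝓝 (extChartAt I x₀ x) :=
  (isOpen_extChartAt_target x₀).mem_nhds
    ((extChartAt I x₀).map_source (by rwa [extChartAt_source]))

theorem contMDiffAt_extChartAt_symm {x₀ x : X} (hx : x ∈ (chartAt H x₀).source) :
    ContMDiffAt 𝓘(ℝ, E) I ∞ (extChartAt I x₀).symm (extChartAt I x₀ x) :=
  (contMDiffOn_extChartAt_symm x₀).contMDiffAt (extChartAt_target_nhds hx)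

theorem extChartAt_symm_apply_self {x₀ x : X} (hx : x ∈ (chartAt H x₀).source) :
    (extChartAt I x₀).symm (extChartAt I x₀ x) = x :=
  (extChartAt I x₀).left_inv (by rwa [extChartAt_source])

theorem chart_source_nhds {x₀ x : X} (hx : x ∈ (chartAt H x₀).source) :
    (chartAt H x₀).source ∈ 𝓝 x := (chartAt H x₀).open_source.mem_nhds hx

variable (I I') in
/-- The derivative of a map between manifolds, as a map between the model spaces. -/
def mD (f : X → X') (x : X) : E →L[ℝ] E' := mfderiv I I' f x

theorem mD_comp {E'' : Type*} [NormedAddCommGroup E''] [NormedSpace ℝ E''] {H'' : Type*}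
    [TopologicalSpace H''] {I'' : ModelWithCorners ℝ E'' H''} {X'' : Type*} [TopologicalSpace X'']
    [ChartedSpace H'' X''] {g : X' → X''} {f : X → X'} {x : X} {y : X'}
    (hg : MDifferentiableAt I' I'' g y) (hf : MDifferentiableAt I I' f x) (hy : f x = y) :
    mD I I'' (fun z => g (f z)) x = (mD I' I'' g y).comp (mD I I' f x) := by
  subst hy; exact mfderiv_comp x hg hf

theorem mD_eq_fderiv (f : E → E') (x : E) : mD 𝓘(ℝ, E) 𝓘(ℝ, E') f x = fderiv ℝ f x :=
  mfderiv_eq_fderiv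

theorem mD_congr {f g : X → X'} {x : X} (h : f =ᶠ[𝓝 x] g) : mD I I' f x = mD I I' g x :=
  h.mfderiv_eq

/-- The derivative of a map in arbitrary preferred charts. -/
theorem fderiv_in_charts {f : X → X'} {x₀ x : X} {y₀ : X'} (hf : MDifferentiableAt I I' f x)
    (hx : x ∈ (chartAt H x₀).source) (hy : f x ∈ (chartAt H' y₀).source) :
    fderiv ℝ (fun e => extChartAt I' y₀ (f ((extChartAt I x₀).symm e))) (extChartAt I x₀ x) =
      ((chartD I' y₀ (f x)).comp (mD I I' f x)).comp (chartDInv I x₀ x) := by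
  have e1 : (extChartAt I x₀).symm (extChartAt I x₀ x) = x := extChartAt_symm_apply_self hx
  have h1 : MDifferentiableAt 𝓘(ℝ, E) I (extChartAt I x₀).symm (extChartAt I x₀ x) :=
    (contMDiffAt_extChartAt_symm hx).mdiff
  have h3 := mdifferentiableAt_extChartAt (I := I') hy
  rw [← mD_eq_fderiv, mD_comp (f := (extChartAt I x₀).symm) (g := fun z => extChartAt I' y₀ (f z))
    (h3.comp x hf) h1 e1, mD_comp h3 hf rfl]
  rfl

end ChartDerivative

/-! ### Smoothness of maps into tangent and cotangent bundles -/

section Bundles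

variable {E : Type*} [NormedAddCommGroup E] [NormedSpace ℝ E] {H : Type*} [TopologicalSpace H]
  {I : ModelWithCorners ℝ E H} [I.Boundaryless]
  {X : Type*} [TopologicalSpace X] [ChartedSpace H X] [IsManifold I ∞ X]
  {E' : Type*} [NormedAddCommGroup E'] [NormedSpace ℝ E'] {H' : Type*} [TopologicalSpace H']
  {J : ModelWithCorners ℝ E' H'}
  {Z : Type*} [TopologicalSpace Z] [ChartedSpace H' Z]

theorem trivializationAt_tangent_snd {x₀ : X} {p : TangentBundle I X}
    (hp : p.proj ∈ (chartAt H x₀).source) :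
    (trivializationAt E (TangentSpace I) x₀ p).2 = chartD I x₀ p.proj p.snd := by
  have := TangentBundle.continuousLinearMapAt_trivializationAt (I := I) hp
  have h2 := DFunLike.congr_fun this p.snd
  rw [Bundle.Trivialization.continuousLinearMapAt_apply,
    Bundle.Trivialization.linearMapAt_apply, if_pos (by simpa using hp)] at h2
  exact h2

/-- The trivialization of the tangent bundle at `x₀` is the derivative of the chart there, so a
field along a map can be tested as a function into the model space. Any `x₀` whose chart contains
the base point is allowed. -/
theorem contMDiffAt_tangent_iff {n : WithTop ℕ∞} (hn : n ≤ ∞) {g : Z → TangentBundle I X}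
    {a : Z} {x₀ : X} (hx : (g a).proj ∈ (chartAt H x₀).source) :
    ContMDiffAt J I.tangent n g a ↔ ContMDiffAt J I n (fun z => (g z).proj) a ∧
      ContMDiffAt J 𝓘(ℝ, E) n
        (fun z => chartD I x₀ (g z).proj (g z).snd) a := by
  have : ContMDiffVectorBundle n E (TangentSpace I : X → Type _) I :=
    ContMDiffVectorBundle.of_le hn
  rw [Bundle.Trivialization.contMDiffAt_iff (e := trivializationAt E (TangentSpace I) x₀)
    (by simpa [Bundle.Trivialization.mem_source] using hx)]
  refine and_congr_right fun h => ?_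
  have : ∀ᶠ z in 𝓝 a, (g z).proj ∈ (chartAt H x₀).source :=
    h.continuousAt.preimage_mem_nhds (chart_source_nhds hx)
  exact Filter.EventuallyEq.contMDiffAt_iff (this.mono fun z hz => trivializationAt_tangent_snd hz)

end Bundles

section Cotangent

variable {d : ℕ} {X : Type*} [TopologicalSpace X] [ChartedSpace (ℰ d) X]
  [IsManifold (𝓡 d) ∞ X]
  {E' : Type*} [NormedAddCommGroup E'] [NormedSpace ℝ E'] {H' : Type*} [TopologicalSpace H']
  {J : ModelWithCorners ℝ E' H'}
  {Z : Type*} [TopologicalSpace Z] [ChartedSpace H' Z]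

/-- The covector of a point of the cotangent bundle, with the tangent space regarded as the model
space. -/
def CotangentTotal.cov (p : CotangentTotal d X) : ℰ d →L[ℝ] ℝ := p.snd

/-- The fibre coordinate of a covector in the preferred chart at `x₀`. -/
def cotCoord (x₀ : X) (p : CotangentTotal d X) : ℰ d →L[ℝ] ℝ :=
  p.cov.comp (chartDInv (𝓡 d) x₀ p.proj)

theorem inCoordinates_cotangent {x₀ : X} {p : CotangentTotal d X}
    (hp : p.proj ∈ (chartAt (ℰ d) x₀).source) :
    ContinuousLinearMap.inCoordinates (ℰ d) (TangentSpace (𝓡 d)) ℝ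
      (Bundle.Trivial X ℝ) x₀ p.proj x₀ p.proj p.snd = cotCoord x₀ p := by
  have h := TangentBundle.symmL_trivializationAt (I := 𝓡 d) hp
  rw [(𝓡 d).range_eq_univ, mfderivWithin_univ] at h
  ext v
  simp only [ContinuousLinearMap.inCoordinates, h]
  exact DFunLike.congr_fun
    (Bundle.Trivial.continuousLinearMapAt_trivialization ℝ X ℝ p.proj) _

theorem contMDiffAt_cotangent_iff {n : WithTop ℕ∞} (hn : n ≤ ∞) {g : Z → CotangentTotal d X}
    {a : Z} {x₀ : X} (hx : (g a).proj ∈ (chartAt (ℰ d) x₀).source) :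
    ContMDiffAt J (cotangentModel d) n g a ↔ ContMDiffAt J (𝓡 d) n (fun z => (g z).proj) a ∧
      ContMDiffAt J 𝓘(ℝ, ℰ* d) n
        (fun z => cotCoord x₀ (g z)) a := by
  have : ContMDiffVectorBundle n ℰ* d (CotangentFiber d X) (𝓡 d) :=
    ContMDiffVectorBundle.of_le hn
  rw [Bundle.Trivialization.contMDiffAt_iff
    (e := trivializationAt ℰ* d (CotangentFiber d X) x₀)
    (by rw [hom_trivializationAt_source]; simpa using hx)]
  refine and_congr_right fun h => ?_
  have : ∀ᶠ z in 𝓝 a, (g z).proj ∈ (chartAt (ℰ d) x₀).source :=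
    h.continuousAt.preimage_mem_nhds (chart_source_nhds hx)
  exact Filter.EventuallyEq.contMDiffAt_iff (this.mono fun z hz => inCoordinates_cotangent hz)

end Cotangent

theorem two_le_infty : (2 : WithTop ℕ∞) ≤ ∞ := by
  exact WithTop.coe_le_coe.2 (le_top : (2 : ℕ∞) ≤ ⊤)

/-! ### The exterior derivative and its naturality -/

section ExteriorDerivative

variable {V W : Type*} [NormedAddCommGroup V] [NormedSpace ℝ V] [NormedAddCommGroup W]
  [NormedSpace ℝ W]

/-- The exterior derivative of a one-form on a normed space. -/
def dext (B : V → V →L[ℝ] ℝ) (e a b : V) : ℝ := fderiv ℝ B e a b - fderiv ℝ B e b a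

theorem dext_congr {B B' : V → V →L[ℝ] ℝ} {e : V} (h : B =ᶠ[𝓝 e] B') (a b : V) :
    dext B e a b = dext B' e a b := by
  simp only [dext, h.fderiv_eq]

/-- `d(μ ∘ Dp)(a, b) = Dμ(a)(Dp b) - Dμ(b)(Dp a)`. -/
theorem dext_comp_fderiv {m : V → W →L[ℝ] ℝ} {p : V → W} {e : V} (hm : DifferentiableAt ℝ m e)
    (hp : ContDiffAt ℝ 2 p e) (a b : V) :
    dext (fun x => (m x).comp (fderiv ℝ p x)) e a b =
      fderiv ℝ m e a (fderiv ℝ p e b) - fderiv ℝ m e b (fderiv ℝ p e a) := by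
  have hp' : DifferentiableAt ℝ (fderiv ℝ p) e :=
    (hp.fderiv_right (m := 1) (by norm_num)).differentiableAt (by norm_num)
  -- The two terms with the second derivative of `p` cancel by symmetry.
  have hs : IsSymmSndFDerivAt ℝ p e := hp.isSymmSndFDerivAt (by simp)
  have h := (hm.hasFDerivAt.clm_comp hp'.hasFDerivAt).fderiv
  simp only [dext, h]
  simp only [add_apply, ContinuousLinearMap.comp_apply,
    ContinuousLinearMap.compL_apply, ContinuousLinearMap.flip_apply]
  rw [hs.eq a b]; ring

theorem dext_pullback {B : W → W →L[ℝ] ℝ} {h : V → W} {e : V} (hB : DifferentiableAt ℝ B (h e))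
    (hh : ContDiffAt ℝ 2 h e) (a b : V) :
    dext (fun x => (B (h x)).comp (fderiv ℝ h x)) e a b =
      dext B (h e) (fderiv ℝ h e a) (fderiv ℝ h e b) := by
  have hd : DifferentiableAt ℝ h e := hh.differentiableAt (by norm_num)
  rw [dext_comp_fderiv (m := fun x => B (h x)) (hB.comp e hd) hh, dext]
  have : fderiv ℝ (fun x => B (h x)) e = (fderiv ℝ B (h e)).comp (fderiv ℝ h e) :=
    fderiv_comp e hB hd
  simp only [this, ContinuousLinearMap.comp_apply]

variable {d : ℕ} {X : Type*} [TopologicalSpace X] [ChartedSpace (ℰ d) X]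
  [IsManifold (𝓡 d) ∞ X]
  {E' : Type*} [NormedAddCommGroup E'] [NormedSpace ℝ E'] {H' : Type*} [TopologicalSpace H']
  {J : ModelWithCorners ℝ E' H'}
  {Z : Type*} [TopologicalSpace Z] [ChartedSpace H' Z]

/-- The value of a one-form, with the tangent space regarded as the model space. -/
def OneForm.cov (μ : OneForm d X) (x : X) : ℰ d →L[ℝ] ℝ := μ x

theorem CotangentTotal.cov_eq {x₀ : X} {p : CotangentTotal d X}
    (hp : p.proj ∈ (chartAt (ℰ d) x₀).source) :
    p.cov = (cotCoord x₀ p).comp (chartD (𝓡 d) x₀ p.proj) := by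
  rw [cotCoord, ContinuousLinearMap.comp_assoc, chartDInv_comp_chartD hp,
    ContinuousLinearMap.comp_id]

theorem mD_extChartAt_comp {g : V → X} {e : V} {x₀ : X}
    (hg : MDifferentiableAt 𝓘(ℝ, V) (𝓡 d) g e)
    (hx : g e ∈ (chartAt (ℰ d) x₀).source) :
    fderiv ℝ (fun z => extChartAt (𝓡 d) x₀ (g z)) e =
      (chartD (𝓡 d) x₀ (g e)).comp (mD 𝓘(ℝ, V) (𝓡 d) g e) := by
  rw [← mD_eq_fderiv, mD_comp (mdifferentiableAt_extChartAt hx) hg rfl]; rfl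

theorem contDiffAt_extChartAt_comp {g : V → X} {e : V} {x₀ : X} {n : WithTop ℕ∞} (hn : n ≤ ∞)
    (hg : ContMDiffAt 𝓘(ℝ, V) (𝓡 d) n g e)
    (hx : g e ∈ (chartAt (ℰ d) x₀).source) :
    ContDiffAt ℝ n (fun z => extChartAt (𝓡 d) x₀ (g z)) e :=
  (ContMDiffAt.comp e ((contMDiffAt_extChartAt' hx).of_le hn) hg).contDiffAt

theorem contMDiffAt_eventually_top {E₁ E₂ : Type*} [NormedAddCommGroup E₁] [NormedSpace ℝ E₁]
    [NormedAddCommGroup E₂] [NormedSpace ℝ E₂] {H₁ H₂ : Type*} [TopologicalSpace H₁]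
    [TopologicalSpace H₂] {I₁ : ModelWithCorners ℝ E₁ H₁} {I₂ : ModelWithCorners ℝ E₂ H₂}
    {X₁ X₂ : Type*} [TopologicalSpace X₁] [ChartedSpace H₁ X₁] [IsManifold I₁ ∞ X₁]
    [TopologicalSpace X₂] [ChartedSpace H₂ X₂] [IsManifold I₂ ∞ X₂] {f : X₁ → X₂} {x : X₁}
    (hf : ContMDiffAt I₁ I₂ ∞ f x) : ∀ᶠ y in 𝓝 x, MDifferentiableAt I₁ I₂ f y := by
  have := (contMDiffAt_iff_contMDiffAt_nhds (n := 1) (by simp)).1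
    (hf.of_le (show (1 : WithTop ℕ∞) ≤ ∞ by exact_mod_cast le_top))
  exact this.mono fun y hy => hy.mdifferentiableAt (by simp)

/-- The two factors need not be smooth as functions into fixed spaces, because they refer to the
preferred chart at a moving point. Inserting the chart at `g e` between them writes the composition
as a smooth fibre coordinate times the derivative of a map of normed spaces. -/
theorem contDiffAt_cov_comp {σ : V → CotangentTotal d X} {g : V → X} {e : V}
    (hσ : ContMDiffAt 𝓘(ℝ, V) (cotangentModel d) ∞ σ e)
    (hg : ContMDiffAt 𝓘(ℝ, V) (𝓡 d) ∞ g e) (hσg : ∀ᶠ z in 𝓝 e, (σ z).proj = g z) :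
    ContDiffAt ℝ ∞ (fun z => (σ z).cov.comp (mD 𝓘(ℝ, V) (𝓡 d) g z)) e := by
  have h0 := hσg.self_of_nhds
  have hx := mem_chart_source (ℰ d) (g e)
  rw [contMDiffAt_cotangent_iff le_rfl (x₀ := g e) (by rwa [h0])] at hσ
  have h1 := contDiffAt_extChartAt_comp le_rfl hg hx
  refine (hσ.2.contDiffAt.clm_comp (h1.fderiv_right (m := ∞) le_rfl)).congr_of_eventuallyEq ?_
  filter_upwards [hσg, contMDiffAt_eventually_top hg,
    hg.continuousAt.preimage_mem_nhds (chart_source_nhds hx)] with z hz hz' hz''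
  rw [mD_extChartAt_comp hz' hz'', CotangentTotal.cov_eq (x₀ := g e) (by rw [hz]; exact hz''), hz,
    ContinuousLinearMap.comp_assoc]

/-- The pullback of a one-form to a normed space. -/
def pb (μ : OneForm d X) (g : V → X) (e : V) : V →L[ℝ] ℝ :=
  (μ.cov (g e)).comp (mD 𝓘(ℝ, V) (𝓡 d) g e)

theorem contDiffAt_pb (μ : OneForm d X) {g : V → X} {e : V}
    (hg : ContMDiffAt 𝓘(ℝ, V) (𝓡 d) ∞ g e) : ContDiffAt ℝ ∞ (pb μ g) e :=
  contDiffAt_cov_comp (σ := fun z => μ.toMap (g z)) (μ.toMap.contMDiff.contMDiffAt.comp e hg) hg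
    (.of_forall fun _ => rfl)

theorem pb_comp {V' : Type*} [NormedAddCommGroup V'] [NormedSpace ℝ V'] (μ : OneForm d X)
    {g : V → X} {h : V' → V} {e : V'} (hg : MDifferentiableAt 𝓘(ℝ, V) (𝓡 d) g (h e))
    (hh : DifferentiableAt ℝ h e) :
    pb μ (fun z => g (h z)) e = (pb μ g (h e)).comp (fderiv ℝ h e) := by
  rw [pb, mD_comp hg hh.mdifferentiableAt rfl, mD_eq_fderiv]; rfl

/-- Naturality of the exterior derivative. -/
theorem dext_pb (μ : OneForm d X) {g : V → X} {e : V}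
    (hg : ContMDiffAt 𝓘(ℝ, V) (𝓡 d) ∞ g e) (a b : V) :
    dext (pb μ g) e a b = μ.extDerivAt (g e) (mD 𝓘(ℝ, V) (𝓡 d) g e a)
      (mD 𝓘(ℝ, V) (𝓡 d) g e b) := by
  set x := g e with hxdef
  have hx := mem_chart_source (ℰ d) x
  have hh := contDiffAt_extChartAt_comp le_rfl hg hx
  have hφ : ContMDiffAt 𝓘(ℝ, ℰ d) (𝓡 d) ∞ (extChartAt (𝓡 d) x).symm
      (extChartAt (𝓡 d) x (g e)) := contMDiffAt_extChartAt_symm hx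
  -- Near `e` the map `g` factors through the chart at `g e`, which reduces the claim to naturality
  -- between normed spaces; at the centre the derivative of the chart is the identity.
  have h1 : pb μ g =ᶠ[𝓝 e] fun z => (pb μ (extChartAt (𝓡 d) x).symm
      (extChartAt (𝓡 d) x (g z))).comp (fderiv ℝ (fun z => extChartAt (𝓡 d) x (g z)) z) := by
    have hc : ∀ᶠ z in 𝓝 e, g z ∈ (chartAt (ℰ d) x).source :=
      hg.continuousAt.preimage_mem_nhds (chart_source_nhds hx)
    filter_upwards [eventually_eventually_nhds.2 hc, contMDiffAt_eventually_top hg] with z hz hz'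
    rw [← pb_comp (h := fun z => extChartAt (𝓡 d) x (g z))]
    · have : (fun z => (extChartAt (𝓡 d) x).symm (extChartAt (𝓡 d) x (g z))) =ᶠ[𝓝 z] g :=
        hz.mono fun y hy => extChartAt_symm_apply_self hy
      rw [pb, pb, mD_congr this, this.eq_of_nhds]
    · exact (contMDiffAt_extChartAt_symm hz.self_of_nhds).mdiff
    · exact ((mdifferentiableAt_extChartAt hz.self_of_nhds).comp z hz').differentiableAt
  rw [dext_congr h1, dext_pullback (h := fun z => extChartAt (𝓡 d) x (g z)) ((contDiffAt_pb μ hφ).differentiableAt (by simp))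
    (hh.of_le two_le_infty), mD_extChartAt_comp (hg.mdiff) hx,
    chartD_self]
  rfl

end ExteriorDerivative

/-! ### Smoothness of composition operators on spaces of curves -/

section Nemytskii

universe u

variable {K : Type*} [TopologicalSpace K] [CompactSpace K]
  {E F : Type u} [NormedAddCommGroup E] [NormedSpace ℝ E] [NormedAddCommGroup F] [NormedSpace ℝ F]

variable (K E F) in
/-- Pointwise application of a continuous family of continuous linear maps. -/
def pointwiseApply : C(K, E →L[ℝ] F) →L[ℝ] C(K, E) →L[ℝ] C(K, F) :=
  LinearMap.mkContinuous₂
    (LinearMap.mk₂ ℝ (fun (A : C(K, E →L[ℝ] F)) (h : C(K, E)) =>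
      (⟨fun k => A k (h k), by fun_prop⟩ : C(K, F)))
      (fun A B h => by ext; simp) (fun c A h => by ext; simp)
      (fun A h h' => by ext; simp) (fun c A h => by ext; simp)) 1 (fun A h => by
        rw [ContinuousMap.norm_le _ (by positivity)]
        intro k
        rw [one_mul]
        exact ((A k).le_opNorm _).trans
          (mul_le_mul (A.norm_coe_le_norm k) (h.norm_coe_le_norm k) (norm_nonneg _) (norm_nonneg A)))

/-- The mean value inequality bounds the remainder at each point of `K`. The bound is uniform
because `γ ↦ v' ∘ γ` is continuous for the supremum norm. -/
theorem hasFDerivAt_continuousMap_comp (v : C(E, F)) (v' : C(E, E →L[ℝ] F))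
    (hv : ∀ x, HasFDerivAt v (v' x) x) (γ : C(K, E)) :
    HasFDerivAt (fun γ : C(K, E) => v.comp γ) (pointwiseApply K E F (v'.comp γ)) γ := by
  rw [hasFDerivAt_iff_isLittleO, Asymptotics.isLittleO_iff]
  intro ε hε
  have hc : ContinuousAt (fun γ : C(K, E) => v'.comp γ) γ := v'.continuous_postcomp.continuousAt
  obtain ⟨δ, hδ, h⟩ :=
    (Metric.continuousAt_iff (α := C(K, E)) (β := C(K, E →L[ℝ] F))).1 hc ε hε
  filter_upwards [Metric.ball_mem_nhds γ hδ] with γ' hγ'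
  rw [ContinuousMap.norm_le _ (by positivity)]
  intro k
  have hball : ∀ y ∈ Metric.ball (γ k) δ, ‖fderiv ℝ v y - v' (γ k)‖ ≤ ε := by
    intro y hy
    -- Shifting the whole curve by the constant `y - γ k` turns continuity on the space of curves
    -- into an estimate for `v'` at the arbitrary point `y` of the ball.
    have h1 := h (x := γ + ContinuousMap.const K (y - γ k)) (by
      rw [dist_eq_norm, add_sub_cancel_left]
      refine lt_of_le_of_lt ?_ (mem_ball_iff_norm.1 hy)
      exact (ContinuousMap.norm_le _ (norm_nonneg _)).2 fun _ => le_rfl)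
    have h2 := (ContinuousMap.dist_apply_le_dist k).trans h1.le
    simp only [ContinuousMap.comp_apply, ContinuousMap.add_apply,
      ContinuousMap.const_apply, add_sub_cancel, dist_eq_norm] at h2
    rw [(hv y).fderiv]
    exact h2
  have hk : dist (γ' k) (γ k) ≤ dist γ' γ := ContinuousMap.dist_apply_le_dist k
  have := (convex_ball (γ k) δ).norm_image_sub_le_of_norm_fderiv_le' (𝕜 := ℝ) (f := v)
    (fun x _ => (hv x).differentiableAt) hball (Metric.mem_ball_self hδ)
    (show γ' k ∈ Metric.ball (γ k) δ from hk.trans_lt hγ')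
  refine this.trans (mul_le_mul_of_nonneg_left ?_ hε.le)
  rw [← dist_eq_norm, ← dist_eq_norm]; exact hk

/-- Induction over all target spaces at once: the derivative is `γ ↦ v' ∘ γ`, with `v'` valued in `E
→L[ℝ] F`, followed by a fixed continuous linear map. -/
theorem contDiff_continuousMap_comp_nat (n : ℕ) : ∀ {F : Type u} [NormedAddCommGroup F]
    [NormedSpace ℝ F] (v : C(E, F)), ContDiff ℝ n v →
    ContDiff ℝ n (fun γ : C(K, E) => v.comp γ) := by
  induction n with
  | zero => intro F _ _ v _; exact contDiff_zero.2 v.continuous_postcomp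
  | succ n ih =>
    intro F _ _ v hv
    obtain ⟨v', h1, h2⟩ := contDiff_succ_iff_hasFDerivAt.1 (by exact_mod_cast hv)
    have := ih (⟨v', h1.continuous⟩ : C(E, E →L[ℝ] F)) h1
    refine mod_cast contDiff_succ_iff_hasFDerivAt.2
      ⟨_, (pointwiseApply K E F).contDiff.comp this, fun γ => ?_⟩
    exact hasFDerivAt_continuousMap_comp v ⟨v', h1.continuous⟩ h2 γ

theorem contDiff_continuousMap_comp (v : C(E, F)) (hv : ContDiff ℝ ∞ v) :
    ContDiff ℝ ∞ (fun γ : C(K, E) => v.comp γ) :=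
  contDiff_infty.2 fun n => contDiff_continuousMap_comp_nat n v (contDiff_infty.1 hv n)

end Nemytskii

/-! ### Smooth local flows in Banach spaces -/

section Flow

variable {E : Type*} [NormedAddCommGroup E] [NormedSpace ℝ E] [CompleteSpace E]

/-- Extension of a continuous curve on `[-1, 1]` to the real line by constants. -/
def extendCurve (γ : C(Icc (-1 : ℝ) 1, E)) (s : ℝ) : E := γ (projIcc (-1) 1 (by norm_num) s)

theorem continuous_extendCurve (γ : C(Icc (-1 : ℝ) 1, E)) : Continuous (extendCurve γ) :=
  γ.continuous.comp continuous_projIcc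

theorem norm_extendCurve_le (γ : C(Icc (-1 : ℝ) 1, E)) (s : ℝ) : ‖extendCurve γ s‖ ≤ ‖γ‖ :=
  γ.norm_coe_le_norm _

variable (E) in
/-- The primitive `γ ↦ (τ ↦ ∫₀^τ γ)` on curves on `[-1, 1]`. -/
def primitiveCurve : C(Icc (-1 : ℝ) 1, E) →L[ℝ] C(Icc (-1 : ℝ) 1, E) :=
  LinearMap.mkContinuous
    { toFun := fun γ => ⟨fun τ => ∫ s in (0 : ℝ)..τ, extendCurve γ s,
        (intervalIntegral.continuous_primitive
          (fun a b => (continuous_extendCurve γ).intervalIntegrable a b) 0).comp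
            continuous_subtype_val⟩
      map_add' := fun γ γ' => by
        ext τ
        exact intervalIntegral.integral_add ((continuous_extendCurve γ).intervalIntegrable _ _)
          ((continuous_extendCurve γ').intervalIntegrable _ _)
      map_smul' := fun c γ => by
        ext τ
        exact intervalIntegral.integral_smul c (extendCurve γ) } 1 (fun γ => by
    rw [ContinuousMap.norm_le _ (by positivity)]
    rintro ⟨τ, hτ⟩
    refine (intervalIntegral.norm_integral_le_of_norm_le_const
      (fun s _ => norm_extendCurve_le γ s)).trans ?_
    rw [one_mul, sub_zero]
    exact mul_le_of_le_one_right (norm_nonneg _) (abs_le.2 hτ))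

/-- The implicit function theorem gives smoothness at the centre, and for `n = ∞` this does not by
itself spread to a neighbourhood. Invertibility is open, so the theorem applies again at nearby
solutions, and local uniqueness identifies the two implicit functions. -/
theorem eventually_contDiffAt_implicitFunction {E₁ E₂ F : Type*} [NormedAddCommGroup E₁]
    [NormedSpace ℝ E₁] [CompleteSpace E₁] [NormedAddCommGroup E₂] [NormedSpace ℝ E₂]
    [CompleteSpace E₂] [NormedAddCommGroup F] [NormedSpace ℝ F] [CompleteSpace F] {u : E₁ × E₂}
    {f : E₁ × E₂ → F} {n : WithTop ℕ∞} (hf : ContDiff ℝ n f) (hn : n ≠ 0)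
    (hinv : (fderiv ℝ f u ∘L .inr ℝ E₁ E₂).IsInvertible) :
    ∀ᶠ p in 𝓝 u.1, ContDiffAt ℝ n (hf.contDiffAt.implicitFunction hn hinv) p := by
  set ψ := hf.contDiffAt.implicitFunction hn hinv with hψ
  have hu : (u.1, ψ u.1) = u := by
    rw [hψ, hf.contDiffAt.implicitFunction_apply_self hn hinv]
  have hcont : Filter.Tendsto (fun p => (p, ψ p)) (𝓝 u.1) (𝓝 u) := by
    have : ContinuousAt (fun p => (p, ψ p)) u.1 :=
      continuousAt_id.prodMk (hf.contDiffAt.contDiffAt_implicitFunction hn hinv).continuousAt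
    rwa [ContinuousAt, hu] at this
  have h1 : ∀ᶠ v in 𝓝 u, (fderiv ℝ f v ∘L .inr ℝ E₁ E₂).IsInvertible := by
    obtain ⟨e, he⟩ := hinv
    have hc : Continuous fun v => fderiv ℝ f v ∘L ContinuousLinearMap.inr ℝ E₁ E₂ :=
      (hf.continuous_fderiv hn).clm_comp continuous_const
    refine hc.continuousAt.preimage_mem_nhds (t := {A | A.IsInvertible}) ?_
    rw [← he]
    exact Filter.mem_of_superset e.nhds (by rintro _ ⟨e', rfl⟩; exact ⟨e', rfl⟩)
  have h2 := eventually_eventually_nhds.2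
    (hf.contDiffAt.eventually_apply_eq_iff_implicitFunction hn hinv)
  have h3 := hf.contDiffAt.eventually_apply_implicitFunction hn hinv
  filter_upwards [hcont.eventually h1, hcont.eventually h2, h3] with p hp1 hp2 hp3
  have hself := hf.contDiffAt.implicitFunction_apply_self hn hp1
  have hsm := hf.contDiffAt.contDiffAt_implicitFunction hn hp1
  refine hsm.congr_of_eventuallyEq ?_
  have hc' : ContinuousAt (fun q => (q, hf.contDiffAt.implicitFunction hn hp1 q)) p :=
    continuousAt_id.prodMk hsm.continuousAt
  have hp2' : ∀ᶠ v in 𝓝 ((fun q => (q, hf.contDiffAt.implicitFunction hn hp1 q)) p),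
      f v = f u ↔ ψ v.1 = v.2 := by
    simp only [hself]
    exact hp2
  filter_upwards [hc'.eventually hp2', hf.contDiffAt.eventually_apply_implicitFunction hn hp1]
    with q hq1 hq2
  exact hq1.1 (hq2.trans hp3)

/-- Smooth local flows of smooth Lipschitz vector fields. -/
theorem exists_local_flow_of_lipschitz {v : E → E} (hv : ContDiff ℝ ∞ v) {C : NNReal}
    (hC : LipschitzWith C v) (x₀ : E) :
    ∃ ε > 0, ∃ U ∈ 𝓝 x₀, ∃ Φ : ℝ × E → E, ContDiffOn ℝ ∞ Φ (Ioo (-ε) ε ×ˢ U) ∧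
      ∀ x ∈ U, Φ (0, x) = x ∧ ∀ t ∈ Ioo (-ε) ε, HasDerivAt (fun s => Φ (s, x)) (v (Φ (t, x))) t := by
  set K := Icc (-1 : ℝ) 1
  let vc : C(E, E) := ⟨v, hv.continuous⟩
  let cst : E →L[ℝ] C(K, E) := ContinuousLinearMap.const ℝ K
  -- A zero `γ` of `f ((t, x), ·)` is the integral curve from `x` with time rescaled by `t` to the
  -- fixed interval `[-1, 1]`. So time becomes a parameter of the implicit function theorem.
  let f : (ℝ × E) × C(K, E) → C(K, E) := fun p =>
    p.2 - cst p.1.2 - p.1.1 • primitiveCurve E (vc.comp p.2)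
  have hf : ContDiff ℝ ∞ f := by
    have := contDiff_continuousMap_comp (K := K) vc hv
    fun_prop
  let u : (ℝ × E) × C(K, E) := ((0, x₀), cst x₀)
  have hu : f u = 0 := by simp [f, u]
  have hinv : (fderiv ℝ f u ∘L ContinuousLinearMap.inr ℝ (ℝ × E) C(K, E)).IsInvertible := by
    have h1 : HasFDerivAt (fun γ : C(K, E) => f ((0, x₀), γ))
        (fderiv ℝ f u ∘L ContinuousLinearMap.inr ℝ (ℝ × E) C(K, E)) (cst x₀) :=
      HasFDerivAt.comp (cst x₀) (hf.differentiable (by simp) u).hasFDerivAt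
        (hasFDerivAt_prodMk_right _ _)
    -- At `t = 0` the integral term drops out, so the partial derivative in `γ` is the identity.
    have h2 : HasFDerivAt (fun γ : C(K, E) => f ((0, x₀), γ))
        (ContinuousLinearMap.id ℝ C(K, E)) (cst x₀) := by
      have : (fun γ : C(K, E) => f ((0, x₀), γ)) = fun γ => γ - cst x₀ := by
        funext γ; simp [f]
      rw [this]
      exact (hasFDerivAt_id _).sub_const _
    rw [h1.unique h2]
    exact ⟨ContinuousLinearEquiv.refl ℝ _, rfl⟩
  have hfa : ContDiffAt ℝ ∞ f u := hf.contDiffAt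
  have hne : (∞ : WithTop ℕ∞) ≠ 0 := by simp
  set ψ := hfa.implicitFunction hne hinv with hψ
  have hev : ∀ᶠ p in 𝓝 ((0, x₀) : ℝ × E), f (p, ψ p) = 0 ∧ ContDiffAt ℝ ∞ ψ p := by
    have h1 := hfa.eventually_apply_implicitFunction hne hinv
    rw [hu] at h1
    exact h1.and (eventually_contDiffAt_implicitFunction hf hne hinv)
  obtain ⟨a, ha, U, hU, hball⟩ : ∃ a > 0, ∃ U ∈ 𝓝 x₀, ∀ p ∈ Ioo (-a) a ×ˢ U,
      f (p, ψ p) = 0 ∧ ContDiffAt ℝ ∞ ψ p := by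
    obtain ⟨S, hS, U, hU, h⟩ := Filter.mem_prod_iff.1 (nhds_prod_eq (x := (0 : ℝ)) (y := x₀) ▸ hev)
    obtain ⟨a, ha, haS⟩ := Metric.mem_nhds_iff.1 hS
    rw [Real.ball_eq_Ioo, zero_sub, zero_add] at haS
    exact ⟨a, ha, U, hU, fun p hp => h ⟨haS hp.1, hp.2⟩⟩
  let cv : ℝ → E → ℝ → E := fun t x τ => x + t • ∫ s in (0 : ℝ)..τ, v (extendCurve (ψ (t, x)) s)
  have hcv : ∀ t ∈ Ioo (-a) a, ∀ x ∈ U, ∀ τ : Icc (-1 : ℝ) 1, ψ (t, x) τ = cv t x τ := by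
    intro t ht x hx τ
    have := DFunLike.congr_fun (hball (t, x) ⟨ht, hx⟩).1 τ
    simp only [f, ContinuousMap.sub_apply, ContinuousMap.zero_apply, sub_sub, sub_eq_zero] at this
    exact this
  have hcvd : ∀ t ∈ Ioo (-a) a, ∀ x ∈ U, ∀ τ ∈ Icc (-1 : ℝ) 1,
      HasDerivAt (cv t x) (t • v (cv t x τ)) τ := by
    intro t ht x hx τ hτ
    have h1 : extendCurve (ψ (t, x)) τ = cv t x τ := by
      rw [← hcv t ht x hx ⟨τ, hτ⟩, extendCurve, projIcc_of_mem _ hτ]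
    have h2 : Continuous fun s => v (extendCurve (ψ (t, x)) s) :=
      hv.continuous.comp (continuous_extendCurve _)
    rw [← h1]
    exact ((h2.integral_hasStrictDerivAt 0 τ).hasDerivAt.const_smul t).const_add x
  have one_mem : (1 : ℝ) ∈ Icc (-1 : ℝ) 1 := by norm_num
  refine ⟨a / 2, by positivity, U, hU, fun p => ψ p ⟨1, one_mem⟩, ?_, fun x hx => ⟨?_, ?_⟩⟩
  · intro p hp
    have : ContDiffAt ℝ ∞ ψ p :=
      (hball p ⟨⟨by linarith [hp.1.1], by linarith [hp.1.2]⟩, hp.2⟩).2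
    exact ((ContinuousMap.evalCLM ℝ (⟨1, one_mem⟩ : K)).contDiff.contDiffAt.comp p
      this).contDiffWithinAt
  · change ψ (0, x) _ = x
    rw [hcv 0 ⟨by linarith, ha⟩ x hx]; simp [cv]
  · intro t ht
    have hb : a / 2 ∈ Ioo (-a) a := ⟨by linarith, by linarith⟩
    -- By uniqueness for the rescaled equation, which uses the Lipschitz bound, the endpoint for
    -- time `s` is a value of the single curve for time `a / 2`. Hence `s ↦ Φ (s, x)` is
    -- differentiated along one curve.
    have hrep : ∀ s ∈ Ioo (-(a / 2)) (a / 2),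
        ψ (s, x) ⟨1, one_mem⟩ = cv (a / 2) x (s * (a / 2)⁻¹) := by
      intro s hs
      have hs' : s ∈ Ioo (-a) a := ⟨by linarith [hs.1], by linarith [hs.2]⟩
      have hr : |s * (a / 2)⁻¹| ≤ 1 := by
        rw [abs_mul, abs_of_pos (inv_pos.2 (by positivity : 0 < a / 2)), ← div_eq_mul_inv,
          div_le_one (by positivity)]
        exact (abs_lt.2 hs).le
      have hmem : ∀ τ ∈ Icc (0 : ℝ) 1, s * (a / 2)⁻¹ * τ ∈ Icc (-1 : ℝ) 1 := fun τ hτ =>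
        abs_le.1 (by
          rw [abs_mul]
          exact mul_le_one₀ hr (abs_nonneg _) (abs_le.2 ⟨by linarith [hτ.1], hτ.2⟩))
      have hd1 : ∀ τ ∈ Icc (0 : ℝ) 1, HasDerivAt (cv s x) (s • v (cv s x τ)) τ := fun τ hτ =>
        hcvd s hs' x hx τ ⟨by linarith [hτ.1], hτ.2⟩
      have hd2 : ∀ τ ∈ Icc (0 : ℝ) 1, HasDerivAt (fun τ => cv (a / 2) x (s * (a / 2)⁻¹ * τ))
          (s • v (cv (a / 2) x (s * (a / 2)⁻¹ * τ))) τ := fun τ hτ => by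
        have h1 := hcvd (a / 2) hb x hx _ (hmem τ hτ)
        have h2 := h1.scomp τ ((hasDerivAt_id τ).const_mul (s * (a / 2)⁻¹))
        convert! h2 using 1
        rw [smul_smul]; congr 1; field_simp
      have := ODE_solution_unique_of_mem_Icc_right (v := fun _ y => s • v y) (s := fun _ => univ)
        (K := ‖s‖₊ * C) (f := cv s x) (g := fun τ => cv (a / 2) x (s * (a / 2)⁻¹ * τ)) (a := 0)
        (b := 1) (fun τ _ => (((lipschitzWith_smul s).comp hC).lipschitzOnWith))
        (fun τ hτ => (hd1 τ hτ).continuousAt.continuousWithinAt)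
        (fun τ hτ => (hd1 τ (Ico_subset_Icc_self hτ)).hasDerivWithinAt) (fun _ _ => mem_univ _)
        (fun τ hτ => (hd2 τ hτ).continuousAt.continuousWithinAt)
        (fun τ hτ => (hd2 τ (Ico_subset_Icc_self hτ)).hasDerivWithinAt) (fun _ _ => mem_univ _)
        (by simp [cv]) (show (1 : ℝ) ∈ Icc (0 : ℝ) 1 by norm_num)
      rw [hcv s hs' x hx]
      simpa using this
    have ht1 : t * (a / 2)⁻¹ ∈ Icc (-1 : ℝ) 1 := by
      rw [← div_eq_mul_inv]
      exact ⟨by rw [le_div_iff₀ (by positivity)]; linarith [ht.1],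
        by rw [div_le_iff₀ (by positivity)]; linarith [ht.2]⟩
    have h1 := (hcvd (a / 2) hb x hx _ ht1).scomp t ((hasDerivAt_id t).mul_const (a / 2)⁻¹)
    rw [smul_smul, show 1 * (a / 2)⁻¹ * (a / 2) = 1 by field_simp, one_smul, ← hrep t ht] at h1
    refine h1.congr_of_eventuallyEq ?_
    filter_upwards [Ioo_mem_nhds ht.1 ht.2] with s hs
    exact hrep s hs

end Flow

/-! ### Flows of vector fields on manifolds -/

section ManifoldFlow

variable {E : Type*} [NormedAddCommGroup E] [NormedSpace ℝ E] [FiniteDimensional ℝ E]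
  {H : Type*} [TopologicalSpace H] {I : ModelWithCorners ℝ E H} [I.Boundaryless]
  {X : Type*} [TopologicalSpace X] [ChartedSpace H X] [IsManifold I ∞ X]

/-- `v` is the velocity of the curve `c` at time `t`. -/
def HasVelocity (I : ModelWithCorners ℝ E H) (c : ℝ → X) (v : E) (t : ℝ) : Prop :=
  MDifferentiableAt 𝓘(ℝ, ℝ) I c t ∧ mD 𝓘(ℝ, ℝ) I c t 1 = v

theorem hasVelocity_iff {c : ℝ → X} {v : E} {t : ℝ} : HasVelocity I c v t ↔
    HasMFDerivAt 𝓘(ℝ, ℝ) I c t ((1 : ℝ →L[ℝ] ℝ).smulRight v : ℝ →L[ℝ] E) := by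
  constructor
  · rintro ⟨h1, h2⟩
    have : mfderiv 𝓘(ℝ, ℝ) I c t = ((1 : ℝ →L[ℝ] ℝ).smulRight v : ℝ →L[ℝ] E) := by
      have : mD 𝓘(ℝ, ℝ) I c t = (1 : ℝ →L[ℝ] ℝ).smulRight v :=
        ContinuousLinearMap.ext_ring (by rw [h2]; simp)
      exact this
    rw [← this]; exact h1.hasMFDerivAt
  · intro h
    have h2 : mD 𝓘(ℝ, ℝ) I c t = (1 : ℝ →L[ℝ] ℝ).smulRight v := h.mfderiv
    refine ⟨h.mdifferentiableAt, ?_⟩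
    rw [h2]; simp

theorem HasVelocity.comp {E' : Type*} [NormedAddCommGroup E'] [NormedSpace ℝ E']
    {H' : Type*} [TopologicalSpace H'] {I' : ModelWithCorners ℝ E' H'}
    {X' : Type*} [TopologicalSpace X'] [ChartedSpace H' X'] [IsManifold I' ∞ X']
    {c : ℝ → X} {v : E} {t : ℝ} (h : HasVelocity I c v t) {f : X → X'}
    (hf : MDifferentiableAt I I' f (c t)) :
    HasVelocity I' (fun s => f (c s)) (mD I I' f (c t) v) t :=
  ⟨hf.comp t h.1, by rw [mD_comp hf h.1 rfl, ← h.2]; rfl⟩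

theorem hasVelocity_iff_hasDerivAt {c : ℝ → E} {v : E} {t : ℝ} :
    HasVelocity 𝓘(ℝ, E) c v t ↔ HasDerivAt c v t := by
  refine hasVelocity_iff.trans (Iff.trans hasMFDerivAt_iff_hasFDerivAt ?_)
  rw [hasDerivAt_iff_hasFDerivAt]
  have : (1 : ℝ →L[ℝ] ℝ).smulRight v = ContinuousLinearMap.toSpanSingleton ℝ v := by ext; simp
  exact this ▸ Iff.rfl

theorem HasVelocity.unique {c : ℝ → X} {v v' : E} {t : ℝ} (h : HasVelocity I c v t)
    (h' : HasVelocity I c v' t) : v = v' := h.2.symm.trans h'.2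

theorem HasVelocity.congr {c c' : ℝ → X} {v : E} {t : ℝ} (h : HasVelocity I c v t)
    (hc : c' =ᶠ[𝓝 t] c) : HasVelocity I c' v t :=
  ⟨h.1.congr_of_eventuallyEq hc, by rw [mD_congr hc, h.2]⟩

/-- A smooth function equal to one near a point of an open set and compactly supported in it. -/
theorem exists_cutoff_normed {U : Set E} (hU : IsOpen U) {e : E} (he : e ∈ U) :
    ∃ χ : E → ℝ, ContDiff ℝ ∞ χ ∧ HasCompactSupport χ ∧ tsupport χ ⊆ U ∧ ∀ᶠ x in 𝓝 e, χ x = 1 := by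
  obtain ⟨r, hr, hrU⟩ := Metric.isOpen_iff.1 hU e he
  let f : ContDiffBump e := ⟨r / 4, r / 2, by positivity, by linarith⟩
  refine ⟨f, f.contDiff, f.hasCompactSupport, ?_, f.eventuallyEq_one⟩
  rw [f.tsupport_eq]
  exact (Metric.closedBall_subset_ball (by simp only [f]; linarith)).trans hrU

theorem contDiff_smul_of_tsupport_subset {F : Type*} [NormedAddCommGroup F] [NormedSpace ℝ F]
    {χ : E → ℝ} (hχ : ContDiff ℝ ∞ χ) {f : E → F}
    (hf : ∀ e ∈ tsupport χ, ContDiffAt ℝ ∞ f e) : ContDiff ℝ ∞ (fun e => χ e • f e) := by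
  rw [contDiff_iff_contDiffAt]
  intro e
  by_cases he : e ∈ tsupport χ
  · exact hχ.contDiffAt.smul (hf e he)
  · refine (contDiffAt_const (c := (0 : F))).congr_of_eventuallyEq ?_
    filter_upwards [(isClosed_tsupport χ).isOpen_compl.mem_nhds he] with y hy
    rw [image_eq_zero_of_notMem_tsupport hy, zero_smul]

/-- Smooth local flows of smooth vector fields on manifolds. -/
theorem exists_local_flow (v : ∀ x : X, TangentSpace I x)
    (hv : ContMDiff I I.tangent ∞ (fun x => (⟨x, v x⟩ : TangentBundle I X))) (x₀ : X) :
    ∃ ε > 0, ∃ U ∈ 𝓝 x₀, ∃ Φ : ℝ × X → X,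
      (∀ p ∈ Ioo (-ε) ε ×ˢ U, ContMDiffAt (𝓘(ℝ, ℝ).prod I) I ∞ Φ p) ∧
      ∀ x ∈ U, Φ (0, x) = x ∧ ∀ t ∈ Ioo (-ε) ε, HasVelocity I (fun s => Φ (s, x)) (v (Φ (t, x))) t := by
  set φ := extChartAt I x₀ with hφ
  let w : E → E := fun e => chartD I x₀ (φ.symm e) (v (φ.symm e))
  have hsrc : ∀ e ∈ φ.target, φ.symm e ∈ (chartAt H x₀).source := fun e he => by
    rw [← extChartAt_source (I := I)]; exact φ.map_target he
  have hw : ∀ e ∈ φ.target, ContDiffAt ℝ ∞ w e := by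
    intro e he
    have hs : ContMDiffAt 𝓘(ℝ, E) I ∞ φ.symm e :=
      (contMDiffOn_extChartAt_symm x₀).contMDiffAt ((isOpen_extChartAt_target x₀).mem_nhds he)
    exact ((contMDiffAt_tangent_iff (x₀ := x₀) le_rfl (hsrc e he)).1
      (hv.contMDiffAt.comp e hs)).2.contDiffAt
  have he₀ : φ x₀ ∈ φ.target := mem_extChartAt_target x₀
  -- The cutoff makes the coordinate field globally smooth and Lipschitz. It is one near the centre,
  -- where the flow of the product stays for short times.
  obtain ⟨χ, hχ, hχc, hχs, hχ1⟩ := exists_cutoff_normed (isOpen_extChartAt_target (I := I) x₀) he₀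
  have hsm : ContDiff ℝ ∞ (fun e => χ e • w e) :=
    contDiff_smul_of_tsupport_subset hχ fun e he => hw e (hχs he)
  obtain ⟨C, hC⟩ := ContDiff.lipschitzWith_of_hasCompactSupport (n := ∞)
    (hχc.smul_right (f' := w)) hsm (by simp)
  obtain ⟨ε, hε, U, hU, F, hF, hF'⟩ := exists_local_flow_of_lipschitz hsm hC (φ x₀)
  have hFc : ContinuousAt F (0, φ x₀) :=
    (hF.continuousOn).continuousAt (prod_mem_nhds (Ioo_mem_nhds (by linarith) hε) hU)
  have hgood : ∀ᶠ e in 𝓝 (φ x₀), χ e = 1 ∧ e ∈ φ.target :=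
    hχ1.and ((isOpen_extChartAt_target x₀).mem_nhds he₀)
  have h1 : ∀ᶠ p in 𝓝 ((0, φ x₀) : ℝ × E), χ (F p) = 1 ∧ F p ∈ φ.target := by
    rw [ContinuousAt, (hF' _ (mem_of_mem_nhds hU)).1] at hFc
    exact hFc.eventually hgood
  obtain ⟨S, hS, U', hU', h2⟩ := Filter.mem_prod_iff.1 (nhds_prod_eq (x := (0 : ℝ)) (y := φ x₀) ▸ h1)
  obtain ⟨a, ha, haS⟩ := Metric.mem_nhds_iff.1 hS
  rw [Real.ball_eq_Ioo, zero_sub, zero_add] at haS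
  have hUo : interior U ∈ 𝓝 (φ x₀) := interior_mem_nhds.2 hU
  refine ⟨min ε a, lt_min hε ha, φ.source ∩ φ ⁻¹' (interior U ∩ U'), Filter.inter_mem
    (extChartAt_source_mem_nhds x₀) ((continuousAt_extChartAt x₀).preimage_mem_nhds
      (Filter.inter_mem hUo hU')), fun p => φ.symm (F (p.1, φ p.2)), ?_, ?_⟩
  · rintro ⟨t, x⟩ ⟨ht, hx, hxU, hxU'⟩
    have ht1 : t ∈ Ioo (-ε) ε := ⟨by linarith [ht.1, min_le_left ε a],
      ht.2.trans_le (min_le_left _ _)⟩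
    have ht2 : t ∈ Ioo (-a) a := ⟨by linarith [ht.1, min_le_right ε a],
      ht.2.trans_le (min_le_right _ _)⟩
    have hm := (h2 (show (t, φ x) ∈ S ×ˢ U' from ⟨haS ht2, hxU'⟩)).2
    have c1 : ContMDiffAt (𝓘(ℝ, ℝ).prod I) (𝓘(ℝ, ℝ).prod 𝓘(ℝ, E)) ∞
        (fun p : ℝ × X => (p.1, φ p.2)) (t, x) :=
      contMDiffAt_fst.prodMk ((contMDiffAt_extChartAt' (by rwa [extChartAt_source] at hx)).comp
        (t, x) contMDiffAt_snd)
    have c2 : ContMDiffAt (𝓘(ℝ, ℝ).prod 𝓘(ℝ, E)) 𝓘(ℝ, E) ∞ F (t, φ x) := by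
      rw [← modelWithCornersSelf_prod, chartedSpaceSelf_prod]
      exact ((hF.contDiffAt (prod_mem_nhds (Ioo_mem_nhds ht1.1 ht1.2)
        (mem_interior_iff_mem_nhds.1 hxU)))).contMDiffAt
    have c3 : ContMDiffAt 𝓘(ℝ, E) I ∞ φ.symm (F (t, φ x)) :=
      (contMDiffOn_extChartAt_symm x₀).contMDiffAt ((isOpen_extChartAt_target x₀).mem_nhds hm)
    exact c3.comp (t, x) (c2.comp (t, x) c1)
  · rintro x ⟨hx, hxU, hxU'⟩
    have hxU := interior_subset hxU
    refine ⟨by simp only [(hF' _ hxU).1]; exact φ.left_inv hx, fun t ht => ?_⟩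
    have ht1 : t ∈ Ioo (-ε) ε := ⟨by linarith [ht.1, min_le_left ε a],
      ht.2.trans_le (min_le_left _ _)⟩
    have ht2 : t ∈ Ioo (-a) a := ⟨by linarith [ht.1, min_le_right ε a],
      ht.2.trans_le (min_le_right _ _)⟩
    obtain ⟨hm1, hm⟩ := h2 (show (t, φ x) ∈ S ×ˢ U' from ⟨haS ht2, hxU'⟩)
    have hd := (hF' _ hxU).2 t ht1
    simp only [hm1, one_smul] at hd
    have c3 : MDifferentiableAt 𝓘(ℝ, E) I φ.symm (F (t, φ x)) :=
      ((contMDiffOn_extChartAt_symm (n := ∞) x₀).contMDiffAt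
        ((isOpen_extChartAt_target x₀).mem_nhds hm)).mdiff
    have := (hasVelocity_iff_hasDerivAt.2 hd).comp c3
    have h3 := chartDInv_chartD_apply (I := I) (hsrc _ hm) (v (φ.symm (F (t, φ x))))
    rw [chartDInv, ← hφ, φ.right_inv hm] at h3
    exact h3 ▸ this

/-- Integral curves that exist for a uniform time give a smooth global flow. -/
theorem exists_global_flow [T2Space X] (v : ∀ x : X, TangentSpace I x)
    (hv : ContMDiff I I.tangent ∞ (fun x => (⟨x, v x⟩ : TangentBundle I X))) {ε : ℝ} (hε : 0 < ε)
    (hloc : ∀ x₀ : X, ∃ U ∈ 𝓝 x₀, ∃ Φ : ℝ × X → X,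
      (∀ p ∈ Ioo (-ε) ε ×ˢ U, ContMDiffAt (𝓘(ℝ, ℝ).prod I) I ∞ Φ p) ∧
      ∀ x ∈ U, Φ (0, x) = x ∧
        ∀ t ∈ Ioo (-ε) ε, HasVelocity I (fun s => Φ (s, x)) (v (Φ (t, x))) t) :
    ∃ Φ : ℝ × X → X, ContMDiff (𝓘(ℝ, ℝ).prod I) I ∞ Φ ∧ (∀ x, Φ (0, x) = x) ∧
      (∀ x t, HasVelocity I (fun s => Φ (s, x)) (v (Φ (t, x))) t) ∧
      ∀ s t x, Φ (s + t, x) = Φ (s, Φ (t, x)) := by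
  have hv1 : ContMDiff I I.tangent 1 (fun x => (⟨x, v x⟩ : TangentBundle I X)) :=
    hv.of_le (by exact_mod_cast le_top)
  have hex := exists_isMIntegralCurve_of_isMIntegralCurveOn hv1 hε (fun x => by
    obtain ⟨U, hU, Φ, -, h⟩ := hloc x
    obtain ⟨h0, h1⟩ := h x (mem_of_mem_nhds hU)
    exact ⟨_, h0, fun t ht => (hasVelocity_iff.1 (h1 t ht)).hasMFDerivWithinAt⟩)
  choose γ hγ0 hγ using hex
  have hgroup : ∀ s t x, γ x (s + t) = γ (γ x t) s := by
    intro s t x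
    have := isMIntegralCurve_Ioo_eq_of_contMDiff_boundaryless (t₀ := 0) hv1 ((hγ x).comp_add t)
      (hγ (γ x t)) (by simp [hγ0])
    exact congrFun this s
  -- The range of times is doubled at each step, since the flow for time `t` is the flow for time `t
  -- / 2` applied twice.
  have hsm : ∀ n : ℕ, ∀ t x, |t| < 2 ^ n * ε →
      ContMDiffAt (𝓘(ℝ, ℝ).prod I) I ∞ (fun p : ℝ × X => γ p.2 p.1) (t, x) := by
    intro n
    induction n with
    | zero =>
      intro t x ht
      rw [pow_zero, one_mul] at ht
      have ht := abs_lt.1 ht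
      obtain ⟨U, hU, Φ, hΦ, h⟩ := hloc x
      refine (hΦ (t, x) ⟨ht, mem_of_mem_nhds hU⟩).congr_of_eventuallyEq ?_
      filter_upwards [prod_mem_nhds (Ioo_mem_nhds ht.1 ht.2) hU] with p hp
      exact isMIntegralCurveOn_Ioo_eqOn_of_contMDiff_boundaryless (t₀ := 0) ⟨by linarith, hε⟩ hv1
        ((hγ p.2).isMIntegralCurveOn _)
        (fun t ht => (hasVelocity_iff.1 ((h p.2 hp.2).2 t ht)).hasMFDerivWithinAt)
        (by rw [hγ0, (h p.2 hp.2).1]) hp.1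
    | succ n ih =>
      intro t x ht
      have ht2 : |t / 2| < 2 ^ n * ε := by
        rw [abs_div, abs_two, div_lt_iff₀ two_pos]
        calc |t| < _ := ht
          _ = _ := by ring
      have heq : (fun p : ℝ × X => γ p.2 p.1) =
          fun p : ℝ × X => γ (γ p.2 (p.1 / 2)) (p.1 / 2) := by
        funext p; rw [← hgroup, add_halves]
      rw [heq]
      have hhalf : ContMDiffAt (𝓘(ℝ, ℝ).prod I) 𝓘(ℝ, ℝ) ∞ (fun p : ℝ × X => p.1 / 2) (t, x) :=
        (contDiff_id.div_const (2 : ℝ)).contMDiff.contMDiffAt.comp (t, x) contMDiffAt_fst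
      have h1 : ContMDiffAt (𝓘(ℝ, ℝ).prod I) I ∞ (fun p : ℝ × X => γ p.2 (p.1 / 2)) (t, x) :=
        ContMDiffAt.comp (t, x) (g := fun p : ℝ × X => γ p.2 p.1)
          (f := fun p : ℝ × X => (p.1 / 2, p.2)) (ih (t / 2) x ht2) (hhalf.prodMk contMDiffAt_snd)
      exact ContMDiffAt.comp (t, x) (g := fun p : ℝ × X => γ p.2 p.1)
        (f := fun p : ℝ × X => (p.1 / 2, γ p.2 (p.1 / 2))) (ih (t / 2) _ ht2) (hhalf.prodMk h1)
  refine ⟨fun p => γ p.2 p.1, ?_, hγ0, fun x t => hasVelocity_iff.2 (hγ x t), hgroup⟩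
  rintro ⟨t, x⟩
  obtain ⟨n, hn⟩ := pow_unbounded_of_one_lt (|t| / ε) (one_lt_two)
  exact hsm n t x ((div_lt_iff₀ hε).1 hn)

end ManifoldFlow

/-! ### Flows of time-dependent vector fields with compact support -/

section TimeDependentFlow

variable {E : Type*} [NormedAddCommGroup E] [NormedSpace ℝ E] [FiniteDimensional ℝ E]
  {H : Type*} [TopologicalSpace H] {I : ModelWithCorners ℝ E H} [I.Boundaryless]
  {X : Type*} [TopologicalSpace X] [ChartedSpace H X] [IsManifold I ∞ X]

theorem HasVelocity.fst {c : ℝ → ℝ × X} {v : ℝ × E} {t : ℝ}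
    (h : HasVelocity (𝓘(ℝ, ℝ).prod I) c v t) : HasDerivAt (fun s => (c s).1) v.1 t := by
  have := h.comp (f := Prod.fst) (I' := 𝓘(ℝ, ℝ)) mdifferentiableAt_fst
  rw [hasVelocity_iff_hasDerivAt, mD, mfderiv_fst] at this
  exact this

theorem HasVelocity.snd {c : ℝ → ℝ × X} {v : ℝ × E} {t : ℝ}
    (h : HasVelocity (𝓘(ℝ, ℝ).prod I) c v t) : HasVelocity I (fun s => (c s).2) v.2 t := by
  have := h.comp (f := Prod.snd) (I' := I) mdifferentiableAt_snd
  rw [mD, mfderiv_snd] at this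
  exact this

theorem HasVelocity.prodMk {c : ℝ → X} {a : ℝ → ℝ} {v : E} {b t : ℝ} (ha : HasDerivAt a b t)
    (h : HasVelocity I c v t) :
    HasVelocity (𝓘(ℝ, ℝ).prod I) (fun s => (a s, c s)) ((b, v) : ℝ × E) t := by
  have ha := hasVelocity_iff_hasDerivAt.2 ha
  refine ⟨ha.1.prodMk h.1, ?_⟩
  have := mfderiv_prodMk ha.1 h.1
  rw [mD, this]
  exact Prod.ext ha.2 h.2

theorem hasVelocity_const (x : X) (t : ℝ) : HasVelocity I (fun _ => x) (0 : E) t :=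
  ⟨mdifferentiableAt_const, by rw [mD, mfderiv_const]; rfl⟩

/-- The vector field `(1, V)` on `ℝ × X`. -/
def suspension (V : ℝ → ∀ x : X, TangentSpace I x) (p : ℝ × X) :
    TangentSpace (𝓘(ℝ, ℝ).prod I) p := ((1, V p.1 p.2) : ℝ × E)

theorem contMDiff_suspension {V : ℝ → ∀ x : X, TangentSpace I x}
    (hV : ContMDiff (𝓘(ℝ, ℝ).prod I) I.tangent ∞
      (fun p : ℝ × X => (⟨p.2, V p.1 p.2⟩ : TangentBundle I X))) :
    ContMDiff (𝓘(ℝ, ℝ).prod I) (𝓘(ℝ, ℝ).prod I).tangent ∞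
      (fun p : ℝ × X => (⟨p, suspension V p⟩ : TangentBundle (𝓘(ℝ, ℝ).prod I) (ℝ × X))) := by
  have h1 : ContMDiff (𝓘(ℝ, ℝ).prod I) 𝓘(ℝ, ℝ).tangent ∞
      (fun p : ℝ × X => (⟨p.1, (1 : ℝ)⟩ : TangentBundle 𝓘(ℝ, ℝ) ℝ)) := by
    have : ContMDiff 𝓘(ℝ, ℝ) 𝓘(ℝ, ℝ).tangent ∞
        (fun t : ℝ => (⟨t, (1 : ℝ)⟩ : TangentBundle 𝓘(ℝ, ℝ) ℝ)) :=
      contMDiff_vectorSpace_iff_contDiff.2 contDiff_const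
    exact this.comp contMDiff_fst
  exact (contMDiff_equivTangentBundleProd_symm (I := 𝓘(ℝ, ℝ)) (M := ℝ) (I' := I) (M' := X)
    (n := ∞)).comp (h1.prodMk hV)

theorem hasVelocity_suspension_iff {V : ℝ → ∀ x : X, TangentSpace I x} {c : ℝ → X} {s t : ℝ} :
    HasVelocity (𝓘(ℝ, ℝ).prod I) (fun r => (s + r, c r)) (suspension V (s + t, c t)) t ↔
      HasVelocity I c (V (s + t) (c t)) t :=
  ⟨fun h => h.snd, fun h => HasVelocity.prodMk ((hasDerivAt_id t).const_add s) h⟩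

/-- The flow of a smooth time-dependent vector field with compact support. -/
theorem exists_flow_of_compact_support [T2Space X] (V : ℝ → ∀ x : X, TangentSpace I x)
    (hV : ContMDiff (𝓘(ℝ, ℝ).prod I) I.tangent ∞
      (fun p : ℝ × X => (⟨p.2, V p.1 p.2⟩ : TangentBundle I X)))
    {K : Set X} (hK : IsCompact K) (hVK : ∀ t, ∀ x ∉ K, V t x = 0) {T : ℝ}
    (hVT : ∀ t x, T < |t| → V t x = 0) :
    ∃ φ : ℝ → Diffeomorph I I X X ∞,
      ContMDiff (𝓘(ℝ, ℝ).prod I) I ∞ (fun p : ℝ × X => φ p.1 p.2) ∧ (∀ x, φ 0 x = x) ∧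
      (∀ x t, HasVelocity I (fun s => φ s x) (V t (φ t x)) t) ∧
      ∀ {a b t₀ : ℝ} {c : ℝ → X} {x : X}, t₀ ∈ Ioo a b →
        (∀ t ∈ Ioo a b, HasVelocity I c (V t (c t)) t) → c t₀ = φ t₀ x →
        ∀ t ∈ Ioo a b, c t = φ t x := by
  have hS := contMDiff_suspension hV
  let LF : ℝ → ℝ × X → Prop := fun ε p₀ => ∃ U ∈ 𝓝 p₀, ∃ Φ : ℝ × (ℝ × X) → ℝ × X,
      (∀ p ∈ Ioo (-ε) ε ×ˢ U,
        ContMDiffAt (𝓘(ℝ, ℝ).prod (𝓘(ℝ, ℝ).prod I)) (𝓘(ℝ, ℝ).prod I) ∞ Φ p) ∧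
      ∀ x ∈ U, Φ (0, x) = x ∧ ∀ t ∈ Ioo (-ε) ε,
        HasVelocity (𝓘(ℝ, ℝ).prod I) (fun s => Φ (s, x)) (suspension V (Φ (t, x))) t
  have hmono : ∀ {ε ε' p}, ε' ≤ ε → LF ε p → LF ε' p := by
    rintro ε ε' p hε ⟨U, hU, Φ, h1, h2⟩
    have : Ioo (-ε') ε' ⊆ Ioo (-ε) ε := Ioo_subset_Ioo (by linarith) hε
    exact ⟨U, hU, Φ, fun p hp => h1 p ⟨this hp.1, hp.2⟩,
      fun x hx => ⟨(h2 x hx).1, fun t ht => (h2 x hx).2 t (this ht)⟩⟩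
  -- Compactness gives one lifespan for all starting points at which the field may be nonzero within
  -- unit time.
  have hcomp : ∃ ε > 0, ∀ p ∈ Icc (-T - 1) (T + 1) ×ˢ K, LF ε p := by
    refine (isCompact_Icc.prod hK).induction_on (p := fun s => ∃ ε > 0, ∀ p ∈ s, LF ε p)
      ⟨1, one_pos, by simp⟩ ?_ ?_ ?_
    · rintro s t hst ⟨ε, hε, h⟩; exact ⟨ε, hε, fun p hp => h p (hst hp)⟩
    · rintro s t ⟨ε, hε, h⟩ ⟨ε', hε', h'⟩
      refine ⟨min ε ε', lt_min hε hε', ?_⟩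
      rintro p (hp | hp)
      · exact hmono (min_le_left _ _) (h p hp)
      · exact hmono (min_le_right _ _) (h' p hp)
    · intro p _
      obtain ⟨ε, hε, U, hU, Φ, h1, h2⟩ := exists_local_flow (suspension V) hS p
      exact ⟨_, mem_nhdsWithin_of_mem_nhds (interior_mem_nhds.2 hU), ε, hε,
        fun q hq => ⟨U, mem_interior_iff_mem_nhds.1 hq, Φ, h1, h2⟩⟩
  obtain ⟨ε, hε, hB⟩ := hcomp
  -- Where the field vanishes for a unit of time, the suspended flow is a translation in time. The
  -- margin 1 around `[-T, T]` makes this cover all starting times outside the compact interval.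
  have htrans : ∀ U : Set (ℝ × X), (∀ p ∈ U, ∀ s ∈ Ioo (-1 : ℝ) 1, V (p.1 + s) p.2 = 0) →
      ∀ p₀, U ∈ 𝓝 p₀ → LF 1 p₀ := by
    intro U hU p₀ hp₀
    refine ⟨U, hp₀, fun q => (q.2.1 + q.1, q.2.2), fun p _ => ?_, fun p hp => ⟨by simp, ?_⟩⟩
    · have h1 : ContMDiffAt (𝓘(ℝ, ℝ).prod (𝓘(ℝ, ℝ).prod I)) 𝓘(ℝ, ℝ) ∞
          (fun q : ℝ × (ℝ × X) => q.2.1 + q.1) p :=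
        (contMDiffAt_fst.comp p contMDiffAt_snd).add contMDiffAt_fst
      exact h1.prodMk (contMDiffAt_snd.comp p contMDiffAt_snd)
    · intro t ht
      have h0 : HasVelocity I (fun _ : ℝ => p.2) (V (p.1 + t) p.2) t := by
        rw [hU p hp t ht]
        exact hasVelocity_const _ _
      exact (hasVelocity_suspension_iff (I := I) (V := V) (s := p.1) (t := t)
        (c := fun _ => p.2)).2 h0
  have hall : ∀ p, LF (min ε 1) p := by
    rintro ⟨t, x⟩
    by_cases hx : x ∈ K
    · by_cases ht : t ∈ Icc (-T - 1) (T + 1)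
      · exact hmono (min_le_left _ _) (hB _ ⟨ht, hx⟩)
      · refine hmono (min_le_right _ _) (htrans ((Icc (-T - 1) (T + 1))ᶜ ×ˢ univ) ?_ _
          (prod_mem_nhds (isClosed_Icc.isOpen_compl.mem_nhds ht) Filter.univ_mem))
        rintro ⟨t', x'⟩ ⟨ht', -⟩ s hs
        refine hVT _ _ ?_
        simp only [mem_compl_iff, mem_Icc, not_and_or, not_le] at ht'
        rcases ht' with h | h
        · exact lt_of_lt_of_le (by linarith [hs.2]) (neg_le_abs _)
        · exact lt_of_lt_of_le (by linarith [hs.1]) (le_abs_self _)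
    · exact hmono (min_le_right _ _) (htrans (univ ×ˢ Kᶜ) (fun p hp s _ => hVK _ _ hp.2) _
        (prod_mem_nhds Filter.univ_mem (hK.isClosed.isOpen_compl.mem_nhds hx)))
  obtain ⟨Φ, hΦ, hΦ0, hΦv, hΦg⟩ := exists_global_flow (suspension V) hS (lt_min hε one_pos) hall
  have hfst : ∀ s p, (Φ (s, p)).1 = p.1 + s := by
    intro s p
    have hd : ∀ t, HasDerivAt (fun t => (Φ (t, p)).1 - t) 0 t := fun t => by
      have h : HasDerivAt (fun t => (Φ (t, p)).1 - t) ((1 : ℝ) - 1) t :=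
        (hΦv p t).fst.sub (hasDerivAt_id t)
      rwa [sub_self] at h
    have := is_const_of_deriv_eq_zero (fun t => (hd t).differentiableAt) (fun t => (hd t).deriv) s 0
    simp only [hΦ0] at this
    linarith
  have hinv : ∀ s t x, Φ (s, (t, x)) = (t + s, (Φ (s, (t, x))).2) := fun s t x =>
    Prod.ext (hfst s (t, x)) rfl
  have hsm : ∀ s t : ℝ, ContMDiff I I ∞ fun x : X => (Φ (s, (t, x))).2 := fun s t =>
    contMDiff_snd.comp (hΦ.comp (contMDiff_const.prodMk (contMDiff_const.prodMk contMDiff_id)))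
  -- The map at time `t` runs the suspended flow from time `0`; its inverse starts at time `t` and
  -- runs for `-t`.
  let φ : ℝ → Diffeomorph I I X X ∞ := fun t =>
    { toFun := fun x => (Φ (t, (0, x))).2
      invFun := fun x => (Φ (-t, (t, x))).2
      left_inv := fun x => by
        have := hΦg (-t) t (0, x)
        rw [hinv t 0 x, neg_add_cancel, hΦ0, zero_add] at this
        simp only [← this]
      right_inv := fun x => by
        have := hΦg t (-t) (t, x)
        rw [hinv (-t) t x, add_neg_cancel, hΦ0] at this
        simp only [← this]
      contMDiff_toFun := hsm t 0
      contMDiff_invFun := hsm (-t) t }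
  refine ⟨φ, ?_, fun x => ?_, fun x t => ?_, ?_⟩
  · exact contMDiff_snd.comp (hΦ.comp (contMDiff_fst.prodMk (contMDiff_const.prodMk contMDiff_snd)))
  · change (Φ (0, (0, x))).2 = x
    rw [hΦ0]
  · have := (hΦv (0, x) t).snd
    rw [hinv t 0 x, zero_add] at this
    exact this
  · intro a b t₀ c x ht₀ hc h0 t ht
    have hS1 := hS.of_le (show (1 : WithTop ℕ∞) ≤ ∞ by exact_mod_cast le_top)
    have := isMIntegralCurveOn_Ioo_eqOn_of_contMDiff_boundaryless (t₀ := t₀) ht₀ hS1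
      (γ := fun r => (0 + r, c r)) (γ' := fun r => Φ (r, (0, x)))
      (fun t ht => (hasVelocity_iff.1 ((hasVelocity_suspension_iff (V := V) (c := c) (s := 0)
        (t := t)).2 (by rw [zero_add]; exact hc t ht))).hasMFDerivWithinAt)
      (fun t _ => (hasVelocity_iff.1 (hΦv (0, x) t)).hasMFDerivWithinAt)
      (by rw [hinv t₀ 0 x]; exact Prod.ext rfl h0) ht
    exact congrArg Prod.snd this

end TimeDependentFlow

/-! ### The inverse function theorem on manifolds -/

section InverseFunction

variable {E : Type*} [NormedAddCommGroup E] [NormedSpace ℝ E] [FiniteDimensional ℝ E]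
  {H : Type*} [TopologicalSpace H]
  {I : ModelWithCorners ℝ E H} [I.Boundaryless]
  {X : Type*} [TopologicalSpace X] [ChartedSpace H X] [IsManifold I ∞ X]
  {E' : Type*} [NormedAddCommGroup E'] [NormedSpace ℝ E'] [FiniteDimensional ℝ E']
  {H' : Type*} [TopologicalSpace H']
  {I' : ModelWithCorners ℝ E' H'} [I'.Boundaryless]
  {X' : Type*} [TopologicalSpace X'] [ChartedSpace H' X'] [IsManifold I' ∞ X']

/-- Smoothness at all points near `e` of the expression of a map in charts. -/
theorem eventually_contDiffAt_in_charts {f : X → X'} {x₀ x : X} {y₀ : X'}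
    (hf : ∀ᶠ z in 𝓝 x, ContMDiffAt I I' ∞ f z)
    (hx : x ∈ (chartAt H x₀).source) (hy : f x ∈ (chartAt H' y₀).source) :
    ∀ᶠ e in 𝓝 (extChartAt I x₀ x),
      ContDiffAt ℝ ∞ (fun e => extChartAt I' y₀ (f ((extChartAt I x₀).symm e))) e := by
  have hsymm : Filter.Tendsto (extChartAt I x₀).symm (𝓝 (extChartAt I x₀ x)) (𝓝 x) := by
    have := (contMDiffAt_extChartAt_symm (I := I) hx).continuousAt
    rwa [ContinuousAt, extChartAt_symm_apply_self hx] at this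
  filter_upwards [hsymm.eventually hf, extChartAt_target_nhds hx,
    hsymm.eventually (hf.self_of_nhds.continuousAt.preimage_mem_nhds (chart_source_nhds hy))]
    with e he he' he''
  exact (((contMDiffAt_extChartAt' (x := y₀) he'').comp _ he).comp e
    ((contMDiffOn_extChartAt_symm x₀).contMDiffAt
      ((isOpen_extChartAt_target x₀).mem_nhds he'))).contDiffAt

/-- The inverse function theorem for smooth functions, with smoothness of the inverse at all nearby
points. -/
theorem exists_local_inverse_normed {f : E → E'} {e₀ : E} (hf : ∀ᶠ e in 𝓝 e₀, ContDiffAt ℝ ∞ f e)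
    (hD : Function.Bijective (fderiv ℝ f e₀)) :
    ∃ g : E' → E, g (f e₀) = e₀ ∧ (∀ᶠ e in 𝓝 e₀, g (f e) = e) ∧
      ∀ᶠ w in 𝓝 (f e₀), f (g w) = w ∧ ContDiffAt ℝ ∞ g w := by
  let A : E ≃L[ℝ] E' := (LinearEquiv.ofBijective (fderiv ℝ f e₀).toLinearMap hD).toContinuousLinearEquiv
  have hA : (A : E →L[ℝ] E') = fderiv ℝ f e₀ := by ext; rfl
  have hs : HasStrictFDerivAt f (A : E →L[ℝ] E') e₀ := by
    rw [hA]; exact hf.self_of_nhds.hasStrictFDerivAt (by simp)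
  set P := hs.toOpenPartialHomeomorph f with hP
  have h0 : e₀ ∈ P.source := hs.mem_toOpenPartialHomeomorph_source
  have hPf : (P : E → E') = f := hs.toOpenPartialHomeomorph_coe
  have h0' : P.symm (f e₀) = e₀ := by rw [← hPf]; exact P.left_inv h0
  have ht : f e₀ ∈ P.target := by rw [← hPf]; exact P.map_source h0
  refine ⟨P.symm, h0', ?_, ?_⟩
  · filter_upwards [P.open_source.mem_nhds h0] with e he
    rw [← hPf]; exact P.left_inv he
  · have hc : ContinuousAt P.symm (f e₀) := P.continuousAt_symm ht
    -- Invertibility of the derivative is open, so the inverse is smooth at all points near `f e₀`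
    -- and not only there.
    have h1 : ∀ᶠ e in 𝓝 e₀, fderiv ℝ f e ∈ range ((↑) : (E ≃L[ℝ] E') → E →L[ℝ] E') := by
      have : ContinuousAt (fderiv ℝ f) e₀ :=
        (hf.self_of_nhds.fderiv_right (m := 0) (by simp)).continuousAt
      exact this.preimage_mem_nhds (by rw [← hA]; exact ContinuousLinearEquiv.nhds A)
    have h2 := hf.and h1
    rw [← h0'] at h2
    filter_upwards [P.open_target.mem_nhds ht, hc.eventually h2] with w hw hw2
    refine ⟨by rw [← hPf]; exact P.right_inv hw, ?_⟩
    obtain ⟨⟨h3, B, hB⟩⟩ := And.intro hw2.1 hw2.2 |> fun h => Nonempty.intro h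
    refine P.contDiffAt_symm (f₀' := B) hw ?_ (by rw [hPf]; exact hw2.1)
    rw [hB, hPf]
    exact (hw2.1.differentiableAt (by simp)).hasFDerivAt

/-- The inverse function theorem on manifolds. -/
theorem exists_local_inverse {f : X → X'} {x : X} (hf : ∀ᶠ z in 𝓝 x, ContMDiffAt I I' ∞ f z)
    (hD : Function.Bijective (mD I I' f x)) :
    ∃ g : X' → X, g (f x) = x ∧ (∀ᶠ z in 𝓝 x, g (f z) = z) ∧
      ∀ᶠ w in 𝓝 (f x), f (g w) = w ∧ ContMDiffAt I' I ∞ g w := by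
  have hx := mem_chart_source H x
  have hy := mem_chart_source H' (f x)
  set φ := extChartAt I x
  set φ' := extChartAt I' (f x)
  have hfc := hf.self_of_nhds.continuousAt
  have h1 : ∀ᶠ e in 𝓝 (φ x), ContDiffAt ℝ ∞ (fun e => φ' (f (φ.symm e))) e :=
    eventually_contDiffAt_in_charts hf hx hy
  have e1 : φ.symm (φ x) = x := extChartAt_symm_apply_self hx
  have hD' : Function.Bijective (fderiv ℝ (fun e => φ' (f (φ.symm e))) (φ x)) := by
    rw [fderiv_in_charts (hf.self_of_nhds.mdiff) hx hy, chartD_self,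
      chartDInv_self]
    exact hD
  obtain ⟨g, hg0, hg1, hg2⟩ := exists_local_inverse_normed h1 hD'
  rw [e1] at hg0 hg2
  have hφ' : ContMDiffAt I' 𝓘(ℝ, E') ∞ φ' (f x) := contMDiffAt_extChartAt' hy
  have hφ : ContinuousAt φ x := continuousAt_extChartAt x
  have hgs : Filter.Tendsto (fun w => φ.symm (g (φ' w))) (𝓝 (f x)) (𝓝 x) := by
    have h2 : ContinuousAt g (φ' (f x)) := hg2.self_of_nhds.2.continuousAt
    have h3 : Filter.Tendsto (fun w => g (φ' w)) (𝓝 (f x)) (𝓝 (φ x)) := by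
      have := h2.tendsto.comp hφ'.continuousAt.tendsto
      rwa [hg0] at this
    have h4 := (contMDiffAt_extChartAt_symm (I := I) hx).continuousAt.tendsto.comp h3
    rwa [e1] at h4
  have htar : ∀ᶠ w in 𝓝 (f x), g (φ' w) ∈ φ.target := by
    have h2 : ContinuousAt g (φ' (f x)) := hg2.self_of_nhds.2.continuousAt
    refine hφ'.continuousAt.tendsto.eventually (h2.preimage_mem_nhds ?_)
    rw [hg0]; exact extChartAt_target_nhds hx
  refine ⟨fun w => φ.symm (g (φ' w)), by beta_reduce; rw [hg0, e1], ?_, ?_⟩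
  · filter_upwards [chart_source_nhds hx, hφ.eventually hg1] with z hz hz'
    have hz1 : φ.symm (φ z) = z := extChartAt_symm_apply_self hz
    rw [hz1] at hz'
    rw [hz', hz1]
  · filter_upwards [chart_source_nhds hy, hφ'.continuousAt.tendsto.eventually hg2, htar,
      hgs.eventually (hfc.preimage_mem_nhds (chart_source_nhds hy))] with w hw hw2 hw3 hw4
    refine ⟨?_, ?_⟩
    · exact (extChartAt_symm_apply_self hw4).symm.trans
        ((congrArg φ'.symm hw2.1).trans (extChartAt_symm_apply_self hw))
    · exact ((contMDiffOn_extChartAt_symm x).contMDiffAt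
        ((isOpen_extChartAt_target x).mem_nhds hw3)).comp w
        (hw2.2.contMDiffAt.comp w (contMDiffAt_extChartAt' hw))

/-- A bijective smooth map whose derivatives are bijective is a diffeomorphism. -/
theorem exists_diffeomorph {f : X → X'} (hf : ContMDiff I I' ∞ f) (hb : Function.Bijective f)
    (hD : ∀ x, Function.Bijective (mD I I' f x)) : ∃ F : Diffeomorph I I' X X' ∞, ⇑F = f := by
  refine ⟨⟨Equiv.ofBijective f hb, hf, fun y => ?_⟩, rfl⟩
  obtain ⟨x, rfl⟩ := hb.2 y
  obtain ⟨g, hg0, hg1, hg2⟩ := exists_local_inverse (.of_forall fun z => hf z) (hD x)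
  refine hg2.self_of_nhds.2.congr_of_eventuallyEq ?_
  filter_upwards [hg2] with w hw
  exact ((Equiv.ofBijective f hb).symm_apply_eq).2 hw.1.symm

end InverseFunction

/-! ### Operations on smooth families of covectors and vectors -/

section BundleValued

variable {d : ℕ} {X : Type*} [TopologicalSpace X] [ChartedSpace (ℰ d) X]
  [IsManifold (𝓡 d) ∞ X]
  {E' : Type*} [NormedAddCommGroup E'] [NormedSpace ℝ E'] {H' : Type*} [TopologicalSpace H']
  {J : ModelWithCorners ℝ E' H'}
  {Z : Type*} [TopologicalSpace Z] [ChartedSpace H' Z]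
  {E'' : Type*} [NormedAddCommGroup E''] [NormedSpace ℝ E''] {H'' : Type*} [TopologicalSpace H'']
  {J' : ModelWithCorners ℝ E'' H''}
  {Z' : Type*} [TopologicalSpace Z'] [ChartedSpace H'' Z']

/-- The covector `c` at `x`. -/
def mkCot (x : X) (c : ℰ* d) : CotangentTotal d X := ⟨x, c⟩

/-- The tangent vector `v` at `x`. -/
def mkTan {E : Type*} [NormedAddCommGroup E] [NormedSpace ℝ E] {H : Type*} [TopologicalSpace H]
    (I : ModelWithCorners ℝ E H) {X : Type*} [TopologicalSpace X] [ChartedSpace H X] (x : X)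
    (v : E) : TangentBundle I X := ⟨x, v⟩

theorem mkCot_eq_iff {p : CotangentTotal d X} {x : X} {c : ℰ* d} :
    p = mkCot x c ↔ p.proj = x ∧ p.cov = c := by
  constructor
  · rintro rfl; exact ⟨rfl, rfl⟩
  · rintro ⟨rfl, rfl⟩; rfl

theorem contMDiffAt_proj {n : WithTop ℕ∞} (hn : n ≤ ∞) {g : Z → CotangentTotal d X} {a : Z}
    (hg : ContMDiffAt J (cotangentModel d) n g a) :
    ContMDiffAt J (𝓡 d) n (fun z => (g z).proj) a :=
  ((contMDiffAt_cotangent_iff hn (x₀ := (g a).proj) (mem_chart_source _ _)).1 hg).1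

theorem contMDiffAt_mkCot_iff {n : WithTop ℕ∞} (hn : n ≤ ∞) {y : Z → X}
    {c : Z → ℰ* d} {a : Z} {x₀ : X}
    (hx : y a ∈ (chartAt (ℰ d) x₀).source) :
    ContMDiffAt J (cotangentModel d) n (fun z => mkCot (y z) (c z)) a ↔
      ContMDiffAt J (𝓡 d) n y a ∧ ContMDiffAt J 𝓘(ℝ, ℰ* d) n
        (fun z => (c z).comp (chartDInv (𝓡 d) x₀ (y z))) a :=
  contMDiffAt_cotangent_iff hn hx

theorem ContMDiffAt.mkCot_add {n : WithTop ℕ∞} (hn : n ≤ ∞) {y : Z → X}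
    {c c' : Z → ℰ* d} {a : Z}
    (h : ContMDiffAt J (cotangentModel d) n (fun z => mkCot (y z) (c z)) a)
    (h' : ContMDiffAt J (cotangentModel d) n (fun z => mkCot (y z) (c' z)) a) :
    ContMDiffAt J (cotangentModel d) n (fun z => mkCot (y z) (c z + c' z)) a := by
  have hx := mem_chart_source (ℰ d) (y a)
  rw [contMDiffAt_mkCot_iff hn hx] at h h' ⊢
  refine ⟨h.1, ?_⟩
  simp only [ContinuousLinearMap.add_comp]
  exact h.2.add h'.2

theorem ContMDiffAt.mkCot_sub {n : WithTop ℕ∞} (hn : n ≤ ∞) {y : Z → X}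
    {c c' : Z → ℰ* d} {a : Z}
    (h : ContMDiffAt J (cotangentModel d) n (fun z => mkCot (y z) (c z)) a)
    (h' : ContMDiffAt J (cotangentModel d) n (fun z => mkCot (y z) (c' z)) a) :
    ContMDiffAt J (cotangentModel d) n (fun z => mkCot (y z) (c z - c' z)) a := by
  have hx := mem_chart_source (ℰ d) (y a)
  rw [contMDiffAt_mkCot_iff hn hx] at h h' ⊢
  refine ⟨h.1, ?_⟩
  simp only [ContinuousLinearMap.sub_comp]
  exact h.2.sub h'.2

theorem ContMDiffAt.mkCot_smul {n : WithTop ℕ∞} (hn : n ≤ ∞) {y : Z → X}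
    {c : Z → ℰ* d} {r : Z → ℝ} {a : Z}
    (hr : ContMDiffAt J 𝓘(ℝ, ℝ) n r a)
    (h : ContMDiffAt J (cotangentModel d) n (fun z => mkCot (y z) (c z)) a) :
    ContMDiffAt J (cotangentModel d) n (fun z => mkCot (y z) (r z • c z)) a := by
  have hx := mem_chart_source (ℰ d) (y a)
  rw [contMDiffAt_mkCot_iff hn hx] at h ⊢
  refine ⟨h.1, ?_⟩
  simp only [ContinuousLinearMap.smul_comp]
  exact hr.smul h.2

theorem ContMDiffAt.cov_apply {n : WithTop ℕ∞} (hn : n ≤ ∞) {y : Z → X}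
    {c : Z → ℰ* d} {v : Z → ℰ d} {a : Z}
    (h : ContMDiffAt J (cotangentModel d) n (fun z => mkCot (y z) (c z)) a)
    (hv : ContMDiffAt J (𝓡 d).tangent n (fun z => mkTan (𝓡 d) (y z) (v z)) a) :
    ContMDiffAt J 𝓘(ℝ, ℝ) n (fun z => c z (v z)) a := by
  have hx := mem_chart_source (ℰ d) (y a)
  have h1 := (contMDiffAt_mkCot_iff hn hx).1 h
  have h2 := (contMDiffAt_tangent_iff hn (x₀ := y a) hx).1 hv
  refine (h1.2.clm_apply h2.2).congr_of_eventuallyEq ?_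
  filter_upwards [h1.1.continuousAt.preimage_mem_nhds (chart_source_nhds hx)] with z hz
  change _ = c z (chartDInv (𝓡 d) (y a) (y z) (chartD (𝓡 d) (y a) (y z) (v z)))
  rw [chartDInv_chartD_apply hz]

end BundleValued

/-- A form of the tube lemma. It converts local statements, uniform near each point, into statements
on a whole compact set. -/
theorem eventually_forall_of_isCompact {ι X : Type*} [TopologicalSpace X] {l : Filter ι}
    {K : Set X} (hK : IsCompact K) {P : ι → X → Prop}
    (h : ∀ x ∈ K, ∀ᶠ p in l ×ˢ 𝓝 x, P p.1 p.2) : ∀ᶠ i in l, ∀ x ∈ K, P i x :=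
  (Filter.Eventually.curry (hK.mem_prod_nhdsSet_of_forall (s := {p | P p.1 p.2}) h :
    ∀ᶠ p in l ×ˢ 𝓝ˢ K, P p.1 p.2)).mono fun _ h => h.self_of_nhdsSet

/-- In finite dimensions the operator norm is bounded by the values on a basis. -/
theorem tendsto_clm_of_apply {ι E F : Type*} [NormedAddCommGroup E] [NormedSpace ℝ E]
    [FiniteDimensional ℝ E] [NormedAddCommGroup F] [NormedSpace ℝ F] {l : Filter ι}
    {A : ι → E →L[ℝ] F} {B : E →L[ℝ] F} (h : ∀ v, Filter.Tendsto (fun i => A i v) l (𝓝 (B v))) :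
    Filter.Tendsto A l (𝓝 B) := by
  obtain ⟨C, hC, hb⟩ := (Module.finBasis ℝ E).exists_opNorm_le (F := F)
  rw [Metric.tendsto_nhds]
  intro ε hε
  have : ∀ᶠ i in l, ∀ j, ‖(A i - B) (Module.finBasis ℝ E j)‖ ≤ ε / (2 * C) := by
    rw [Filter.eventually_all]
    intro j
    filter_upwards [Metric.tendsto_nhds.1 (h (Module.finBasis ℝ E j)) (ε / (2 * C)) (by positivity)]
      with i hi
    rw [dist_eq_norm] at hi
    exact hi.le
  filter_upwards [this] with i hi
  rw [dist_eq_norm]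
  calc ‖A i - B‖ ≤ C * (ε / (2 * C)) := hb (by positivity) hi
    _ = ε / 2 := by field_simp
    _ < ε := by linarith

/-! ### The `C¹` topology in charts -/

section C1Convergence

variable {E : Type*} [NormedAddCommGroup E] [NormedSpace ℝ E]
  {H : Type*} [TopologicalSpace H]
  {I : ModelWithCorners ℝ E H} [I.Boundaryless]
  {X : Type*} [TopologicalSpace X] [ChartedSpace H X] [IsManifold I ∞ X]
  {E' : Type*} [NormedAddCommGroup E'] [NormedSpace ℝ E']
  {H' : Type*} [TopologicalSpace H']
  {I' : ModelWithCorners ℝ E' H'} [I'.Boundaryless]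
  {X' : Type*} [TopologicalSpace X'] [ChartedSpace H' X'] [IsManifold I' ∞ X']
  {E'' : Type*} [NormedAddCommGroup E''] [NormedSpace ℝ E'']
  {H'' : Type*} [TopologicalSpace H'']
  {I'' : ModelWithCorners ℝ E'' H''} [I''.Boundaryless]
  {X'' : Type*} [TopologicalSpace X''] [ChartedSpace H'' X''] [IsManifold I'' ∞ X'']
  {ι : Type*} {l : Filter ι}

variable (I I') in
/-- The derivative of `f` at `x` in the preferred charts at `x₀` and `y₀`. -/
def chartMD (x₀ : X) (y₀ : X') (f : X → X') (x : X) : E →L[ℝ] E' :=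
  (chartD I' y₀ (f x)).comp ((mD I I' f x).comp (chartDInv I x₀ x))

theorem chartMD_self (x : X) (f : X → X') : chartMD I I' x (f x) f x = mD I I' f x := by
  rw [chartMD, chartD_self, chartDInv_self]; rfl

theorem chartMD_comp {f : X → X'} {g : X' → X''} {x₀ x : X} {y₀ : X'} {z₀ : X''}
    (hg : MDifferentiableAt I' I'' g (f x)) (hf : MDifferentiableAt I I' f x)
    (hx : f x ∈ (chartAt H' y₀).source) :
    chartMD I I'' x₀ z₀ (fun z => g (f z)) x =
      (chartMD I' I'' y₀ z₀ g (f x)).comp (chartMD I I' x₀ y₀ f x) := by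
  ext v
  simp only [chartMD, mD_comp hg hf rfl, ContinuousLinearMap.comp_apply]
  rw [chartDInv_chartD_apply hx]

variable (I I') in
/-- The family `F` converges in `C¹` to `f`, uniformly near `x₀`. -/
structure C1TendstoAt (l : Filter ι) (F : ι → X → X') (f : X → X') (x₀ : X) : Prop where
  mdiff : ∀ᶠ p in l ×ˢ 𝓝 x₀, MDifferentiableAt I I' (F p.1) p.2
  tendsto : Filter.Tendsto (fun p : ι × X => F p.1 p.2) (l ×ˢ 𝓝 x₀) (𝓝 (f x₀))
  deriv : Filter.Tendsto (fun p : ι × X => chartMD I I' x₀ (f x₀) (F p.1) p.2) (l ×ˢ 𝓝 x₀)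
    (𝓝 (mD I I' f x₀))

theorem continuousAt_chartMD {f : X → X'} {x₀ : X} (hf : ContMDiffAt I I' 1 f x₀) :
    ContinuousAt (chartMD I I' x₀ (f x₀) f) x₀ := by
  have h1 : ContDiffAt ℝ 1 (fun e => extChartAt I' (f x₀) (f ((extChartAt I x₀).symm e)))
      (extChartAt I x₀ x₀) := by
    have hs : ContMDiffAt 𝓘(ℝ, E) I 1 (extChartAt I x₀).symm (extChartAt I x₀ x₀) :=
      (contMDiffAt_extChartAt_symm (mem_chart_source H x₀)).of_le (by exact_mod_cast le_top)
    have e1 : (extChartAt I x₀).symm (extChartAt I x₀ x₀) = x₀ :=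
      extChartAt_symm_apply_self (mem_chart_source H x₀)
    have h2 : ContMDiffAt I' 𝓘(ℝ, E') 1 (extChartAt I' (f x₀)) (f x₀) :=
      contMDiffAt_extChartAt.of_le (le_refl _)
    rw [← e1] at hf h2
    simp only [e1] at h2
    refine ContMDiffAt.contDiffAt (ContMDiffAt.comp _ (I' := I') ?_ (hf.comp _ hs))
    simpa only [Function.comp_apply, e1] using h2
  have h3 := ((h1.fderiv_right (m := 0) (by simp)).continuousAt).comp
    (f := extChartAt I x₀) (continuousAt_extChartAt x₀)
  refine h3.congr ?_
  filter_upwards [chart_source_nhds (mem_chart_source H x₀),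
    (contMDiffAt_iff_contMDiffAt_nhds (by simp)).1 hf,
    hf.continuousAt.preimage_mem_nhds (chart_source_nhds (mem_chart_source H' (f x₀)))]
    with x hx hx' hx''
  exact fderiv_in_charts (hx'.mdifferentiableAt (by simp)) hx hx''

theorem C1TendstoAt.const {f : X → X'} {x₀ : X} (hf : ContMDiffAt I I' 1 f x₀) :
    C1TendstoAt I I' l (fun _ => f) f x₀ := by
  refine ⟨?_, hf.continuousAt.tendsto.comp Filter.tendsto_snd, ?_⟩
  · refine Filter.tendsto_snd.eventually ?_
    exact ((contMDiffAt_iff_contMDiffAt_nhds (by simp)).1 hf).mono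
      fun x hx => hx.mdifferentiableAt (by simp)
  · have := (continuousAt_chartMD hf).tendsto.comp (Filter.tendsto_snd (f := l) (g := 𝓝 x₀))
    rwa [chartMD_self] at this

/-- The chain rule evaluates the derivative of `G i` at the moving point `F i x`. This is why
convergence is required jointly in the index and the point. -/
theorem C1TendstoAt.comp {F : ι → X → X'} {f : X → X'} {G : ι → X' → X''} {g : X' → X''} {x₀ : X}
    (hG : C1TendstoAt I' I'' l G g (f x₀)) (hF : C1TendstoAt I I' l F f x₀)
    (hg : MDifferentiableAt I' I'' g (f x₀)) (hf : MDifferentiableAt I I' f x₀) :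
    C1TendstoAt I I'' l (fun i x => G i (F i x)) (fun x => g (f x)) x₀ := by
  have ht : Filter.Tendsto (fun p : ι × X => (p.1, F p.1 p.2)) (l ×ˢ 𝓝 x₀) (l ×ˢ 𝓝 (f x₀)) :=
    Filter.tendsto_fst.prodMk hF.tendsto
  refine ⟨?_, hG.tendsto.comp ht, ?_⟩
  · filter_upwards [ht.eventually hG.mdiff, hF.mdiff] with p hp hp'
    exact hp.comp p.2 hp'
  · rw [mD_comp hg hf rfl]
    have h1 : Filter.Tendsto (fun p : ι × X => (chartMD I' I'' (f x₀) (g (f x₀)) (G p.1)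
        (F p.1 p.2)).comp (chartMD I I' x₀ (f x₀) (F p.1) p.2)) (l ×ˢ 𝓝 x₀)
        (𝓝 ((mD I' I'' g (f x₀)).comp (mD I I' f x₀))) := by
      have hc : Continuous fun q : (E' →L[ℝ] E'') × (E →L[ℝ] E') => q.1.comp q.2 :=
        continuous_fst.clm_comp continuous_snd
      exact (hc.tendsto (mD I' I'' g (f x₀), mD I I' f x₀)).comp
        ((hG.deriv.comp ht).prodMk_nhds hF.deriv)
    refine h1.congr' ?_
    filter_upwards [ht.eventually hG.mdiff, hF.mdiff,
      hF.tendsto.eventually (chart_source_nhds (mem_chart_source H' (f x₀)))] with p hp hp' hp''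
    exact (chartMD_comp hp hp' hp'').symm

/-- Postcomposition with a fixed map. -/
theorem C1TendstoAt.postcomp {F : ι → X → X'} {f : X → X'} {g : X' → X''} {x₀ : X}
    (hF : C1TendstoAt I I' l F f x₀) (hg : ContMDiffAt I' I'' 1 g (f x₀))
    (hf : MDifferentiableAt I I' f x₀) :
    C1TendstoAt I I'' l (fun i x => g (F i x)) (fun x => g (f x)) x₀ :=
  (C1TendstoAt.const hg).comp hF (hg.mdifferentiableAt (by simp)) hf

theorem C1TendstoAt.congr {F F' : ι → X → X'} {f f' : X → X'} {x₀ : X}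
    (hF : C1TendstoAt I I' l F f x₀) (h : ∀ᶠ p in l ×ˢ 𝓝 x₀, F p.1 p.2 = F' p.1 p.2)
    (h' : f =ᶠ[𝓝 x₀] f') : C1TendstoAt I I' l F' f' x₀ := by
  have h2 : ∀ᶠ p in l ×ˢ 𝓝 x₀, F p.1 =ᶠ[𝓝 p.2] F' p.1 := by
    obtain ⟨pa, ha, pb, hb, hab⟩ := Filter.eventually_prod_iff.1 h
    exact Filter.eventually_prod_iff.2 ⟨pa, ha, fun x => ∀ᶠ x' in 𝓝 x, pb x',
      eventually_eventually_nhds.2 hb, fun {i} hx {x} hy =>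
        Filter.Eventually.mono hy fun y hy => hab hx hy⟩
  refine ⟨?_, ?_, ?_⟩
  · filter_upwards [hF.mdiff, h2] with p hp hp'
    exact hp.congr_of_eventuallyEq hp'.symm
  · rw [← h'.eq_of_nhds]
    exact hF.tendsto.congr' h
  · rw [← h'.eq_of_nhds, ← mD_congr h']
    refine hF.deriv.congr' ?_
    filter_upwards [h2] with p hp
    rw [chartMD, chartMD, mD_congr hp, hp.eq_of_nhds]

theorem tendsto_tangent_iff {κ : Type*} {k : Filter κ} {g : κ → TangentBundle I X}
    {q : TangentBundle I X} : Filter.Tendsto g k (𝓝 q) ↔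
      Filter.Tendsto (fun z => (g z).proj) k (𝓝 q.proj) ∧
      Filter.Tendsto (fun z => (chartD I q.proj (g z).proj (g z).snd : E)) k (𝓝 (q.snd : E)) := by
  have hq := mem_chart_source H q.proj
  rw [(trivializationAt E (TangentSpace I) q.proj).tendsto_nhds_iff
    (FiberBundle.mem_trivializationAt_proj_source)]
  refine and_congr_right fun h => ?_
  rw [trivializationAt_tangent_snd hq]
  have h2 : (chartD I q.proj q.proj q.snd : E) = (q.snd : E) := by rw [chartD_self]; rfl
  change Filter.Tendsto _ _ (𝓝 (chartD I q.proj q.proj q.snd : E)) ↔ _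
  rw [h2]
  refine Filter.tendsto_congr' ?_
  filter_upwards [h.eventually (chart_source_nhds hq)] with z hz
  exact trivializationAt_tangent_snd hz

/-- Convergence in the `C¹` topology. -/
theorem tendsto_c1Nhds_iff [FiniteDimensional ℝ E] [LocallyCompactSpace H]
    {F : ι → ContMDiffMap I I' X X' ∞}
    {f : ContMDiffMap I I' X X' ∞} : Filter.Tendsto F l (c1Nhds f) ↔
      ∀ x, C1TendstoAt I I' l (fun i => F i) f x := by
  have hmd : ∀ (g : ContMDiffMap I I' X X' ∞) x, MDifferentiableAt I I' g x := fun g x =>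
    (g.contMDiff x).mdiff
  rw [c1Nhds, Filter.tendsto_comap_iff]
  constructor
  · intro h x
    have : LocallyCompactSpace (TangentBundle I X) := Manifold.locallyCompact_of_finiteDimensional I.tangent
    -- The tangent bundle is locally compact, so evaluation of maps in the compact-open topology is
    -- jointly continuous. It is applied to the local fields that are constant in the chart at `x`.
    have key : ∀ (v : E), Filter.Tendsto (fun p : ι × X =>
        (mkTan I' (F p.1 p.2) (mD I I' (F p.1) p.2 (chartDInv I x p.2 v))))
        (l ×ˢ 𝓝 x) (𝓝 (mkTan I' (f x) (mD I I' f x v))) := by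
      intro v
      have h1 : Filter.Tendsto (fun x' : X => mkTan I x' (chartDInv I x x' v)) (𝓝 x)
          (𝓝 (mkTan I x v)) := by
        refine tendsto_tangent_iff.2 ⟨Filter.tendsto_id, ?_⟩
        refine (tendsto_const_nhds (x := v)).congr' ?_
        filter_upwards [chart_source_nhds (mem_chart_source H x)] with z hz
        exact (chartD_chartDInv_apply hz v).symm
      have h2 : Filter.Tendsto (fun p : ι × X => (tangentC (F p.1), mkTan I p.2 (chartDInv I x p.2 v)))
          (l ×ˢ 𝓝 x) (𝓝 (tangentC f, mkTan I x v)) :=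
        (h.comp Filter.tendsto_fst).prodMk_nhds (h1.comp Filter.tendsto_snd)
      exact ((ContinuousEval.continuous_eval (F := C(TangentBundle I X, TangentBundle I' X'))).tendsto
        (tangentC f, mkTan I x v)).comp h2
    refine ⟨.of_forall fun p => hmd _ _, ((tendsto_tangent_iff).1 (key 0)).1,
      tendsto_clm_of_apply fun v => (tendsto_tangent_iff.1 (key v)).2⟩
  · intro h
    rw [ContinuousMap.tendsto_nhds_compactOpen]
    intro K hK U hU hKU
    refine eventually_forall_of_isCompact (P := fun i q => tangentC (F i) q ∈ U) hK fun q hq => ?_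
    suffices ht : Filter.Tendsto (fun p : ι × TangentBundle I X => tangentC (F p.1) p.2)
      (l ×ˢ 𝓝 q) (𝓝 (tangentC f q)) from ht.eventually (hU.mem_nhds (hKU hq))
    have hc := h q.proj
    have hpr : Filter.Tendsto (fun p : ι × TangentBundle I X => (p.1, p.2.proj)) (l ×ˢ 𝓝 q)
        (l ×ˢ 𝓝 q.proj) := Filter.tendsto_fst.prodMk
      ((FiberBundle.continuous_proj E (TangentSpace I : X → Type _)).continuousAt.tendsto.comp
        Filter.tendsto_snd)
    refine tendsto_tangent_iff.2 ⟨hc.tendsto.comp hpr, ?_⟩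
    have h3 := (tendsto_tangent_iff (g := fun p : ι × TangentBundle I X => p.2)
      (k := l ×ˢ 𝓝 q)).1 Filter.tendsto_snd
    have h4 := ((continuous_fst.clm_apply continuous_snd).tendsto
      ((mD I I' f q.proj), (q.snd : E))).comp ((hc.deriv.comp hpr).prodMk_nhds h3.2)
    refine h4.congr' ?_
    filter_upwards [h3.1.eventually (chart_source_nhds (mem_chart_source H q.proj))] with p hp
    exact congrArg (fun w : E => chartD I' (f q.proj) (F p.1 p.2.proj)
      (mD I I' (F p.1) p.2.proj w)) (chartDInv_chartD_apply (E := E) (I := I) hp _)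

end C1Convergence

/-! ### Maps that are `C¹`-close to the identity -/

section C1Applications

variable {E : Type*} [NormedAddCommGroup E] [NormedSpace ℝ E] [FiniteDimensional ℝ E]
  {H : Type*} [TopologicalSpace H]
  {I : ModelWithCorners ℝ E H} [I.Boundaryless]
  {X : Type*} [TopologicalSpace X] [ChartedSpace H X] [IsManifold I ∞ X]
  {E' : Type*} [NormedAddCommGroup E'] [NormedSpace ℝ E']
  {H' : Type*} [TopologicalSpace H']
  {I' : ModelWithCorners ℝ E' H'} [I'.Boundaryless]
  {X' : Type*} [TopologicalSpace X'] [ChartedSpace H' X'] [IsManifold I' ∞ X']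
  {ι : Type*} {l : Filter ι}

theorem chartMD_eq_fderiv {f : X → X'} {x₀ x : X} {y₀ : X'} (hf : MDifferentiableAt I I' f x)
    (hx : x ∈ (chartAt H x₀).source) (hy : f x ∈ (chartAt H' y₀).source) :
    chartMD I I' x₀ y₀ f x =
      fderiv ℝ (fun e => extChartAt I' y₀ (f ((extChartAt I x₀).symm e))) (extChartAt I x₀ x) :=
  (fderiv_in_charts hf hx hy).symm

theorem mD_id (x : X) : mD I I (fun z : X => z) x = ContinuousLinearMap.id ℝ E := mfderiv_id

theorem chartMD_id {x₀ x : X} (hx : x ∈ (chartAt H x₀).source) :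
    chartMD I I x₀ x₀ (fun z : X => z) x = ContinuousLinearMap.id ℝ E := by
  rw [chartMD, mD_id, ContinuousLinearMap.id_comp]
  exact chartD_comp_chartDInv hx

/-- The universal jointly smooth family: all others arise from it by postcomposition with a fixed
map. -/
theorem c1TendstoAt_prodMk (t₀ : ℝ) (x₀ : X) :
    C1TendstoAt I (𝓘(ℝ, ℝ).prod I) (𝓝 t₀) (fun t (x : X) => (t, x)) (fun x => (t₀, x)) x₀ := by
  have hd : ∀ (t : ℝ) (x : X), MDifferentiableAt I (𝓘(ℝ, ℝ).prod I) (fun x : X => (t, x)) x :=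
    fun t x => mdifferentiableAt_const.prodMk mdifferentiableAt_id
  have hD : ∀ t, ∀ x ∈ (chartAt H x₀).source, chartMD I (𝓘(ℝ, ℝ).prod I) x₀ (t₀, x₀)
      (fun x : X => (t, x)) x = ContinuousLinearMap.inr ℝ ℝ E := by
    intro t x hx
    rw [chartMD_eq_fderiv (hd t x) hx (show (t, x) ∈ (chartAt (ModelProd ℝ H) (t₀, x₀)).source from
      ⟨by rw [chartAt_self_eq]; trivial, hx⟩)]
    have : (fun e => extChartAt (𝓘(ℝ, ℝ).prod I) (t₀, x₀) (t, (extChartAt I x₀).symm e))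
        =ᶠ[𝓝 (extChartAt I x₀ x)] fun e => (t, e) := by
      filter_upwards [extChartAt_target_nhds (I := I) hx] with e he
      rw [extChartAt_prod]
      exact Prod.ext rfl ((extChartAt I x₀).right_inv he)
    rw [this.fderiv_eq]
    exact (hasFDerivAt_prodMk_right t _).fderiv
  refine ⟨.of_forall fun p => hd _ _, ?_, ?_⟩
  · rw [nhds_prod_eq]; exact Filter.tendsto_id
  · have h0 := hD t₀ x₀ (mem_chart_source H x₀)
    rw [chartMD_self (I := I) (I' := 𝓘(ℝ, ℝ).prod I) x₀ (fun x : X => (t₀, x))] at h0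
    rw [h0]
    refine tendsto_const_nhds.congr' ?_
    filter_upwards [Filter.tendsto_snd.eventually (chart_source_nhds (mem_chart_source H x₀))]
      with p hp
    exact (hD _ _ hp).symm

/-- A jointly smooth family is continuous in the parameter for the `C¹` topology. -/
theorem c1TendstoAt_of_contMDiffAt {G : ℝ × X → X'} {t₀ : ℝ} {x₀ : X}
    (hG : ContMDiffAt (𝓘(ℝ, ℝ).prod I) I' 1 G (t₀, x₀)) :
    C1TendstoAt I I' (𝓝 t₀) (fun t x => G (t, x)) (fun x => G (t₀, x)) x₀ :=
  (c1TendstoAt_prodMk t₀ x₀).postcomp hG (mdifferentiableAt_const.prodMk mdifferentiableAt_id)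

theorem bijective_mD_of_chartMD {f : X → X} {x₀ x : X} (hx : x ∈ (chartAt H x₀).source)
    (hy : f x ∈ (chartAt H x₀).source) (hu : IsUnit (chartMD I I x₀ x₀ f x)) :
    Function.Bijective (mD I I f x) := by
  obtain ⟨u, hu⟩ := hu
  have h1 : ∀ v, (↑u⁻¹ : E →L[ℝ] E) (chartMD I I x₀ x₀ f x v) = v := fun v => by
    rw [← hu]; exact DFunLike.congr_fun u.inv_mul v
  suffices hinj : Function.Injective (mD I I f x) from
    ⟨hinj, LinearMap.surjective_of_injective (f := (mD I I f x).toLinearMap) hinj⟩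
  intro v w hvw
  have h2 : ∀ v, mD I I f x v = chartDInv I x₀ (f x)
      (chartMD I I x₀ x₀ f x (chartD I x₀ x v)) := fun v => by
    simp only [chartMD, ContinuousLinearMap.comp_apply, chartDInv_chartD_apply hx,
      chartDInv_chartD_apply hy]
  have h3 : chartMD I I x₀ x₀ f x (chartD I x₀ x v) = chartMD I I x₀ x₀ f x (chartD I x₀ x w) := by
    have := congrArg (chartD I x₀ (f x)) hvw
    change chartD I x₀ (f x) (mD I I f x v) = chartD I x₀ (f x) (mD I I f x w) at this
    rwa [h2, h2, chartD_chartDInv_apply hy, chartD_chartDInv_apply hy] at this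
  have h4 := congrArg (chartDInv I x₀ x) ((h1 _).symm.trans ((congrArg _ h3).trans (h1 _)))
  rwa [chartDInv_chartD_apply hx, chartDInv_chartD_apply hx] at h4

theorem C1TendstoAt.eventually_isUnit {F : ι → X → X} {x₀ : X}
    (hF : C1TendstoAt I I l F (fun x => x) x₀) :
    ∀ᶠ p in l ×ˢ 𝓝 x₀, IsUnit (chartMD I I x₀ x₀ (F p.1) p.2) := by
  have := FiniteDimensional.complete ℝ E
  have h1 := hF.deriv
  rw [mD_id] at h1
  exact h1.eventually (Units.nhds (1 : (E →L[ℝ] E)ˣ))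

theorem C1TendstoAt.eventually_bijective_mD {F : ι → X → X} {x₀ : X}
    (hF : C1TendstoAt I I l F (fun x => x) x₀) :
    ∀ᶠ p in l ×ˢ 𝓝 x₀, Function.Bijective (mD I I (F p.1) p.2) := by
  have hs := chart_source_nhds (mem_chart_source H x₀)
  filter_upwards [hF.eventually_isUnit, hF.tendsto.eventually hs,
    Filter.tendsto_snd.eventually hs] with p h1 h2 h3
  exact bijective_mD_of_chartMD h3 h2 h1

/-- Maps that are `C¹`-close to the identity are locally injective in a uniform way. -/
theorem C1TendstoAt.eventually_injective {F : ι → X → X} {x₀ : X}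
    (hF : C1TendstoAt I I l F (fun x => x) x₀) :
    ∀ᶠ p in l ×ˢ 𝓝 (x₀, x₀), F p.1 p.2.1 = F p.1 p.2.2 → p.2.1 = p.2.2 := by
  have hs := chart_source_nhds (mem_chart_source H x₀)
  set φ := extChartAt I x₀ with hφ
  have h1 : ∀ᶠ p in l ×ˢ 𝓝 x₀, MDifferentiableAt I I (F p.1) p.2 ∧
      F p.1 p.2 ∈ (chartAt H x₀).source ∧ p.2 ∈ (chartAt H x₀).source ∧
      ‖chartMD I I x₀ x₀ (F p.1) p.2 - ContinuousLinearMap.id ℝ E‖ < 1 / 2 := by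
    have h2 := hF.deriv
    rw [mD_id] at h2
    have h3 := Metric.tendsto_nhds.1 h2 (1 / 2) (by norm_num)
    filter_upwards [hF.mdiff, hF.tendsto.eventually hs, Filter.tendsto_snd.eventually hs, h3]
      with p a b c d
    rw [dist_eq_norm] at d
    exact ⟨a, b, c, d⟩
  obtain ⟨pa, ha, pb, hb, hab⟩ := Filter.eventually_prod_iff.1 h1
  have hb' : ∀ᶠ e in 𝓝 (φ x₀), pb (φ.symm e) ∧ e ∈ φ.target := by
    refine Filter.Eventually.and ?_ (extChartAt_target_nhds (mem_chart_source H x₀))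
    have h5 := (contMDiffAt_extChartAt_symm (I := I) (mem_chart_source H x₀)).continuousAt
    rw [ContinuousAt, extChartAt_symm_apply_self (mem_chart_source H x₀)] at h5
    exact h5.eventually hb
  obtain ⟨r, hr, hrb⟩ := Metric.eventually_nhds_iff_ball.1 hb'
  have hball : ∀ᶠ x in 𝓝 x₀, φ x ∈ Metric.ball (φ x₀) r ∧ x ∈ (chartAt H x₀).source :=
    ((continuousAt_extChartAt x₀).eventually (Metric.ball_mem_nhds _ hr)).and hs
  have hball2 : ∀ᶠ q in 𝓝 (x₀, x₀), (φ q.1 ∈ Metric.ball (φ x₀) r ∧ q.1 ∈ (chartAt H x₀).source) ∧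
      (φ q.2 ∈ Metric.ball (φ x₀) r ∧ q.2 ∈ (chartAt H x₀).source) := by
    rw [nhds_prod_eq]
    exact hball.prod_mk hball
  refine Filter.eventually_prod_iff.2 ⟨pa, ha, _, hball2, ?_⟩
  rintro i hi ⟨x, y⟩ ⟨⟨hx1, hx2⟩, hy1, hy2⟩ hxy
  let g : E → E := fun e => φ (F i (φ.symm e))
  -- On a convex ball in the chart `g - id` is Lipschitz with constant `1/2`, so two points with the
  -- same image coincide.
  have hg : ∀ e ∈ Metric.ball (φ x₀) r, HasFDerivAt (fun e => g e - e)
      (fderiv ℝ g e - ContinuousLinearMap.id ℝ E) e ∧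
      ‖fderiv ℝ g e - ContinuousLinearMap.id ℝ E‖ ≤ 1 / 2 := by
    intro e he
    obtain ⟨he1, he2⟩ := hrb e he
    obtain ⟨c1, c2, c3, c4⟩ := hab hi he1
    have e1 : φ (φ.symm e) = e := φ.right_inv he2
    have c5 := chartMD_eq_fderiv (x₀ := x₀) (y₀ := x₀) c1 c3 c2
    rw [c5] at c4
    change ‖fderiv ℝ g (φ (φ.symm e)) - _‖ < _ at c4
    rw [e1] at c4
    refine ⟨HasFDerivAt.sub (DifferentiableAt.hasFDerivAt ?_) (hasFDerivAt_id e), c4.le⟩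
    refine MDifferentiableAt.differentiableAt ?_
    have hsm : MDifferentiableAt 𝓘(ℝ, E) I φ.symm e :=
      (((contMDiffOn_extChartAt_symm (n := ∞) x₀).contMDiffAt
        ((isOpen_extChartAt_target x₀).mem_nhds he2))).mdiff
    exact (mdifferentiableAt_extChartAt c2).comp e (c1.comp e hsm)
  have hL := (convex_ball (φ x₀) r).norm_image_sub_le_of_norm_hasFDerivWithin_le
    (f := fun e => g e - e) (fun e he => (hg e he).1.hasFDerivWithinAt)
    (fun e he => (hg e he).2) hx1 hy1
  have hgx : g (φ x) = g (φ y) := by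
    have := congrArg φ hxy
    simp only [g]
    rwa [hφ, extChartAt_symm_apply_self hx2, extChartAt_symm_apply_self hy2]
  have h6 : g (φ y) - φ y - (g (φ x) - φ x) = φ x - φ y := by rw [hgx]; abel
  rw [h6, norm_sub_rev] at hL
  have h7 : ‖φ y - φ x‖ = 0 := by linarith [norm_nonneg (φ y - φ x)]
  have h8 : φ x = φ y := (sub_eq_zero.1 (norm_eq_zero.1 h7)).symm
  exact φ.injOn (by rwa [hφ, extChartAt_source]) (by rwa [hφ, extChartAt_source]) h8

/-- On a compact manifold, maps that are `C¹`-close to the identity are diffeomorphisms. -/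
theorem eventually_exists_diffeomorph [CompactSpace X] [T2Space X] [LocallyConnectedSpace X]
    {F : ι → X → X}
    (hF : ∀ x, C1TendstoAt I I l F (fun x => x) x) :
    ∀ᶠ i in l, ContMDiff I I ∞ (F i) → ∃ D : Diffeomorph I I X X ∞, ⇑D = F i := by
  have h1 : ∀ᶠ i in l, ∀ x ∈ (univ : Set X), Function.Bijective (mD I I (F i) x) :=
    eventually_forall_of_isCompact isCompact_univ fun x _ => (hF x).eventually_bijective_mD
  -- Injectivity by compactness of `X × X`: near the diagonal it comes from the derivative, away
  -- from it from closeness to the identity.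
  have h2 : ∀ᶠ i in l, ∀ q ∈ (univ : Set (X × X)), F i q.1 = F i q.2 → q.1 = q.2 := by
    refine eventually_forall_of_isCompact (P := fun i (q : X × X) => F i q.1 = F i q.2 → q.1 = q.2)
      isCompact_univ fun q _ => ?_
    obtain ⟨x, y⟩ := q
    by_cases hxy : x = y
    · subst hxy; exact (hF x).eventually_injective
    · have ht : Filter.Tendsto (fun p : ι × (X × X) => (F p.1 p.2.1, F p.1 p.2.2)) (l ×ˢ 𝓝 (x, y))
          (𝓝 (x, y)) := by
        refine Filter.Tendsto.prodMk_nhds ((hF x).tendsto.comp (Filter.tendsto_fst.prodMk ?_))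
          ((hF y).tendsto.comp (Filter.tendsto_fst.prodMk ?_))
        · exact (continuous_fst.tendsto (x, y)).comp Filter.tendsto_snd
        · exact (continuous_snd.tendsto (x, y)).comp Filter.tendsto_snd
      have hne : ∀ᶠ q in 𝓝 (x, y), q.1 ≠ q.2 :=
        (isClosed_eq continuous_fst continuous_snd).isOpen_compl.mem_nhds hxy
      exact (ht.eventually hne).mono fun p hp h => absurd h hp
  -- For surjectivity: the image is open and compact, hence a union of components, and it meets each
  -- component because points do not leave theirs.
  have h3 : ∀ᶠ i in l, ∀ x ∈ (univ : Set X), F i x ∈ connectedComponent x := by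
    refine eventually_forall_of_isCompact (P := fun i x => F i x ∈ connectedComponent x)
      isCompact_univ fun x _ => ?_
    have ho : connectedComponent x ∈ 𝓝 x := isOpen_connectedComponent.mem_nhds mem_connectedComponent
    filter_upwards [(hF x).tendsto.eventually ho, Filter.tendsto_snd.eventually ho] with p h1 h2
    rwa [← connectedComponent_eq h2]
  filter_upwards [h1, h2, h3] with i h1 h2 h3 hsm
  refine exists_diffeomorph hsm ⟨fun x y h => h2 (x, y) trivial h, fun y => ?_⟩
    fun x => h1 x trivial
  have hopen : IsOpen (range (F i)) := by
    rw [isOpen_iff_mem_nhds]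
    rintro _ ⟨x, rfl⟩
    obtain ⟨g, -, -, hg⟩ := exists_local_inverse (.of_forall fun z => hsm z) (h1 x trivial)
    exact hg.mono fun w hw => ⟨_, hw.1⟩
  have hcl : IsClopen (range (F i)) := ⟨(isCompact_range hsm.continuous).isClosed, hopen⟩
  refine hcl.connectedComponent_subset (mem_range_self y) ?_
  rw [← connectedComponent_eq (h3 y trivial)]
  exact mem_connectedComponent

/-- By compactness no point outside a neighbourhood of `x₀` is mapped close to `x₀`, so the inverses
converge. Their derivatives converge because inversion of operators is continuous. -/
theorem c1TendstoAt_symm [CompactSpace X] [T2Space X] {F : ι → Diffeomorph I I X X ∞}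
    (hF : ∀ x, C1TendstoAt I I l (fun i => F i) (fun x => x) x) (x₀ : X) :
    C1TendstoAt I I l (fun i => (F i).symm) (fun x => x) x₀ := by
  have := FiniteDimensional.complete ℝ E
  have hb : Filter.Tendsto (fun p : ι × X => (F p.1).symm p.2) (l ×ˢ 𝓝 x₀) (𝓝 x₀) := by
    intro U hU
    have h1 : ∀ᶠ p in l ×ˢ 𝓝 x₀, ∀ y ∈ (interior U)ᶜ, F p.1 y ≠ p.2 := by
      refine eventually_forall_of_isCompact (P := fun (p : ι × X) y => F p.1 y ≠ p.2)
        isOpen_interior.isClosed_compl.isCompact fun y hy => ?_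
      have hxy : y ≠ x₀ := by
        rintro rfl; exact hy (mem_interior_iff_mem_nhds.2 hU)
      have ht : Filter.Tendsto (fun p : (ι × X) × X => (F p.1.1 p.2, p.1.2)) ((l ×ˢ 𝓝 x₀) ×ˢ 𝓝 y)
          (𝓝 (y, x₀)) :=
        Filter.Tendsto.prodMk_nhds ((hF y).tendsto.comp ((Filter.tendsto_fst.comp
          Filter.tendsto_fst).prodMk Filter.tendsto_snd)) (Filter.tendsto_snd.comp Filter.tendsto_fst)
      have hne : ∀ᶠ q in 𝓝 (y, x₀), q.1 ≠ q.2 :=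
        (isClosed_eq continuous_fst continuous_snd).isOpen_compl.mem_nhds hxy
      exact ht.eventually hne
    refine h1.mono fun p hp => ?_
    by_contra hc
    refine hp ((F p.1).symm p.2) (fun h => hc (interior_subset h)) ?_
    exact (F p.1).apply_symm_apply p.2
  have hmd : ∀ (D : Diffeomorph I I X X ∞) x, MDifferentiableAt I I D x := fun D x =>
    (D.contMDiff x).mdiff
  have hs := chart_source_nhds (mem_chart_source H x₀)
  refine ⟨.of_forall fun p => hmd _ _, hb, ?_⟩
  rw [mD_id]
  have h1 := (hF x₀).deriv.comp (Filter.tendsto_fst.prodMk hb)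
  rw [mD_id] at h1
  have h2 := (NormedRing.inverse_continuousAt (1 : (E →L[ℝ] E)ˣ)).tendsto.comp h1
  rw [Units.val_one, Ring.inverse_one] at h2
  refine h2.congr' ?_
  filter_upwards [Filter.tendsto_snd.eventually hs, hb.eventually hs] with p hp hp'
  have c1 : (chartMD I I x₀ x₀ (F p.1) ((F p.1).symm p.2)).comp
      (chartMD I I x₀ x₀ (F p.1).symm p.2) = ContinuousLinearMap.id ℝ E := by
    rw [← chartMD_comp (hmd _ _) (hmd _ _) hp', ← chartMD_id (I := I) hp]
    congr 1
    funext z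
    exact (F p.1).apply_symm_apply z
  have c2 : (chartMD I I x₀ x₀ (F p.1).symm p.2).comp
      (chartMD I I x₀ x₀ (F p.1) ((F p.1).symm p.2)) = ContinuousLinearMap.id ℝ E := by
    have e1 : F p.1 ((F p.1).symm p.2) = p.2 := (F p.1).apply_symm_apply p.2
    have := chartMD_comp (g := (F p.1).symm) (f := F p.1) (x₀ := x₀) (z₀ := x₀) (I := I) (I' := I)
      (I'' := I)
      (x := (F p.1).symm p.2) (hmd _ _) (hmd _ _) (by rwa [e1])
    rw [e1] at this
    rw [← this, ← chartMD_id (I := I) hp']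
    congr 1
    funext z
    exact (F p.1).symm_apply_apply z
  exact Ring.inverse_unit (⟨_, _, c1, c2⟩ : (E →L[ℝ] E)ˣ)

end C1Applications

/-! ### Immersions and embeddings -/

section Immersions

/-- The inverse function theorem, as an open partial homeomorphism. -/
theorem exists_openPartialHomeomorph {E : Type*} [NormedAddCommGroup E] [NormedSpace ℝ E]
    [FiniteDimensional ℝ E]
    {H : Type*} [TopologicalSpace H]
    {I : ModelWithCorners ℝ E H} [I.Boundaryless]
    {X : Type*} [TopologicalSpace X] [ChartedSpace H X] [IsManifold I ∞ X]
    {E' : Type*} [NormedAddCommGroup E'] [NormedSpace ℝ E'] [FiniteDimensional ℝ E']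
    {H' : Type*} [TopologicalSpace H']
    {I' : ModelWithCorners ℝ E' H'} [I'.Boundaryless]
    {X' : Type*} [TopologicalSpace X'] [ChartedSpace H' X'] [IsManifold I' ∞ X']
    {f : X → X'} {x : X} (hf : ∀ᶠ z in 𝓝 x, ContMDiffAt I I' ∞ f z)
    (hD : Function.Bijective (mD I I' f x)) :
    ∃ Q : OpenPartialHomeomorph X X', ⇑Q = f ∧ x ∈ Q.source ∧ ContMDiffOn I I' ∞ Q Q.source ∧
      ContMDiffOn I' I ∞ Q.symm Q.target := by
  obtain ⟨g, hg0, hg1, hg2⟩ := exists_local_inverse hf hD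
  set S := interior {z | ContMDiffAt I I' ∞ f z ∧ g (f z) = z} with hS
  set T := interior {w | f (g w) = w ∧ ContMDiffAt I' I ∞ g w} with hT
  have hSf : ∀ z ∈ S, ContMDiffAt I I' ∞ f z ∧ g (f z) = z := fun z hz => by
    have h : z ∈ {z | ContMDiffAt I I' ∞ f z ∧ g (f z) = z} := interior_subset hz
    exact h
  have hTg : ∀ w ∈ T, f (g w) = w ∧ ContMDiffAt I' I ∞ g w := fun w hw => by
    have h : w ∈ {w | f (g w) = w ∧ ContMDiffAt I' I ∞ g w} := interior_subset hw
    exact h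
  have hfc : ContinuousOn f S := fun z hz => (hSf z hz).1.continuousAt.continuousWithinAt
  have hgc : ContinuousOn g T := fun z hz => (hTg z hz).2.continuousAt.continuousWithinAt
  refine ⟨{ toFun := f, invFun := g, source := S ∩ f ⁻¹' T, target := T ∩ g ⁻¹' S
            map_source' := fun z hz => ⟨hz.2, by rw [mem_preimage, (hSf z hz.1).2]; exact hz.1⟩
            map_target' := fun w hw => ⟨hw.2, by rw [mem_preimage, (hTg w hw.1).1]; exact hw.1⟩
            left_inv' := fun z hz => (hSf z hz.1).2
            right_inv' := fun w hw => (hTg w hw.1).1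
            open_source := hfc.isOpen_inter_preimage isOpen_interior isOpen_interior
            open_target := hgc.isOpen_inter_preimage isOpen_interior isOpen_interior
            continuousOn_toFun := hfc.mono inter_subset_left
            continuousOn_invFun := hgc.mono inter_subset_left }, rfl, ?_, ?_, ?_⟩
  · exact ⟨mem_interior_iff_mem_nhds.2 (hf.and hg1), mem_interior_iff_mem_nhds.2 hg2⟩
  · exact fun z hz => (hSf z hz.1).1.contMDiffWithinAt
  · exact fun z hz => (hTg z hz.1).2.contMDiffWithinAt

variable {d k : ℕ}
  {X : Type*} [TopologicalSpace X] [ChartedSpace (ℰ d) X]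
  [IsManifold (𝓡 d) ∞ X]
  {Y : Type*} [TopologicalSpace Y] [ChartedSpace (ℰ k) Y]
  [IsManifold (𝓡 k) ∞ Y]

theorem exists_equiv_prod_of_injective {A : ℰ k →L[ℝ] ℰ d}
    (hA : Function.Injective A) :
    ∃ B : (ℰ k × EuclideanSpace ℝ (Fin (d - k))) ≃L[ℝ]
      ℰ d, ∀ v, B (v, 0) = A v := by
  obtain ⟨C, hC⟩ := Submodule.exists_isCompl (LinearMap.range A.toLinearMap)
  have h1 : Module.finrank ℝ (LinearMap.range A.toLinearMap) = k := by
    rw [LinearMap.finrank_range_of_inj hA, finrank_euclideanSpace_fin]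
  have h2 : Module.finrank ℝ C = d - k := by
    have := Submodule.finrank_add_eq_of_isCompl hC
    rw [h1, finrank_euclideanSpace_fin] at this
    omega
  have h3 : Module.finrank ℝ (ℰ (d - k)) = Module.finrank ℝ C := by
    rw [h2, finrank_euclideanSpace_fin]
  let e2 : EuclideanSpace ℝ (Fin (d - k)) ≃ₗ[ℝ] C := LinearEquiv.ofFinrankEq _ _ h3
  let e1 : ℰ k ≃ₗ[ℝ] LinearMap.range A.toLinearMap := LinearEquiv.ofInjective A.toLinearMap hA
  refine ⟨((e1.prodCongr e2).trans (Submodule.prodEquivOfIsCompl _ _ hC)).toContinuousLinearEquiv,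
    fun v => ?_⟩
  simp [e1]

/-- A smooth map with injective derivatives is an immersion. -/
theorem isImmersion_of_injective {f : Y → X} (hf : ContMDiff (𝓡 k) (𝓡 d) ∞ f)
    (hD : ∀ y, Function.Injective (mD (𝓡 k) (𝓡 d) f y)) :
    Manifold.IsImmersion (𝓡 k) (𝓡 d) ∞ f := by
  refine ⟨EuclideanSpace ℝ (Fin (d - k)), inferInstance, inferInstance, fun y => ?_⟩
  obtain ⟨B, hB⟩ := exists_equiv_prod_of_injective (hD y)
  have hy := mem_chart_source (ℰ k) y
  have hx := mem_chart_source (ℰ d) (f y)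
  set φ := chartAt (ℰ k) y
  set ψ := chartAt (ℰ d) (f y)
  let fh : ℰ k → ℰ d := fun e => ψ (f (φ.symm e))
  have hfh : ∀ᶠ e in 𝓝 (φ y), ContDiffAt ℝ ∞ fh e :=
    eventually_contDiffAt_in_charts (.of_forall fun z => hf z) hy hx
  have hfhD : fderiv ℝ fh (φ y) = mD (𝓡 k) (𝓡 d) f y := by
    have := fderiv_in_charts ((hf y).mdiff) hy hx
    rw [chartD_self, chartDInv_self] at this
    exact this
  -- The coordinate expression of `f`, extended linearly along a complement of the image of its
  -- derivative. The derivative of `G` at `b₀` is the identity, so `ψ.symm ∘ G` is a local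
  -- diffeomorphism whose inverse is a chart that straightens `f`.
  let G : ℰ d → ℰ d := fun b =>
    fh (B.symm b).1 + B (0, (B.symm b).2)
  have hfhy : fh (φ y) = ψ (f y) := by simp only [fh]; rw [φ.left_inv hy]
  set b₀ := B (φ y, 0) with hb₀
  have hBb : B.symm b₀ = (φ y, 0) := B.symm_apply_apply _
  have hGb : G b₀ = ψ (f y) := by
    simp only [G, hBb, hfhy]
    rw [show ((0 : ℰ k), (0 : EuclideanSpace ℝ (Fin (d - k)))) = 0 from rfl,
      map_zero, add_zero]
  have hBs : ContDiff ℝ ∞ fun b => (B.symm b).1 := contDiff_fst.comp B.symm.contDiff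
  have hBs2 : ContDiff ℝ ∞ fun b => B (0, (B.symm b).2) :=
    B.contDiff.comp (contDiff_const.prodMk (contDiff_snd.comp B.symm.contDiff))
  have hBc : Filter.Tendsto (fun b => (B.symm b).1) (𝓝 b₀) (𝓝 (φ y)) := by
    have := hBs.continuous.tendsto b₀
    rwa [hBb] at this
  have hG : ∀ᶠ b in 𝓝 b₀, ContDiffAt ℝ ∞ G b := by
    filter_upwards [hBc.eventually hfh] with b hb
    exact (hb.comp b hBs.contDiffAt).add hBs2.contDiffAt
  have hGD : HasFDerivAt G (ContinuousLinearMap.id ℝ _) b₀ := by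
    have h1 : HasFDerivAt fh (mD (𝓡 k) (𝓡 d) f y) (B.symm b₀).1 := by
      rw [hBb, ← hfhD]
      exact (hfh.self_of_nhds.differentiableAt (by simp)).hasFDerivAt
    have h2 := B.symm.hasFDerivAt (x := b₀)
    have h3 := (h1.comp b₀ h2.fst).add
      (B.hasFDerivAt.comp b₀ ((hasFDerivAt_const (0 : ℰ k) b₀).prodMk h2.snd))
    refine h3.congr_fderiv ?_
    ext1 b
    change mD (𝓡 k) (𝓡 d) f y (B.symm b).1 + B (0, (B.symm b).2) = b
    rw [← hB, ← map_add, Prod.mk_add_mk, add_zero, zero_add]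
    exact B.apply_symm_apply b
  let K : ℰ d → X := fun b => ψ.symm (G b)
  have hψt : ψ.target ∈ 𝓝 (G b₀) := by rw [hGb]; exact ψ.open_target.mem_nhds (ψ.map_source hx)
  have hψs : ∀ a ∈ ψ.target, ContMDiffAt (𝓡 d) (𝓡 d) ∞ ψ.symm a := fun a ha =>
    contMDiffAt_symm_of_mem_maximalAtlas (IsManifold.chart_mem_maximalAtlas _) ha
  have hK : ∀ᶠ b in 𝓝 b₀, ContMDiffAt (𝓡 d) (𝓡 d) ∞ K b := by
    filter_upwards [hG, hG.self_of_nhds.continuousAt.preimage_mem_nhds hψt] with b hb hb'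
    exact (hψs _ hb').comp b hb.contMDiffAt
  have hKD : Function.Bijective (mD (𝓡 d) (𝓡 d) K b₀) := by
    have h1 : mD (𝓡 d) (𝓡 d) K b₀ = (mD (𝓡 d) (𝓡 d) ψ.symm (G b₀)).comp (mD (𝓡 d) (𝓡 d) G b₀) :=
      mD_comp ((hψs _ (mem_of_mem_nhds hψt)).mdiff)
        hGD.hasMFDerivAt.mdifferentiableAt rfl
    have h2 : mD (𝓡 d) (𝓡 d) G b₀ = ContinuousLinearMap.id ℝ _ := by
      rw [mD_eq_fderiv]; exact hGD.fderiv
    have h3 : mD (𝓡 d) (𝓡 d) ψ.symm (G b₀) = ContinuousLinearMap.id ℝ _ := by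
      rw [hGb]; exact chartDInv_self (I := 𝓡 d) (f y)
    rw [h1, h2, h3]
    exact Function.bijective_id
  obtain ⟨Q, hQ, hQb, hQ1, hQ2⟩ := exists_openPartialHomeomorph hK hKD
  let U : Set (ℰ k) := (fun u => B (u, 0)) ⁻¹' Q.source
  have hU : IsOpen U := Q.open_source.preimage (by fun_prop)
  have hW := φ.isOpen_inter_preimage hU
  set W := (φ.source ∩ φ ⁻¹' U) ∩ f ⁻¹' ψ.source with hWdef
  have hWo : IsOpen W := hW.inter (ψ.open_source.preimage hf.continuous)
  have hKf : ∀ u, φ.symm u ∈ f ⁻¹' ψ.source → K (B (u, 0)) = f (φ.symm u) := by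
    intro u hu
    simp only [K, G, B.symm_apply_apply, fh]
    rw [show ((0 : ℰ k), (0 : EuclideanSpace ℝ (Fin (d - k)))) = 0 from rfl,
      map_zero, add_zero, ψ.left_inv hu]
  have hyW : y ∈ W := ⟨⟨hy, hQb⟩, hx⟩
  refine Manifold.IsImmersionAtOfComplement.mk_of_continuousAt hf.continuous.continuousAt B
    (φ.restr W) Q.symm (by rw [φ.restr_source' _ hWo]; exact ⟨hy, hyW⟩) ?_ ?_ ?_ ?_
  · have : f y = Q b₀ := by
      rw [hQ]
      have h := hKf (φ y) (by rw [φ.left_inv hy]; exact hx)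
      rw [φ.left_inv hy] at h
      exact h.symm
    rw [this]
    exact Q.map_source hQb
  · exact restr_mem_maximalAtlas (contDiffGroupoid ∞ (𝓡 k))
      (IsManifold.chart_mem_maximalAtlas y) hWo
  · exact OpenPartialHomeomorph.mem_maximalAtlas_of_contMDiffOn Q.symm hQ2 (by simpa using hQ1)
  · intro u hu
    have hu0 : u ∈ (φ.restr W).target := by simpa using hu
    have hu' : φ.symm u ∈ W := by
      have h := (φ.restr W).map_target hu0
      rw [φ.restr_source' _ hWo] at h
      exact h.2
    have hu1 : φ (φ.symm u) = u := (φ.restr W).right_inv hu0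
    change Q.symm (f (φ.symm u)) = B (u, 0)
    rw [← hKf u hu'.2, ← hQ]
    exact Q.left_inv (by have := hu'.1.2; rwa [mem_preimage, hu1] at this)

/-- An immersion has a smooth local left inverse. -/
theorem Manifold.IsImmersion.exists_leftInverse {f : Y → X}
    (hf : Manifold.IsImmersion (𝓡 k) (𝓡 d) ∞ f) (y : Y) :
    ∃ r : X → Y, (∀ᶠ x in 𝓝 (f y), ContMDiffAt (𝓡 d) (𝓡 k) ∞ r x) ∧ ∀ᶠ z in 𝓝 y, r (f z) = z := by
  obtain ⟨F, _, _, hF⟩ := hf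
  have h := hF y
  let r : X → Y := fun x => h.domChart.symm (h.equiv.symm (h.codChart x)).1
  have hf : ContMDiffAt (𝓡 k) (𝓡 d) ∞ f y := h.contMDiffAt
  have hcod : ∀ x ∈ h.codChart.source, ContMDiffAt (𝓡 d) (𝓡 d) ∞ h.codChart x := fun x hx =>
    contMDiffAt_of_mem_maximalAtlas h.codChart_mem_maximalAtlas hx
  have hdom : ∀ u ∈ h.domChart.target, ContMDiffAt (𝓡 k) (𝓡 k) ∞ h.domChart.symm u := fun x hx =>
    contMDiffAt_symm_of_mem_maximalAtlas h.domChart_mem_maximalAtlas hx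
  have hwr : ∀ z ∈ h.domChart.source, h.codChart (f z) = h.equiv (h.domChart z, 0) := by
    intro z hz
    have := h.writtenInCharts (show h.domChart z ∈ (h.domChart.extend (𝓡 k)).target by
      simpa using h.domChart.map_source hz)
    change h.codChart (f (h.domChart.symm (h.domChart z))) = _ at this
    rwa [h.domChart.left_inv hz] at this
  have hlin : ContDiff ℝ ∞ fun b => (h.equiv.symm b).1 := contDiff_fst.comp h.equiv.symm.contDiff
  refine ⟨r, ?_, ?_⟩
  · have hc : ContinuousAt (fun x => (h.equiv.symm (h.codChart x)).1) (f y) :=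
      hlin.continuous.continuousAt.comp (hcod _ h.mem_codChart_source).continuousAt
    have hval : (h.equiv.symm (h.codChart (f y))).1 = h.domChart y := by
      rw [hwr y h.mem_domChart_source, h.equiv.symm_apply_apply]
    filter_upwards [h.codChart.open_source.mem_nhds h.mem_codChart_source,
      hc.preimage_mem_nhds (by
        rw [hval]
        exact h.domChart.open_target.mem_nhds (h.domChart.map_source h.mem_domChart_source))]
      with x hx hx'
    exact (hdom _ hx').comp x (hlin.contDiffAt.contMDiffAt.comp x (hcod x hx))
  · filter_upwards [h.domChart.open_source.mem_nhds h.mem_domChart_source] with z hz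
    simp only [r]
    rw [hwr z hz, h.equiv.symm_apply_apply]
    exact h.domChart.left_inv hz

theorem Manifold.IsImmersion.injective_mD {f : Y → X}
    (hf : Manifold.IsImmersion (𝓡 k) (𝓡 d) ∞ f) (y : Y) :
    Function.Injective (mD (𝓡 k) (𝓡 d) f y) := by
  obtain ⟨r, hr, hrf⟩ := hf.exists_leftInverse y
  have h1 := mD_comp (hr.self_of_nhds.mdiff)
    ((hf.contMDiff y).mdiff) rfl
  rw [mD_congr (g := fun z : Y => z) hrf, mD_id] at h1
  intro v w hvw
  have := congrArg (mD (𝓡 d) (𝓡 k) r (f y)) hvw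
  rw [← ContinuousLinearMap.comp_apply, ← ContinuousLinearMap.comp_apply, ← h1] at this
  exact this

/-- An injective immersion of a compact manifold is an embedding. -/
theorem isSmoothEmbedding_of_injective [CompactSpace Y] [T2Space X] {f : Y → X}
    (hf : ContMDiff (𝓡 k) (𝓡 d) ∞ f) (hinj : Function.Injective f)
    (hD : ∀ y, Function.Injective (mD (𝓡 k) (𝓡 d) f y)) :
    Manifold.IsSmoothEmbedding (𝓡 k) (𝓡 d) ∞ f :=
  ⟨isImmersion_of_injective hf hD, (hf.continuous.isClosedEmbedding hinj).isEmbedding⟩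

end Immersions

/-! ### Linear algebra of a contact hyperplane -/

section LinearAlgebra

theorem exists_ne_zero_of_clm_ne_zero {E : Type*} [NormedAddCommGroup E] [NormedSpace ℝ E]
    {A : E →L[ℝ] ℝ} (hA : A ≠ 0) : ∃ ζ, A ζ ≠ 0 := by
  by_contra! h
  exact hA (ContinuousLinearMap.ext h)


variable {E : Type*} [NormedAddCommGroup E] [NormedSpace ℝ E] [FiniteDimensional ℝ E]

/-- `Ω` is nondegenerate on the kernel of the nonzero covector `A`. -/
def ContactPair (A : E →L[ℝ] ℝ) (Ω : E →L[ℝ] E →L[ℝ] ℝ) : Prop :=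
  A ≠ 0 ∧ ∀ v, A v = 0 → (∀ w, A w = 0 → Ω v w = 0) → v = 0

theorem finrank_clm_real : Module.finrank ℝ (E →L[ℝ] ℝ) = Module.finrank ℝ E := by
  rw [← Subspace.dual_finrank_eq (K := ℝ) (V := E)]
  exact (LinearMap.toContinuousLinearMap (𝕜 := ℝ) (E := E) (F' := ℝ)).finrank_eq.symm

/-- The projection onto the kernel of `A` along `ζ`. -/
def kerProj (ζ : E) (A : E →L[ℝ] ℝ) : E →L[ℝ] E :=
  ContinuousLinearMap.id ℝ E - (A ζ)⁻¹ • A.smulRight ζ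

theorem kerProj_apply (ζ : E) (A : E →L[ℝ] ℝ) (w : E) :
    kerProj ζ A w = w - ((A ζ)⁻¹ * A w) • ζ := by
  simp [kerProj, mul_smul]

theorem apply_kerProj {ζ : E} {A : E →L[ℝ] ℝ} (h : A ζ ≠ 0) (w : E) : A (kerProj ζ A w) = 0 := by
  rw [kerProj_apply, map_sub, map_smul, smul_eq_mul, mul_right_comm, inv_mul_cancel₀ h, one_mul,
    sub_self]

theorem kerProj_of_apply_eq_zero (ζ : E) {A : E →L[ℝ] ℝ} {w : E} (h : A w = 0) :
    kerProj ζ A w = w := by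
  rw [kerProj_apply, h, mul_zero, zero_smul, sub_zero]

theorem kerProj_self {ζ : E} {A : E →L[ℝ] ℝ} (h : A ζ ≠ 0) : kerProj ζ A ζ = 0 := by
  rw [kerProj_apply, inv_mul_cancel₀ h, one_smul, sub_self]

/-- The operator whose inverse solves the equations of a contact vector field. -/
def contactOp (ζ : E) (A : E →L[ℝ] ℝ) (Ω : E →L[ℝ] E →L[ℝ] ℝ) : E →L[ℝ] E →L[ℝ] ℝ :=
  ((ContinuousLinearMap.compL ℝ E E ℝ).flip (kerProj ζ A)).comp Ω + A.smulRight A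

theorem contactOp_apply (ζ : E) (A : E →L[ℝ] ℝ) (Ω : E →L[ℝ] E →L[ℝ] ℝ) (v w : E) :
    contactOp ζ A Ω v w = Ω v (kerProj ζ A w) + A v * A w := by
  simp [contactOp]

/-- Evaluation on `ζ`, which the projection kills, isolates the condition on `A v`; evaluation on
`ker A` gives the other one. A system with a constraint thus becomes a single equation in the dual
space, which has the same dimension as `E`. -/
theorem contactOp_eq_iff {ζ : E} {A : E →L[ℝ] ℝ} (hζ : A ζ ≠ 0) (Ω : E →L[ℝ] E →L[ℝ] ℝ)
    (θ : E →L[ℝ] ℝ) (h : ℝ) (v : E) :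
    contactOp ζ A Ω v = θ.comp (kerProj ζ A) + h • A ↔
      A v = h ∧ ∀ w, A w = 0 → Ω v w = θ w := by
  constructor
  · intro hv
    have h0 : A v = h := by
      have := DFunLike.congr_fun hv ζ
      rw [contactOp_apply, kerProj_self hζ, map_zero, zero_add] at this
      simp only [add_apply, ContinuousLinearMap.comp_apply, kerProj_self hζ, map_zero, zero_add,
        smul_apply, smul_eq_mul] at this
      exact mul_right_cancel₀ hζ this
    refine ⟨h0, fun w hw => ?_⟩
    have := DFunLike.congr_fun hv w
    simpa [contactOp_apply, kerProj_of_apply_eq_zero ζ hw, hw] using! this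
  · rintro ⟨h1, h2⟩
    ext w
    rw [contactOp_apply, h1, h2 _ (apply_kerProj hζ w)]
    rfl

theorem ContactPair.bijective_contactOp {ζ : E} {A : E →L[ℝ] ℝ} {Ω : E →L[ℝ] E →L[ℝ] ℝ}
    (h : ContactPair A Ω) (hζ : A ζ ≠ 0) : Function.Bijective (contactOp ζ A Ω) := by
  have hinj : Function.Injective (contactOp ζ A Ω) := by
    rw [injective_iff_map_eq_zero]
    intro v hv
    have := (contactOp_eq_iff hζ Ω 0 0 v).1 (by rw [hv]; simp)
    exact h.2 v this.1 this.2
  exact ⟨hinj, (LinearMap.injective_iff_surjective_of_finrank_eq_finrank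
    (f := (contactOp ζ A Ω).toLinearMap) finrank_clm_real.symm).1 hinj⟩

/-- The equations of a contact vector field have unique solutions, depending smoothly on the
data. -/
theorem ContactPair.exists_solution {A₀ : E →L[ℝ] ℝ} {Ω₀ : E →L[ℝ] E →L[ℝ] ℝ}
    (h₀ : ContactPair A₀ Ω₀) :
    ∃ S : (E →L[ℝ] ℝ) × (E →L[ℝ] E →L[ℝ] ℝ) × (E →L[ℝ] ℝ) × ℝ → E, ∀ θ₀ r₀,
      ∀ᶠ p in 𝓝 (A₀, Ω₀, θ₀, r₀), ContDiffAt ℝ ∞ S p ∧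
        ∀ v, (p.1 v = p.2.2.2 ∧ ∀ w, p.1 w = 0 → p.2.1 v w = p.2.2.1 w) ↔ v = S p := by
  obtain ⟨ζ, hζ⟩ := exists_ne_zero_of_clm_ne_zero h₀.1
  have hcomp := FiniteDimensional.complete ℝ E
  let Op : (E →L[ℝ] ℝ) × (E →L[ℝ] E →L[ℝ] ℝ) × (E →L[ℝ] ℝ) × ℝ → E →L[ℝ] E →L[ℝ] ℝ :=
    fun p => contactOp ζ p.1 p.2.1
  let S : (E →L[ℝ] ℝ) × (E →L[ℝ] E →L[ℝ] ℝ) × (E →L[ℝ] ℝ) × ℝ → E := fun p =>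
    (Op p).inverse (p.2.2.1.comp (kerProj ζ p.1) + p.2.2.2 • p.1)
  have hne : ∀ p : (E →L[ℝ] ℝ) × (E →L[ℝ] E →L[ℝ] ℝ) × (E →L[ℝ] ℝ) × ℝ, p.1 ζ ≠ 0 →
      ContDiffAt ℝ ∞ (fun p : (E →L[ℝ] ℝ) × (E →L[ℝ] E →L[ℝ] ℝ) × (E →L[ℝ] ℝ) × ℝ =>
        kerProj ζ p.1) p := by
    intro p hp
    have h1 : ContDiff ℝ ∞ fun p : (E →L[ℝ] ℝ) × (E →L[ℝ] E →L[ℝ] ℝ) × (E →L[ℝ] ℝ) × ℝ =>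
        p.1 ζ := contDiff_fst.clm_apply contDiff_const
    have h2 : ContDiff ℝ ∞ fun p : (E →L[ℝ] ℝ) × (E →L[ℝ] E →L[ℝ] ℝ) × (E →L[ℝ] ℝ) × ℝ =>
        p.1.smulRight ζ := contDiff_fst.smulRight contDiff_const
    exact contDiffAt_const.sub ((h1.contDiffAt.inv hp).smul h2.contDiffAt)
  have hOp : ∀ p, p.1 ζ ≠ 0 → ContDiffAt ℝ ∞ Op p := by
    intro p hp
    have h3 : ContDiffAt ℝ ∞ (fun p : (E →L[ℝ] ℝ) × (E →L[ℝ] E →L[ℝ] ℝ) × (E →L[ℝ] ℝ) × ℝ =>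
        (ContinuousLinearMap.compL ℝ E E ℝ).flip (kerProj ζ p.1)) p :=
      (ContinuousLinearMap.contDiff _).contDiffAt.comp p (hne p hp)
    have h4 : ContDiff ℝ ∞ (fun p : (E →L[ℝ] ℝ) × (E →L[ℝ] E →L[ℝ] ℝ) × (E →L[ℝ] ℝ) × ℝ =>
        p.1.smulRight p.1) := contDiff_fst.smulRight contDiff_fst
    exact (h3.clm_comp (contDiff_fst.comp contDiff_snd).contDiffAt).add h4.contDiffAt
  refine ⟨S, fun θ₀ r₀ => ?_⟩
  let B : E ≃L[ℝ] (E →L[ℝ] ℝ) := (LinearEquiv.ofBijective (contactOp ζ A₀ Ω₀).toLinearMap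
    (h₀.bijective_contactOp hζ)).toContinuousLinearEquiv
  have hB : (B : E →L[ℝ] E →L[ℝ] ℝ) = Op (A₀, Ω₀, θ₀, r₀) := by ext; rfl
  have e1 : ∀ᶠ p : (E →L[ℝ] ℝ) × (E →L[ℝ] E →L[ℝ] ℝ) × (E →L[ℝ] ℝ) × ℝ in 𝓝 (A₀, Ω₀, θ₀, r₀),
      p.1 ζ ≠ 0 :=
    (continuous_fst.clm_apply continuous_const).continuousAt.eventually_ne hζ
  have e2 : ∀ᶠ p in 𝓝 (A₀, Ω₀, θ₀, r₀), Op p ∈ range ((↑) : (E ≃L[ℝ] (E →L[ℝ] ℝ)) → _) :=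
    (hOp (A₀, Ω₀, θ₀, r₀) hζ).continuousAt.preimage_mem_nhds
      (by rw [← hB]; exact ContinuousLinearEquiv.nhds B)
  filter_upwards [e1, e2] with p hp1 hp2
  obtain ⟨C, hC⟩ := hp2
  have hinv : ContDiffAt ℝ ∞ (fun p => (Op p).inverse) p := by
    have := contDiffAt_map_inverse (n := ∞) C
    rw [hC] at this
    exact this.comp p (hOp p hp1)
  refine ⟨hinv.clm_apply (((contDiff_fst.comp (contDiff_snd.comp contDiff_snd)).contDiffAt.clm_comp
    (hne p hp1)).add ((contDiff_snd.comp (contDiff_snd.comp contDiff_snd)).contDiffAt.smul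
      contDiff_fst.contDiffAt)), fun v => ?_⟩
  rw [← contactOp_eq_iff hp1 p.2.1 p.2.2.1 p.2.2.2 v]
  have hS : S p = C.symm (p.2.2.1.comp (kerProj ζ p.1) + p.2.2.2 • p.1) := by
    simp only [S, ← hC, ContinuousLinearMap.inverse_equiv]; rfl
  rw [hS, ContinuousLinearEquiv.eq_symm_apply]
  change Op p v = _ ↔ _
  rw [← hC]; rfl

/-- For a subspace of half the dimension transverse to the contact hyperplane, coisotropic means
isotropic. -/
theorem ContactPair.coisotropic_iff_isotropic {n : ℕ} (hE : Module.finrank ℝ E = 2 * n + 1)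
    {W : Type*} [NormedAddCommGroup W] [NormedSpace ℝ W] [FiniteDimensional ℝ W]
    (hW : Module.finrank ℝ W = n + 1)
    {A : E →L[ℝ] ℝ} {Ω : E →L[ℝ] E →L[ℝ] ℝ} (hΩ : ∀ v, Ω v v = 0) (h : ContactPair A Ω)
    {T : W →L[ℝ] E} (hT : Function.Injective T) (hAT : A.comp T ≠ 0) :
    (∀ v, A v = 0 → (∀ u, A (T u) = 0 → Ω v (T u) = 0) → ∃ u, T u = v) ↔
      ∀ u u', A (T u) = 0 → A (T u') = 0 → Ω (T u) (T u') = 0 := by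
  have hskew : ∀ v w, Ω v w = - Ω w v := by
    intro v w
    have := hΩ (v + w)
    simp only [map_add, add_apply, hΩ] at this
    linarith
  let ξ := LinearMap.ker A.toLinearMap
  let B : LinearMap.BilinForm ℝ ξ := LinearMap.mk₂ ℝ (fun v w => Ω v w)
    (fun v w z => by simp) (fun c v w => by simp) (fun v w z => by simp) (fun c v w => by simp)
  have hB : ∀ v w : ξ, B v w = Ω v w := fun v w => rfl
  have hrefl : B.IsRefl := fun v w hvw => by rw [hB] at hvw ⊢; rw [hskew, hvw, neg_zero]
  have hnd : B.Nondegenerate := by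
    refine (LinearMap.IsRefl.nondegenerate_iff_separatingLeft hrefl).2 fun v hv => ?_
    exact Subtype.ext (h.2 v v.2 fun w hw => hv ⟨w, hw⟩)
  let K := LinearMap.ker (A.comp T).toLinearMap
  let τ : K →ₗ[ℝ] ξ := LinearMap.codRestrict ξ (T.toLinearMap.comp K.subtype) fun u => u.2
  have hτ : Function.Injective τ := fun u u' huu => by
    have := congrArg Subtype.val huu
    exact Subtype.ext (hT this)
  let S := LinearMap.range τ
  -- The subspace `S` has dimension `n` in the symplectic space `ξ` of dimension `2n`, so `S` and
  -- its orthogonal have equal dimension and an inclusion either way is an equality.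
  have h1 : Module.finrank ℝ ξ = 2 * n := by
    have : Module.finrank ℝ ξ + 1 = Module.finrank ℝ E :=
      Module.Dual.finrank_ker_add_one_of_ne_zero (f := A.toLinearMap) fun h0 =>
        h.1 (by ext v; exact DFunLike.congr_fun h0 v)
    omega
  have h2 : Module.finrank ℝ S = n := by
    rw [LinearMap.finrank_range_of_inj hτ]
    have : Module.finrank ℝ K + 1 = Module.finrank ℝ W :=
      Module.Dual.finrank_ker_add_one_of_ne_zero (f := (A.comp T).toLinearMap) fun h0 =>
        hAT (by ext v; exact DFunLike.congr_fun h0 v)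
    omega
  have h3 : Module.finrank ℝ (B.orthogonal S) = n := by
    rw [LinearMap.BilinForm.finrank_orthogonal hnd, h1, h2]; omega
  have hmem : ∀ v : ξ, v ∈ B.orthogonal S ↔ ∀ u, A (T u) = 0 → Ω v (T u) = 0 := by
    intro v
    rw [LinearMap.BilinForm.mem_orthogonal_iff]
    constructor
    · intro hv u hu
      have := hv (τ ⟨u, hu⟩) ⟨_, rfl⟩
      rw [hskew]
      exact neg_eq_zero.2 this
    · rintro hv _ ⟨u, rfl⟩
      change Ω (T u) v = 0
      rw [hskew, hv u u.2, neg_zero]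
  constructor
  · intro hco u u' hu hu'
    have hle : B.orthogonal S ≤ S := by
      intro v hv
      obtain ⟨u, hu⟩ := hco v v.2 ((hmem v).1 hv)
      exact ⟨⟨u, by change A (T u) = 0; rw [hu]; exact v.2⟩, Subtype.ext hu⟩
    have heq := Submodule.eq_of_le_of_finrank_eq hle (by rw [h2, h3])
    have : τ ⟨u, hu⟩ ∈ B.orthogonal S := by rw [heq]; exact ⟨_, rfl⟩
    exact (hmem _).1 this u' hu'
  · intro hiso v hv hvu
    have hle : S ≤ B.orthogonal S := by
      rintro _ ⟨u, rfl⟩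
      exact (hmem _).2 fun u' hu' => hiso u u' u.2 hu'
    have heq := Submodule.eq_of_le_of_finrank_eq hle (by rw [h2, h3])
    have : (⟨v, hv⟩ : ξ) ∈ S := by rw [heq]; exact (hmem _).2 hvu
    obtain ⟨u, hu⟩ := this
    exact ⟨u, congrArg Subtype.val hu⟩

end LinearAlgebra

/-! ### Contact vector fields with given Hamiltonian -/

section ContactFields

/-- The exterior derivative of a one-form on a normed space, as a bilinear map. -/
def dextL {V : Type*} [NormedAddCommGroup V] [NormedSpace ℝ V] (B : V → V →L[ℝ] ℝ) (e : V) :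
    V →L[ℝ] V →L[ℝ] ℝ :=
  fderiv ℝ B e - (fderiv ℝ B e).flip

theorem dextL_apply {V : Type*} [NormedAddCommGroup V] [NormedSpace ℝ V] (B : V → V →L[ℝ] ℝ)
    (e a b : V) : dextL B e a b = dext B e a b := rfl

/-- The coefficients of the equations of a contact vector field. -/
abbrev ContactData (E : Type*) [NormedAddCommGroup E] [NormedSpace ℝ E] : Type _ :=
  (E →L[ℝ] ℝ) × (E →L[ℝ] E →L[ℝ] ℝ) × (E →L[ℝ] ℝ) × ℝ

/-- The coefficients of the equations of a contact vector field on a normed space. -/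
def contactData {E : Type*} [NormedAddCommGroup E] [NormedSpace ℝ E] (bα bδ : E → E →L[ℝ] ℝ)
    (τ : ℝ → ℝ) (h : ℝ × E → ℝ) (q : ℝ × E) : ContactData E :=
  (bα q.2 + τ q.1 • bδ q.2, dextL bα q.2 + τ q.1 • dextL bδ q.2,
    -((fderiv ℝ h q).comp (ContinuousLinearMap.inr ℝ ℝ E)) - deriv τ q.1 • bδ q.2, h q)

theorem contDiffAt_clm_apply_of_finiteDimensional {W E F : Type*} [NormedAddCommGroup W]
    [NormedSpace ℝ W] [NormedAddCommGroup E] [NormedSpace ℝ E] [FiniteDimensional ℝ E]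
    [NormedAddCommGroup F] [NormedSpace ℝ F] {f : W → E →L[ℝ] F} {x : W}
    (h : ∀ v, ContDiffAt ℝ ∞ (fun x => f x v) x) : ContDiffAt ℝ ∞ f x := by
  let b := Module.finBasis ℝ E
  have hf : f = fun x => ∑ i, (LinearMap.toContinuousLinearMap (b.coord i)).smulRight (f x (b i)) := by
    funext x
    ext v
    conv_lhs => rw [← b.sum_repr v]
    rw [map_sum, _root_.sum_apply]
    exact Finset.sum_congr rfl fun i _ => map_smul _ _ _
  rw [hf]
  exact ContDiffAt.sum fun i _ => contDiffAt_const.smulRight (h (b i))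

theorem contDiffAt_contactData {E : Type*} [NormedAddCommGroup E] [NormedSpace ℝ E]
    [FiniteDimensional ℝ E]
    {bα bδ : E → E →L[ℝ] ℝ} {τ : ℝ → ℝ} {h : ℝ × E → ℝ} {q : ℝ × E}
    (hα : ContDiffAt ℝ ∞ bα q.2) (hδ : ContDiffAt ℝ ∞ bδ q.2) (hτ : ContDiff ℝ ∞ τ)
    (hh : ContDiffAt ℝ ∞ h q) : ContDiffAt ℝ ∞ (contactData bα bδ τ h) q := by
  have hs : ContDiffAt ℝ ∞ (fun q : ℝ × E => q.2) q := contDiff_snd.contDiffAt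
  have hd : ∀ {b : E → E →L[ℝ] ℝ}, ContDiffAt ℝ ∞ b q.2 → ∀ v w,
      ContDiffAt ℝ ∞ (fun q : ℝ × E => dextL b q.2 v w) q := fun {b} hb v w => by
    have h1 : ContDiffAt ℝ ∞ (fun q : ℝ × E => fderiv ℝ b q.2) q :=
      (hb.fderiv_right (m := ∞) le_rfl).comp q hs
    exact ((h1.clm_apply contDiffAt_const).clm_apply contDiffAt_const).sub
      ((h1.clm_apply contDiffAt_const).clm_apply contDiffAt_const)
  have hτ1 : ContDiffAt ℝ ∞ (fun q : ℝ × E => τ q.1) q := (hτ.comp contDiff_fst).contDiffAt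
  have hτ2 : ContDiffAt ℝ ∞ (fun q : ℝ × E => deriv τ q.1) q :=
    ((contDiff_infty_iff_deriv.1 hτ).2.comp contDiff_fst).contDiffAt
  refine ((hα.comp q hs).add (hτ1.smul (hδ.comp q hs))).prodMk
    (ContDiffAt.prodMk ?_ (ContDiffAt.prodMk ?_ hh))
  · refine contDiffAt_clm_apply_of_finiteDimensional fun v =>
      contDiffAt_clm_apply_of_finiteDimensional fun w => ?_
    exact (hd hα v w).add (hτ1.mul (hd hδ v w))
  · exact (((hh.fderiv_right (m := ∞) le_rfl).clm_comp contDiffAt_const).neg).sub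
      (hτ2.smul (hδ.comp q hs))

variable {d : ℕ} {X : Type*} [TopologicalSpace X] [ChartedSpace (ℰ d) X]
  [IsManifold (𝓡 d) ∞ X]

/-- The exterior derivative of a one-form, as a bilinear map on the model space. -/
def OneForm.extL (μ : OneForm d X) (x : X) :
    ℰ d →L[ℝ] ℰ d →L[ℝ] ℝ :=
  dextL (pb μ (extChartAt (𝓡 d) x).symm) (extChartAt (𝓡 d) x x)

theorem OneForm.extL_self (μ : OneForm d X) (x : X) (v : ℰ d) :
    μ.extL x v v = 0 := by
  rw [OneForm.extL, dextL_apply, dext, sub_self]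

theorem dext_pb_extL {V : Type*} [NormedAddCommGroup V] [NormedSpace ℝ V] (μ : OneForm d X)
    {g : V → X} {e : V} (hg : ContMDiffAt 𝓘(ℝ, V) (𝓡 d) ∞ g e) (a b : V) :
    dext (pb μ g) e a b = μ.extL (g e) (mD 𝓘(ℝ, V) (𝓡 d) g e a) (mD 𝓘(ℝ, V) (𝓡 d) g e b) :=
  dext_pb μ hg a b

/-- `α` is a contact form at `x`. -/
def OneForm.IsContactAt (α : OneForm d X) (x : X) : Prop := ContactPair (α.cov x) (α.extL x)

theorem IsContactForm.isContactAt {α : OneForm d X} (h : IsContactForm α) (x : X) :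
    α.IsContactAt x :=
  ⟨(h x).1, fun v hv hvw => (h x).2 v hv fun w hw => hvw w hw⟩

/-- The value at `(t, x)` of the family of one-forms `α + τ(t)δ`. -/
def contactCov (α δ : OneForm d X) (τ : ℝ → ℝ) (p : ℝ × X) : ℰ d →L[ℝ] ℝ :=
  α.cov p.2 + τ p.1 • δ.cov p.2

/-- The exterior derivative at `(t, x)` of the family of one-forms `α + τ(t)δ`. -/
def contactExt (α δ : OneForm d X) (τ : ℝ → ℝ) (p : ℝ × X) :
    ℰ d →L[ℝ] ℰ d →L[ℝ] ℝ :=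
  α.extL p.2 + τ p.1 • δ.extL p.2

/-- The covector `-dh - τ'δ`. -/
def contactRhs (δ : OneForm d X) (τ : ℝ → ℝ) (h : ℝ × X → ℝ) (p : ℝ × X) :
    ℰ d →L[ℝ] ℝ :=
  -(mD (𝓡 d) 𝓘(ℝ, ℝ) (fun x => h (p.1, x)) p.2) - deriv τ p.1 • δ.cov p.2

/-- `v` is the value at `(t, x)` of the contact vector field of the family `α + τ(t)δ` with the
Hamiltonian `h`. -/
def IsContactVector (α δ : OneForm d X) (τ : ℝ → ℝ) (h : ℝ × X → ℝ) (p : ℝ × X)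
    (v : ℰ d) : Prop :=
  contactCov α δ τ p v = h p ∧
    ∀ w, contactCov α δ τ p w = 0 → contactExt α δ τ p v w = contactRhs δ τ h p w

/-- The contact vector field of the family `α + τ(t)δ` with the Hamiltonian `h`. -/
def contactField (α δ : OneForm d X) (τ : ℝ → ℝ) (h : ℝ × X → ℝ) (t : ℝ) (x : X) :
    TangentSpace (𝓡 d) x :=
  Classical.epsilon (α := ℰ d) (IsContactVector α δ τ h (t, x))

theorem pb_extChartAt_symm (μ : OneForm d X) {x₀ x : X}
    (hx : x ∈ (chartAt (ℰ d) x₀).source) :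
    pb μ (extChartAt (𝓡 d) x₀).symm (extChartAt (𝓡 d) x₀ x) =
      (μ.cov x).comp (chartDInv (𝓡 d) x₀ x) := by
  rw [pb, extChartAt_symm_apply_self hx]; rfl

theorem dextL_pb_extChartAt_symm (μ : OneForm d X) {x₀ x : X}
    (hx : x ∈ (chartAt (ℰ d) x₀).source) (a b : ℰ d) :
    dextL (pb μ (extChartAt (𝓡 d) x₀).symm) (extChartAt (𝓡 d) x₀ x) a b =
      μ.extL x (chartDInv (𝓡 d) x₀ x a) (chartDInv (𝓡 d) x₀ x b) := by
  rw [dextL_apply, dext_pb_extL μ (contMDiffAt_extChartAt_symm hx)]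
  rw [extChartAt_symm_apply_self hx]; rfl

/-- In a chart the two conditions become those of `ContactPair.exists_solution`, with coefficients
smooth in time and space. Existence and uniqueness identify the chosen value of `contactField` with
that solution. Nondegeneracy at `p₀` suffices for the conclusion at all nearby points. -/
theorem contactField_spec {α δ : OneForm d X} {τ : ℝ → ℝ} (hτ : ContDiff ℝ ∞ τ) {h : ℝ × X → ℝ}
    (hh : ContMDiff (𝓘(ℝ, ℝ).prod (𝓡 d)) 𝓘(ℝ, ℝ) ∞ h) {p₀ : ℝ × X}
    (hp₀ : ContactPair (contactCov α δ τ p₀) (contactExt α δ τ p₀)) :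
    ∀ᶠ p in 𝓝 p₀, ContMDiffAt (𝓘(ℝ, ℝ).prod (𝓡 d)) (𝓡 d).tangent ∞
        (fun p : ℝ × X => mkTan (𝓡 d) p.2 (contactField α δ τ h p.1 p.2)) p ∧
      ∀ v, IsContactVector α δ τ h p v ↔ v = contactField α δ τ h p.1 p.2 := by
  obtain ⟨t₀, x₀⟩ := p₀
  set φ := extChartAt (𝓡 d) x₀ with hφ
  have hx₀ := mem_chart_source (ℰ d) x₀
  obtain ⟨S, hS⟩ := hp₀.exists_solution
  let bα := pb α φ.symm
  let bδ := pb δ φ.symm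
  let hc : ℝ × ℰ d → ℝ := fun q => h (q.1, φ.symm q.2)
  have hbsm : ∀ (μ : OneForm d X), ∀ e ∈ φ.target, ContDiffAt ℝ ∞ (pb μ φ.symm) e := fun μ e he =>
    contDiffAt_pb μ ((contMDiffOn_extChartAt_symm x₀).contMDiffAt
      ((isOpen_extChartAt_target x₀).mem_nhds he))
  have hhc : ∀ q : ℝ × ℰ d, q.2 ∈ φ.target → ContDiffAt ℝ ∞ hc q := by
    intro q hq
    have h1 : ContMDiffAt 𝓘(ℝ, ℰ d) (𝓡 d) ∞ φ.symm q.2 :=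
      (contMDiffOn_extChartAt_symm x₀).contMDiffAt ((isOpen_extChartAt_target x₀).mem_nhds hq)
    have h2 : ContMDiffAt 𝓘(ℝ, ℝ × ℰ d) (𝓘(ℝ, ℝ).prod (𝓡 d)) ∞
        (fun q : ℝ × ℰ d => (q.1, φ.symm q.2)) q :=
      contDiff_fst.contDiffAt.contMDiffAt.prodMk (h1.comp q contDiff_snd.contDiffAt.contMDiffAt)
    exact (hh.contMDiffAt.comp q h2).contDiffAt
  let D : ℝ × ℰ d → ContactData (ℰ d) :=
    contactData bα bδ τ hc
  have hsm : ∀ q : ℝ × ℰ d, q.2 ∈ φ.target → ContDiffAt ℝ ∞ D q :=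
    fun q hq => contDiffAt_contactData (hbsm α q.2 hq) (hbsm δ q.2 hq) hτ (hhc q hq)
  have hA : ∀ t, ∀ x ∈ (chartAt (ℰ d) x₀).source,
      (D (t, φ x)).1 = (contactCov α δ τ (t, x)).comp (chartDInv (𝓡 d) x₀ x) := by
    intro t x hx
    simp only [D, contactData, bα, bδ, hφ, pb_extChartAt_symm _ hx, contactCov, ContinuousLinearMap.add_comp,
      ContinuousLinearMap.smul_comp]
  have hΩ : ∀ t, ∀ x ∈ (chartAt (ℰ d) x₀).source, ∀ a b,
      (D (t, φ x)).2.1 a b = contactExt α δ τ (t, x) (chartDInv (𝓡 d) x₀ x a)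
        (chartDInv (𝓡 d) x₀ x b) := by
    intro t x hx a b
    have h1 := dextL_pb_extChartAt_symm α hx a b
    have h2 := dextL_pb_extChartAt_symm δ hx a b
    change dextL bα (φ x) a b + τ t * dextL bδ (φ x) a b = _
    rw [h1, h2]; rfl
  have hθ : ∀ t, ∀ x ∈ (chartAt (ℰ d) x₀).source,
      (D (t, φ x)).2.2.1 = (contactRhs δ τ h (t, x)).comp (chartDInv (𝓡 d) x₀ x) := by
    intro t x hx
    have hφx : φ x ∈ φ.target := φ.map_source (by rwa [hφ, extChartAt_source])
    have h1 : (fderiv ℝ hc (t, φ x)).comp (ContinuousLinearMap.inr ℝ ℝ _) =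
        (mD (𝓡 d) 𝓘(ℝ, ℝ) (fun x => h (t, x)) x).comp (chartDInv (𝓡 d) x₀ x) := by
      have h2 := ((hhc (t, φ x) hφx).differentiableAt (by simp)).hasFDerivAt.comp (φ x)
        (hasFDerivAt_prodMk_right t (φ x))
      have hm : MDifferentiableAt (𝓡 d) 𝓘(ℝ, ℝ) (fun x => h (t, x)) x :=
        (hh.comp (contMDiff_const.prodMk contMDiff_id)).mdifferentiable (by simp) x
      have h3 := mD_comp (f := φ.symm) (g := fun x => h (t, x)) (x := φ x) hm
        ((contMDiffAt_extChartAt_symm hx).mdiff)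
        (extChartAt_symm_apply_self hx)
      rw [mD_eq_fderiv] at h3
      exact h2.fderiv.symm.trans h3
    change -((fderiv ℝ hc (t, φ x)).comp (ContinuousLinearMap.inr ℝ ℝ _)) - deriv τ t • bδ (φ x) = _
    rw [h1, show bδ (φ x) = _ from pb_extChartAt_symm δ hx, contactRhs,
      ContinuousLinearMap.sub_comp, ContinuousLinearMap.neg_comp, ContinuousLinearMap.smul_comp]
  have hhc' : ∀ t, ∀ x ∈ (chartAt (ℰ d) x₀).source, hc (t, φ x) = h (t, x) := by
    intro t x hx
    simp only [hc, hφ, extChartAt_symm_apply_self hx]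
  let P : ℝ × X → ContactData (ℰ d) := fun p => D (p.1, φ p.2)
  have hP : ∀ p : ℝ × X, p.2 ∈ (chartAt (ℰ d) x₀).source →
      ContMDiffAt (𝓘(ℝ, ℝ).prod (𝓡 d)) 𝓘(ℝ, ContactData (ℰ d)) ∞ P p := by
    intro p hp
    have h1 : ContMDiffAt (𝓘(ℝ, ℝ).prod (𝓡 d)) 𝓘(ℝ, ℝ × ℰ d) ∞
        (fun p : ℝ × X => (p.1, φ p.2)) p := by
      rw [modelWithCornersSelf_prod, ← chartedSpaceSelf_prod]
      exact contMDiffAt_fst.prodMk ((contMDiffAt_extChartAt' hp).comp p contMDiffAt_snd)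
    exact (hsm (p.1, φ p.2) (φ.map_source (by rwa [hφ, extChartAt_source]))).contMDiffAt.comp p h1
  have hsrc : ∀ᶠ p : ℝ × X in 𝓝 (t₀, x₀), p.2 ∈ (chartAt (ℰ d) x₀).source :=
    continuousAt_snd.eventually (chart_source_nhds hx₀)
  have hP0 : P (t₀, x₀) = (contactCov α δ τ (t₀, x₀), contactExt α δ τ (t₀, x₀),
      (D (t₀, φ x₀)).2.2.1, hc (t₀, φ x₀)) := by
    refine Prod.ext ?_ (Prod.ext ?_ rfl)
    · exact (hA _ _ hx₀).trans (by rw [chartDInv_self]; rfl)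
    · ext1 a
      ext1 b
      exact (hΩ _ _ hx₀ a b).trans (by rw [chartDInv_self]; rfl)
  have hev : ∀ᶠ p in 𝓝 (t₀, x₀), ContDiffAt ℝ ∞ S (P p) ∧
        ∀ v, ((P p).1 v = (P p).2.2.2 ∧ ∀ w, (P p).1 w = 0 → (P p).2.1 v w = (P p).2.2.1 w) ↔
          v = S (P p) := by
    have h1 := (hP (t₀, x₀) hx₀).continuousAt
    rw [ContinuousAt, hP0] at h1
    exact h1.eventually (hS _ _)
  have hsol : ∀ᶠ p in 𝓝 (t₀, x₀), p.2 ∈ (chartAt (ℰ d) x₀).source ∧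
      ContDiffAt ℝ ∞ S (P p) ∧ contactField α δ τ h p.1 p.2 = chartDInv (𝓡 d) x₀ p.2 (S (P p)) ∧
      ∀ v, IsContactVector α δ τ h p v ↔ v = contactField α δ τ h p.1 p.2 := by
    filter_upwards [hsrc, hev] with p hp hp'
    obtain ⟨t, x⟩ := p
    have h1 : ∀ v, IsContactVector α δ τ h (t, x) v ↔ v = chartDInv (𝓡 d) x₀ x (S (P (t, x))) := by
      intro v
      have h2 := hp'.2 (chartD (𝓡 d) x₀ x v)
      have h3 : (chartD (𝓡 d) x₀ x v = S (P (t, x))) ↔ v = chartDInv (𝓡 d) x₀ x (S (P (t, x))) :=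
        ⟨fun h => by rw [← h, chartDInv_chartD_apply hp],
          fun h => by rw [h, chartD_chartDInv_apply hp]⟩
      rw [← h3, ← h2]
      have h5 : (P (t, x)).2.2.2 = h (t, x) := hhc' t x hp
      rw [h5]
      simp only [P, hA t x hp, hΩ t x hp, hθ t x hp, ContinuousLinearMap.comp_apply,
        chartDInv_chartD_apply hp, IsContactVector]
      refine and_congr_right fun _ => ⟨fun h w hw => h _ hw, fun h w hw => ?_⟩
      have := h (chartD (𝓡 d) x₀ x w)
      rw [chartDInv_chartD_apply hp] at this
      exact this hw
    have h4 : contactField α δ τ h t x = chartDInv (𝓡 d) x₀ x (S (P (t, x))) :=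
      (h1 _).1 (Classical.epsilon_spec (p := IsContactVector α δ τ h (t, x)) ⟨_, (h1 _).2 rfl⟩)
    refine ⟨hp, hp'.1, h4, fun v => ?_⟩
    rw [h1 v]
    exact ⟨fun h => h.trans h4.symm, fun h => h.trans h4⟩
  filter_upwards [eventually_eventually_nhds.2 hsol] with p hp
  obtain ⟨hp1, hp2, hp3, hp4⟩ := hp.self_of_nhds
  refine ⟨(contMDiffAt_tangent_iff le_rfl (x₀ := x₀) hp1).2 ⟨contMDiffAt_snd, ?_⟩, hp4⟩
  refine (hp2.contMDiffAt.comp p (hP p hp1)).congr_of_eventuallyEq ?_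
  filter_upwards [hp] with q hq
  change chartD (𝓡 d) x₀ q.2 (contactField α δ τ h q.1 q.2) = S (P q)
  rw [hq.2.2.1]
  exact chartD_chartDInv_apply hq.1 _

end ContactFields

/-! ### Contact flows preserve the contact planes -/

section Transport

theorem eventually_eq_const_of_deriv_eq_zero {q : ℝ → ℝ} {t : ℝ}
    (h : ∀ᶠ s in 𝓝 t, HasDerivAt q 0 s) : ∀ᶠ s in 𝓝 t, q s = q t := by
  obtain ⟨r, hr, hb⟩ := Metric.eventually_nhds_iff_ball.1 h
  filter_upwards [Metric.ball_mem_nhds t hr] with s hs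
  exact (convex_ball t r).is_const_of_fderivWithin_eq_zero (𝕜 := ℝ)
    (fun x hx => (hb x hx).differentiableAt.differentiableWithinAt)
    (fun x hx => by
      rw [fderivWithin_of_isOpen Metric.isOpen_ball hx, (hb x hx).hasFDerivAt.fderiv]; ext; simp)
    hs (Metric.mem_ball_self hr)

/-- A function whose ratio to a nonvanishing function is locally constant and which vanishes at one
point of an interval vanishes on the interval. -/
theorem eq_zero_of_locally_proportional {f f' : ℝ → ℝ} {a b t₀ : ℝ} (ht₀ : t₀ ∈ Ioo a b)
    (h0 : f t₀ = 0)
    (h : ∀ t ∈ Ioo a b, ∃ g g' : ℝ → ℝ, ∀ᶠ s in 𝓝 t, g s ≠ 0 ∧ HasDerivAt f (f' s) s ∧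
      HasDerivAt g (g' s) s ∧ f' s * g s = f s * g' s) :
    ∀ t ∈ Ioo a b, f t = 0 := by
  -- Near each time `f` is a constant multiple of a nonvanishing function, so it vanishes
  -- identically or nowhere; connectedness of the interval then decides.
  have key : ∀ t ∈ Ioo a b, (∀ᶠ s in 𝓝 t, f s = 0) ∨ ∀ᶠ s in 𝓝 t, f s ≠ 0 := by
    intro t ht
    obtain ⟨g, g', hg⟩ := h t ht
    have hq : ∀ᶠ s in 𝓝 t, HasDerivAt (fun s => f s / g s) 0 s := by
      filter_upwards [hg] with s hs
      have := hs.2.1.div hs.2.2.1 hs.1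
      rwa [hs.2.2.2, sub_self, zero_div] at this
    have hc := eventually_eq_const_of_deriv_eq_zero hq
    by_cases hz : f t / g t = 0
    · left
      filter_upwards [hc, hg] with s hs hs'
      rw [hz, div_eq_zero_iff] at hs
      exact hs.resolve_right hs'.1
    · right
      filter_upwards [hc] with s hs hs'
      rw [hs', zero_div] at hs
      exact hz hs.symm
  by_contra! hne
  obtain ⟨t₁, ht₁, hne⟩ := hne
  let U := {t | ∀ᶠ s in 𝓝 t, f s = 0}
  let V := {t | ∀ᶠ s in 𝓝 t, f s ≠ 0}
  have hU : IsOpen U := isOpen_iff_mem_nhds.2 fun t ht => eventually_eventually_nhds.2 ht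
  have hV : IsOpen V := isOpen_iff_mem_nhds.2 fun t ht => eventually_eventually_nhds.2 ht
  obtain ⟨s, hs, hsU, hsV⟩ := isPreconnected_Ioo (a := a) (b := b) U V hU hV
    (fun t ht => key t ht) ⟨t₀, ht₀, (key t₀ ht₀).resolve_right fun h => h.self_of_nhds h0⟩
    ⟨t₁, ht₁, (key t₁ ht₁).resolve_left fun h => hne h.self_of_nhds⟩
  exact (hsV : ∀ᶠ s in 𝓝 s, f s ≠ 0).self_of_nhds (hsU : ∀ᶠ s in 𝓝 s, f s = 0).self_of_nhds

theorem HasFDerivAt.hasDerivAt_comp_apply {W F : Type*} [NormedAddCommGroup W] [NormedSpace ℝ W]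
    [NormedAddCommGroup F] [NormedSpace ℝ F] {B : W → F →L[ℝ] ℝ} {B' : W →L[ℝ] F →L[ℝ] ℝ} {p : W}
    (hB : HasFDerivAt B B' p) {c : ℝ → W} {c' : W} {s : ℝ} (hc : HasDerivAt c c' s) (hcs : c s = p)
    (u : F) : HasDerivAt (fun r => B (c r) u) (B' c' u) s := by
  subst hcs
  have h2 := (hB.comp_hasDerivAt s hc).clm_apply (hasDerivAt_const s u)
  rwa [map_zero, add_zero] at h2

theorem hasDerivAt_const_prodMk_line {F : Type*} [NormedAddCommGroup F] [NormedSpace ℝ F]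
    (t : ℝ) (e w : F) : HasDerivAt (fun r : ℝ => (t, e + r • w)) ((0 : ℝ), w) 0 := by
  refine (hasDerivAt_const 0 t).prodMk ?_
  have := ((hasDerivAt_id (0 : ℝ)).smul_const w).const_add e
  rwa [one_smul] at this

variable {d : ℕ} {X : Type*} [TopologicalSpace X] [ChartedSpace (ℰ d) X]
  [IsManifold (𝓡 d) ∞ X]

set_option maxHeartbeats 1000000 in
/-- The flow of a contact vector field preserves the contact planes. -/
theorem contact_transport {α δ : OneForm d X} {τ : ℝ → ℝ} (hτ : ContDiff ℝ ∞ τ) {h : ℝ × X → ℝ}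
    (hh : ContMDiff (𝓘(ℝ, ℝ).prod (𝓡 d)) 𝓘(ℝ, ℝ) ∞ h)
    {Φ : ℝ × X → X} (hΦ : ContMDiff (𝓘(ℝ, ℝ).prod (𝓡 d)) (𝓡 d) ∞ Φ) {a b t₀ : ℝ} {x : X}
    (ht₀ : t₀ ∈ Ioo a b)
    (hvel : ∀ t ∈ Ioo a b, ∀ᶠ p in 𝓝 (t, x), ∃ v,
      HasVelocity (𝓡 d) (fun s => Φ (s, p.2)) v p.1 ∧ IsContactVector α δ τ h (p.1, Φ p) v)
    (hne : ∀ t ∈ Ioo a b, contactCov α δ τ (t, Φ (t, x)) ≠ 0)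
    (hsurj : ∀ t ∈ Ioo a b, Function.Surjective (mD (𝓡 d) (𝓡 d) (fun z => Φ (t, z)) x))
    {v : ℰ d}
    (hv : contactCov α δ τ (t₀, Φ (t₀, x)) (mD (𝓡 d) (𝓡 d) (fun z => Φ (t₀, z)) x v) = 0) :
    ∀ t ∈ Ioo a b,
      contactCov α δ τ (t, Φ (t, x)) (mD (𝓡 d) (𝓡 d) (fun z => Φ (t, z)) x v) = 0 := by
  set φ := extChartAt (𝓡 d) x with hφ
  have hx := mem_chart_source (ℰ d) x
  have hφx : φ.symm (φ x) = x := extChartAt_symm_apply_self hx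
  let g : ℝ × ℰ d → X := fun q => Φ (q.1, φ.symm q.2)
  have hsymm : ContMDiffAt 𝓘(ℝ, ℰ d) (𝓡 d) ∞ φ.symm (φ x) :=
    contMDiffAt_extChartAt_symm hx
  have hpair : ∀ t, ContMDiffAt 𝓘(ℝ, ℝ × ℰ d) (𝓘(ℝ, ℝ).prod (𝓡 d)) ∞
      (fun q : ℝ × ℰ d => (q.1, φ.symm q.2)) (t, φ x) := fun t =>
    contDiff_fst.contDiffAt.contMDiffAt.prodMk
      (ContMDiffAt.comp (t, φ x) hsymm contDiff_snd.contDiffAt.contMDiffAt)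
  have hg : ∀ t, ContMDiffAt 𝓘(ℝ, ℝ × ℰ d) (𝓡 d) ∞ g (t, φ x) := fun t =>
    hΦ.contMDiffAt.comp (t, φ x) (hpair t)
  have hgx : ∀ t, g (t, φ x) = Φ (t, x) := fun t => by simp only [g, hφx]
  have hgd : ∀ t, MDifferentiableAt 𝓘(ℝ, ℝ × ℰ d) (𝓡 d) g (t, φ x) :=
    fun t => (hg t).mdiff
  have hΦt : ∀ t, MDifferentiable (𝓡 d) (𝓡 d) (fun z => Φ (t, z)) := fun t =>
    (hΦ.comp (contMDiff_const.prodMk contMDiff_id)).mdifferentiable (by simp)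
  have hw : ∀ t w, mD 𝓘(ℝ, ℝ × ℰ d) (𝓡 d) g (t, φ x) (0, w) =
      mD (𝓡 d) (𝓡 d) (fun z => Φ (t, z)) x w := by
    intro t w
    have h1 := mD_comp (f := fun e : ℰ d => (t, e)) (hgd t)
      (hasFDerivAt_prodMk_right t (φ x)).differentiableAt.mdifferentiableAt rfl
    have h2 := mD_comp (f := φ.symm) (hΦt t x) (hsymm.mdiff) hφx
    have h3 : mD 𝓘(ℝ, ℰ d) (𝓡 d) φ.symm (φ x) = ContinuousLinearMap.id ℝ _ :=
      chartDInv_self (I := 𝓡 d) x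
    rw [mD_eq_fderiv, (hasFDerivAt_prodMk_right t (φ x)).fderiv] at h1
    rw [h3] at h2
    exact DFunLike.congr_fun (h1.symm.trans h2) w
  have hvelD : ∀ {t : ℝ} {e v}, MDifferentiableAt 𝓘(ℝ, ℝ × ℰ d) (𝓡 d) g (t, e) →
      HasVelocity (𝓡 d) (fun s => g (s, e)) v t →
      mD 𝓘(ℝ, ℝ × ℰ d) (𝓡 d) g (t, e) (1, 0) = v := by
    intro t e v h1 h2
    have h3 := mD_comp (f := fun s : ℝ => (s, e)) h1
      (hasFDerivAt_prodMk_left t e).differentiableAt.mdifferentiableAt rfl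
    rw [mD_eq_fderiv, (hasFDerivAt_prodMk_left t e).fderiv] at h3
    rw [← h2.2, h3]; rfl
  let B : OneForm d X → ℝ × ℰ d → ℝ × ℰ d →L[ℝ] ℝ :=
    fun μ => pb μ g
  have hB : ∀ μ t, HasFDerivAt (B μ) (fderiv ℝ (B μ) (t, φ x)) (t, φ x) := fun μ t =>
    ((contDiffAt_pb μ (hg t)).differentiableAt (by simp)).hasFDerivAt
  -- `f w t` is the pullback of `α + τ δ` by the map at time `t`, evaluated on `w`. By Cartan's
  -- formula its derivative is `F t` at the image of `w`, and the equation of a contact vector says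
  -- that `F t` vanishes on the kernel of the form.
  let f : ℰ d → ℝ → ℝ := fun w t =>
    contactCov α δ τ (t, Φ (t, x)) (mD (𝓡 d) (𝓡 d) (fun z => Φ (t, z)) x w)
  let F : ℝ → ℰ d → ℝ := fun t w =>
    contactExt α δ τ (t, Φ (t, x)) (mD 𝓘(ℝ, ℝ × ℰ d) (𝓡 d) g (t, φ x) (1, 0)) w -
      contactRhs δ τ h (t, Φ (t, x)) w
  have hfB : ∀ w t, f w t = B α (t, φ x) (0, w) + τ t * B δ (t, φ x) (0, w) := by
    intro w t
    simp only [f, B, pb, ContinuousLinearMap.comp_apply, hw, hgx]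
    rfl
  have hder : ∀ w, ∀ t ∈ Ioo a b, HasDerivAt (f w)
      (F t (mD (𝓡 d) (𝓡 d) (fun z => Φ (t, z)) x w)) t := by
    intro w t ht
    have hBt : ∀ μ, HasDerivAt (fun t => B μ (t, φ x) (0, w))
        (fderiv ℝ (B μ) (t, φ x) (1, 0) (0, w)) t := fun μ =>
      (hB μ t).hasDerivAt_comp_apply ((hasDerivAt_id t).prodMk (hasDerivAt_const t (φ x))) rfl _
    have h0 : (t, φ x + (0 : ℝ) • w) = (t, φ x) := by rw [zero_smul, add_zero]
    have hBe : ∀ μ, HasDerivAt (fun r : ℝ => B μ (t, φ x + r • w) (1, 0))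
        (fderiv ℝ (B μ) (t, φ x) (0, w) (1, 0)) 0 := fun μ =>
      (hB μ t).hasDerivAt_comp_apply (hasDerivAt_const_prodMk_line t (φ x) w) h0 _
    -- The form evaluated on the velocity equals the Hamiltonian at all nearby points, which yields
    -- its derivative in the direction `w`.
    have hev : ∀ᶠ r : ℝ in 𝓝 0, h (t, g (t, φ x + r • w)) =
        B α (t, φ x + r • w) (1, 0) + τ t * B δ (t, φ x + r • w) (1, 0) := by
      have hc : Filter.Tendsto (fun r : ℝ => (t, φ x + r • w)) (𝓝 0) (𝓝 (t, φ x)) := by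
        have : Continuous (fun r : ℝ => (t, φ x + r • w)) := by fun_prop
        have h1 := this.tendsto 0
        rwa [zero_smul, add_zero] at h1
      have hc2 : Filter.Tendsto (fun q : ℝ × ℰ d => (q.1, φ.symm q.2))
          (𝓝 (t, φ x)) (𝓝 (t, x)) := by
        have := (hpair t).continuousAt
        rw [ContinuousAt] at this
        simpa only [hφx] using this
      filter_upwards [hc.eventually (contMDiffAt_eventually_top (hg t)),
        (hc2.comp hc).eventually (hvel t ht)] with r hr1 hr2
      obtain ⟨v', hv1, hv2⟩ := hr2
      refine hv2.1.symm.trans ?_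
      simp only [B, pb, ContinuousLinearMap.comp_apply]
      rw [hvelD hr1 hv1]; rfl
    have hhd : HasDerivAt (fun r : ℝ => h (t, g (t, φ x + r • w)))
        (mD (𝓡 d) 𝓘(ℝ, ℝ) (fun z => h (t, z)) (Φ (t, x))
          (mD (𝓡 d) (𝓡 d) (fun z => Φ (t, z)) x w)) 0 := by
      have h1 : HasVelocity 𝓘(ℝ, ℝ × ℰ d) (fun r : ℝ => (t, φ x + r • w))
          ((0 : ℝ), w) 0 := hasVelocity_iff_hasDerivAt.2 (hasDerivAt_const_prodMk_line t (φ x) w)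
      have h2 := h1.comp (f := g) (I' := 𝓡 d) (by rw [h0]; exact hgd t)
      have hm : MDifferentiable (𝓡 d) 𝓘(ℝ, ℝ) (fun z => h (t, z)) :=
        (hh.comp (contMDiff_const.prodMk contMDiff_id)).mdifferentiable (by simp)
      have h3 := h2.comp (f := fun z => h (t, z)) (I' := 𝓘(ℝ, ℝ)) (hm _)
      rw [hasVelocity_iff_hasDerivAt, h0, hgx, hw] at h3
      exact h3
    have hsum := (hhd.congr_of_eventuallyEq (hev.mono fun r hr => hr.symm)).unique
      ((hBe α).add ((hBe δ).const_mul (τ t)))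
    have hext : ∀ μ : OneForm d X, fderiv ℝ (B μ) (t, φ x) (1, 0) (0, w) =
        μ.extL (Φ (t, x)) (mD 𝓘(ℝ, ℝ × ℰ d) (𝓡 d) g (t, φ x) (1, 0))
          (mD (𝓡 d) (𝓡 d) (fun z => Φ (t, z)) x w) + fderiv ℝ (B μ) (t, φ x) (0, w) (1, 0) := by
      intro μ
      have h1 := dext_pb_extL μ (hg t) (1, 0) (0, w)
      rw [hw, hgx, dext] at h1
      rw [← h1]
      simp only [B]
      ring
    have htot := (hBt α).add (((hτ.differentiable (by simp)).differentiableAt (x := t)).hasDerivAt.mul (hBt δ))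
    have hfeq : f w = (fun t => B α (t, φ x) (0, w)) + (τ * fun t => B δ (t, φ x) (0, w)) := by
      funext t; exact hfB w t
    rw [hfeq]
    refine htot.congr_deriv ?_
    have hBδ : B δ (t, φ x) (0, w) = δ.cov (Φ (t, x)) (mD (𝓡 d) (𝓡 d) (fun z => Φ (t, z)) x w) := by
      simp only [B, pb, ContinuousLinearMap.comp_apply, hw, hgx]
    rw [hext α, hext δ, hBδ]
    simp only [F, contactExt, contactRhs, add_apply, smul_apply, sub_apply, neg_apply, smul_eq_mul]
    linear_combination (norm := skip) -hsum
    ring_nf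
  refine eq_zero_of_locally_proportional (f := f v)
    (f' := fun t => F t (mD (𝓡 d) (𝓡 d) (fun z => Φ (t, z)) x v)) ht₀ hv fun t ht => ?_
  obtain ⟨ζ, hζ⟩ := exists_ne_zero_of_clm_ne_zero (hne t ht)
  obtain ⟨w₀, hw₀⟩ := hsurj t ht ζ
  refine ⟨f w₀, fun t => F t (mD (𝓡 d) (𝓡 d) (fun z => Φ (t, z)) x w₀), ?_⟩
  have hnz : f w₀ t ≠ 0 := by simp only [f, hw₀]; exact hζ
  filter_upwards [(hder w₀ t ht).continuousAt.eventually_ne hnz, Ioo_mem_nhds ht.1 ht.2]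
    with s hs hs'
  refine ⟨hs, hder v s hs', hder w₀ s hs', ?_⟩
  obtain ⟨u, hu1, hu2⟩ := (hvel s hs').self_of_nhds
  have hu3 : mD 𝓘(ℝ, ℝ × ℰ d) (𝓡 d) g (s, φ x) (1, 0) = u := by
    refine hvelD (hgd s) ?_
    simpa only [g, hφx] using hu1
  set A := contactCov α δ τ (s, Φ (s, x)) with hA
  set wv := mD (𝓡 d) (𝓡 d) (fun z => Φ (s, z)) x v
  set w0 := mD (𝓡 d) (𝓡 d) (fun z => Φ (s, z)) x w₀
  -- The vector tested lies in `ker A`. So `F s` is proportional to `A`, and `f v` and `f w₀`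
  -- satisfy the same linear differential equation.
  have hker := hu2.2 (A w0 • wv - A wv • w0) (by
    rw [map_sub, map_smul, map_smul, smul_eq_mul, smul_eq_mul]; ring)
  simp only [map_sub, map_smul, smul_eq_mul] at hker
  change F s wv * A w0 = A wv * F s w0
  simp only [F, hu3]
  linear_combination hker

end Transport

/-! ### Exterior derivatives of proportional forms -/

section Conformal

variable {V : Type*} [NormedAddCommGroup V] [NormedSpace ℝ V]

/-- Proportional one-forms have proportional exterior derivatives on their kernels. -/
theorem dext_conformal {B B' : V → V →L[ℝ] ℝ} {e : V} (hB : DifferentiableAt ℝ B e)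
    (hB' : DifferentiableAt ℝ B' e) (hne : B e ≠ 0)
    (hker : ∀ᶠ x in 𝓝 e, ∀ v, B x v = 0 → B' x v = 0) :
    ∃ c : ℝ, B' e = c • B e ∧ ∀ a b, B e a = 0 → B e b = 0 →
      dext B' e a b = c * dext B e a b := by
  obtain ⟨ζ, hζ⟩ := exists_ne_zero_of_clm_ne_zero hne
  -- So `B' = c B` with a differentiable function `c`, and the term `dc ∧ B` of its exterior
  -- derivative vanishes on pairs in `ker B`.
  have hprop : B' =ᶠ[𝓝 e] fun x => (B' x ζ / B x ζ) • B x := by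
    have h1 : ∀ᶠ x in 𝓝 e, B x ζ ≠ 0 :=
      (hB.continuousAt.clm_apply continuousAt_const).eventually_ne hζ
    filter_upwards [hker, h1] with x hx hx1
    ext v
    have := hx (v - (B x v / B x ζ) • ζ) (by
      rw [map_sub, map_smul, smul_eq_mul, div_mul_cancel₀ _ hx1, sub_self])
    rw [map_sub, map_smul, smul_eq_mul, sub_eq_zero] at this
    rw [this, smul_apply, smul_eq_mul]
    ring
  refine ⟨B' e ζ / B e ζ, hprop.eq_of_nhds, fun a b ha hb => ?_⟩
  have hc : DifferentiableAt ℝ (fun x => B' x ζ / B x ζ) e := by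
    have h1 : DifferentiableAt ℝ (fun x => B' x ζ) e := hB'.clm_apply (differentiableAt_const ζ)
    have h2 : DifferentiableAt ℝ (fun x => B x ζ) e := hB.clm_apply (differentiableAt_const ζ)
    simpa only [div_eq_mul_inv] using h1.fun_mul (h2.fun_inv hζ)
  have hd : fderiv ℝ B' e = _ := (Filter.EventuallyEq.fderiv_eq hprop).trans (hc.hasFDerivAt.smul hB.hasFDerivAt).fderiv
  rw [dext, hd, dext]
  simp only [add_apply, smul_apply, ContinuousLinearMap.smulRight_apply, smul_eq_mul, ha, hb]
  ring

end Conformal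

/-! ### The normalized section of the transverse line field -/

section TransverseSection

variable {k : ℕ} {Y : Type*} [TopologicalSpace Y] [ChartedSpace (ℰ k) Y]
  [IsManifold (𝓡 k) ∞ Y]
  {E' : Type*} [NormedAddCommGroup E'] [NormedSpace ℝ E'] {H' : Type*} [TopologicalSpace H']
  {J : ModelWithCorners ℝ E' H'}
  {Z : Type*} [TopologicalSpace Z] [ChartedSpace H' Z]

/-- `R` is the section of the line field `L` normalized by `μ R = 1`. -/
structure IsTransverseSection (μ : OneForm k Y) (L : PlaneField k Y)
    (R : Y → ℰ k) : Prop where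
  contMDiff : ContMDiff (𝓡 k) (𝓡 k).tangent ∞ (fun y => mkTan (𝓡 k) y (R y))
  apply_eq_one : ∀ y, μ.cov y (R y) = 1
  annihilator_iff : ∀ y (c : ℰ* k), (∀ v ∈ L y, c v = 0) ↔ c (R y) = 0

theorem ContMDiffAt.mkTan_smul {E : Type*} [NormedAddCommGroup E] [NormedSpace ℝ E] {H : Type*}
    [TopologicalSpace H] {I : ModelWithCorners ℝ E H} [I.Boundaryless] {X : Type*}
    [TopologicalSpace X] [ChartedSpace H X] [IsManifold I ∞ X] {n : WithTop ℕ∞} (hn : n ≤ ∞)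
    {y : Z → X} {v : Z → E} {r : Z → ℝ} {a : Z} (hr : ContMDiffAt J 𝓘(ℝ, ℝ) n r a)
    (h : ContMDiffAt J I.tangent n (fun z => mkTan I (y z) (v z)) a) :
    ContMDiffAt J I.tangent n (fun z => mkTan I (y z) (r z • v z)) a := by
  have hx : (mkTan I (y a) (v a)).proj ∈ (chartAt H (y a)).source := mem_chart_source _ _
  have hx' : (mkTan I (y a) (r a • v a)).proj ∈ (chartAt H (y a)).source := mem_chart_source _ _
  obtain ⟨h1, h2⟩ := (contMDiffAt_tangent_iff (g := fun z => mkTan I (y z) (v z)) hn hx).1 h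
  refine (contMDiffAt_tangent_iff (g := fun z => mkTan I (y z) (r z • v z)) hn hx').2 ⟨h1, ?_⟩
  refine (hr.smul h2).congr_of_eventuallyEq (Filter.Eventually.of_forall fun z => ?_)
  exact (chartD I (y a) (y z)).map_smul (r z) (v z)

theorem OneForm.contMDiffAt_mkCot (μ : OneForm k Y) (y : Y) :
    ContMDiffAt (𝓡 k) (cotangentModel k) ∞ (fun y => mkCot y (μ.cov y)) y := μ.contMDiff y

/-- The vector `V / μ(V)` does not depend on the local generator `V` of the line field, so the local
choices agree on overlaps and the result is smooth. -/
theorem exists_isTransverseSection {μ : OneForm k Y} {L : PlaneField k Y} (hL : IsLineField L)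
    (hLF : ∀ y, IsCompl (L y) (μ.kerField y)) : ∃ R, IsTransverseSection μ L R := by
  have hV : ∀ {y} {v : ℰ k}, v ≠ 0 → L y = Submodule.span ℝ {v} →
      μ.cov y v ≠ 0 := by
    intro y v hv hLy h
    have hmem : v ∈ L y := by rw [hLy]; exact Submodule.mem_span_singleton_self v
    exact hv (Submodule.disjoint_def.1 (hLF y).disjoint v hmem h)
  choose V hVL using hL
  let R : Y → ℰ k := fun y => (μ.cov y (V y y))⁻¹ • V y y
  have huniq : ∀ {y} {v w : ℰ k}, v ≠ 0 → L y = Submodule.span ℝ {v} →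
      w ≠ 0 → L y = Submodule.span ℝ {w} → (μ.cov y v)⁻¹ • v = (μ.cov y w)⁻¹ • w := by
    intro y v w hv hLv hw hLw
    have h1 : v ∈ Submodule.span ℝ {w} := by
      rw [← hLw, hLv]; exact Submodule.mem_span_singleton_self v
    obtain ⟨c, rfl⟩ := Submodule.mem_span_singleton.1 h1
    have hc : c ≠ 0 := fun hc => hv (by rw [hc, zero_smul])
    rw [map_smul, smul_eq_mul, smul_smul, mul_inv, mul_assoc, mul_comm _ c, ← mul_assoc,
      inv_mul_cancel₀ hc, one_mul]
  have hself : ∀ y, V y y ≠ 0 ∧ L y = Submodule.span ℝ {V y y} := fun y => (hVL y).self_of_nhds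
  refine ⟨R, fun y => ?_, fun y => ?_, fun y c => ?_⟩
  · have h1 : ContMDiffAt (𝓡 k) (𝓡 k).tangent ∞ (fun z => mkTan (𝓡 k) z (V y z)) y :=
      (V y).contMDiff y
    have h2 : ContMDiffAt (𝓡 k) 𝓘(ℝ, ℝ) ∞ (fun z => μ.cov z (V y z)) y :=
      (μ.contMDiffAt_mkCot y).cov_apply le_rfl h1
    have h3 := (h2.inv₀ (hV (hself y).1 (hself y).2)).mkTan_smul le_rfl h1
    refine h3.congr_of_eventuallyEq ((hVL y).mono fun z hz => ?_)
    exact congrArg (mkTan (𝓡 k) z) (huniq (hself z).1 (hself z).2 hz.1 hz.2)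
  · exact ((μ.cov y).map_smul _ _).trans (inv_mul_cancel₀ (hV (hself y).1 (hself y).2))
  · have hne := inv_ne_zero (hV (hself y).1 (hself y).2)
    have hmap : ∀ r : ℝ, c (r • (V y y : TangentSpace (𝓡 k) y)) = r * c (V y y) := fun r =>
      c.map_smul r (V y y : TangentSpace (𝓡 k) y)
    constructor
    · intro h
      refine (hmap _).trans (mul_eq_zero_of_right _ (h _ ?_))
      rw [(hself y).2]; exact Submodule.mem_span_singleton_self _
    · intro h v hv
      rw [(hself y).2] at hv
      obtain ⟨r, rfl⟩ := Submodule.mem_span_singleton.1 hv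
      exact (hmap r).trans (mul_eq_zero_of_right _
        ((mul_eq_zero.1 ((hmap _).symm.trans h)).resolve_left hne))

/-- The value of a covector on a section. -/
def fiberPairing (R : Y → ℰ k) (p : CotangentTotal k Y) : ℝ := p.cov (R p.proj)

theorem IsTransverseSection.contMDiffAt_fiberPairing {μ : OneForm k Y} {L : PlaneField k Y}
    {R : Y → ℰ k} (hR : IsTransverseSection μ L R)
    {g : Z → CotangentTotal k Y} {a : Z} (hg : ContMDiffAt J (cotangentModel k) ∞ g a) :
    ContMDiffAt J 𝓘(ℝ, ℝ) ∞ (fun z => fiberPairing R (g z)) a :=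
  ContMDiffAt.cov_apply (y := fun z => (g z).proj) (c := fun z => (g z).cov)
    (v := fun z => R (g z).proj) le_rfl hg
    ((hR.contMDiff _).comp a (contMDiffAt_proj le_rfl hg))

end TransverseSection

/-! ### Smoothness of the inverse of `Θ` -/

namespace StandardNbhd

variable {d k : ℕ}
  {M : Type*} [TopologicalSpace M] [ChartedSpace (ℰ d) M]
  [IsManifold (𝓡 d) ∞ M]
  {Y : Type*} [TopologicalSpace Y] [ChartedSpace (ℰ k) Y]
  [IsManifold (𝓡 k) ∞ Y]
  {α : OneForm d M} {ι : ContMDiffMap (𝓡 k) (𝓡 d) Y M ∞} {L : PlaneField k Y}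
  {R : Y → ℰ k}
  {E' : Type*} [NormedAddCommGroup E'] [NormedSpace ℝ E'] {H' : Type*} [TopologicalSpace H']
  {J : ModelWithCorners ℝ E' H'}
  {Z : Type*} [TopologicalSpace Z] [ChartedSpace H' Z]

theorem contMDiffAt_Θ (𝒩 : StandardNbhd α ι L) {z : M} (hz : z ∈ 𝒩.N) :
    ContMDiffAt (𝓡 d) (cotangentModel k) ∞ 𝒩.Θ z :=
  𝒩.contMDiffOn_Θ.contMDiffAt (𝒩.isOpen_N.mem_nhds hz)

theorem fiberPairing_Θ (𝒩 : StandardNbhd α ι L) (hR : IsTransverseSection (α.pullback ι) L R)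
    {z : M} (hz : z ∈ 𝒩.N) : fiberPairing R (𝒩.Θ z) = 0 := by
  obtain ⟨W, -, hW⟩ := 𝒩.image_Θ
  have h : 𝒩.Θ z ∈ 𝒩.Θ '' 𝒩.N := mem_image_of_mem _ hz
  rw [hW] at h
  exact (hR.annihilator_iff _ _).1 h.2

theorem eventually_mem_image_Θ (𝒩 : StandardNbhd α ι L)
    (hR : IsTransverseSection (α.pullback ι) L R) {p₀ : CotangentTotal k Y}
    (hp₀ : p₀ ∈ 𝒩.Θ '' 𝒩.N) : ∀ᶠ p in 𝓝 p₀, fiberPairing R p = 0 → p ∈ 𝒩.Θ '' 𝒩.N := by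
  obtain ⟨W, hWo, hW⟩ := 𝒩.image_Θ
  rw [hW] at hp₀ ⊢
  filter_upwards [hWo.mem_nhds hp₀.1] with p hp hp'
  exact ⟨hp, (hR.annihilator_iff _ _).2 hp'⟩

/-- The inverse of `Θ`. -/
def inv [Nonempty M] (𝒩 : StandardNbhd α ι L) (p : CotangentTotal k Y) : M :=
  Function.invFunOn 𝒩.Θ 𝒩.N p

variable [Nonempty M]

theorem inv_mem (𝒩 : StandardNbhd α ι L) {p : CotangentTotal k Y} (hp : p ∈ 𝒩.Θ '' 𝒩.N) :
    𝒩.inv p ∈ 𝒩.N := Function.invFunOn_mem hp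

theorem Θ_inv (𝒩 : StandardNbhd α ι L) {p : CotangentTotal k Y} (hp : p ∈ 𝒩.Θ '' 𝒩.N) :
    𝒩.Θ (𝒩.inv p) = p := Function.invFunOn_eq hp

theorem inv_Θ (𝒩 : StandardNbhd α ι L) {z : M} (hz : z ∈ 𝒩.N) : 𝒩.inv (𝒩.Θ z) = z :=
  𝒩.injOn_Θ (𝒩.inv_mem (mem_image_of_mem _ hz)) hz (𝒩.Θ_inv (mem_image_of_mem _ hz))

/-- The map `(z, τ) ↦ Θ z + τ λ`. -/
def thicken (𝒩 : StandardNbhd α ι L) (q : M × ℝ) : CotangentTotal k Y :=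
  mkCot (𝒩.Θ q.1).proj ((𝒩.Θ q.1).cov + q.2 • (α.pullback ι).cov (𝒩.Θ q.1).proj)

theorem contMDiffAt_thicken (𝒩 : StandardNbhd α ι L) {q : M × ℝ} (hq : q.1 ∈ 𝒩.N) :
    ContMDiffAt ((𝓡 d).prod 𝓘(ℝ, ℝ)) (cotangentModel k) ∞ 𝒩.thicken q := by
  have h1 : ContMDiffAt ((𝓡 d).prod 𝓘(ℝ, ℝ)) (cotangentModel k) ∞ (fun q : M × ℝ => 𝒩.Θ q.1) q :=
    (𝒩.contMDiffAt_Θ hq).comp q contMDiffAt_fst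
  refine ContMDiffAt.mkCot_add (y := fun q : M × ℝ => (𝒩.Θ q.1).proj)
    (c := fun q : M × ℝ => (𝒩.Θ q.1).cov) le_rfl h1 ?_
  exact ContMDiffAt.mkCot_smul (y := fun q : M × ℝ => (𝒩.Θ q.1).proj) le_rfl contMDiffAt_snd
    (((α.pullback ι).contMDiffAt_mkCot _).comp q (contMDiffAt_proj le_rfl h1))

theorem fiberPairing_thicken (𝒩 : StandardNbhd α ι L)
    (hR : IsTransverseSection (α.pullback ι) L R) {q : M × ℝ} (hq : q.1 ∈ 𝒩.N) :
    fiberPairing R (𝒩.thicken q) = q.2 := by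
  have h1 : (𝒩.Θ q.1).cov (R (𝒩.Θ q.1).proj) = 0 := 𝒩.fiberPairing_Θ hR hq
  change ((𝒩.Θ q.1).cov + q.2 • (α.pullback ι).cov (𝒩.Θ q.1).proj) (R (𝒩.Θ q.1).proj) = q.2
  rw [add_apply, smul_apply, h1, hR.apply_eq_one, smul_eq_mul, mul_one, zero_add]

/-- `Θ` maps onto an open part of the annihilator of `L`, which has codimension one in `T*Y`;
multiples of `λ` supply the missing dimension and make the inverse function theorem available. The
parameter `τ` is recovered by pairing with `R`, and at `τ = 0` the map is the immersion `Θ`. -/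
theorem bijective_mD_thicken (𝒩 : StandardNbhd α ι L)
    (hR : IsTransverseSection (α.pullback ι) L R) (hdk : d + 1 = k + k) {z : M} (hz : z ∈ 𝒩.N) :
    Function.Bijective (mD ((𝓡 d).prod 𝓘(ℝ, ℝ)) (cotangentModel k) 𝒩.thicken (z, 0)) := by
  have hinj : Function.Injective
      (mD ((𝓡 d).prod 𝓘(ℝ, ℝ)) (cotangentModel k) 𝒩.thicken (z, 0)) := by
    rw [injective_iff_map_eq_zero]
    rintro ⟨v, a⟩ hva
    have hT := (𝒩.contMDiffAt_thicken (q := (z, 0)) hz).mdiff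
    have h1 := mD_comp (g := fiberPairing R) (I'' := 𝓘(ℝ, ℝ))
      ((hR.contMDiffAt_fiberPairing (g := fun p => p) (J := cotangentModel k)
        contMDiffAt_id).mdiff) hT rfl
    have h2 : (fun q => fiberPairing R (𝒩.thicken q)) =ᶠ[𝓝 (z, (0 : ℝ))] fun q => q.2 := by
      have : ∀ᶠ q : M × ℝ in 𝓝 (z, 0), q.1 ∈ 𝒩.N :=
        continuous_fst.continuousAt.eventually (𝒩.isOpen_N.mem_nhds hz)
      exact this.mono fun q hq => 𝒩.fiberPairing_thicken hR hq
    rw [mD_congr h2] at h1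
    have h3 : mD ((𝓡 d).prod 𝓘(ℝ, ℝ)) 𝓘(ℝ, ℝ) (fun q : M × ℝ => q.2) (z, 0) (v, a) = a :=
      DFunLike.congr_fun (mfderiv_snd (I := 𝓡 d) (I' := 𝓘(ℝ, ℝ)) (x := (z, (0 : ℝ)))) (v, a)
    rw [h1, ContinuousLinearMap.comp_apply, hva, map_zero] at h3
    subst h3
    have h4 := mD_comp (f := fun z : M => (z, (0 : ℝ))) (I := 𝓡 d) (x := z) hT
      (mdifferentiableAt_id.prodMk mdifferentiableAt_const) rfl
    have h5 : (fun z : M => 𝒩.thicken (z, 0)) = 𝒩.Θ := by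
      funext z
      refine ((mkCot_eq_iff (p := 𝒩.Θ z)).2 ⟨rfl, ?_⟩).symm
      simp
    have h6 : mD (𝓡 d) ((𝓡 d).prod 𝓘(ℝ, ℝ)) (fun z : M => (z, (0 : ℝ))) z v = (v, 0) := by
      exact DFunLike.congr_fun (mfderiv_prod_left (I := 𝓡 d) (I' := 𝓘(ℝ, ℝ)) (x₀ := z)
        (y₀ := (0 : ℝ))) v
    rw [h5] at h4
    have h7 : mD (𝓡 d) (cotangentModel k) 𝒩.Θ z v = 0 := by
      rw [h4, ContinuousLinearMap.comp_apply, h6]; exact hva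
    have h8 : v = 0 := (injective_iff_map_eq_zero _).1 (𝒩.immersion_Θ z hz) v h7
    rw [h8]; rfl
  refine ⟨hinj, ?_⟩
  have hdim : Module.finrank ℝ (ℰ d × ℝ) =
      Module.finrank ℝ (ℰ k × ℰ* k) := by
    rw [Module.finrank_prod, Module.finrank_prod, finrank_clm_real, finrank_euclideanSpace_fin,
      finrank_euclideanSpace_fin, Module.finrank_self, hdk]
  exact (LinearMap.injective_iff_surjective_of_finrank_eq_finrank hdim
    (f := (mD ((𝓡 d).prod 𝓘(ℝ, ℝ)) (cotangentModel k) 𝒩.thicken (z, 0)).toLinearMap)).1 hinj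

/-- The inverse of `Θ` extends locally to a smooth map on the cotangent bundle. -/
theorem exists_smooth_inverse (𝒩 : StandardNbhd α ι L)
    (hR : IsTransverseSection (α.pullback ι) L R) (hdk : d + 1 = k + k)
    {p₀ : CotangentTotal k Y} (hp₀ : p₀ ∈ 𝒩.Θ '' 𝒩.N) :
    ∃ Γ : CotangentTotal k Y → M, (∀ᶠ p in 𝓝 p₀, ContMDiffAt (cotangentModel k) (𝓡 d) ∞ Γ p) ∧
      ∀ᶠ p in 𝓝 p₀, fiberPairing R p = 0 → Γ p = 𝒩.inv p := by
  obtain ⟨z, hz, rfl⟩ := hp₀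
  have hT : 𝒩.thicken (z, 0) = 𝒩.Θ z := by
    refine ((mkCot_eq_iff (p := 𝒩.Θ z)).2 ⟨rfl, ?_⟩).symm
    simp
  obtain ⟨g, hg0, -, hg⟩ := exists_local_inverse (I := (𝓡 d).prod 𝓘(ℝ, ℝ)) (I' := cotangentModel k)
    (f := 𝒩.thicken) (x := (z, (0 : ℝ)))
    ((continuous_fst.continuousAt.eventually (𝒩.isOpen_N.mem_nhds hz)).mono
      fun q hq => 𝒩.contMDiffAt_thicken hq) (𝒩.bijective_mD_thicken hR hdk hz)
  rw [hT] at hg hg0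
  refine ⟨fun p => (g p).1, hg.mono fun p hp => contMDiffAt_fst.comp p hp.2, ?_⟩
  have hN : ∀ᶠ p in 𝓝 (𝒩.Θ z), (g p).1 ∈ 𝒩.N := by
    have hc : ContinuousAt (fun p => (g p).1) (𝒩.Θ z) :=
      continuous_fst.continuousAt.comp hg.self_of_nhds.2.continuousAt
    refine hc.eventually (p := fun w => w ∈ 𝒩.N) ?_
    beta_reduce
    rw [hg0]
    exact 𝒩.isOpen_N.mem_nhds hz
  filter_upwards [hg, hN] with p hp hpN h0
  have h1 := 𝒩.fiberPairing_thicken hR hpN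
  rw [hp.1, h0] at h1
  have h2 : 𝒩.Θ (g p).1 = p := by
    rw [← hp.1]
    refine (mkCot_eq_iff.2 ⟨?_, ?_⟩)
    · simp [hp.1]
    · rw [hp.1, ← h1]; simp
  conv_rhs => rw [← h2, 𝒩.inv_Θ hpN]

/-- The inverse of `Θ` is controlled only on the annihilator of `R`, so its smoothness is expressed
through maps whose values lie there. -/
theorem contMDiffAt_inv_comp (𝒩 : StandardNbhd α ι L)
    (hR : IsTransverseSection (α.pullback ι) L R) (hdk : d + 1 = k + k)
    {g : Z → CotangentTotal k Y} {a : Z} (hg : ContMDiffAt J (cotangentModel k) ∞ g a)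
    (h0 : g a ∈ 𝒩.Θ '' 𝒩.N) (h : ∀ᶠ z in 𝓝 a, fiberPairing R (g z) = 0) :
    ContMDiffAt J (𝓡 d) ∞ (fun z => 𝒩.inv (g z)) a := by
  obtain ⟨Γ, hΓ, hΓ'⟩ := 𝒩.exists_smooth_inverse hR hdk h0
  refine (hΓ.self_of_nhds.comp a hg).congr_of_eventuallyEq ?_
  filter_upwards [h, hg.continuousAt.eventually hΓ'] with z hz hz'
  exact (hz' hz).symm

end StandardNbhd

/-! ### Integrability and coisotropic embeddings -/

section Involutive

variable {d k : ℕ}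
  {X : Type*} [TopologicalSpace X] [ChartedSpace (ℰ d) X]
  [IsManifold (𝓡 d) ∞ X]
  {Y : Type*} [TopologicalSpace Y] [ChartedSpace (ℰ k) Y]
  [IsManifold (𝓡 k) ∞ Y]

theorem OneForm.ext_cov {μ ν : OneForm d X} (h : ∀ x, μ.cov x = ν.cov x) : μ = ν :=
  ContMDiffSection.ext h

theorem OneForm.cov_sub (μ ν : OneForm d X) (x : X) : (μ - ν).cov x = μ.cov x - ν.cov x := rfl

theorem OneForm.cov_pullback (μ : OneForm d X) (f : ContMDiffMap (𝓡 k) (𝓡 d) Y X ∞) (y : Y) :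
    (μ.pullback f).cov y = (μ.cov (f y)).comp (mD (𝓡 k) (𝓡 d) f y) := rfl

theorem OneForm.pb_pullback {V : Type*} [NormedAddCommGroup V] [NormedSpace ℝ V] (μ : OneForm d X)
    (f : ContMDiffMap (𝓡 k) (𝓡 d) Y X ∞) {g : V → Y} {e : V}
    (hg : MDifferentiableAt 𝓘(ℝ, V) (𝓡 k) g e) :
    pb (μ.pullback f) g e = pb μ (fun e => f (g e)) e := by
  have := mD_comp ((f.contMDiff (g e)).mdiff) hg rfl
  simp only [pb]
  rw [this]
  rfl

/-- The exterior derivative is natural. -/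
theorem OneForm.extL_pullback (μ : OneForm d X) (f : ContMDiffMap (𝓡 k) (𝓡 d) Y X ∞) (y : Y)
    (v w : ℰ k) : (μ.pullback f).extL y v w =
      μ.extL (f y) (mD (𝓡 k) (𝓡 d) f y v) (mD (𝓡 k) (𝓡 d) f y w) := by
  have hy := mem_chart_source (ℰ k) y
  set g := (extChartAt (𝓡 k) y).symm
  set e := extChartAt (𝓡 k) y y
  have hge : g e = y := extChartAt_symm_apply_self hy
  have hg : ContMDiffAt 𝓘(ℝ, ℰ k) (𝓡 k) ∞ g e := contMDiffAt_extChartAt_symm hy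
  have hgD : mD 𝓘(ℝ, ℰ k) (𝓡 k) g e = ContinuousLinearMap.id ℝ _ :=
    chartDInv_self (I := 𝓡 k) y
  have hf := f.contMDiff y
  have hD := mD_comp (f := g) (hf.mdiff) (hg.mdiff) hge
  rw [hgD, ContinuousLinearMap.comp_id] at hD
  have h1 := dext_pb_extL (μ.pullback f) hg v w
  rw [hgD, hge] at h1
  have h2 := dext_pb_extL μ (g := fun e => f (g e)) (e := e)
    ((by rw [hge]; exact hf : ContMDiffAt (𝓡 k) (𝓡 d) ∞ f (g e)).comp e hg) v w
  rw [hD] at h2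
  simp only [hge] at h2
  refine (h1.symm.trans (dext_congr ?_ v w)).trans h2
  filter_upwards [contMDiffAt_eventually_top hg] with e' he'
  exact μ.pb_pullback f he'

/-- `dμ` vanishes on `ker μ`. -/
def OneForm.Involutive (μ : OneForm d X) : Prop :=
  ∀ x v w, μ.cov x v = 0 → μ.cov x w = 0 → μ.extL x v w = 0

/-- This is `dext_conformal` read in the chart at `x`. It makes integrability, and orthogonality
within the planes, properties of the plane field alone. -/
theorem OneForm.extL_conformal {μ μ' : OneForm d X} {x : X} (hne : μ.cov x ≠ 0)
    (hker : ∀ᶠ z in 𝓝 x, ∀ v, μ.cov z v = 0 → μ'.cov z v = 0) :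
    ∃ c : ℝ, μ'.cov x = c • μ.cov x ∧ ∀ v w, μ.cov x v = 0 → μ.cov x w = 0 →
      μ'.extL x v w = c * μ.extL x v w := by
  have hx := mem_chart_source (ℰ d) x
  set g := (extChartAt (𝓡 d) x).symm with hgdef
  set e := extChartAt (𝓡 d) x x
  have hge : g e = x := extChartAt_symm_apply_self hx
  have hg : ContMDiffAt 𝓘(ℝ, ℰ d) (𝓡 d) ∞ g e := contMDiffAt_extChartAt_symm hx
  have hgD : mD 𝓘(ℝ, ℰ d) (𝓡 d) g e = ContinuousLinearMap.id ℝ _ :=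
    chartDInv_self (I := 𝓡 d) x
  have hpb : ∀ ν : OneForm d X, pb ν g e = ν.cov x := by
    intro ν
    simp only [pb, hgD, ContinuousLinearMap.comp_id, hge]
  have hd : ∀ (ν : OneForm d X) v w, dext (pb ν g) e v w = ν.extL x v w := by
    intro ν v w
    have := dext_pb_extL ν hg v w
    rwa [hgD, hge] at this
  have hdiff : ∀ ν : OneForm d X, DifferentiableAt ℝ (pb ν g) e := fun ν =>
    (contDiffAt_pb ν hg).differentiableAt (by simp)
  have hc : Filter.Tendsto g (𝓝 e) (𝓝 x) := by
    have := hg.continuousAt; rwa [ContinuousAt, hge] at this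
  obtain ⟨c, h1, h2⟩ := dext_conformal (hdiff μ) (hdiff μ') (by rw [hpb]; exact hne)
    ((hc.eventually hker).mono fun e' he' v hv => he' _ hv)
  refine ⟨c, by rw [← hpb, ← hpb, h1], fun v w hv hw => ?_⟩
  rw [← hd, ← hd]
  exact h2 v w (by rw [hpb]; exact hv) (by rw [hpb]; exact hw)

theorem OneForm.Involutive.congr {μ μ' : OneForm d X} (h : μ.Involutive)
    (hne : ∀ x, μ.cov x ≠ 0) (hker : ∀ x v, μ'.cov x v = 0 ↔ μ.cov x v = 0) :
    μ'.Involutive := by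
  intro x v w hv hw
  obtain ⟨c, -, h2⟩ := OneForm.extL_conformal (hne x)
    (Filter.Eventually.of_forall fun z v => (hker z v).2)
  rw [h2 v w ((hker x v).1 hv) ((hker x w).1 hw), h x v w ((hker x v).1 hv) ((hker x w).1 hw),
    mul_zero]

/-- The local forms in the definition of a foliation have the kernel of `ν`, so `ν` is a multiple of
them and can itself be used to test integrability. -/
theorem isFoliation_kerField_iff {ν : OneForm d X} (hν : ∀ x, ν.cov x ≠ 0) :
    IsFoliation ν.kerField ↔ ν.Involutive := by
  constructor
  · intro h x v w hv hw
    obtain ⟨μ, hμ⟩ := h x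
    have hx := hμ.self_of_nhds
    have hker : ∀ {z v}, ν.kerField z = μ.kerField z → (μ.cov z v = 0 ↔ ν.cov z v = 0) := by
      intro z v hz
      have : v ∈ ν.kerField z ↔ v ∈ μ.kerField z := by rw [hz]
      exact this.symm
    obtain ⟨c, -, h2⟩ := OneForm.extL_conformal (μ := μ) (μ' := ν) (x := x) hx.1
      (hμ.mono fun z hz v => (hker hz.2.1).1)
    have hv' := (hker hx.2.1).2 hv
    have hw' := (hker hx.2.1).2 hw
    rw [h2 v w hv' hw']
    exact mul_eq_zero_of_right c (hx.2.2 v hv' w hw')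
  · intro h x
    exact ⟨ν, Filter.Eventually.of_forall fun z => ⟨hν z, rfl, fun v hv w hw => h z v w hv hw⟩⟩

/-- As `d` commutes with the pullback, integrability of the pulled back form says that the tangent
spaces meet `ξ` in isotropic subspaces. A nonzero pullback means transversality to `ξ`, so these
have half the dimension of `ξ` and isotropic is the same as coisotropic. -/
theorem isCoisotropicEmbedding_iff_involutive {n : ℕ} (hd : d = 2 * n + 1) (hk : k = n + 1)
    {α : OneForm d X} (hα : IsContactForm α) {j : ContMDiffMap (𝓡 k) (𝓡 d) Y X ∞}
    (hj : Manifold.IsSmoothEmbedding (𝓡 k) (𝓡 d) ∞ j) (hne : ∀ y, (α.pullback j).cov y ≠ 0) :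
    IsCoisotropicEmbedding α j ↔ (α.pullback j).Involutive := by
  have key : ∀ y, _ ↔ _ := fun y => (hα.isContactAt (j y)).coisotropic_iff_isotropic (n := n)
    (by rw [finrank_euclideanSpace_fin, hd]) (by rw [finrank_euclideanSpace_fin, hk])
    (α.extL_self (j y)) (hj.isImmersion.injective_mD y) (hne y)
  constructor
  · intro h y v w hv hw
    rw [OneForm.extL_pullback]
    exact (key y).1 (fun u hu hu' => h.2 y u hu hu') v w hv hw
  · intro h
    refine ⟨hj, fun y => (key y).2 fun u u' hu hu' => ?_⟩
    have := h y u u' hu hu'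
    rwa [OneForm.extL_pullback] at this

/-- Being coisotropic only depends on the image. -/
theorem IsCoisotropicEmbedding.of_comp {α : OneForm d X} {j j' : ContMDiffMap (𝓡 k) (𝓡 d) Y X ∞}
    (h : IsCoisotropicEmbedding α j') (hj : Manifold.IsSmoothEmbedding (𝓡 k) (𝓡 d) ∞ j)
    {ψ : Y → Y} (hψ : Function.Surjective ψ) (hc : ∀ y, j' y = j (ψ y))
    (hψd : MDifferentiable (𝓡 k) (𝓡 k) ψ) :
    IsCoisotropicEmbedding α j := by
  refine ⟨hj, fun y => ?_⟩
  obtain ⟨y, rfl⟩ := hψ y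
  have hD : mD (𝓡 k) (𝓡 d) j' y = (mD (𝓡 k) (𝓡 d) j (ψ y)).comp (mD (𝓡 k) (𝓡 k) ψ y) := by
    rw [← mD_comp ((j.contMDiff _).mdiff) (hψd y) rfl]
    exact mD_congr (Filter.Eventually.of_forall hc)
  have hinj : Function.Injective (mD (𝓡 k) (𝓡 k) ψ y) := by
    have := h.1.isImmersion.injective_mD y
    rw [hD] at this
    exact Function.Injective.of_comp this
  have hsurj : Function.Surjective (mD (𝓡 k) (𝓡 k) ψ y) :=
    LinearMap.surjective_of_injective (f := (mD (𝓡 k) (𝓡 k) ψ y).toLinearMap) hinj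
  have h2 : ∀ v, α.cov (j' y) v = 0 →
      (∀ u, α.cov (j' y) (mD (𝓡 k) (𝓡 d) j' y u) = 0 →
        α.extL (j' y) v (mD (𝓡 k) (𝓡 d) j' y u) = 0) → ∃ u, mD (𝓡 k) (𝓡 d) j' y u = v := h.2 y
  rw [hc y, hD] at h2
  intro v hv hv'
  obtain ⟨u, hu⟩ := h2 v hv fun u hu => hv' _ hu
  exact ⟨mD (𝓡 k) (𝓡 k) ψ y u, hu⟩

end Involutive

/-! ### Graphs of sections and the bijection with foliations -/

namespace StandardNbhd

variable {n d k : ℕ}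
  {M : Type*} [TopologicalSpace M] [T2Space M] [ChartedSpace (ℰ d) M]
  [IsManifold (𝓡 d) ∞ M]
  {Y : Type*} [TopologicalSpace Y] [CompactSpace Y] [ChartedSpace (ℰ k) Y]
  [IsManifold (𝓡 k) ∞ Y] [Nonempty M]
  {α : OneForm d M} {ι : ContMDiffMap (𝓡 k) (𝓡 d) Y M ∞} {L : PlaneField k Y}
  {R : Y → ℰ k} {𝒩 : StandardNbhd α ι L}

/-- The projection of the standard neighbourhood to `Y`. -/
def proj (𝒩 : StandardNbhd α ι L) (z : M) : Y := (𝒩.Θ z).proj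

theorem contMDiffAt_projN (𝒩 : StandardNbhd α ι L) {z : M} (hz : z ∈ 𝒩.N) :
    ContMDiffAt (𝓡 d) (𝓡 k) ∞ 𝒩.proj z := contMDiffAt_proj le_rfl (𝒩.contMDiffAt_Θ hz)

/-- The contact condition in the standard neighbourhood. -/
theorem cov_eq_zero_iff (𝒩 : StandardNbhd α ι L) {z : M} (hz : z ∈ 𝒩.N)
    (v : ℰ d) : α.cov z v = 0 ↔
      ((α.pullback ι).cov (𝒩.proj z) - (𝒩.Θ z).cov) (mD (𝓡 d) (𝓡 k) 𝒩.proj z v) = 0 :=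
  𝒩.contact_Θ z hz v

theorem isSection_iff (hR : IsTransverseSection (α.pullback ι) L R) {s : OneForm k Y} :
    𝒩.IsSection s ↔ (∀ y, s.cov y (R y) = 0) ∧ ∀ y, s.toMap y ∈ 𝒩.Θ '' 𝒩.N :=
  and_congr_left' (forall_congr' fun y => hR.annihilator_iff y (s.cov y))

/-- The embedding with image the graph of `s`. -/
def embed (𝒩 : StandardNbhd α ι L) (s : OneForm k Y) (y : Y) : M := 𝒩.inv (s.toMap y)

theorem IsSection.embed_mem {s : OneForm k Y} (hs : 𝒩.IsSection s) (y : Y) : 𝒩.embed s y ∈ 𝒩.N :=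
  𝒩.inv_mem (hs.2 y)

theorem IsSection.Θ_embed {s : OneForm k Y} (hs : 𝒩.IsSection s) (y : Y) :
    𝒩.Θ (𝒩.embed s y) = s.toMap y := 𝒩.Θ_inv (hs.2 y)

theorem IsSection.proj_embed {s : OneForm k Y} (hs : 𝒩.IsSection s) (y : Y) :
    𝒩.proj (𝒩.embed s y) = y := congrArg (·.proj) (hs.Θ_embed y)

theorem IsSection.cov_Θ_embed {s : OneForm k Y} (hs : 𝒩.IsSection s) (y : Y) :
    (𝒩.Θ (𝒩.embed s y)).cov = s.cov y := congrArg CotangentTotal.cov (hs.Θ_embed y)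

theorem IsSection.contMDiff_embed (hR : IsTransverseSection (α.pullback ι) L R)
    (hdk : d + 1 = k + k) {s : OneForm k Y} (hs : 𝒩.IsSection s) :
    ContMDiff (𝓡 k) (𝓡 d) ∞ (𝒩.embed s) := fun y =>
  𝒩.contMDiffAt_inv_comp hR hdk (s.toMap.contMDiff y) (hs.2 y)
    (Filter.Eventually.of_forall fun z => ((isSection_iff hR).1 hs).1 z)

/-- The embedding with image the graph of `s`, as a smooth map. -/
def embedC (hR : IsTransverseSection (α.pullback ι) L R)
    (hdk : d + 1 = k + k) {s : OneForm k Y} (hs : 𝒩.IsSection s) :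
    ContMDiffMap (𝓡 k) (𝓡 d) Y M ∞ := ⟨𝒩.embed s, hs.contMDiff_embed hR hdk⟩

theorem IsSection.range_embed {s : OneForm k Y} (hs : 𝒩.IsSection s) :
    range (𝒩.embed s) = 𝒩.graph s := by
  ext z
  constructor
  · rintro ⟨y, rfl⟩
    exact ⟨hs.embed_mem y, y, (hs.Θ_embed y).symm⟩
  · rintro ⟨hz, y, hy⟩
    refine ⟨y, ?_⟩
    rw [embed, hy, 𝒩.inv_Θ hz]

theorem IsSection.mem_graph_iff {s : OneForm k Y} (hs : 𝒩.IsSection s) {z : M} :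
    z ∈ 𝒩.graph s ↔ z ∈ 𝒩.N ∧ 𝒩.embed s (𝒩.proj z) = z := by
  rw [← hs.range_embed]
  constructor
  · rintro ⟨y, rfl⟩
    exact ⟨hs.embed_mem y, by rw [hs.proj_embed]⟩
  · rintro ⟨-, h⟩
    exact ⟨_, h⟩

theorem IsSection.mD_proj_embed (hR : IsTransverseSection (α.pullback ι) L R)
    (hdk : d + 1 = k + k) {s : OneForm k Y} (hs : 𝒩.IsSection s) (y : Y)
    (v : ℰ k) :
    mD (𝓡 d) (𝓡 k) 𝒩.proj (𝒩.embed s y) (mD (𝓡 k) (𝓡 d) (𝒩.embed s) y v) = v := by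
  have h := mD_comp ((𝒩.contMDiffAt_projN (hs.embed_mem y)).mdiff)
    ((hs.contMDiff_embed hR hdk y).mdiff) rfl
  rw [mD_congr (Filter.Eventually.of_forall hs.proj_embed), mD_id] at h
  exact (DFunLike.congr_fun h v).symm

theorem IsSection.isSmoothEmbedding (hR : IsTransverseSection (α.pullback ι) L R)
    (hdk : d + 1 = k + k) {s : OneForm k Y} (hs : 𝒩.IsSection s) :
    Manifold.IsSmoothEmbedding (𝓡 k) (𝓡 d) ∞ (𝒩.embed s) :=
  isSmoothEmbedding_of_injective (hs.contMDiff_embed hR hdk)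
    (Function.LeftInverse.injective hs.proj_embed)
    fun y => Function.LeftInverse.injective (hs.mD_proj_embed hR hdk y)

/-- The differential of the projection is a left inverse of that of the embedding, so the contact
condition at `embed s y` is tested on `v` itself. -/
theorem IsSection.cov_pullback_eq_zero_iff (hR : IsTransverseSection (α.pullback ι) L R)
    (hdk : d + 1 = k + k) {s : OneForm k Y} (hs : 𝒩.IsSection s) (y : Y)
    (v : ℰ k) :
    (α.pullback (embedC hR hdk hs)).cov y v = 0 ↔ (α.pullback ι - s).cov y v = 0 := by
  have := 𝒩.cov_eq_zero_iff (hs.embed_mem y) (mD (𝓡 k) (𝓡 d) (𝒩.embed s) y v)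
  rwa [hs.mD_proj_embed hR hdk, hs.proj_embed, hs.cov_Θ_embed] at this

theorem IsSection.apply_eq_one (hR : IsTransverseSection (α.pullback ι) L R) {s : OneForm k Y}
    (hs : 𝒩.IsSection s) (y : Y) : (α.pullback ι - s).cov y (R y) = 1 := by
  rw [OneForm.cov_sub, sub_apply, hR.apply_eq_one, ((isSection_iff hR).1 hs).1, sub_zero]

theorem IsSection.cov_ne_zero (hR : IsTransverseSection (α.pullback ι) L R) {s : OneForm k Y}
    (hs : 𝒩.IsSection s) (y : Y) : (α.pullback ι - s).cov y ≠ 0 := by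
  intro h
  have := hs.apply_eq_one hR y
  rw [h, zero_apply] at this
  exact zero_ne_one this

/-- The graph of `s` is coisotropic if and only if `ker (λ - s)` is a foliation. -/
theorem IsSection.isCoisotropicEmbedding_iff (hd : d = 2 * n + 1) (hk : k = n + 1)
    (hα : IsContactForm α) (hR : IsTransverseSection (α.pullback ι) L R)
    (hdk : d + 1 = k + k) {s : OneForm k Y} (hs : 𝒩.IsSection s) :
    IsCoisotropicEmbedding α (embedC hR hdk hs) ↔ IsFoliation (α.pullback ι - s).kerField := by
  have hne : ∀ y, (α.pullback (embedC hR hdk hs)).cov y ≠ 0 := by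
    intro y h
    have := (hs.cov_pullback_eq_zero_iff hR hdk y (R y)).1 (by rw [h]; rfl)
    rw [hs.apply_eq_one hR] at this
    exact one_ne_zero this
  rw [isCoisotropicEmbedding_iff_involutive hd hk hα (hs.isSmoothEmbedding hR hdk) hne,
    isFoliation_kerField_iff (hs.cov_ne_zero hR)]
  exact ⟨fun h => h.congr hne fun y v => (hs.cov_pullback_eq_zero_iff hR hdk y v).symm,
    fun h => h.congr (hs.cov_ne_zero hR) fun y v => hs.cov_pullback_eq_zero_iff hR hdk y v⟩

/-- Membership asks for some coisotropic embedding `j` onto the graph. Such a `j` is `embed s` after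
the surjection `proj ∘ j` of `Y`, so the canonical embedding is coisotropic as well. -/
theorem IsSection.graph_mem_coisotropics_iff (hd : d = 2 * n + 1) (hk : k = n + 1)
    (hα : IsContactForm α) (hR : IsTransverseSection (α.pullback ι) L R)
    (hdk : d + 1 = k + k) {s : OneForm k Y} (hs : 𝒩.IsSection s) :
    𝒩.graph s ∈ 𝒩.coisotropics ↔ IsFoliation (α.pullback ι - s).kerField := by
  rw [← hs.isCoisotropicEmbedding_iff hd hk hα hR hdk]
  constructor
  · rintro ⟨-, j, hj, hjs⟩
    have hmem : ∀ y, j y ∈ 𝒩.graph s := fun y => by rw [← hjs]; exact mem_range_self y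
    refine hj.of_comp (ψ := fun y => 𝒩.proj (j y)) (hs.isSmoothEmbedding hR hdk) (fun y => ?_)
      (fun y => ((hs.mem_graph_iff).1 (hmem y)).2.symm)
      (fun y => ((𝒩.contMDiffAt_projN (hmem y).1).comp y (j.contMDiff y)).mdiff)
    have : 𝒩.embed s y ∈ range j := by rw [hjs, ← hs.range_embed]; exact mem_range_self y
    obtain ⟨y', hy'⟩ := this
    exact ⟨y', (congrArg 𝒩.proj hy').trans (hs.proj_embed y)⟩
  · intro h
    exact ⟨⟨s, hs, rfl⟩, _, h, hs.range_embed⟩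

variable (𝒩) in
/-- The sections whose graph is coisotropic. -/
def coisotropicSections : Set (OneForm k Y) :=
  {s | 𝒩.IsSection s ∧ IsFoliation (α.pullback ι - s).kerField}

theorem injOn_graph : InjOn 𝒩.graph 𝒩.coisotropicSections := by
  intro s hs s' hs' h
  refine OneForm.ext_cov fun y => ?_
  have h1 : 𝒩.embed s y ∈ 𝒩.graph s' := by
    rw [← h, ← hs.1.range_embed]; exact mem_range_self y
  have h2 := ((hs'.1.mem_graph_iff).1 h1).2
  rw [hs.1.proj_embed] at h2
  rw [← hs.1.cov_Θ_embed, ← hs'.1.cov_Θ_embed, h2]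

/-- Both `λ - s` and `λ - s'` take the value 1 on `R`, so the kernel determines the form. -/
theorem eq_of_kerField_eq (hR : IsTransverseSection (α.pullback ι) L R) {s s' : OneForm k Y}
    (hs : 𝒩.IsSection s) (hs' : 𝒩.IsSection s')
    (h : ∀ y v, (α.pullback ι - s).cov y v = 0 → (α.pullback ι - s').cov y v = 0) : s = s' := by
  refine OneForm.ext_cov fun y => ?_
  have key : ∀ v, (α.pullback ι - s').cov y v = (α.pullback ι - s).cov y v := by
    intro v
    have h1 := h y (v - ((α.pullback ι - s).cov y v) • R y) (by
      rw [map_sub, map_smul, hs.apply_eq_one hR, smul_eq_mul, mul_one, sub_self])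
    rwa [map_sub, map_smul, hs'.apply_eq_one hR, smul_eq_mul, mul_one, sub_eq_zero] at h1
  ext v
  have := key v
  rw [OneForm.cov_sub, OneForm.cov_sub, sub_apply, sub_apply] at this
  linarith

theorem injOn_kerField (hR : IsTransverseSection (α.pullback ι) L R) :
    InjOn (fun s => (α.pullback ι - s).kerField) 𝒩.coisotropicSections := by
  intro s hs s' hs' h
  refine eq_of_kerField_eq hR hs.1 hs'.1 fun y v hv => ?_
  have : v ∈ (α.pullback ι - s).kerField y := hv
  rw [show (α.pullback ι - s).kerField = _ from h] at this
  exact this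

theorem coisotropics_eq_image (hd : d = 2 * n + 1) (hk : k = n + 1)
    (hα : IsContactForm α) (hR : IsTransverseSection (α.pullback ι) L R)
    (hdk : d + 1 = k + k) : 𝒩.graph '' 𝒩.coisotropicSections = 𝒩.coisotropics := by
  ext S
  constructor
  · rintro ⟨s, hs, rfl⟩
    exact (hs.1.graph_mem_coisotropics_iff hd hk hα hR hdk).2 hs.2
  · rintro ⟨⟨s, hs, rfl⟩, h⟩
    exact ⟨s, ⟨hs, (hs.graph_mem_coisotropics_iff hd hk hα hR hdk).1 ⟨⟨s, hs, rfl⟩, h⟩⟩, rfl⟩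

theorem foliations_eq_image :
    (fun s => (α.pullback ι - s).kerField) '' 𝒩.coisotropicSections = 𝒩.foliations := by
  ext G
  constructor
  · rintro ⟨s, hs, rfl⟩
    exact ⟨hs.2, s, hs.1, rfl⟩
  · rintro ⟨h, s, hs, rfl⟩
    exact ⟨s, ⟨hs, h⟩, rfl⟩

/-- The bijection between coisotropic graphs and foliations. -/
theorem exists_equiv (hd : d = 2 * n + 1) (hk : k = n + 1)
    (hα : IsContactForm α) (hR : IsTransverseSection (α.pullback ι) L R)
    (hdk : d + 1 = k + k) : ∃ e : 𝒩.coisotropics ≃ 𝒩.foliations,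
      ∀ (S : 𝒩.coisotropics) (s : OneForm k Y), 𝒩.IsSection s → S.1 = 𝒩.graph s →
          (e S).1 = (α.pullback ι - s).kerField := by
  have h1 := (injOn_graph (𝒩 := 𝒩)).bijOn_image
  have h2 := (injOn_kerField (𝒩 := 𝒩) hR).bijOn_image
  rw [coisotropics_eq_image hd hk hα hR hdk] at h1
  rw [foliations_eq_image] at h2
  refine ⟨(h1.equiv _).symm.trans (h2.equiv _), ?_⟩
  rintro ⟨S, hS⟩ s hs rfl
  have hs' : s ∈ 𝒩.coisotropicSections :=
    ⟨hs, (hs.graph_mem_coisotropics_iff hd hk hα hR hdk).1 hS⟩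
  have : (h1.equiv _).symm ⟨𝒩.graph s, hS⟩ = ⟨s, hs'⟩ := by
    rw [Equiv.symm_apply_eq]; rfl
  rw [Equiv.trans_apply, this]; rfl

end StandardNbhd

/-! ### Convergence of one-forms -/

section CotangentConvergence

variable {d : ℕ} {X : Type*} [TopologicalSpace X] [ChartedSpace (ℰ d) X]
  [IsManifold (𝓡 d) ∞ X] {κ : Type*} {l : Filter κ}

theorem cotCoord_self (p : CotangentTotal d X) : cotCoord p.proj p = p.cov := by
  rw [cotCoord, chartDInv_self, ContinuousLinearMap.comp_id]

theorem tendsto_cotangent_iff {g : κ → CotangentTotal d X} {q : CotangentTotal d X} :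
    Filter.Tendsto g l (𝓝 q) ↔ Filter.Tendsto (fun z => (g z).proj) l (𝓝 q.proj) ∧
      Filter.Tendsto (fun z => cotCoord q.proj (g z)) l (𝓝 q.cov) := by
  have hq := mem_chart_source (ℰ d) q.proj
  rw [(trivializationAt ℰ* d (CotangentFiber d X)
    q.proj).tendsto_nhds_iff (FiberBundle.mem_trivializationAt_proj_source)]
  refine and_congr_right fun h => ?_
  have h1 : ∀ p : CotangentTotal d X, p.proj ∈ (chartAt (ℰ d) q.proj).source →
      (trivializationAt ℰ* d (CotangentFiber d X) q.proj p).2 =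
        cotCoord q.proj p := fun p hp => inCoordinates_cotangent hp
  rw [h1 q hq, cotCoord_self]
  refine Filter.tendsto_congr' ?_
  filter_upwards [h.eventually (chart_source_nhds hq)] with z hz
  exact h1 _ hz

/-- The one-form with a given graph. -/
def OneForm.ofMap (g : X → CotangentTotal d X) (hg : ContMDiff (𝓡 d) (cotangentModel d) ∞ g)
    (hp : ∀ x, (g x).proj = x) : OneForm d X :=
  ⟨fun x => (g x).cov, by
    have : g = fun x => (mkCot x (g x).cov) := funext fun x => mkCot_eq_iff.2 ⟨hp x, rfl⟩
    rw [this] at hg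
    exact hg⟩

theorem OneForm.toMap_ofMap {g : X → CotangentTotal d X}
    (hg : ContMDiff (𝓡 d) (cotangentModel d) ∞ g) (hp : ∀ x, (g x).proj = x) (x : X) :
    (OneForm.ofMap g hg hp).toMap x = g x :=
  (mkCot_eq_iff.2 ⟨hp x, rfl⟩).symm

theorem OneForm.tendsto_c1Nhds_iff {ν : κ → OneForm d X} {μ : OneForm d X} :
    Filter.Tendsto ν l μ.c1Nhds ↔
      ∀ x, C1TendstoAt (𝓡 d) (cotangentModel d) l (fun i => (ν i).toMap) μ.toMap x := by
  rw [OneForm.c1Nhds, Filter.tendsto_comap_iff, _root_.tendsto_c1Nhds_iff]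
  rfl

/-- Pulling back by diffeomorphisms close to the identity changes one-forms little. -/
theorem tendsto_pullback_toMap {ν : κ → OneForm d X} {μ : OneForm d X}
    {f : κ → ContMDiffMap (𝓡 d) (𝓡 d) X X ∞} {x : X}
    (hν : Filter.Tendsto (fun p : κ × X => (ν p.1).toMap p.2) (l ×ˢ 𝓝 x) (𝓝 (μ.toMap x)))
    (hf : C1TendstoAt (𝓡 d) (𝓡 d) l (fun i => f i) (fun x => x) x) :
    Filter.Tendsto (fun p : κ × X => ((ν p.1).pullback (f p.1)).toMap p.2) (l ×ˢ 𝓝 x)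
      (𝓝 (μ.toMap x)) := by
  refine tendsto_cotangent_iff.2 ⟨Filter.tendsto_snd, ?_⟩
  have hu : Filter.Tendsto (fun p : κ × X => (p.1, f p.1 p.2)) (l ×ˢ 𝓝 x) (l ×ˢ 𝓝 x) :=
    Filter.tendsto_fst.prodMk hf.tendsto
  have h1 := (tendsto_cotangent_iff.1 (hν.comp hu)).2
  have h2 := hf.deriv
  have hx := mem_chart_source (ℰ d) x
  have hid : mD (𝓡 d) (𝓡 d) (fun z : X => z) x = ContinuousLinearMap.id ℝ _ := mD_id x
  rw [hid] at h2
  have h3 := ((continuous_fst.clm_comp continuous_snd).tendsto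
    ((μ.toMap x).cov, ContinuousLinearMap.id ℝ (ℰ d))).comp
    (h1.prodMk_nhds h2)
  simp only [ContinuousLinearMap.comp_id] at h3
  refine h3.congr' ?_
  filter_upwards [hf.tendsto.eventually (chart_source_nhds hx)] with p hp
  have h4 := chartDInv_comp_chartD (I := 𝓡 d) hp
  change (((ν p.1).cov (f p.1 p.2)).comp (chartDInv (𝓡 d) x (f p.1 p.2))).comp
      (((chartD (𝓡 d) x (f p.1 p.2)).comp (mD (𝓡 d) (𝓡 d) (f p.1) p.2)).comp
        (chartDInv (𝓡 d) x p.2)) =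
    (((ν p.1).cov (f p.1 p.2)).comp (mD (𝓡 d) (𝓡 d) (f p.1) p.2)).comp (chartDInv (𝓡 d) x p.2)
  ext v
  simp only [ContinuousLinearMap.comp_apply, chartDInv_chartD_apply hp]

end CotangentConvergence

/-! ### Diffeomorphisms acting on plane fields and coisotropic submanifolds -/

section Carries

variable {d k : ℕ}
  {X : Type*} [TopologicalSpace X] [ChartedSpace (ℰ d) X]
  [IsManifold (𝓡 d) ∞ X]
  {Y : Type*} [TopologicalSpace Y] [ChartedSpace (ℰ k) Y]
  [IsManifold (𝓡 k) ∞ Y]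

theorem Diffeomorph.mD_symm_apply {E : Type*} [NormedAddCommGroup E] [NormedSpace ℝ E]
    [FiniteDimensional ℝ E]
    {H : Type*} [TopologicalSpace H]
    {I : ModelWithCorners ℝ E H} [I.Boundaryless]
    {X : Type*} [TopologicalSpace X] [ChartedSpace H X] [IsManifold I ∞ X]
    (f : Diffeomorph I I X X ∞) (x : X) (v : E) : mD I I f.symm (f x) (mD I I f x v) = v := by
  have h := mD_comp (f := f) (x := x) (f.symm.contMDiff.mdifferentiable (by simp) (f x))
    (f.contMDiff.mdifferentiable (by simp) x) rfl
  rw [mD_congr (Filter.Eventually.of_forall f.symm_apply_apply), mD_id] at h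
  exact (DFunLike.congr_fun h v).symm

theorem Diffeomorph.mD_apply_symm {E : Type*} [NormedAddCommGroup E] [NormedSpace ℝ E]
    [FiniteDimensional ℝ E]
    {H : Type*} [TopologicalSpace H]
    {I : ModelWithCorners ℝ E H} [I.Boundaryless]
    {X : Type*} [TopologicalSpace X] [ChartedSpace H X] [IsManifold I ∞ X]
    (f : Diffeomorph I I X X ∞) (x : X) (v : E) : mD I I f x (mD I I f.symm (f x) v) = v := by
  have h := f.symm.mD_symm_apply (f x) v
  rw [f.symm_apply_apply] at h
  exact h

theorem carriesTo_iff {f : Diffeomorph (𝓡 d) (𝓡 d) X X ∞} {G G' : PlaneField d X} :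
    CarriesTo f G G' ↔ ∀ x (v : ℰ d),
      (mD (𝓡 d) (𝓡 d) f x v ∈ G' (f x)) ↔ (v ∈ G x) := by
  have hmem : ∀ x (G : Submodule ℝ (ℰ d)) v,
      mD (𝓡 d) (𝓡 d) f x v ∈ G.map (mD (𝓡 d) (𝓡 d) f x).toLinearMap ↔ v ∈ G := by
    intro x G v
    refine ⟨?_, fun h => ⟨v, h, rfl⟩⟩
    rintro ⟨w, hw, hwv⟩
    rwa [← Function.LeftInverse.injective (f.mD_symm_apply x) hwv]
  have key : ∀ x (G : Submodule ℝ (ℰ d))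
      (G' : Submodule ℝ (ℰ d)),
      G' = G.map (mD (𝓡 d) (𝓡 d) f x).toLinearMap ↔ ∀ v, mD (𝓡 d) (𝓡 d) f x v ∈ G' ↔ v ∈ G := by
    intro x G G'
    constructor
    · rintro rfl v
      exact hmem x G v
    · intro h
      ext w
      rw [← f.mD_apply_symm x w, h]
      exact (hmem x G _).symm
  exact forall_congr' fun x => key x (G x) (G' (f x))

theorem carriesTo_kerField_iff {f : Diffeomorph (𝓡 d) (𝓡 d) X X ∞} {ν ν' : OneForm d X} :
    CarriesTo f ν.kerField ν'.kerField ↔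
      ∀ x v, ν'.cov (f x) (mD (𝓡 d) (𝓡 d) f x v) = 0 ↔ ν.cov x v = 0 := carriesTo_iff

theorem CarriesTo.involutive {f : Diffeomorph (𝓡 d) (𝓡 d) X X ∞} {ν ν' : OneForm d X}
    (h : CarriesTo f ν.kerField ν'.kerField) (hne : ∀ x, ν.cov x ≠ 0) (hν : ν.Involutive) :
    ν'.Involutive := by
  rw [carriesTo_kerField_iff] at h
  have h1 : (ν'.pullback (f : ContMDiffMap (𝓡 d) (𝓡 d) X X ∞)).Involutive := hν.congr hne h
  intro x v w hv hw
  have h2 := h1 (f.symm x) (mD (𝓡 d) (𝓡 d) f.symm x v) (mD (𝓡 d) (𝓡 d) f.symm x w)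
  have e : f (f.symm x) = x := f.apply_symm_apply x
  have hD : ∀ v, mD (𝓡 d) (𝓡 d) f (f.symm x) (mD (𝓡 d) (𝓡 d) f.symm x v) = v :=
    fun v => f.symm.mD_symm_apply x v
  have hcov : ∀ v, (ν'.pullback (f : ContMDiffMap (𝓡 d) (𝓡 d) X X ∞)).cov (f.symm x)
      (mD (𝓡 d) (𝓡 d) f.symm x v) = ν'.cov x v := by
    intro v
    rw [OneForm.cov_pullback]
    change ν'.cov (f (f.symm x)) (mD (𝓡 d) (𝓡 d) f (f.symm x) (mD (𝓡 d) (𝓡 d) f.symm x v)) = _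
    rw [hD, e]
  rw [hcov, hcov, OneForm.extL_pullback] at h2
  have h3 := h2 hv hw
  change ν'.extL (f (f.symm x)) (mD (𝓡 d) (𝓡 d) f (f.symm x) (mD (𝓡 d) (𝓡 d) f.symm x v))
    (mD (𝓡 d) (𝓡 d) f (f.symm x) (mD (𝓡 d) (𝓡 d) f.symm x w)) = 0 at h3
  rwa [hD, hD, e] at h3

/-- Contactomorphisms preserve coisotropic submanifolds. -/
theorem IsCoisotropicEmbedding.comp_contacto [CompactSpace Y] [T2Space X] {α : OneForm d X}
    (hα : IsContactForm α) {j : ContMDiffMap (𝓡 k) (𝓡 d) Y X ∞} (hj : IsCoisotropicEmbedding α j)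
    {f : Diffeomorph (𝓡 d) (𝓡 d) X X ∞} (hf : IsContacto α f) :
    IsCoisotropicEmbedding α ((f : ContMDiffMap (𝓡 d) (𝓡 d) X X ∞).comp j) := by
  have hD : ∀ y, mD (𝓡 k) (𝓡 d) ((f : ContMDiffMap (𝓡 d) (𝓡 d) X X ∞).comp j) y =
      (mD (𝓡 d) (𝓡 d) f (j y)).comp (mD (𝓡 k) (𝓡 d) j y) := fun y =>
    mD_comp (g := f) (f.contMDiff.mdifferentiable (by simp) (j y))
      ((j.contMDiff y).mdiff) rfl
  refine ⟨isSmoothEmbedding_of_injective (ContMDiffMap.contMDiff _)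
    (f.injective.comp hj.1.isEmbedding.injective) fun y => ?_, fun y => ?_⟩
  · rw [hD]
    exact (Function.LeftInverse.injective (f.mD_symm_apply (j y))).comp
      (hj.1.isImmersion.injective_mD y)
  · change ∀ v, α.cov (f (j y)) v = 0 → (∀ u, α.cov (f (j y)) (mD (𝓡 k) (𝓡 d)
      ((f : ContMDiffMap (𝓡 d) (𝓡 d) X X ∞).comp j) y u) = 0 → α.extL (f (j y)) v (mD (𝓡 k) (𝓡 d)
      ((f : ContMDiffMap (𝓡 d) (𝓡 d) X X ∞).comp j) y u) = 0) → ∃ u, mD (𝓡 k) (𝓡 d)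
      ((f : ContMDiffMap (𝓡 d) (𝓡 d) X X ∞).comp j) y u = v
    have h2 : ∀ v, α.cov (j y) v = 0 →
      (∀ u, α.cov (j y) (mD (𝓡 k) (𝓡 d) j y u) = 0 →
        α.extL (j y) v (mD (𝓡 k) (𝓡 d) j y u) = 0) → ∃ u, mD (𝓡 k) (𝓡 d) j y u = v := hj.2 y
    have hfc : ∀ x v, α.cov (f x) (mD (𝓡 d) (𝓡 d) f x v) = 0 ↔ α.cov x v = 0 := hf
    rw [hD]
    intro v hv hv'
    rw [← f.mD_apply_symm (j y) v] at hv hv' ⊢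
    set w := mD (𝓡 d) (𝓡 d) f.symm (f (j y)) v
    rw [hfc] at hv
    -- At the point considered `f^*α = c α` with `c ≠ 0`, and the derivative of `f` scales `dα` on
    -- `ξ` by `c`; orthogonality in `ξ` is preserved.
    obtain ⟨c, hc1, hc2⟩ := OneForm.extL_conformal (μ := α)
      (μ' := α.pullback (f : ContMDiffMap (𝓡 d) (𝓡 d) X X ∞)) (x := j y) (hα (j y)).1
      (Filter.Eventually.of_forall fun z v => (hfc z v).2)
    have hc : c ≠ 0 := by
      rintro rfl
      obtain ⟨ζ, hζ⟩ := exists_ne_zero_of_clm_ne_zero (A := α.cov (j y)) (hα (j y)).1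
      refine hζ ((hfc _ ζ).1 ?_)
      have := DFunLike.congr_fun hc1 ζ
      rwa [zero_smul] at this
    obtain ⟨u, hu⟩ := h2 w hv fun u hu => by
      have h3 := hc2 w _ hv hu
      rw [OneForm.extL_pullback] at h3
      have h4 := hv' u ((hfc _ _).2 hu)
      exact (mul_eq_zero.1 (h3.symm.trans h4)).resolve_left hc
    exact ⟨u, congrArg (mD (𝓡 d) (𝓡 d) f (j y)) hu⟩

end Carries

/-! ### Normalization of covectors by the transverse section -/

section Normalize

variable {k : ℕ} {Y : Type*} [TopologicalSpace Y] [ChartedSpace (ℰ k) Y]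
  [IsManifold (𝓡 k) ∞ Y]
  {E' : Type*} [NormedAddCommGroup E'] [NormedSpace ℝ E'] {H' : Type*} [TopologicalSpace H']
  {J : ModelWithCorners ℝ E' H'}
  {Z : Type*} [TopologicalSpace Z] [ChartedSpace H' Z]
  {μ : OneForm k Y} {L : PlaneField k Y} {R : Y → ℰ k}

/-- The covector `s` with `R s = 0` such that `μ - s` is proportional to the given covector. -/
def normalizeCot (μ : OneForm k Y) (R : Y → ℰ k) (p : CotangentTotal k Y) :
    CotangentTotal k Y :=
  mkCot p.proj (μ.cov p.proj - (fiberPairing R p)⁻¹ • p.cov)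

theorem IsTransverseSection.fiberPairing_normalizeCot (hR : IsTransverseSection μ L R)
    {p : CotangentTotal k Y} (hp : fiberPairing R p ≠ 0) :
    fiberPairing R (normalizeCot μ R p) = 0 := by
  change (μ.cov p.proj - (fiberPairing R p)⁻¹ • p.cov) (R p.proj) = 0
  rw [sub_apply, smul_apply, hR.apply_eq_one]
  exact sub_eq_zero.2 (inv_mul_cancel₀ hp).symm

theorem IsTransverseSection.contMDiffAt_normalizeCot (hR : IsTransverseSection μ L R)
    {g : Z → CotangentTotal k Y} {a : Z} (hg : ContMDiffAt J (cotangentModel k) ∞ g a)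
    (ha : fiberPairing R (g a) ≠ 0) :
    ContMDiffAt J (cotangentModel k) ∞ (fun z => normalizeCot μ R (g z)) a := by
  refine ContMDiffAt.mkCot_sub (y := fun z => (g z).proj) (c := fun z => μ.cov (g z).proj) le_rfl
    ((μ.contMDiffAt_mkCot _).comp a (contMDiffAt_proj le_rfl hg)) ?_
  exact ContMDiffAt.mkCot_smul (y := fun z => (g z).proj) (c := fun z => (g z).cov) le_rfl
    ((hR.contMDiffAt_fiberPairing hg).inv₀ ha) hg

theorem IsTransverseSection.fiberPairing_toMap (hR : IsTransverseSection μ L R) (y : Y) :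
    fiberPairing R (μ.toMap y) = 1 := hR.apply_eq_one y

theorem IsTransverseSection.normalizeCot_toMap (hR : IsTransverseSection μ L R) (y : Y) :
    normalizeCot μ R (μ.toMap y) = mkCot y 0 := by
  refine mkCot_eq_iff.2 ⟨rfl, ?_⟩
  change μ.cov y - (fiberPairing R (μ.toMap y))⁻¹ • μ.cov y = 0
  rw [hR.fiberPairing_toMap, inv_one, one_smul, sub_self]

end Normalize

section

theorem C1TendstoAt.congr_left {ι' E E' H H' X X' : Type*}
    [NormedAddCommGroup E] [NormedSpace ℝ E]
    [TopologicalSpace H] {I : ModelWithCorners ℝ E H} [I.Boundaryless]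
    [TopologicalSpace X] [ChartedSpace H X] [IsManifold I ∞ X]
    [NormedAddCommGroup E'] [NormedSpace ℝ E'] [TopologicalSpace H']
    {I' : ModelWithCorners ℝ E' H'} [I'.Boundaryless]
    [TopologicalSpace X'] [ChartedSpace H' X'] [IsManifold I' ∞ X'] {l : Filter ι'}
    {F F' : ι' → X → X'} {f f' : X → X'} {x₀ : X}
    (hF : C1TendstoAt I I' l F f x₀) (h : ∀ᶠ i in l, ∀ x, F i x = F' i x)
    (h' : ∀ x, f x = f' x) : C1TendstoAt I I' l F' f' x₀ :=
  hF.congr ((h.prod_inl _).mono fun p hp => hp p.2) (.of_forall h')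

end

theorem carriesTo_pullback_symm {k : ℕ} {Y : Type*} [TopologicalSpace Y]
    [ChartedSpace (ℰ k) Y] [IsManifold (𝓡 k) ∞ Y]
    (f : Diffeomorph (𝓡 k) (𝓡 k) Y Y ∞) (ν : OneForm k Y) :
    CarriesTo f ν.kerField
      (ν.pullback (f.symm : ContMDiffMap (𝓡 k) (𝓡 k) Y Y ∞)).kerField := by
  rw [carriesTo_kerField_iff]
  intro y v
  have h : (ν.pullback (f.symm : ContMDiffMap (𝓡 k) (𝓡 k) Y Y ∞)).cov (f y)
      (mD (𝓡 k) (𝓡 k) f y v) = ν.cov (f.symm (f y)) (mD (𝓡 k) (𝓡 k) f.symm (f y)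
      (mD (𝓡 k) (𝓡 k) f y v)) := rfl
  rw [h, f.mD_symm_apply, f.symm_apply_apply]

/-! ### `C¹`-close submanifolds and foliations -/

namespace StandardNbhd

variable {n d k : ℕ}
  {M : Type*} [TopologicalSpace M] [T2Space M] [ChartedSpace (ℰ d) M]
  [IsManifold (𝓡 d) ∞ M]
  {Y : Type*} [TopologicalSpace Y] [CompactSpace Y] [T2Space Y]
  [ChartedSpace (ℰ k) Y]
  [IsManifold (𝓡 k) ∞ Y] [Nonempty M]
  {α : OneForm d M} {ι : ContMDiffMap (𝓡 k) (𝓡 d) Y M ∞} {L : PlaneField k Y}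
  {R : Y → ℰ k} (𝒩 : StandardNbhd α ι L) {κ : Type*} {l : Filter κ}

theorem zero_mem_image (y : Y) : mkCot y 0 ∈ 𝒩.Θ '' 𝒩.N := ⟨ι y, 𝒩.mem_N y, 𝒩.Θ_zero y⟩

theorem inv_zero (y : Y) : 𝒩.inv (mkCot y 0) = ι y := by
  have h : 𝒩.Θ (ι y) = mkCot y 0 := 𝒩.Θ_zero y
  rw [← h, 𝒩.inv_Θ (𝒩.mem_N y)]

theorem proj_ι (y : Y) : 𝒩.proj (ι y) = y := congrArg (·.proj) (𝒩.Θ_zero y)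

/-- One-forms close to `λ` define sections with graphs in the standard neighbourhood. -/
theorem eventually_exists_section (hR : IsTransverseSection (α.pullback ι) L R)
    {ν : κ → OneForm k Y}
    (hν : ∀ y, Filter.Tendsto (fun p : κ × Y => (ν p.1).toMap p.2) (l ×ˢ 𝓝 y)
      (𝓝 ((α.pullback ι).toMap y))) :
    ∀ᶠ i in l, ∃ s : OneForm k Y, 𝒩.IsSection s ∧
      (∀ y, s.toMap y = normalizeCot (α.pullback ι) R ((ν i).toMap y)) ∧
      ∀ y, (ν i).cov y (R y) ≠ 0 := by
  -- The section is `s = λ - ν / ν(R)`, which lies near zero because `ν` is near `λ`. Only `C⁰`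
  -- closeness is needed.
  have key : ∀ᶠ i in l, ∀ y ∈ (univ : Set Y), fiberPairing R ((ν i).toMap y) ≠ 0 ∧
      normalizeCot (α.pullback ι) R ((ν i).toMap y) ∈ 𝒩.Θ '' 𝒩.N := by
    refine eventually_forall_of_isCompact (P := fun i y => fiberPairing R ((ν i).toMap y) ≠ 0 ∧
      normalizeCot (α.pullback ι) R ((ν i).toMap y) ∈ 𝒩.Θ '' 𝒩.N) isCompact_univ fun y _ => ?_
    have hne : fiberPairing R ((α.pullback ι).toMap y) ≠ 0 := by
      rw [hR.fiberPairing_toMap]; exact one_ne_zero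
    have h1 := (hR.contMDiffAt_fiberPairing (J := cotangentModel k) (g := fun p => p)
      (a := (α.pullback ι).toMap y) contMDiffAt_id).continuousAt.eventually_ne hne
    have h2 := (hR.contMDiffAt_normalizeCot (J := cotangentModel k) (g := fun p => p)
      (a := (α.pullback ι).toMap y) contMDiffAt_id hne).continuousAt
    have h3 : ∀ᶠ p in 𝓝 ((α.pullback ι).toMap y), fiberPairing R (normalizeCot (α.pullback ι) R p) = 0 →
        normalizeCot (α.pullback ι) R p ∈ 𝒩.Θ '' 𝒩.N := by
      refine h2.eventually (p := fun p => fiberPairing R p = 0 → p ∈ 𝒩.Θ '' 𝒩.N) ?_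
      beta_reduce
      rw [hR.normalizeCot_toMap]
      exact 𝒩.eventually_mem_image_Θ hR (𝒩.zero_mem_image y)
    filter_upwards [(hν y).eventually h1, (hν y).eventually h3] with p hp1 hp3
    exact ⟨hp1, hp3 (hR.fiberPairing_normalizeCot hp1)⟩
  filter_upwards [key] with i hi
  let g : Y → CotangentTotal k Y := fun y => normalizeCot (α.pullback ι) R ((ν i).toMap y)
  have hg : ContMDiff (𝓡 k) (cotangentModel k) ∞ g := fun y =>
    hR.contMDiffAt_normalizeCot ((ν i).toMap.contMDiff y) (hi y (mem_univ y)).1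
  have hgm := OneForm.toMap_ofMap hg fun y => rfl
  refine ⟨OneForm.ofMap g hg fun y => rfl, (isSection_iff hR).2 ⟨fun y => ?_, fun y => ?_⟩,
    hgm, fun y => (hi y (mem_univ y)).1⟩
  · exact hR.fiberPairing_normalizeCot (hi y (mem_univ y)).1
  · rw [hgm]; exact (hi y (mem_univ y)).2

theorem kerField_of_toMap_eq_normalizeCot {ν s : OneForm k Y}
    (hs : ∀ y, s.toMap y = normalizeCot (α.pullback ι) R (ν.toMap y))
    (hν : ∀ y, ν.cov y (R y) ≠ 0) (y : Y) (v : ℰ k) :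
    (α.pullback ι - s).cov y v = 0 ↔ ν.cov y v = 0 := by
  have h1 : s.cov y = (α.pullback ι).cov y - (ν.cov y (R y))⁻¹ • ν.cov y :=
    congrArg CotangentTotal.cov (hs y)
  rw [OneForm.cov_sub, h1, sub_sub_cancel, smul_apply, smul_eq_mul, mul_eq_zero]
  simp [hν y]

theorem kerField_eq {ν ν' : OneForm k Y} (h : ∀ y v, ν.cov y v = 0 ↔ ν'.cov y v = 0) :
    ν.kerField = ν'.kerField := by
  funext y
  ext v
  exact h y v

theorem eventually_kerField_mem_foliations (hR : IsTransverseSection (α.pullback ι) L R)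
    {ν : κ → OneForm k Y}
    (hν : ∀ y, Filter.Tendsto (fun p : κ × Y => (ν p.1).toMap p.2) (l ×ˢ 𝓝 y)
      (𝓝 ((α.pullback ι).toMap y))) :
    ∀ᶠ i in l, (∀ y, (ν i).cov y ≠ 0) ∧
      (IsFoliation (ν i).kerField → (ν i).kerField ∈ 𝒩.foliations) := by
  filter_upwards [𝒩.eventually_exists_section hR hν] with i hi
  obtain ⟨s, hs, hsν, hne⟩ := hi
  refine ⟨fun y h => hne y (by rw [h]; rfl), fun hF => ⟨hF, s, hs, ?_⟩⟩
  exact kerField_eq fun y v => (kerField_of_toMap_eq_normalizeCot hsν hne y v).symm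

theorem containsC1CloseFoliations (hR : IsTransverseSection (α.pullback ι) L R) :
    ContainsC1CloseFoliations (α.pullback ι) 𝒩.foliations :=
  (𝒩.eventually_kerField_mem_foliations hR fun y =>
    (OneForm.tendsto_c1Nhds_iff.1 Filter.tendsto_id y).tendsto).mono fun _ h => h.2

/-- Embeddings close to `ι` are reparametrized graphs. -/
theorem exists_graph_of_tendsto (hR : IsTransverseSection (α.pullback ι) L R)
    {j : κ → ContMDiffMap (𝓡 k) (𝓡 d) Y M ∞}
    (hj : ∀ y, C1TendstoAt (𝓡 k) (𝓡 d) l (fun i => j i) ι y) :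
    ∃ s : κ → OneForm k Y, (∀ᶠ i in l, 𝒩.IsSection (s i) ∧ range (j i) = 𝒩.graph (s i)) ∧
      ∀ y, C1TendstoAt (𝓡 k) (cotangentModel k) l (fun i => (s i).toMap) (fun y => mkCot y 0) y := by
  classical
  have : LocallyConnectedSpace Y :=
    ChartedSpace.locallyConnectedSpace (ℰ k) Y
  have hmem : ∀ᶠ i in l, ∀ y, j i y ∈ 𝒩.N := by
    have := eventually_forall_of_isCompact (l := l) (P := fun i y => j i y ∈ 𝒩.N) isCompact_univ
      fun y _ => (hj y).tendsto.eventually (𝒩.isOpen_N.mem_nhds (𝒩.mem_N y))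
    exact this.mono fun i hi y => hi y (mem_univ y)
  have hιd : ∀ y, MDifferentiableAt (𝓡 k) (𝓡 d) ι y := fun y =>
    (ι.contMDiff y).mdiff
  have hΘj : ∀ y, C1TendstoAt (𝓡 k) (cotangentModel k) l (fun i y => 𝒩.Θ (j i y))
      (fun y => mkCot y 0) y := fun y =>
    ((hj y).postcomp ((𝒩.contMDiffAt_Θ (𝒩.mem_N y)).of_le (by exact_mod_cast le_top))
      (hιd y)).congr_left (.of_forall fun i x => rfl) 𝒩.Θ_zero
  -- The projection of the embedding to `Y` is `C¹`-close to the identity, hence eventually a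
  -- diffeomorphism `D`, and the section sought is `Θ ∘ j ∘ D⁻¹`.
  have hψ : ∀ y, C1TendstoAt (𝓡 k) (𝓡 k) l (fun i y => 𝒩.proj (j i y)) (fun y => y) y := fun y =>
    ((hj y).postcomp ((𝒩.contMDiffAt_projN (𝒩.mem_N y)).of_le (by exact_mod_cast le_top))
      (hιd y)).congr_left (.of_forall fun i x => rfl) 𝒩.proj_ι
  have hex : ∀ᶠ i in l, ∃ D : Diffeomorph (𝓡 k) (𝓡 k) Y Y ∞, ∀ y, D y = 𝒩.proj (j i y) := by
    filter_upwards [eventually_exists_diffeomorph hψ, hmem] with i hi hi'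
    obtain ⟨D, hD⟩ := hi fun y => (𝒩.contMDiffAt_projN (hi' y)).comp y ((j i).contMDiff y)
    exact ⟨D, fun y => congrFun hD y⟩
  let D : κ → Diffeomorph (𝓡 k) (𝓡 k) Y Y ∞ := fun i =>
    if h : ∃ D : Diffeomorph (𝓡 k) (𝓡 k) Y Y ∞, ∀ y, D y = 𝒩.proj (j i y) then h.choose
    else Diffeomorph.refl (𝓡 k) Y ∞
  have hD : ∀ᶠ i in l, ∀ y, D i y = 𝒩.proj (j i y) := by
    filter_upwards [hex] with i hi
    simp only [D, dif_pos hi]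
    exact hi.choose_spec
  have hDt : ∀ y, C1TendstoAt (𝓡 k) (𝓡 k) l (fun i => D i) (fun y => y) y := fun y =>
    (hψ y).congr_left (hD.mono fun i hi x => (hi x).symm) fun _ => rfl
  have hDs := c1TendstoAt_symm hDt
  have hs : ∀ᶠ i in l, ∃ s : OneForm k Y, ∀ y, s.toMap y = 𝒩.Θ (j i ((D i).symm y)) := by
    filter_upwards [hD, hmem] with i hi hi'
    have hg : ContMDiff (𝓡 k) (cotangentModel k) ∞ (fun y => 𝒩.Θ (j i ((D i).symm y))) := fun y =>
      ContMDiffAt.comp (f := fun y => j i ((D i).symm y)) y (𝒩.contMDiffAt_Θ (hi' _))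
        (((j i).contMDiff.comp (D i).symm.contMDiff) y)
    have hp : ∀ y, (𝒩.Θ (j i ((D i).symm y))).proj = y := fun y =>
      (hi ((D i).symm y)).symm.trans ((D i).apply_symm_apply y)
    exact ⟨OneForm.ofMap _ hg hp, OneForm.toMap_ofMap hg hp⟩
  let s : κ → OneForm k Y := fun i =>
    if h : ∃ s : OneForm k Y, ∀ y, s.toMap y = 𝒩.Θ (j i ((D i).symm y)) then h.choose else 0
  have hs' : ∀ᶠ i in l, ∀ y, (s i).toMap y = 𝒩.Θ (j i ((D i).symm y)) := by
    filter_upwards [hs] with i hi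
    simp only [s, dif_pos hi]
    exact hi.choose_spec
  refine ⟨s, ?_, fun y => ?_⟩
  · filter_upwards [hs', hmem] with i hi hi'
    have hsec : 𝒩.IsSection (s i) := by
      refine (isSection_iff hR).2 ⟨fun y => ?_, fun y => ?_⟩
      · have := 𝒩.fiberPairing_Θ hR (hi' ((D i).symm y))
        rwa [← hi y] at this
      · rw [hi y]; exact mem_image_of_mem _ (hi' _)
    refine ⟨hsec, ?_⟩
    rw [← hsec.range_embed]
    have : ∀ y, 𝒩.embed (s i) y = j i ((D i).symm y) := fun y => by
      rw [embed, hi y, 𝒩.inv_Θ (hi' _)]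
    ext z
    constructor
    · rintro ⟨y, rfl⟩
      exact ⟨D i y, by rw [this, (D i).symm_apply_apply]⟩
    · rintro ⟨y, rfl⟩
      exact ⟨(D i).symm y, (this y).symm⟩
  · have := C1TendstoAt.comp (G := fun i y => 𝒩.Θ (j i y)) (g := fun y => mkCot y 0) (hΘj y) (hDs y)
      (by
        have h : (fun y => mkCot y 0) = fun y => 𝒩.Θ (ι y) := funext fun y => (𝒩.Θ_zero y).symm
        rw [h]
        exact ((𝒩.contMDiffAt_Θ (𝒩.mem_N y)).comp y (ι.contMDiff y)).mdiff)
      mdifferentiableAt_id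
    exact this.congr_left (hs'.mono fun i hi x => (hi x).symm) fun _ => rfl

theorem containsC1CloseCoisotropics (hR : IsTransverseSection (α.pullback ι) L R) :
    ContainsC1CloseCoisotropics α ι 𝒩.coisotropics := by
  obtain ⟨s, hs, -⟩ := 𝒩.exists_graph_of_tendsto hR (tendsto_c1Nhds_iff.1 Filter.tendsto_id)
  exact hs.mono fun j hj hco => ⟨⟨s j, hj.1, hj.2⟩, j, hco, rfl⟩

theorem eventually_contacto_image_mem (hα : IsContactForm α)
    (hR : IsTransverseSection (α.pullback ι) L R) :
    ∀ᶠ p in c1Nhds ι ×ˢ c1Nhds (ContMDiffMap.id : ContMDiffMap (𝓡 d) (𝓡 d) M M ∞),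
      ∀ f : Diffeomorph (𝓡 d) (𝓡 d) M M ∞, IsCoisotropicEmbedding α p.1 →
        (f : ContMDiffMap (𝓡 d) (𝓡 d) M M ∞) = p.2 → IsContacto α f →
        f '' range p.1 ∈ 𝒩.coisotropics := by
  have h1 := tendsto_c1Nhds_iff.1 (Filter.tendsto_fst (f := c1Nhds ι)
    (g := c1Nhds (ContMDiffMap.id : ContMDiffMap (𝓡 d) (𝓡 d) M M ∞)))
  have h2 := tendsto_c1Nhds_iff.1 (Filter.tendsto_snd (f := c1Nhds ι)
    (g := c1Nhds (ContMDiffMap.id : ContMDiffMap (𝓡 d) (𝓡 d) M M ∞)))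
  have h3 : ∀ y, C1TendstoAt (𝓡 k) (𝓡 d) _ (fun p : ContMDiffMap (𝓡 k) (𝓡 d) Y M ∞ ×
      ContMDiffMap (𝓡 d) (𝓡 d) M M ∞ => p.2.comp p.1) ι y := fun y =>
    (h2 (ι y)).comp (h1 y) mdifferentiableAt_id ((ι.contMDiff y).mdiff)
  obtain ⟨s, hs, -⟩ := 𝒩.exists_graph_of_tendsto hR h3
  filter_upwards [hs] with p hp f hco hf hfα
  have hc : (f : ContMDiffMap (𝓡 d) (𝓡 d) M M ∞).comp p.1 = p.2.comp p.1 := by rw [hf]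
  have hr : range (p.2.comp p.1) = f '' range p.1 := by
    rw [← hc, ← range_comp]; rfl
  rw [← hr]
  exact ⟨⟨s p, hp.1, hp.2⟩, p.2.comp p.1, by rw [← hc]; exact hco.comp_contacto hα hfα, rfl⟩

/-- The image foliation is the kernel of the pullback of `ν` by `f⁻¹`. This form is `C⁰`-close to
`λ` because `f⁻¹` is `C¹`-close to the identity, and it is integrable by naturality of `d`. -/
theorem eventually_carriesTo (hR : IsTransverseSection (α.pullback ι) L R)
    {ν : κ → OneForm k Y} {f : κ → Diffeomorph (𝓡 k) (𝓡 k) Y Y ∞}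
    (hν : ∀ y, Filter.Tendsto (fun p : κ × Y => (ν p.1).toMap p.2) (l ×ˢ 𝓝 y)
      (𝓝 ((α.pullback ι).toMap y)))
    (hf : ∀ y, C1TendstoAt (𝓡 k) (𝓡 k) l (fun i => f i) (fun y => y) y) :
    ∀ᶠ i in l, IsFoliation (ν i).kerField →
      ∃ G ∈ 𝒩.foliations, CarriesTo (f i) (ν i).kerField G := by
  obtain ⟨ν', hν'⟩ : ∃ ν' : κ → OneForm k Y, ∀ i,
      ν' i = (ν i).pullback ((f i).symm : ContMDiffMap (𝓡 k) (𝓡 k) Y Y ∞) := ⟨_, fun _ => rfl⟩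
  have h3 : ∀ y, Filter.Tendsto (fun p : κ × Y => (ν' p.1).toMap p.2)
      (l ×ˢ 𝓝 y) (𝓝 ((α.pullback ι).toMap y)) := by
    intro y
    simp only [hν']
    exact tendsto_pullback_toMap (ν := ν)
      (f := fun i => ((f i).symm : ContMDiffMap (𝓡 k) (𝓡 k) Y Y ∞)) (hν y) (c1TendstoAt_symm hf y)
  have h4 := 𝒩.eventually_kerField_mem_foliations (ν := ν') hR h3
  have h5 := 𝒩.eventually_kerField_mem_foliations (ν := ν) hR hν
  filter_upwards [h4, h5] with i hq hq' hF
  have hcar : CarriesTo (f i) (ν i).kerField (ν' i).kerField := by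
    rw [hν']; exact carriesTo_pullback_symm (f i) (ν i)
  exact ⟨_, hq.2 ((isFoliation_kerField_iff hq.1).2
    (hcar.involutive hq'.1 ((isFoliation_kerField_iff hq'.1).1 hF))), hcar⟩

theorem eventually_diffeomorph_carries (hR : IsTransverseSection (α.pullback ι) L R) :
    ∀ᶠ p in (α.pullback ι).c1Nhds ×ˢ
        c1Nhds (ContMDiffMap.id : ContMDiffMap (𝓡 k) (𝓡 k) Y Y ∞),
      ∀ f : Diffeomorph (𝓡 k) (𝓡 k) Y Y ∞, IsFoliation p.1.kerField →
        (f : ContMDiffMap (𝓡 k) (𝓡 k) Y Y ∞) = p.2 →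
        ∃ G ∈ 𝒩.foliations, CarriesTo f p.1.kerField G := by
  generalize hlf : (α.pullback ι).c1Nhds ×ˢ
    c1Nhds (ContMDiffMap.id : ContMDiffMap (𝓡 k) (𝓡 k) Y Y ∞) = lf
  -- The filter is pulled back to pairs of a form and a diffeomorphism, because the inverses must
  -- converge too and a general smooth map has none.
  have hu := Filter.tendsto_comap (f := fun q : OneForm k Y × Diffeomorph (𝓡 k) (𝓡 k) Y Y ∞ =>
    (q.1, (q.2 : ContMDiffMap (𝓡 k) (𝓡 k) Y Y ∞))) (x := lf)
  have hu1 : Filter.Tendsto (fun q : OneForm k Y × Diffeomorph (𝓡 k) (𝓡 k) Y Y ∞ => q.1)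
      (Filter.comap (fun q => (q.1, (q.2 : ContMDiffMap (𝓡 k) (𝓡 k) Y Y ∞))) lf)
      (α.pullback ι).c1Nhds := by
    rw [← hlf] at hu ⊢
    have := Filter.tendsto_fst.comp hu
    exact this
  have hu2 : Filter.Tendsto (fun q : OneForm k Y × Diffeomorph (𝓡 k) (𝓡 k) Y Y ∞ =>
      (q.2 : ContMDiffMap (𝓡 k) (𝓡 k) Y Y ∞))
      (Filter.comap (fun q => (q.1, (q.2 : ContMDiffMap (𝓡 k) (𝓡 k) Y Y ∞))) lf)
      (c1Nhds ContMDiffMap.id) := by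
    rw [← hlf] at hu ⊢
    have := Filter.tendsto_snd.comp hu
    exact this
  have hν := OneForm.tendsto_c1Nhds_iff.1 hu1
  have hf := tendsto_c1Nhds_iff.1 hu2
  have h1 := 𝒩.eventually_carriesTo hR (fun y => (hν y).tendsto) hf
  rw [Filter.eventually_comap] at h1
  exact h1.mono fun p hp f hF hf => hp (p.1, f) (Prod.ext rfl hf) hF

/-- The bijection respects closeness to `Y` and to `ker λ`. -/
theorem containsC1Close_iff (hd : d = 2 * n + 1) (hk : k = n + 1)
    (hα : IsContactForm α) (hR : IsTransverseSection (α.pullback ι) L R)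
    (hdk : d + 1 = k + k) {e : 𝒩.coisotropics ≃ 𝒩.foliations}
    (he : ∀ (S : 𝒩.coisotropics) (s : OneForm k Y), 𝒩.IsSection s → S.1 = 𝒩.graph s →
          (e S).1 = (α.pullback ι - s).kerField) (𝒰 : Set 𝒩.coisotropics) :
    ContainsC1CloseCoisotropics α ι (Subtype.val '' 𝒰) ↔
      ContainsC1CloseFoliations (α.pullback ι) (Subtype.val '' (e '' 𝒰)) := by
  classical
  have hmem : ∀ {s : OneForm k Y}, 𝒩.IsSection s → ∀ hF : IsFoliation (α.pullback ι - s).kerField,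
      𝒩.graph s ∈ Subtype.val '' 𝒰 ↔
        (α.pullback ι - s).kerField ∈ Subtype.val '' (e '' 𝒰) := by
    intro s hs hF
    have hS := (hs.graph_mem_coisotropics_iff hd hk hα hR hdk).2 hF
    have hes := he ⟨_, hS⟩ s hs rfl
    constructor
    · rintro ⟨S, hSU, hSs⟩
      exact ⟨e S, mem_image_of_mem e hSU, he S s hs hSs⟩
    · rintro ⟨G, ⟨S, hSU, rfl⟩, hG⟩
      have : S = ⟨_, hS⟩ := e.injective (Subtype.ext (hG.trans hes.symm))
      exact ⟨S, hSU, by rw [this]⟩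
  constructor
  · intro h
    have hν : ∀ y, C1TendstoAt (𝓡 k) (cotangentModel k) (α.pullback ι).c1Nhds
        (fun ν : OneForm k Y => ν.toMap) (α.pullback ι).toMap y :=
      OneForm.tendsto_c1Nhds_iff.1 Filter.tendsto_id
    have hsec := 𝒩.eventually_exists_section (ν := fun ν : OneForm k Y => ν) hR fun y => (hν y).tendsto
    let P : OneForm k Y → OneForm k Y → Prop := fun ν s => 𝒩.IsSection s ∧
      (∀ y, s.toMap y = normalizeCot (α.pullback ι) R (ν.toMap y)) ∧ ∀ y, ν.cov y (R y) ≠ 0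
    -- For `ν` near `λ` this is the embedding onto the graph of the normalized section; `ι` is a
    -- default for the other forms.
    let j : OneForm k Y → ContMDiffMap (𝓡 k) (𝓡 d) Y M ∞ := fun ν =>
      if hs : ∃ s, P ν s then embedC hR hdk hs.choose_spec.1 else ι
    have hj : ∀ {ν s}, P ν s → ∀ y, j ν y = 𝒩.embed s y := by
      intro ν s hP y
      have hex : ∃ s, P ν s := ⟨s, hP⟩
      have : hex.choose = s := OneForm.ext_cov fun y =>
        congrArg CotangentTotal.cov ((hex.choose_spec.2.1 y).trans (hP.2.1 y).symm)
      simp only [j, dif_pos hex]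
      change 𝒩.embed hex.choose y = _
      rw [this]
    -- Normalization and the local smooth extension `Γ` of the inverse of `Θ` are fixed maps, and
    -- postcomposition with them preserves `C¹` convergence.
    have hjt : Filter.Tendsto j (α.pullback ι).c1Nhds (c1Nhds ι) := by
      refine tendsto_c1Nhds_iff.2 fun y => ?_
      have hne : fiberPairing R ((α.pullback ι).toMap y) ≠ 0 := by
        rw [hR.fiberPairing_toMap]; exact one_ne_zero
      obtain ⟨Γ, hΓ, hΓ'⟩ := 𝒩.exists_smooth_inverse hR hdk (𝒩.zero_mem_image y)
      have hnd := hR.contMDiffAt_normalizeCot (J := cotangentModel k) (g := fun p => p)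
        (a := (α.pullback ι).toMap y) contMDiffAt_id hne
      have hmd := (((α.pullback ι).toMap.contMDiff y).mdiff :
        MDifferentiableAt (𝓡 k) (cotangentModel k) (α.pullback ι).toMap y)
      have h1 := (hν y).postcomp (hnd.of_le (by exact_mod_cast le_top)) hmd
      have h2 := h1.postcomp (g := Γ) (I'' := 𝓡 d)
        (by rw [hR.normalizeCot_toMap]; exact hΓ.self_of_nhds.of_le (by exact_mod_cast le_top))
        ((hnd.mdiff).comp y hmd)
      have h4 := h1.tendsto
      rw [hR.normalizeCot_toMap] at h4
      refine h2.congr ?_ ?_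
      · filter_upwards [hsec.prod_inl _, h4.eventually hΓ'] with p hp hp'
        obtain ⟨s, hs⟩ := hp
        rw [hj hs p.2, embed, hs.2.1]
        exact hp' (hR.fiberPairing_normalizeCot (hs.2.2 _))
      · have hc : ContinuousAt (fun y : Y => (mkCot y 0 : CotangentTotal k Y)) y := by
          have h : (fun y => mkCot y 0) = fun y => 𝒩.Θ (ι y) := funext fun y => (𝒩.Θ_zero y).symm
          rw [h]
          exact ((𝒩.contMDiffAt_Θ (𝒩.mem_N y)).comp y (ι.contMDiff y)).continuousAt
        filter_upwards [hc.eventually hΓ'] with z hz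
        rw [hR.normalizeCot_toMap, hz rfl, 𝒩.inv_zero]
    filter_upwards [hsec, hjt.eventually h] with ν hs hU hF
    obtain ⟨s, hs⟩ := hs
    have hker : ν.kerField = (α.pullback ι - s).kerField :=
      kerField_eq fun y v => (kerField_of_toMap_eq_normalizeCot hs.2.1 hs.2.2 y v).symm
    rw [hker] at hF ⊢
    have hjs : j ν = embedC hR hdk hs.1 := ContMDiffMap.ext (hj hs)
    have h1 := hU (by rw [hjs]; exact (hs.1.isCoisotropicEmbedding_iff hd hk hα hR hdk).2 hF)
    rw [hjs] at h1
    refine (hmem hs.1 hF).1 ?_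
    rw [← hs.1.range_embed]
    exact h1
  · intro h
    obtain ⟨s, hs, hst⟩ := 𝒩.exists_graph_of_tendsto (j := fun j => j) hR
      (tendsto_c1Nhds_iff (F := fun j : ContMDiffMap (𝓡 k) (𝓡 d) Y M ∞ => j) (l := c1Nhds ι).1
        Filter.tendsto_id)
    -- Conversely, the section belonging to a nearby embedding is `C¹`-small, so `λ - s` is close to
    -- `λ`.
    have ht : Filter.Tendsto (fun j => α.pullback ι - s j) (c1Nhds ι) (α.pullback ι).c1Nhds := by
      refine OneForm.tendsto_c1Nhds_iff.2 fun y => ?_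
      have hsm : ContMDiffAt (cotangentModel k) (cotangentModel k) ∞
          (fun p : CotangentTotal k Y => mkCot p.proj ((α.pullback ι).cov p.proj - p.cov))
          (mkCot y 0) :=
        ContMDiffAt.mkCot_sub (y := fun p : CotangentTotal k Y => p.proj)
          (c := fun p => (α.pullback ι).cov p.proj) le_rfl
          (((α.pullback ι).contMDiffAt_mkCot _).comp _ (contMDiffAt_proj le_rfl contMDiffAt_id))
          contMDiffAt_id
      have hz : MDifferentiableAt (𝓡 k) (cotangentModel k) (fun y : Y => (mkCot y 0 : CotangentTotal k Y)) y := by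
        have h : (fun y => mkCot y 0) = fun y => 𝒩.Θ (ι y) := funext fun y => (𝒩.Θ_zero y).symm
        rw [h]
        exact ((𝒩.contMDiffAt_Θ (𝒩.mem_N y)).comp y (ι.contMDiff y)).mdiff
      refine ((hst y).postcomp (hsm.of_le (by exact_mod_cast le_top)) hz).congr_left
        (.of_forall fun i x => rfl) fun x => ?_
      exact (mkCot_eq_iff (p := (α.pullback ι).toMap x)).2 ⟨rfl, (sub_zero _).symm⟩ |>.symm
    filter_upwards [hs, ht.eventually h] with j hj hU hco
    have hg : 𝒩.graph (s j) ∈ 𝒩.coisotropics := ⟨⟨s j, hj.1, rfl⟩, j, hco, hj.2⟩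
    have hF := (hj.1.graph_mem_coisotropics_iff hd hk hα hR hdk).1 hg
    rw [hj.2]
    exact (hmem hj.1 hF).2 (hU hF)

end StandardNbhd

/-! ### Reparametrized isotopies and their short pieces -/

section Isotopies

variable {d : ℕ} {X : Type*} [TopologicalSpace X] [ChartedSpace (ℰ d) X]
  [IsManifold (𝓡 d) ∞ X]

/-- The smooth transition function maps the line into `[0, 1]` and takes the values 0 and 1 at 0 and
1. This makes the isotopy smooth on the whole line without changing its ends. -/
theorem IsIsotopy.contMDiff_reparam {φ : ℝ → Diffeomorph (𝓡 d) (𝓡 d) X X ∞} (hφ : IsIsotopy φ) :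
    ContMDiff (𝓘(ℝ, ℝ).prod (𝓡 d)) (𝓡 d) ∞
      (fun p : ℝ × X => φ (Real.smoothTransition p.1) p.2) := by
  have h1 : ContMDiff (𝓘(ℝ, ℝ).prod (𝓡 d)) (𝓘(ℝ, ℝ).prod (𝓡 d)) ∞
      (fun p : ℝ × X => (Real.smoothTransition p.1, p.2)) :=
    (Real.smoothTransition.contDiff.contMDiff.comp contMDiff_fst).prodMk contMDiff_snd
  rw [← contMDiffOn_univ] at h1 ⊢
  exact hφ.1.comp h1 fun p _ =>
    ⟨⟨Real.smoothTransition.nonneg _, Real.smoothTransition.le_one _⟩, mem_univ _⟩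

theorem smoothTransition_mem_Icc (t : ℝ) : Real.smoothTransition t ∈ Icc (0 : ℝ) 1 :=
  ⟨Real.smoothTransition.nonneg _, Real.smoothTransition.le_one _⟩

/-- A path of diffeomorphisms restarted at `t₀` begins at the identity, so short pieces of it lie in
any given `C¹`-neighbourhood of the identity. -/
theorem tendsto_symm_trans {φ : ℝ → Diffeomorph (𝓡 d) (𝓡 d) X X ∞}
    (hφ : ContMDiff (𝓘(ℝ, ℝ).prod (𝓡 d)) (𝓡 d) ∞ (fun p : ℝ × X => φ p.1 p.2)) (t₀ : ℝ) :
    Filter.Tendsto (fun r => (((φ t₀).symm.trans (φ r) : Diffeomorph (𝓡 d) (𝓡 d) X X ∞) :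
      ContMDiffMap (𝓡 d) (𝓡 d) X X ∞)) (𝓝 t₀) (c1Nhds ContMDiffMap.id) := by
  refine tendsto_c1Nhds_iff.2 fun x => ?_
  have h1 : ContMDiff (𝓘(ℝ, ℝ).prod (𝓡 d)) (𝓡 d) 1
      (fun p : ℝ × X => φ p.1 ((φ t₀).symm p.2)) :=
    (hφ.comp (contMDiff_fst.prodMk ((φ t₀).symm.contMDiff.comp contMDiff_snd))).of_le
      (by exact_mod_cast le_top)
  exact (c1TendstoAt_of_contMDiffAt (h1 (t₀, x))).congr_left (.of_forall fun i x => rfl)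
    fun x => (φ t₀).apply_symm_apply x

theorem contMDiff_symm_trans_line {φ : ℝ → Diffeomorph (𝓡 d) (𝓡 d) X X ∞}
    (hφ : ContMDiff (𝓘(ℝ, ℝ).prod (𝓡 d)) (𝓡 d) ∞ (fun p : ℝ × X => φ p.1 p.2)) (t₀ t : ℝ) :
    IsIsotopy fun u => (φ t₀).symm.trans (φ (t₀ + u * (t - t₀))) := by
  refine ⟨ContMDiff.contMDiffOn ?_, fun x => ?_⟩
  · have h1 : ContMDiff 𝓘(ℝ, ℝ) 𝓘(ℝ, ℝ) ∞ fun u : ℝ => t₀ + u * (t - t₀) :=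
      (contDiff_const.add (contDiff_id.mul contDiff_const)).contMDiff
    exact hφ.comp ((h1.comp contMDiff_fst).prodMk ((φ t₀).symm.contMDiff.comp contMDiff_snd))
  · simp

theorem CarriesTo.unique {f : Diffeomorph (𝓡 d) (𝓡 d) X X ∞} {G G' G'' : PlaneField d X}
    (h : CarriesTo f G G') (h' : CarriesTo f G G'') : G' = G'' := by
  funext x
  have e : f (f.symm x) = x := f.apply_symm_apply x
  have := (h (f.symm x)).trans (h' (f.symm x)).symm
  rwa [e] at this

theorem mD_symm_trans (f g : Diffeomorph (𝓡 d) (𝓡 d) X X ∞) (x : X)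
    (v : ℰ d) :
    mD (𝓡 d) (𝓡 d) (f.symm.trans g) (f x) (mD (𝓡 d) (𝓡 d) f x v) = mD (𝓡 d) (𝓡 d) g x v := by
  have h := mD_comp (g := f.symm.trans g) (f := f) (x := x)
    ((f.symm.trans g).contMDiff.mdifferentiable (by simp) (f x))
    (f.contMDiff.mdifferentiable (by simp) x) rfl
  have h2 : (fun z => (f.symm.trans g) (f z)) = g := funext fun z =>
    congrArg g (f.symm_apply_apply z)
  rw [h2] at h
  exact (DFunLike.congr_fun h v).symm

theorem CarriesTo.symm_trans {f g : Diffeomorph (𝓡 d) (𝓡 d) X X ∞} {G G' G'' : PlaneField d X}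
    (h : CarriesTo f G G') (h' : CarriesTo g G G'') : CarriesTo (f.symm.trans g) G' G'' := by
  rw [carriesTo_iff] at h h' ⊢
  intro y w
  obtain ⟨x, rfl⟩ : ∃ x, f x = y := f.surjective y
  obtain ⟨v, rfl⟩ : ∃ v, mD (𝓡 d) (𝓡 d) f x v = w := ⟨_, f.mD_apply_symm x w⟩
  have e : (f.symm.trans g) (f x) = g x := congrArg g (f.symm_apply_apply x)
  rw [mD_symm_trans, e]
  exact (h' x v).trans (h x v).symm

theorem isContacto_iff {α : OneForm d X} {f : Diffeomorph (𝓡 d) (𝓡 d) X X ∞} :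
    IsContacto α f ↔ CarriesTo f α.kerField α.kerField := carriesTo_iff.symm

theorem carriesTo_of_eq_id {f : Diffeomorph (𝓡 d) (𝓡 d) X X ∞} (hf : ∀ x, f x = x)
    (G : PlaneField d X) : CarriesTo f G G := by
  have : f = Diffeomorph.refl (𝓡 d) X ∞ := Diffeomorph.ext hf
  subst this
  rw [carriesTo_iff]
  intro x v
  have h : mD (𝓡 d) (𝓡 d) (Diffeomorph.refl (𝓡 d) X ∞) x v = v := DFunLike.congr_fun (mD_id x) v
  rw [h]
  rfl

end Isotopies

/-- The class of `G t` is locally constant in `t`, and the line is connected. -/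
theorem eqvGen_of_locally {T : Type*} {r : T → T → Prop} {G : ℝ → T}
    (h : ∀ t₀, ∀ᶠ t in 𝓝 t₀, r (G t₀) (G t)) (a b : ℝ) : Relation.EqvGen r (G a) (G b) := by
  have hlc : IsLocallyConstant fun t => (Quotient.mk (Relation.EqvGen.setoid r) (G t)) := by
    rw [IsLocallyConstant.iff_eventually_eq]
    intro t₀
    filter_upwards [h t₀] with t ht
    exact (Quotient.sound (s := Relation.EqvGen.setoid r) (Relation.EqvGen.rel _ _ ht)).symm
  exact Quotient.exact (s := Relation.EqvGen.setoid r)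
    (hlc.apply_eq_of_isPreconnected isPreconnected_univ (mem_univ a) (mem_univ b))

/-! ### Independence of the size of moves; from contact isotopies to foliations -/

namespace StandardNbhd

variable {n d k : ℕ}
  {M : Type*} [TopologicalSpace M] [T2Space M] [ChartedSpace (ℰ d) M]
  [IsManifold (𝓡 d) ∞ M]
  {Y : Type*} [TopologicalSpace Y] [CompactSpace Y] [T2Space Y]
  [ChartedSpace (ℰ k) Y]
  [IsManifold (𝓡 k) ∞ Y]
  {α : OneForm d M} {ι : ContMDiffMap (𝓡 k) (𝓡 d) Y M ∞} {L : PlaneField k Y}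
  {R : Y → ℰ k} {𝒩 : StandardNbhd α ι L}

theorem line_mem_ball {t₀ t ε u : ℝ} (ht : t ∈ Metric.ball t₀ ε) (hu : u ∈ Icc (0 : ℝ) 1) :
    t₀ + u * (t - t₀) ∈ Metric.ball t₀ ε := by
  rw [Metric.mem_ball, Real.dist_eq] at ht ⊢
  rw [add_sub_cancel_left, abs_mul, abs_of_nonneg hu.1]
  exact (mul_le_of_le_one_left (abs_nonneg _) hu.2).trans_lt ht

/-- A large move of foliations is a composition of small ones. -/
theorem FoliationMove.gauge {G₀ G₁ : 𝒩.foliations} (h : 𝒩.FoliationMove univ G₀.1 G₁.1)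
    {𝒲 : Set (ContMDiffMap (𝓡 k) (𝓡 k) Y Y ∞)} (h𝒲 : 𝒲 ∈ c1Nhds ContMDiffMap.id) :
    𝒩.foliationGauge 𝒲 G₀ G₁ := by
  obtain ⟨ψ, hψ, hG, h1⟩ := h
  have hφ := hψ.contMDiff_reparam
  set φ : ℝ → Diffeomorph (𝓡 k) (𝓡 k) Y Y ∞ := fun t => ψ (Real.smoothTransition t) with hφdef
  choose G hGm hGc using fun t => (hG _ (smoothTransition_mem_Icc t)).2
  have e0 : G 0 = G₀.1 := by
    refine (hGc 0).unique (carriesTo_of_eq_id (fun x => ?_) _)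
    rw [Real.smoothTransition.zero]
    exact hψ.2 x
  have e1 : G 1 = G₁.1 := by
    refine (hGc 1).unique ?_
    rw [Real.smoothTransition.one]
    exact h1
  -- The step from `G t₀` to `G t` uses the maps `φ_r φ_{t₀}⁻¹` with `r` on the segment from `t₀` to
  -- `t`; the segment stays in the ball where these maps belong to `𝒲`.
  have key := eqvGen_of_locally (r := fun G₀ G₁ : 𝒩.foliations => 𝒩.FoliationMove 𝒲 G₀ G₁)
    (G := fun t => ⟨G t, hGm t⟩) (fun t₀ => by
      obtain ⟨ε, hε, hb⟩ := Metric.eventually_nhds_iff_ball.1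
        ((tendsto_symm_trans (φ := φ) hφ t₀).eventually h𝒲)
      filter_upwards [Metric.ball_mem_nhds t₀ hε] with t ht
      refine ⟨_, contMDiff_symm_trans_line (φ := φ) hφ t₀ t, fun u hu => ⟨hb _ (line_mem_ball ht hu), _,
        hGm (t₀ + u * (t - t₀)), (hGc t₀).symm_trans (hGc _)⟩, ?_⟩
      have : t₀ + 1 * (t - t₀) = t := by ring
      rw [this]
      exact (hGc t₀).symm_trans (hGc t)) 0 1
  have hG0 : (⟨G 0, hGm 0⟩ : 𝒩.foliations) = G₀ := Subtype.ext e0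
  have hG1 : (⟨G 1, hGm 1⟩ : 𝒩.foliations) = G₁ := Subtype.ext e1
  rw [hG0, hG1] at key
  exact key

/-- A large move of coisotropic submanifolds is a composition of small ones. -/
theorem CoisotropicMove.gauge {S₀ S₁ : 𝒩.coisotropics} (h : 𝒩.CoisotropicMove univ S₀.1 S₁.1)
    {𝒲 : Set (ContMDiffMap (𝓡 d) (𝓡 d) M M ∞)} (h𝒲 : 𝒲 ∈ c1Nhds ContMDiffMap.id) :
    𝒩.coisotropicGauge 𝒲 S₀ S₁ := by
  obtain ⟨ψ, hψ, ⟨K, hKN, hK, hfix⟩, hS, h1⟩ := h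
  have hφ := hψ.contMDiff_reparam
  set φ : ℝ → Diffeomorph (𝓡 d) (𝓡 d) M M ∞ := fun t => ψ (Real.smoothTransition t) with hφdef
  have hφK : ∀ t, ∀ z ∉ K, φ t z = z := fun t => hfix _ (smoothTransition_mem_Icc t)
  have hφS : ∀ t, IsContacto α (φ t) ∧ φ t '' S₀ ∈ 𝒩.coisotropics := fun t =>
    ⟨(hS _ (smoothTransition_mem_Icc t)).1, (hS _ (smoothTransition_mem_Icc t)).2.2⟩
  have himg : ∀ s t, ((φ s).symm.trans (φ t)) '' (φ s '' S₀.1) = φ t '' S₀.1 := by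
    intro s t
    rw [image_image]
    exact image_congr fun z _ => congrArg (φ t) ((φ s).symm_apply_apply z)
  have key := eqvGen_of_locally (r := fun S₀ S₁ : 𝒩.coisotropics => 𝒩.CoisotropicMove 𝒲 S₀ S₁)
    (G := fun t => ⟨φ t '' S₀.1, (hφS t).2⟩) (fun t₀ => by
      obtain ⟨ε, hε, hb⟩ := Metric.eventually_nhds_iff_ball.1
        ((tendsto_symm_trans (φ := φ) hφ t₀).eventually h𝒲)
      filter_upwards [Metric.ball_mem_nhds t₀ hε] with t ht
      refine ⟨_, contMDiff_symm_trans_line (φ := φ) hφ t₀ t, ⟨K, hKN, hK, fun u hu z hz => ?_⟩,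
        fun u hu => ⟨?_, hb _ (line_mem_ball ht hu), ?_⟩, ?_⟩
      · have : (φ t₀).symm z = z := by
          conv_lhs => rw [← hφK t₀ z hz]
          exact (φ t₀).symm_apply_apply z
        exact (congrArg _ this).trans (hφK _ z hz)
      · exact isContacto_iff.2 ((isContacto_iff.1 (hφS t₀).1).symm_trans
          (isContacto_iff.1 (hφS _).1))
      · rw [himg]; exact (hφS _).2
      · have : t₀ + 1 * (t - t₀) = t := by ring
        rw [this]
        exact himg t₀ t) 0 1
  have hG0 : (⟨φ 0 '' S₀.1, (hφS 0).2⟩ : 𝒩.coisotropics) = S₀ := by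
    refine Subtype.ext ?_
    have : ∀ z, φ 0 z = z := fun z => by
      simp only [hφdef, Real.smoothTransition.zero]; exact hψ.2 z
    simp only [this, image_id']
  have hG1 : (⟨φ 1 '' S₀.1, (hφS 1).2⟩ : 𝒩.coisotropics) = S₁ := by
    refine Subtype.ext ?_
    simp only [hφdef, Real.smoothTransition.one]
    exact h1
  rw [hG0, hG1] at key
  exact key

variable [Nonempty M]

/-- A contact isotopy moving coisotropic graphs induces an isotopy moving the foliations. -/
theorem CoisotropicMove.foliationMove (hR : IsTransverseSection (α.pullback ι) L R)
    (hdk : d + 1 = k + k) {e : 𝒩.coisotropics ≃ 𝒩.foliations}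
    (he : ∀ (S : 𝒩.coisotropics) (s : OneForm k Y), 𝒩.IsSection s → S.1 = 𝒩.graph s →
          (e S).1 = (α.pullback ι - s).kerField)
    {S₀ S₁ : 𝒩.coisotropics} (h : 𝒩.CoisotropicMove univ S₀.1 S₁.1) :
    𝒩.FoliationMove univ (e S₀).1 (e S₁).1 := by
  obtain ⟨φ, hφ, -, hS, h1⟩ := h
  obtain ⟨⟨s₀, hs₀, hS₀⟩, -⟩ := S₀.2
  have hsec : ∀ t ∈ Icc (0 : ℝ) 1, ∃ s, 𝒩.IsSection s ∧ φ t '' S₀.1 = 𝒩.graph s := fun t ht =>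
    (hS t ht).2.2.1
  have hmem : ∀ t ∈ Icc (0 : ℝ) 1, ∀ y, φ t (𝒩.embed s₀ y) ∈ 𝒩.N := by
    intro t ht y
    obtain ⟨s, hs, hst⟩ := hsec t ht
    have : φ t (𝒩.embed s₀ y) ∈ 𝒩.graph s := by
      rw [← hst, hS₀, ← hs₀.range_embed]
      exact mem_image_of_mem _ (mem_range_self y)
    exact this.1
  have hj := hs₀.contMDiff_embed hR hdk
  -- The point of the original graph over `y` is moved to a point over `D y`. Since `φ t` preserves
  -- the contact planes, `D` carries the kernel of `λ - s₀` to that of `λ - s`.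
  have hex : ∀ t ∈ Icc (0 : ℝ) 1, ∃ D : Diffeomorph (𝓡 k) (𝓡 k) Y Y ∞,
      (∀ y, D y = 𝒩.proj (φ t (𝒩.embed s₀ y))) ∧ ∀ s, 𝒩.IsSection s → φ t '' S₀.1 = 𝒩.graph s →
        CarriesTo D (α.pullback ι - s₀).kerField (α.pullback ι - s).kerField := by
    intro t ht
    obtain ⟨s, hs, hst⟩ := hsec t ht
    let u : Y → Y := fun y => 𝒩.proj (φ t (𝒩.embed s₀ y))
    have hu : ContMDiff (𝓡 k) (𝓡 k) ∞ u := fun y =>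
      ContMDiffAt.comp (f := fun y => φ t (𝒩.embed s₀ y)) y (𝒩.contMDiffAt_projN (hmem t ht y))
        (((φ t).contMDiff.comp hj) y)
    have hgr : range (fun y => φ t (𝒩.embed s₀ y)) = 𝒩.graph s := by
      rw [← hst, hS₀, ← hs₀.range_embed, ← range_comp]; rfl
    have hju : ∀ y, φ t (𝒩.embed s₀ y) = 𝒩.embed s (u y) := fun y =>
      ((hs.mem_graph_iff).1 (by rw [← hgr]; exact mem_range_self y)).2.symm
    have hD : ∀ y v, mD (𝓡 d) (𝓡 d) (φ t) (𝒩.embed s₀ y) (mD (𝓡 k) (𝓡 d) (𝒩.embed s₀) y v) =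
        mD (𝓡 k) (𝓡 d) (𝒩.embed s) (u y) (mD (𝓡 k) (𝓡 k) u y v) := by
      intro y v
      have e1 := mD_comp (g := φ t) (f := 𝒩.embed s₀) (x := y)
        ((φ t).contMDiff.mdifferentiable (by simp) _) (hj.mdifferentiable (by simp) y) rfl
      have e2 := mD_comp (g := 𝒩.embed s) (f := u) (x := y)
        ((hs.contMDiff_embed hR hdk).mdifferentiable (by simp) _)
        (hu.mdifferentiable (by simp) y) rfl
      rw [mD_congr (Filter.Eventually.of_forall hju), e2] at e1
      exact (DFunLike.congr_fun e1 v).symm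
    have hinj : ∀ y, Function.Injective (mD (𝓡 k) (𝓡 k) u y) := by
      intro y v w hvw
      have e1 := hD y v
      rw [hvw, ← hD y w] at e1
      have e2 := Function.LeftInverse.injective ((φ t).mD_symm_apply (𝒩.embed s₀ y)) e1
      exact Function.LeftInverse.injective (hs₀.mD_proj_embed hR hdk y) e2
    obtain ⟨D, hDu⟩ := exists_diffeomorph hu ⟨fun y y' hyy => by
        have : φ t (𝒩.embed s₀ y) = φ t (𝒩.embed s₀ y') := by rw [hju, hju, hyy]
        exact Function.LeftInverse.injective hs₀.proj_embed ((φ t).injective this),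
      fun y => by
        have : 𝒩.embed s y ∈ range (fun y => φ t (𝒩.embed s₀ y)) := by
          rw [hgr, ← hs.range_embed]; exact mem_range_self y
        obtain ⟨y', hy'⟩ := this
        exact ⟨y', (congrArg 𝒩.proj hy').trans (hs.proj_embed y)⟩⟩
      fun y => ⟨hinj y, LinearMap.surjective_of_injective
        (f := (mD (𝓡 k) (𝓡 k) u y).toLinearMap) (hinj y)⟩
    refine ⟨D, fun y => congrFun hDu y, fun s' hs' hst' => ?_⟩
    have hker : (α.pullback ι - s').kerField = (α.pullback ι - s).kerField := by
      have hc := (hS t ht).2.2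
      rw [← he ⟨_, hc⟩ s' hs' hst', he ⟨_, hc⟩ s hs hst]
    rw [hker, carriesTo_kerField_iff]
    intro y v
    rw [hDu, ← hs.cov_pullback_eq_zero_iff hR hdk, ← hs₀.cov_pullback_eq_zero_iff hR hdk]
    change α.cov (𝒩.embed s (u y)) (mD (𝓡 k) (𝓡 d) (𝒩.embed s) (u y) (mD (𝓡 k) (𝓡 k) u y v)) = 0 ↔
      α.cov (𝒩.embed s₀ y) (mD (𝓡 k) (𝓡 d) (𝒩.embed s₀) y v) = 0
    rw [← hD, ← hju]
    exact (hS t ht).1 _ _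
  classical
  -- Outside `[0, 1]` nothing is known about the moved graph, and the identity is a harmless
  -- default.
  let D : ℝ → Diffeomorph (𝓡 k) (𝓡 k) Y Y ∞ := fun t =>
    if ht : t ∈ Icc (0 : ℝ) 1 then (hex t ht).choose else Diffeomorph.refl (𝓡 k) Y ∞
  have hD1 : ∀ t ∈ Icc (0 : ℝ) 1, ∀ y, D t y = 𝒩.proj (φ t (𝒩.embed s₀ y)) := by
    intro t ht
    simp only [D, dif_pos ht]
    exact (hex t ht).choose_spec.1
  have hD2 : ∀ t ∈ Icc (0 : ℝ) 1, ∀ S : 𝒩.coisotropics, φ t '' S₀.1 = S.1 →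
      CarriesTo (D t) (e S₀).1 (e S).1 := by
    intro t ht S hSt
    obtain ⟨⟨s, hs, hSs⟩, -⟩ := S.2
    rw [he S₀ s₀ hs₀ hS₀, he S s hs hSs]
    simp only [D, dif_pos ht]
    exact (hex t ht).choose_spec.2 s hs (hSt.trans hSs)
  refine ⟨D, ⟨?_, fun y => ?_⟩, fun t ht => ⟨mem_univ _, ?_⟩, hD2 1 (by simp) S₁ h1⟩
  · have h2 : ContMDiffOn (𝓘(ℝ, ℝ).prod (𝓡 k)) (𝓡 d) ∞
        (fun p : ℝ × Y => φ p.1 (𝒩.embed s₀ p.2)) (Icc 0 1 ×ˢ univ) :=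
      hφ.1.comp (contMDiff_fst.prodMk (hj.comp contMDiff_snd)).contMDiffOn
        fun p hp => ⟨hp.1, mem_univ _⟩
    have h3 : ContMDiffOn (𝓘(ℝ, ℝ).prod (𝓡 k)) (𝓡 k) ∞
        (fun p : ℝ × Y => 𝒩.proj (φ p.1 (𝒩.embed s₀ p.2))) (Icc 0 1 ×ˢ univ) := fun p hp =>
      ContMDiffAt.comp_contMDiffWithinAt (g := 𝒩.proj) p
        (𝒩.contMDiffAt_projN (hmem p.1 hp.1 p.2)) (h2 p hp)
    exact h3.congr fun p hp => hD1 p.1 hp.1 p.2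
  · rw [hD1 0 (by simp), hφ.2, hs₀.proj_embed]
  · exact ⟨(e ⟨_, (hS t ht).2.2⟩).1, (e ⟨_, (hS t ht).2.2⟩).2, hD2 t ht ⟨_, (hS t ht).2.2⟩ rfl⟩

theorem FoliationMove.mono {G₀ G₁ : PlaneField k Y} {𝒲 : Set (ContMDiffMap (𝓡 k) (𝓡 k) Y Y ∞)}
    (h : 𝒩.FoliationMove 𝒲 G₀ G₁) : 𝒩.FoliationMove univ G₀ G₁ := by
  obtain ⟨ψ, h1, h2, h3⟩ := h
  exact ⟨ψ, h1, fun t ht => ⟨mem_univ _, (h2 t ht).2⟩, h3⟩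

theorem CoisotropicMove.mono {S₀ S₁ : Set M} {𝒲 : Set (ContMDiffMap (𝓡 d) (𝓡 d) M M ∞)}
    (h : 𝒩.CoisotropicMove 𝒲 S₀ S₁) : 𝒩.CoisotropicMove univ S₀ S₁ := by
  obtain ⟨φ, h1, h2, h3, h4⟩ := h
  exact ⟨φ, h1, h2, fun t ht => ⟨(h3 t ht).1, mem_univ _, (h3 t ht).2.2⟩, h4⟩

/-- A bijection exchanging moves induces a bijection of the sets of gauge classes. -/
theorem exists_quotient_equiv {e : 𝒩.coisotropics ≃ 𝒩.foliations}
    (h1 : ∀ S₀ S₁ : 𝒩.coisotropics, 𝒩.CoisotropicMove univ S₀.1 S₁.1 ↔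
      𝒩.FoliationMove univ (e S₀).1 (e S₁).1) (𝒰 : Set 𝒩.coisotropics)
    {𝒲 : Set (ContMDiffMap (𝓡 d) (𝓡 d) M M ∞)} (h𝒲 : 𝒲 ∈ c1Nhds ContMDiffMap.id)
    {𝒲' : Set (ContMDiffMap (𝓡 k) (𝓡 k) Y Y ∞)} (h𝒲' : 𝒲' ∈ c1Nhds ContMDiffMap.id) :
    ∃ ē : Quotient ((𝒩.coisotropicGauge 𝒲).comap (Subtype.val : 𝒰 → 𝒩.coisotropics)) ≃
        Quotient ((𝒩.foliationGauge 𝒲').comap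
          (Subtype.val : (e '' 𝒰 : Set 𝒩.foliations) → 𝒩.foliations)),
      ∀ (S : 𝒩.coisotropics) (hS : S ∈ 𝒰),
        ē (Quotient.mk _ ⟨S, hS⟩) = Quotient.mk _ ⟨e S, mem_image_of_mem e hS⟩ := by
  -- A generator inside `𝒲` is in particular an unrestricted move; its counterpart for foliations is
  -- again an unrestricted move, which is then cut into moves inside `𝒲'`.
  have h2 : ∀ S₀ S₁ : 𝒩.coisotropics, 𝒩.coisotropicGauge 𝒲 S₀ S₁ →
      𝒩.foliationGauge 𝒲' (e S₀) (e S₁) := by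
    intro S₀ S₁ h
    induction h with
    | rel S S' h => exact ((h1 S S').1 h.mono).gauge h𝒲'
    | refl S => exact Setoid.refl' _ _
    | symm S S' _ ih => exact Setoid.symm' _ ih
    | trans S S' S'' _ _ ih ih' => exact Setoid.trans' _ ih ih'
  have h3 : ∀ G₀ G₁ : 𝒩.foliations, 𝒩.foliationGauge 𝒲' G₀ G₁ →
      𝒩.coisotropicGauge 𝒲 (e.symm G₀) (e.symm G₁) := by
    intro G₀ G₁ h
    induction h with
    | rel G G' h =>
      refine ((h1 _ _).2 ?_).gauge h𝒲
      rw [e.apply_symm_apply, e.apply_symm_apply]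
      exact h.mono
    | refl S => exact Setoid.refl' _ _
    | symm S S' _ ih => exact Setoid.symm' _ ih
    | trans S S' S'' _ _ ih ih' => exact Setoid.trans' _ ih ih'
  refine ⟨Quotient.congr (e.image 𝒰) fun S S' => ⟨h2 S.1 S'.1, fun h => ?_⟩, fun S hS => rfl⟩
  have := h3 _ _ h
  change 𝒩.coisotropicGauge 𝒲 (e.symm (e S.1)) (e.symm (e S'.1)) at this
  rwa [e.symm_apply_apply, e.symm_apply_apply] at this

end StandardNbhd

/-! ### Smooth families of maps, their velocities and inverses -/

section Families

variable {E : Type*} [NormedAddCommGroup E] [NormedSpace ℝ E] [FiniteDimensional ℝ E]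
  {H : Type*} [TopologicalSpace H]
  {I : ModelWithCorners ℝ E H} [I.Boundaryless]
  {X : Type*} [TopologicalSpace X] [ChartedSpace H X] [IsManifold I ∞ X]
  {E' : Type*} [NormedAddCommGroup E'] [NormedSpace ℝ E'] [FiniteDimensional ℝ E']
  {H' : Type*} [TopologicalSpace H']
  {I' : ModelWithCorners ℝ E' H'} [I'.Boundaryless]
  {X' : Type*} [TopologicalSpace X'] [ChartedSpace H' X'] [IsManifold I' ∞ X']
  {E'' : Type*} [NormedAddCommGroup E''] [NormedSpace ℝ E''] {H'' : Type*} [TopologicalSpace H'']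
  {J : ModelWithCorners ℝ E'' H''}
  {Z : Type*} [TopologicalSpace Z] [ChartedSpace H'' Z] [IsManifold J ∞ Z]

/-- The derivatives of a smooth family of maps depend smoothly on the parameters. -/
theorem contMDiffAt_chartMD_family {f : Z → X → X'} {g : Z → X} {a : Z}
    (hf : ContMDiffAt (J.prod I) I' ∞ (Function.uncurry f) (a, g a))
    (hg : ContMDiffAt J I ∞ g a) :
    ContMDiffAt J 𝓘(ℝ, E →L[ℝ] E') ∞
      (fun z => chartMD I I' (g a) (f a (g a)) (f z) (g z)) a := by
  have : IsManifold J 1 Z := isManifold_one J Z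
  have : IsManifold I 1 X := isManifold_one I X
  have : IsManifold I' 1 X' := isManifold_one I' X'
  have h := ContMDiffAt.mfderiv (m := ∞) f g hf hg (by simp)
  refine h.congr_of_eventuallyEq ?_
  have hfg : ContinuousAt (fun z => f z (g z)) a :=
    ContinuousAt.comp (f := fun z => (z, g z)) (g := Function.uncurry f) hf.continuousAt
      (continuousAt_id.prodMk hg.continuousAt)
  filter_upwards [hg.continuousAt.preimage_mem_nhds (chart_source_nhds (mem_chart_source H (g a))),
    hfg.preimage_mem_nhds (chart_source_nhds (mem_chart_source H' (f a (g a))))] with z hz hz'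
  have e1 := TangentBundle.symmL_trivializationAt (I := I) hz
  have e2 := TangentBundle.continuousLinearMapAt_trivializationAt (I := I') hz'
  rw [I.range_eq_univ, mfderivWithin_univ] at e1
  ext v
  simp only [inTangentCoordinates, ContinuousLinearMap.inCoordinates, e1, e2]
  rfl

/-- The velocities of a smooth family of curves depend smoothly on the parameters. -/
theorem contMDiffAt_velocity {g : ℝ × X → X'} {p : ℝ × X}
    (hg : ContMDiffAt (𝓘(ℝ, ℝ).prod I) I' ∞ g p) :
    ContMDiffAt (𝓘(ℝ, ℝ).prod I) I'.tangent ∞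
      (fun q : ℝ × X => mkTan I' (g q) (mD 𝓘(ℝ, ℝ) I' (fun s => g (s, q.2)) q.1 1)) p := by
  have h1 := contMDiffAt_chartMD_family (J := 𝓘(ℝ, ℝ).prod I) (I := 𝓘(ℝ, ℝ)) (I' := I') (a := p)
    (f := fun (q : ℝ × X) (s : ℝ) => g (s, q.2)) (g := fun q => q.1)
    (ContMDiffAt.comp (f := fun r : (ℝ × X) × ℝ => (r.2, r.1.2)) (p, p.1) hg
      (contMDiffAt_snd.prodMk (contMDiffAt_snd.comp _ contMDiffAt_fst))) contMDiffAt_fst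
  have h2 : ContMDiffAt (𝓘(ℝ, ℝ).prod I) 𝓘(ℝ, E') ∞ (fun q : ℝ × X =>
      chartMD 𝓘(ℝ, ℝ) I' p.1 (g p) (fun s => g (s, q.2)) q.1 1) p :=
    h1.clm_apply contMDiffAt_const
  refine (contMDiffAt_tangent_iff le_rfl (x₀ := g p) (mem_chart_source H' (g p))).2 ⟨hg, ?_⟩
  refine h2.congr_of_eventuallyEq (Filter.Eventually.of_forall fun q => ?_)
  have e1 : chartDInv 𝓘(ℝ, ℝ) p.1 q.1 (1 : ℝ) = 1 := by
    have : chartDInv 𝓘(ℝ, ℝ) p.1 q.1 = ContinuousLinearMap.id ℝ ℝ := chartDInv_self (I := 𝓘(ℝ, ℝ)) q.1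
    rw [this]; rfl
  change chartD I' (g p) (g q) (mD 𝓘(ℝ, ℝ) I' (fun s => g (s, q.2)) q.1 1) =
    chartD I' (g p) (g (q.1, q.2))
      (mD 𝓘(ℝ, ℝ) I' (fun s => g (s, q.2)) q.1 (chartDInv 𝓘(ℝ, ℝ) p.1 q.1 (1 : ℝ)))
  rw [e1]

/-- The map `(t, x) ↦ (t, φ t x)` is a bijection with invertible derivatives, so its inverse is
smooth jointly in both variables. -/
theorem contMDiff_symm_family {φ : ℝ → Diffeomorph I I X X ∞}
    (hφ : ContMDiff (𝓘(ℝ, ℝ).prod I) I ∞ (fun p : ℝ × X => φ p.1 p.2)) :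
    ContMDiff (𝓘(ℝ, ℝ).prod I) I ∞ (fun p : ℝ × X => (φ p.1).symm p.2) := by
  let Q : ℝ × X → ℝ × X := fun p => (p.1, φ p.1 p.2)
  have hQ : ContMDiff (𝓘(ℝ, ℝ).prod I) (𝓘(ℝ, ℝ).prod I) ∞ Q := contMDiff_fst.prodMk hφ
  have hinj : ∀ p, Function.Injective (mD (𝓘(ℝ, ℝ).prod I) (𝓘(ℝ, ℝ).prod I) Q p) := by
    rintro ⟨t, x⟩
    rw [injective_iff_map_eq_zero]
    rintro ⟨a, v⟩ h
    have hQd := hQ.mdifferentiable (by simp) (t, x)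
    have e1 := mD_comp (g := Prod.fst) (I'' := 𝓘(ℝ, ℝ)) mdifferentiableAt_fst hQd rfl
    have e2 : mD (𝓘(ℝ, ℝ).prod I) 𝓘(ℝ, ℝ) (fun q : ℝ × X => q.1) (t, x) (a, v) = a :=
      DFunLike.congr_fun (mfderiv_fst (I := 𝓘(ℝ, ℝ)) (I' := I) (x := (t, x))) (a, v)
    have e3 : mD (𝓘(ℝ, ℝ).prod I) 𝓘(ℝ, ℝ) (fun q : ℝ × X => q.1) (t, x) (a, v) = 0 := by
      refine (DFunLike.congr_fun e1 (a, v)).trans ?_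
      rw [ContinuousLinearMap.comp_apply, h, map_zero]
    obtain rfl : a = 0 := e2.symm.trans e3
    have e4 := mD_comp (f := fun x : X => (t, x)) (I := I) (x := x) hQd
      (mdifferentiableAt_const.prodMk mdifferentiableAt_id) rfl
    have e5 := mD_comp (g := Prod.snd) (I'' := I) (f := fun x : X => Q (t, x)) (x := x)
      mdifferentiableAt_snd
      ((hQd.comp x (mdifferentiableAt_const.prodMk mdifferentiableAt_id)) :
        MDifferentiableAt I (𝓘(ℝ, ℝ).prod I) (fun x => Q (t, x)) x) rfl
    have e6 : mD I (𝓘(ℝ, ℝ).prod I) (fun x : X => (t, x)) x v = (0, v) :=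
      DFunLike.congr_fun (mfderiv_prod_right (I := 𝓘(ℝ, ℝ)) (I' := I) (x₀ := t) (y₀ := x)) v
    have e7 : mD I I (φ t) x v = 0 := by
      refine (DFunLike.congr_fun e5 v).trans ?_
      rw [ContinuousLinearMap.comp_apply, e4, ContinuousLinearMap.comp_apply, e6, h, map_zero]
    have e8 := (φ t).mD_symm_apply x v
    rw [e7, map_zero] at e8
    rw [← e8]; rfl
  obtain ⟨D, hD⟩ := exists_diffeomorph hQ
    ⟨fun p q h => by
      obtain ⟨h1, h2⟩ := Prod.mk.inj h
      rw [h1] at h2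
      exact Prod.ext h1 ((φ q.1).injective h2),
    fun p => ⟨(p.1, (φ p.1).symm p.2), Prod.ext rfl ((φ p.1).apply_symm_apply p.2)⟩⟩
    fun p => ⟨hinj p, LinearMap.surjective_of_injective
      (f := (mD (𝓘(ℝ, ℝ).prod I) (𝓘(ℝ, ℝ).prod I) Q p).toLinearMap) (hinj p)⟩
  have hs : ∀ p : ℝ × X, (φ p.1).symm p.2 = (D.symm p).2 := by
    intro p
    have h1 : D (p.1, (φ p.1).symm p.2) = p := by
      rw [hD]; exact Prod.ext rfl ((φ p.1).apply_symm_apply p.2)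
    conv_rhs => rw [← h1, D.symm_apply_apply]
  exact (contMDiff_snd.comp D.symm.contMDiff).congr hs

end Families

/-! ### Transport of covectors and generators of contact families -/

section Cotangent

variable {d : ℕ} {X : Type*} [TopologicalSpace X] [ChartedSpace (ℰ d) X]
  [IsManifold (𝓡 d) ∞ X]
  {E'' : Type*} [NormedAddCommGroup E''] [NormedSpace ℝ E''] {H'' : Type*} [TopologicalSpace H'']
  {J : ModelWithCorners ℝ E'' H''}
  {Z : Type*} [TopologicalSpace Z] [ChartedSpace H'' Z] [IsManifold J ∞ Z]

/-- The action of a diffeomorphism on covectors. -/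
def transportCot (f : Diffeomorph (𝓡 d) (𝓡 d) X X ∞) (p : CotangentTotal d X) :
    CotangentTotal d X :=
  mkCot (f p.proj) (p.cov.comp (mD (𝓡 d) (𝓡 d) f.symm (f p.proj)))

theorem contMDiffAt_transportCot {φ : ℝ → Diffeomorph (𝓡 d) (𝓡 d) X X ∞}
    (hφ : ContMDiff (𝓘(ℝ, ℝ).prod (𝓡 d)) (𝓡 d) ∞ (fun p : ℝ × X => φ p.1 p.2))
    {u : Z → CotangentTotal d X} {r : Z → ℝ} {a : Z}
    (hu : ContMDiffAt J (cotangentModel d) ∞ u a) (hr : ContMDiffAt J 𝓘(ℝ, ℝ) ∞ r a) :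
    ContMDiffAt J (cotangentModel d) ∞ (fun z => transportCot (φ (r z)) (u z)) a := by
  have hy : ContMDiffAt J (𝓡 d) ∞ (fun z => φ (r z) (u z).proj) a :=
    (hφ _).comp a (hr.prodMk (contMDiffAt_proj le_rfl hu))
  have hsm : ContMDiffAt (J.prod (𝓡 d)) (𝓡 d) ∞
      (Function.uncurry fun (z : Z) (x : X) => (φ (r z)).symm x) (a, φ (r a) (u a).proj) :=
    ContMDiffAt.comp (f := fun q : Z × X => (r q.1, q.2)) _ (contMDiff_symm_family hφ _)
      ((hr.comp (a, φ (r a) (u a).proj) contMDiffAt_fst).prodMk contMDiffAt_snd)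
  have h1 := contMDiffAt_chartMD_family hsm hy
  have hinv : ∀ z, (φ (r z)).symm (φ (r z) (u z).proj) = (u z).proj := fun z =>
    (φ (r z)).symm_apply_apply _
  have h2 := ((contMDiffAt_cotangent_iff le_rfl (x₀ := (u a).proj)
    (mem_chart_source (ℰ d) (u a).proj)).1 hu)
  refine (contMDiffAt_mkCot_iff (y := fun z => φ (r z) (u z).proj) le_rfl
    (x₀ := φ (r a) (u a).proj) (mem_chart_source _ _)).2 ⟨hy, ?_⟩
  refine (h2.2.clm_comp h1).congr_of_eventuallyEq ?_
  filter_upwards [h2.1.continuousAt.preimage_mem_nhds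
    (chart_source_nhds (mem_chart_source (ℰ d) (u a).proj))] with z hz
  ext v
  simp only [chartMD, ContinuousLinearMap.comp_apply, hinv, cotCoord]
  rw [chartDInv_chartD_apply hz]

/-- The generator of a family of maps preserving the contact planes is a contact vector field. -/
theorem extL_generator {α : OneForm d X} {g : ℝ × X → X} {t : ℝ} {x : X}
    (hg : ContMDiffAt (𝓘(ℝ, ℝ).prod (𝓡 d)) (𝓡 d) ∞ g (t, x)) {h : X → ℝ}
    (hh : MDifferentiableAt (𝓡 d) 𝓘(ℝ, ℝ) h (g (t, x))) {w : ℰ d}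
    (hker : ∀ᶠ s in 𝓝 t, α.cov (g (s, x)) (mD (𝓡 d) (𝓡 d) (fun z => g (s, z)) x w) = 0)
    (hval : ∀ᶠ z in 𝓝 x, α.cov (g (t, z)) (mD 𝓘(ℝ, ℝ) (𝓡 d) (fun s => g (s, z)) t 1) =
      h (g (t, z))) :
    α.extL (g (t, x)) (mD 𝓘(ℝ, ℝ) (𝓡 d) (fun s => g (s, x)) t 1)
        (mD (𝓡 d) (𝓡 d) (fun z => g (t, z)) x w) =
      -mD (𝓡 d) 𝓘(ℝ, ℝ) h (g (t, x)) (mD (𝓡 d) (𝓡 d) (fun z => g (t, z)) x w) := by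
  set φ := extChartAt (𝓡 d) x with hφ
  have hx := mem_chart_source (ℰ d) x
  have hφx : φ.symm (φ x) = x := extChartAt_symm_apply_self hx
  have hsymm : ContMDiffAt 𝓘(ℝ, ℰ d) (𝓡 d) ∞ φ.symm (φ x) :=
    contMDiffAt_extChartAt_symm hx
  have hsD : mD 𝓘(ℝ, ℰ d) (𝓡 d) φ.symm (φ x) = ContinuousLinearMap.id ℝ _ :=
    chartDInv_self (I := 𝓡 d) x
  let G : ℝ × ℰ d → X := fun q => g (q.1, φ.symm q.2)
  have hpair : ContMDiffAt 𝓘(ℝ, ℝ × ℰ d) (𝓘(ℝ, ℝ).prod (𝓡 d)) ∞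
      (fun q : ℝ × ℰ d => (q.1, φ.symm q.2)) (t, φ x) :=
    contDiff_fst.contDiffAt.contMDiffAt.prodMk
      (ContMDiffAt.comp (t, φ x) hsymm contDiff_snd.contDiffAt.contMDiffAt)
  have hG : ContMDiffAt 𝓘(ℝ, ℝ × ℰ d) (𝓡 d) ∞ G (t, φ x) :=
    ContMDiffAt.comp (t, φ x) (by rw [hφx]; exact hg) hpair
  have hGx : ∀ s, G (s, φ x) = g (s, x) := fun s => by simp only [G, hφx]
  have hspace : ∀ s w, MDifferentiableAt (𝓘(ℝ, ℝ).prod (𝓡 d)) (𝓡 d) g (s, x) →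
      mD 𝓘(ℝ, ℝ × ℰ d) (𝓡 d) G (s, φ x) (0, w) =
      mD (𝓡 d) (𝓡 d) (fun z => g (s, z)) x w := by
    intro s w hs
    have hGs : MDifferentiableAt 𝓘(ℝ, ℝ × ℰ d) (𝓡 d) G (s, φ x) :=
      MDifferentiableAt.comp (s, φ x) (f := fun q : ℝ × ℰ d => (q.1, φ.symm q.2))
        (by rw [hφx]; exact hs) ((contDiff_fst.contDiffAt.contMDiffAt.prodMk
        (ContMDiffAt.comp (s, φ x) hsymm contDiff_snd.contDiffAt.contMDiffAt)).mdifferentiableAt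
          (by simp : (∞ : WithTop ℕ∞) ≠ 0))
    have hst : MDifferentiableAt (𝓡 d) (𝓡 d) (fun z => g (s, z)) x :=
      hs.comp x (mdifferentiableAt_const.prodMk mdifferentiableAt_id)
    have h1 := mD_comp (f := fun e : ℰ d => (s, e)) hGs
      (hasFDerivAt_prodMk_right s (φ x)).differentiableAt.mdifferentiableAt rfl
    have h2 := mD_comp (f := φ.symm) hst (hsymm.mdiff) hφx
    rw [mD_eq_fderiv, (hasFDerivAt_prodMk_right s (φ x)).fderiv] at h1
    rw [hsD] at h2
    exact DFunLike.congr_fun (h1.symm.trans h2) w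
  have htime : ∀ e, MDifferentiableAt 𝓘(ℝ, ℝ × ℰ d) (𝓡 d) G (t, e) →
      mD 𝓘(ℝ, ℝ × ℰ d) (𝓡 d) G (t, e) (1, 0) =
        mD 𝓘(ℝ, ℝ) (𝓡 d) (fun s => g (s, φ.symm e)) t 1 := by
    intro e he
    have h3 := mD_comp (f := fun s : ℝ => (s, e)) he
      (hasFDerivAt_prodMk_left t e).differentiableAt.mdifferentiableAt rfl
    rw [mD_eq_fderiv, (hasFDerivAt_prodMk_left t e).fderiv] at h3
    exact (DFunLike.congr_fun h3 1).symm
  have hB : HasFDerivAt (pb α G) (fderiv ℝ (pb α G) (t, φ x)) (t, φ x) :=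
    ((contDiffAt_pb α hG).differentiableAt (by simp)).hasFDerivAt
  have hgd : ∀ᶠ p in 𝓝 (t, x), MDifferentiableAt (𝓘(ℝ, ℝ).prod (𝓡 d)) (𝓡 d) g p :=
    contMDiffAt_eventually_top hg
  -- The time derivative vanishes, as `α` vanishes on the image of `w` at all nearby times. The
  -- derivative in the direction `w` is that of the Hamiltonian. Their difference is `dα` of the
  -- generator and the image of `w`.
  have h1 : fderiv ℝ (pb α G) (t, φ x) (1, 0) (0, w) = 0 := by
    have hd := hB.hasDerivAt_comp_apply ((hasDerivAt_id t).prodMk (hasDerivAt_const t (φ x))) rfl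
      (0, w)
    refine hd.unique ((hasDerivAt_const t (0 : ℝ)).congr_of_eventuallyEq ?_)
    have hc : ContinuousAt (fun s : ℝ => (s, x)) t := by fun_prop
    filter_upwards [hker, hc.eventually hgd] with s hs hs'
    simp only [pb, ContinuousLinearMap.comp_apply]
    change α.cov (G (s, φ x)) (mD _ _ G (s, φ x) (0, w)) = 0
    rw [hspace s w hs', hGx]
    exact hs
  have h0 : (t, φ x + (0 : ℝ) • w) = (t, φ x) := by rw [zero_smul, add_zero]
  have h2 : fderiv ℝ (pb α G) (t, φ x) (0, w) (1, 0) =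
      mD (𝓡 d) 𝓘(ℝ, ℝ) h (g (t, x)) (mD (𝓡 d) (𝓡 d) (fun z => g (t, z)) x w) := by
    have hd := hB.hasDerivAt_comp_apply (hasDerivAt_const_prodMk_line t (φ x) w) h0 (1, 0)
    have hhd : HasDerivAt (fun r : ℝ => h (G (t, φ x + r • w)))
        (mD (𝓡 d) 𝓘(ℝ, ℝ) h (g (t, x)) (mD (𝓡 d) (𝓡 d) (fun z => g (t, z)) x w)) 0 := by
      have e1 : HasVelocity 𝓘(ℝ, ℝ × ℰ d) (fun r : ℝ => (t, φ x + r • w))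
          ((0 : ℝ), w) 0 := hasVelocity_iff_hasDerivAt.2 (hasDerivAt_const_prodMk_line t (φ x) w)
      have e2 := e1.comp (f := G) (I' := 𝓡 d) (by rw [h0]; exact hG.mdiff)
      have e3 := e2.comp (f := h) (I' := 𝓘(ℝ, ℝ)) (by rw [h0, hGx]; exact hh)
      rw [hasVelocity_iff_hasDerivAt, h0, hGx, hspace t w (hg.mdiff)] at e3
      exact e3
    refine hd.unique (hhd.congr_of_eventuallyEq ?_)
    have hc : ContinuousAt (fun r : ℝ => (t, φ x + r • w)) 0 := by fun_prop
    have hc2 : ContinuousAt (fun r : ℝ => φ.symm (φ x + r • w)) 0 := by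
      have e1 : ContinuousAt (fun r : ℝ => φ x + r • w) 0 := by fun_prop
      refine ContinuousAt.comp (g := φ.symm) ?_ e1
      rw [zero_smul, add_zero]; exact hsymm.continuousAt
    have hev1 : ∀ᶠ r : ℝ in 𝓝 0, MDifferentiableAt 𝓘(ℝ, ℝ × ℰ d) (𝓡 d) G
        (t, φ x + r • w) := by
      refine hc.eventually (p := fun q => MDifferentiableAt _ (𝓡 d) G q) ?_
      beta_reduce
      rw [h0]; exact contMDiffAt_eventually_top hG
    have hev2 : ∀ᶠ r : ℝ in 𝓝 0, α.cov (g (t, φ.symm (φ x + r • w)))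
        (mD 𝓘(ℝ, ℝ) (𝓡 d) (fun s => g (s, φ.symm (φ x + r • w))) t 1) =
          h (g (t, φ.symm (φ x + r • w))) := by
      refine hc2.eventually (p := fun z => α.cov (g (t, z)) (mD 𝓘(ℝ, ℝ) (𝓡 d)
        (fun s => g (s, z)) t 1) = h (g (t, z))) ?_
      beta_reduce
      rw [zero_smul, add_zero, hφx]; exact hval
    filter_upwards [hev1, hev2] with r hr1 hr2
    simp only [pb, ContinuousLinearMap.comp_apply]
    rw [htime _ hr1]
    exact hr2
  have h3 := dext_pb_extL α hG (1, 0) (0, w)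
  rw [hspace t w (hg.mdiff), htime _ (hG.mdiff), hGx,
    hφx, dext, h1, h2, zero_sub] at h3
  exact h3.symm

end Cotangent

section Cotangent

variable {k : ℕ} {Y : Type*} [TopologicalSpace Y] [ChartedSpace (ℰ k) Y]
  [IsManifold (𝓡 k) ∞ Y] {μ : OneForm k Y} {R : Y → ℰ k}

theorem fiberPairing_mkCot_smul (p : CotangentTotal k Y) (c : ℝ) :
    fiberPairing R (mkCot p.proj (c • p.cov)) = c * fiberPairing R p := rfl

theorem normalizeCot_mkCot_smul (p : CotangentTotal k Y) {c : ℝ} (hc : c ≠ 0) :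
    normalizeCot μ R (mkCot p.proj (c • p.cov)) = normalizeCot μ R p := by
  refine mkCot_eq_iff.2 ⟨rfl, ?_⟩
  change μ.cov p.proj - (c * fiberPairing R p)⁻¹ • (c • p.cov) =
    μ.cov p.proj - (fiberPairing R p)⁻¹ • p.cov
  rw [smul_smul, mul_inv, mul_comm c⁻¹, mul_assoc, inv_mul_cancel₀ hc, mul_one]

theorem transportCot_symm_transportCot (f : Diffeomorph (𝓡 k) (𝓡 k) Y Y ∞)
    (p : CotangentTotal k Y) (c : ℝ) :
    transportCot f.symm (mkCot (transportCot f p).proj (c • (transportCot f p).cov)) =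
      mkCot p.proj (c • p.cov) := by
  -- The base point is generalized so that it can be replaced at once in both components of the
  -- point of the bundle.
  have h : ∀ y, f.symm (f p.proj) = y → ∀ c' : ℰ* k,
      (c • p.cov).comp ((mD (𝓡 k) (𝓡 k) f.symm (f p.proj)).comp (mD (𝓡 k) (𝓡 k) f y)) = c' →
      (mkCot (f.symm (f p.proj)) ((c • p.cov).comp ((mD (𝓡 k) (𝓡 k) f.symm (f p.proj)).comp
        (mD (𝓡 k) (𝓡 k) f (f.symm (f p.proj))))) : CotangentTotal k Y) = mkCot y c' := by
    rintro y rfl c' rfl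
    rfl
  refine h p.proj (f.symm_apply_apply _) (c • p.cov) ?_
  ext v
  simp only [ContinuousLinearMap.comp_apply]
  rw [f.mD_symm_apply]

end Cotangent

/-! ### Lifting diffeomorphisms of `Y` to local contactomorphisms -/

namespace StandardNbhd

variable {n d k : ℕ}
  {M : Type*} [TopologicalSpace M] [T2Space M] [ChartedSpace (ℰ d) M]
  [IsManifold (𝓡 d) ∞ M]
  {Y : Type*} [TopologicalSpace Y] [CompactSpace Y] [T2Space Y]
  [ChartedSpace (ℰ k) Y]
  [IsManifold (𝓡 k) ∞ Y] [Nonempty M]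
  {α : OneForm d M} {ι : ContMDiffMap (𝓡 k) (𝓡 d) Y M ∞} {L : PlaneField k Y}
  {R : Y → ℰ k} (𝒩 : StandardNbhd α ι L)

/-- The covector of `Y` whose pullback by the projection has the kernel `ker α`. -/
def contactCovector (z : M) : CotangentTotal k Y :=
  mkCot (𝒩.proj z) ((α.pullback ι).cov (𝒩.proj z) - (𝒩.Θ z).cov)

theorem fiberPairing_contactCovector (hR : IsTransverseSection (α.pullback ι) L R) {z : M}
    (hz : z ∈ 𝒩.N) : fiberPairing R (𝒩.contactCovector z) = 1 := by
  have h1 : (𝒩.Θ z).cov (R (𝒩.proj z)) = 0 := 𝒩.fiberPairing_Θ hR hz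
  change ((α.pullback ι).cov (𝒩.proj z) - (𝒩.Θ z).cov) (R (𝒩.proj z)) = 1
  rw [sub_apply, hR.apply_eq_one, h1, sub_zero]

theorem normalizeCot_contactCovector (hR : IsTransverseSection (α.pullback ι) L R) {z : M}
    (hz : z ∈ 𝒩.N) : normalizeCot (α.pullback ι) R (𝒩.contactCovector z) = 𝒩.Θ z := by
  refine ((mkCot_eq_iff (p := 𝒩.Θ z)).2 ⟨rfl, ?_⟩).symm
  rw [𝒩.fiberPairing_contactCovector hR hz, inv_one, one_smul]
  exact (sub_sub_cancel _ _).symm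

theorem contMDiffAt_contactCovector {z : M} (hz : z ∈ 𝒩.N) :
    ContMDiffAt (𝓡 d) (cotangentModel k) ∞ 𝒩.contactCovector z :=
  ContMDiffAt.mkCot_sub (y := 𝒩.proj) (c := fun z => (α.pullback ι).cov (𝒩.proj z))
    (c' := fun z => (𝒩.Θ z).cov) le_rfl
    (((α.pullback ι).contMDiffAt_mkCot _).comp z (𝒩.contMDiffAt_projN hz)) (𝒩.contMDiffAt_Θ hz)

/-- The image in the cotangent bundle of the lift of a diffeomorphism. -/
def liftCot (R : Y → ℰ k) (f : Diffeomorph (𝓡 k) (𝓡 k) Y Y ∞) (z : M) :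
    CotangentTotal k Y :=
  normalizeCot (α.pullback ι) R (transportCot f (𝒩.contactCovector z))

/-- The lift of a diffeomorphism of `Y` to a contactomorphism between open subsets of the standard
neighbourhood. -/
def lift (R : Y → ℰ k) (f : Diffeomorph (𝓡 k) (𝓡 k) Y Y ∞) (z : M) : M :=
  𝒩.inv (𝒩.liftCot R f z)

/-- The lift of `f` is defined at `z`. -/
structure LiftsAt (R : Y → ℰ k) (f : Diffeomorph (𝓡 k) (𝓡 k) Y Y ∞) (z : M) :
    Prop where
  mem : z ∈ 𝒩.N
  ne_zero : fiberPairing R (transportCot f (𝒩.contactCovector z)) ≠ 0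
  liftCot_mem : 𝒩.liftCot R f z ∈ 𝒩.Θ '' 𝒩.N

variable {𝒩} {f : Diffeomorph (𝓡 k) (𝓡 k) Y Y ∞} {z : M}

theorem LiftsAt.lift_mem (h : 𝒩.LiftsAt R f z) : 𝒩.lift R f z ∈ 𝒩.N := 𝒩.inv_mem h.liftCot_mem

theorem LiftsAt.Θ_lift (h : 𝒩.LiftsAt R f z) : 𝒩.Θ (𝒩.lift R f z) = 𝒩.liftCot R f z :=
  𝒩.Θ_inv h.liftCot_mem

theorem LiftsAt.proj_lift (h : 𝒩.LiftsAt R f z) : 𝒩.proj (𝒩.lift R f z) = f (𝒩.proj z) :=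
  congrArg (·.proj) h.Θ_lift

theorem LiftsAt.contactCovector_lift (h : 𝒩.LiftsAt R f z) : 𝒩.contactCovector (𝒩.lift R f z) =
    mkCot (transportCot f (𝒩.contactCovector z)).proj
      ((fiberPairing R (transportCot f (𝒩.contactCovector z)))⁻¹ •
        (transportCot f (𝒩.contactCovector z)).cov) := by
  have h1 : 𝒩.contactCovector (𝒩.lift R f z) = mkCot (𝒩.Θ (𝒩.lift R f z)).proj
      ((α.pullback ι).cov (𝒩.Θ (𝒩.lift R f z)).proj - (𝒩.Θ (𝒩.lift R f z)).cov) := rfl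
  rw [h1, h.Θ_lift]
  refine mkCot_eq_iff.2 ⟨rfl, ?_⟩
  exact sub_sub_cancel _ _

theorem LiftsAt.transportCot_symm (h : 𝒩.LiftsAt R f z) :
    transportCot f.symm (𝒩.contactCovector (𝒩.lift R f z)) =
      mkCot (𝒩.contactCovector z).proj
        ((fiberPairing R (transportCot f (𝒩.contactCovector z)))⁻¹ • (𝒩.contactCovector z).cov) := by
  rw [h.contactCovector_lift, transportCot_symm_transportCot]

theorem LiftsAt.liftCot_symm (hR : IsTransverseSection (α.pullback ι) L R)
    (h : 𝒩.LiftsAt R f z) : 𝒩.liftCot R f.symm (𝒩.lift R f z) = 𝒩.Θ z := by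
  rw [liftCot, h.transportCot_symm, normalizeCot_mkCot_smul _ (inv_ne_zero h.ne_zero),
    𝒩.normalizeCot_contactCovector hR h.mem]

/-- Transporting back by `f.symm` returns the original contact covector up to a nonzero factor, and
normalization removes the factor. -/
theorem LiftsAt.symm (hR : IsTransverseSection (α.pullback ι) L R) (h : 𝒩.LiftsAt R f z) :
    𝒩.LiftsAt R f.symm (𝒩.lift R f z) := by
  refine ⟨h.lift_mem, ?_, ?_⟩
  · rw [h.transportCot_symm, fiberPairing_mkCot_smul, 𝒩.fiberPairing_contactCovector hR h.mem,
      mul_one]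
    exact inv_ne_zero h.ne_zero
  · rw [h.liftCot_symm hR]
    exact mem_image_of_mem _ h.mem

theorem LiftsAt.lift_symm_lift (hR : IsTransverseSection (α.pullback ι) L R)
    (h : 𝒩.LiftsAt R f z) : 𝒩.lift R f.symm (𝒩.lift R f z) = z := by
  rw [lift, h.liftCot_symm hR, 𝒩.inv_Θ h.mem]

section Family

variable {φ : ℝ → Diffeomorph (𝓡 k) (𝓡 k) Y Y ∞} {t : ℝ}

theorem contMDiffAt_transportCot_contactCovector
    (hφ : ContMDiff (𝓘(ℝ, ℝ).prod (𝓡 k)) (𝓡 k) ∞ (fun p : ℝ × Y => φ p.1 p.2)) (hz : z ∈ 𝒩.N) :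
    ContMDiffAt (𝓘(ℝ, ℝ).prod (𝓡 d)) (cotangentModel k) ∞
      (fun p : ℝ × M => transportCot (φ p.1) (𝒩.contactCovector p.2)) (t, z) :=
  contMDiffAt_transportCot hφ ((𝒩.contMDiffAt_contactCovector hz).comp (t, z) contMDiffAt_snd)
    contMDiffAt_fst

/-- All the conditions are open; the image of `Θ` is open only within the annihilator of `R`, but
normalized covectors lie there. -/
theorem LiftsAt.eventually (hR : IsTransverseSection (α.pullback ι) L R)
    (hφ : ContMDiff (𝓘(ℝ, ℝ).prod (𝓡 k)) (𝓡 k) ∞ (fun p : ℝ × Y => φ p.1 p.2))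
    (h : 𝒩.LiftsAt R (φ t) z) : ∀ᶠ p : ℝ × M in 𝓝 (t, z), 𝒩.LiftsAt R (φ p.1) p.2 := by
  have h1 := contMDiffAt_transportCot_contactCovector (t := t) hφ h.mem
  have h2 := hR.contMDiffAt_fiberPairing h1
  have h3 := (hR.contMDiffAt_normalizeCot h1 h.ne_zero).continuousAt
  have h4 : ∀ᶠ p : ℝ × M in 𝓝 (t, z), p.2 ∈ 𝒩.N :=
    continuous_snd.continuousAt.eventually (𝒩.isOpen_N.mem_nhds h.mem)
  filter_upwards [h4, h2.continuousAt.eventually_ne h.ne_zero,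
    h3.eventually (𝒩.eventually_mem_image_Θ hR h.liftCot_mem)] with p hp hp' hp''
  exact ⟨hp, hp', hp'' (hR.fiberPairing_normalizeCot hp')⟩

theorem LiftsAt.contMDiffAt (hR : IsTransverseSection (α.pullback ι) L R) (hdk : d + 1 = k + k)
    (hφ : ContMDiff (𝓘(ℝ, ℝ).prod (𝓡 k)) (𝓡 k) ∞ (fun p : ℝ × Y => φ p.1 p.2))
    (h : 𝒩.LiftsAt R (φ t) z) :
    ContMDiffAt (𝓘(ℝ, ℝ).prod (𝓡 d)) (𝓡 d) ∞ (fun p : ℝ × M => 𝒩.lift R (φ p.1) p.2) (t, z) :=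
  𝒩.contMDiffAt_inv_comp hR hdk (hR.contMDiffAt_normalizeCot
    (contMDiffAt_transportCot_contactCovector (t := t) hφ h.mem) h.ne_zero) h.liftCot_mem
    ((h.eventually hR hφ).mono fun _ hp => hR.fiberPairing_normalizeCot hp.ne_zero)

end Family

theorem LiftsAt.contMDiffAt_lift (hR : IsTransverseSection (α.pullback ι) L R)
    (hdk : d + 1 = k + k) (h : 𝒩.LiftsAt R f z) :
    ContMDiffAt (𝓡 d) (𝓡 d) ∞ (𝒩.lift R f) z :=
  ContMDiffAt.comp (f := fun x : M => ((0 : ℝ), x)) z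
    (LiftsAt.contMDiffAt (φ := fun _ => f) (t := 0) hR hdk (f.contMDiff.comp contMDiff_snd) h)
    (contMDiffAt_const.prodMk contMDiffAt_id)

theorem LiftsAt.eventually_liftsAt (hR : IsTransverseSection (α.pullback ι) L R)
    (h : 𝒩.LiftsAt R f z) : ∀ᶠ x in 𝓝 z, 𝒩.LiftsAt R f x := by
  have hc : ContinuousAt (fun x : M => ((0 : ℝ), x)) z := by fun_prop
  exact hc.eventually (LiftsAt.eventually (φ := fun _ => f) (t := 0) hR
    (f.contMDiff.comp contMDiff_snd) h)

theorem LiftsAt.mD_lift_symm (hR : IsTransverseSection (α.pullback ι) L R)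
    (hdk : d + 1 = k + k) (h : 𝒩.LiftsAt R f z) (v : ℰ d) :
    mD (𝓡 d) (𝓡 d) (𝒩.lift R f.symm) (𝒩.lift R f z) (mD (𝓡 d) (𝓡 d) (𝒩.lift R f) z v) = v := by
  have h1 := mD_comp (((h.symm hR).contMDiffAt_lift hR hdk).mdiff)
    ((h.contMDiffAt_lift hR hdk).mdiff) rfl
  rw [mD_congr ((h.eventually_liftsAt hR).mono fun x hx => hx.lift_symm_lift hR), mD_id] at h1
  exact (DFunLike.congr_fun h1 v).symm

/-- The contact plane at a point is the preimage, under the projection to `Y`, of the kernel of its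
contact covector. The lift covers `f`, and the contact covector at the image is a nonzero multiple
of the transported one. -/
theorem LiftsAt.cov_mD_lift (hR : IsTransverseSection (α.pullback ι) L R)
    (hdk : d + 1 = k + k) (h : 𝒩.LiftsAt R f z) (v : ℰ d) :
    α.cov (𝒩.lift R f z) (mD (𝓡 d) (𝓡 d) (𝒩.lift R f) z v) = 0 ↔ α.cov z v = 0 := by
  have h1 := mD_comp ((𝒩.contMDiffAt_projN h.lift_mem).mdiff)
    ((h.contMDiffAt_lift hR hdk).mdiff) rfl
  have h2 := mD_comp (g := f) (f.contMDiff.mdifferentiable (by simp) _)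
    ((𝒩.contMDiffAt_projN h.mem).mdiff) rfl
  rw [mD_congr ((h.eventually_liftsAt hR).mono fun x hx => hx.proj_lift), h2] at h1
  have h3 : mD (𝓡 d) (𝓡 k) 𝒩.proj (𝒩.lift R f z) (mD (𝓡 d) (𝓡 d) (𝒩.lift R f) z v) =
      mD (𝓡 k) (𝓡 k) f (𝒩.proj z) (mD (𝓡 d) (𝓡 k) 𝒩.proj z v) := (DFunLike.congr_fun h1 v).symm
  rw [𝒩.cov_eq_zero_iff h.lift_mem, 𝒩.cov_eq_zero_iff h.mem, h3]
  have h4 : ∀ p : CotangentTotal k Y, 𝒩.contactCovector (𝒩.lift R f z) = p →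
      ((α.pullback ι).cov (𝒩.proj (𝒩.lift R f z)) - (𝒩.Θ (𝒩.lift R f z)).cov) = p.cov := by
    rintro p rfl; rfl
  rw [h4 _ h.contactCovector_lift]
  change (_ • (𝒩.contactCovector z).cov.comp _) _ = 0 ↔ _
  rw [smul_apply, smul_eq_mul, ContinuousLinearMap.comp_apply]
  change _ * (𝒩.contactCovector z).cov (mD (𝓡 k) (𝓡 k) f.symm (f (𝒩.proj z)) _) = 0 ↔ _
  rw [f.mD_symm_apply, mul_eq_zero, or_iff_right (inv_ne_zero h.ne_zero)]
  rfl

/-- On the graph of `s` the contact covector is `λ - s`, which `f` transports to a nonzero multiple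
of `λ - s'`. Normalization then gives exactly `s'`, so the lift maps one graph onto the other
wherever needed. -/
theorem liftsAt_embed (hR : IsTransverseSection (α.pullback ι) L R) {s s' : OneForm k Y}
    (hs : 𝒩.IsSection s) (hs' : 𝒩.IsSection s')
    (hf : CarriesTo f (α.pullback ι - s).kerField (α.pullback ι - s').kerField) (y : Y) :
    𝒩.LiftsAt R f (𝒩.embed s y) ∧ 𝒩.lift R f (𝒩.embed s y) = 𝒩.embed s' (f y) := by
  rw [carriesTo_kerField_iff] at hf
  have e1 : 𝒩.contactCovector (𝒩.embed s y) = mkCot y ((α.pullback ι - s).cov y) := by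
    have h1 : 𝒩.contactCovector (𝒩.embed s y) = mkCot (𝒩.Θ (𝒩.embed s y)).proj
      ((α.pullback ι).cov (𝒩.Θ (𝒩.embed s y)).proj - (𝒩.Θ (𝒩.embed s y)).cov) := rfl
    rw [h1, hs.Θ_embed]; rfl
  set β : ℰ k →L[ℝ] ℝ :=
    ((α.pullback ι - s).cov y).comp (mD (𝓡 k) (𝓡 k) f.symm (f y)) with hβ
  set β' := (α.pullback ι - s').cov (f y) with hβ'
  have e2 : transportCot f (𝒩.contactCovector (𝒩.embed s y)) = mkCot (f y) β := by rw [e1]; rfl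
  have hker : ∀ v, β' v = 0 → β v = 0 := by
    intro v hv
    have := (hf y (mD (𝓡 k) (𝓡 k) f.symm (f y) v))
    rw [f.mD_apply_symm] at this
    exact this.1 hv
  have hβR : β = (β (R (f y))) • β' := by
    ext v
    have h1 := hker (v - β' v • R (f y)) (by
      rw [map_sub, map_smul, hs'.apply_eq_one hR, smul_eq_mul, mul_one, sub_self])
    rw [map_sub, map_smul, smul_eq_mul] at h1
    rw [smul_apply, smul_eq_mul, mul_comm]
    exact sub_eq_zero.1 h1
  have hne : β (R (f y)) ≠ 0 := by
    intro h0
    rw [h0, zero_smul] at hβR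
    have h1 : (α.pullback ι - s).cov y (R y) = 0 := by
      rw [← f.mD_symm_apply y (R y)]
      exact DFunLike.congr_fun hβR _
    exact one_ne_zero ((hs.apply_eq_one hR y).symm.trans h1)
  have e3 : 𝒩.liftCot R f (𝒩.embed s y) = s'.toMap (f y) := by
    rw [liftCot, e2]
    refine mkCot_eq_iff.2 ⟨rfl, ?_⟩
    change (α.pullback ι).cov (f y) - (β (R (f y)))⁻¹ • β = s'.cov (f y)
    rw [hβR, smul_smul, ← hβR, inv_mul_cancel₀ hne, one_smul, hβ', OneForm.cov_sub,
      sub_sub_cancel]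
  refine ⟨⟨hs.embed_mem y, ?_, ?_⟩, ?_⟩
  · rw [e2]; exact hne
  · rw [e3]; exact hs'.2 _
  · rw [lift, e3]; rfl

end StandardNbhd

/-! ### Contact isotopies generated by Hamiltonians -/

section ContactFlow

variable {d : ℕ} {X : Type*} [TopologicalSpace X] [T2Space X]
  [ChartedSpace (ℰ d) X] [IsManifold (𝓡 d) ∞ X] {α : OneForm d X}

theorem contactCov_zero (α δ : OneForm d X) (p : ℝ × X) : contactCov α δ 0 p = α.cov p.2 := by
  simp only [contactCov, Pi.zero_apply, zero_smul, add_zero]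

theorem contactExt_zero (α δ : OneForm d X) (p : ℝ × X) : contactExt α δ 0 p = α.extL p.2 := by
  ext1 a
  ext1 b
  change α.extL p.2 a b + (0 : ℝ) * δ.extL p.2 a b = _
  rw [zero_mul, add_zero]

theorem isContactVector_zero_iff {δ : OneForm d X} {h : ℝ × X → ℝ} {p : ℝ × X}
    {v : ℰ d} : IsContactVector α δ 0 h p v ↔ α.cov p.2 v = h p ∧
      ∀ w, α.cov p.2 w = 0 →
        α.extL p.2 v w = -mD (𝓡 d) 𝓘(ℝ, ℝ) (fun x => h (p.1, x)) p.2 w := by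
  have h3 : contactRhs δ 0 h p = -mD (𝓡 d) 𝓘(ℝ, ℝ) (fun x => h (p.1, x)) p.2 := by
    have : deriv (0 : ℝ → ℝ) p.1 = 0 := deriv_const _ _
    simp only [contactRhs, this, zero_smul, sub_zero]
  rw [IsContactVector, contactCov_zero, contactExt_zero, h3]
  rfl

/-- The contact isotopy generated by a Hamiltonian with compact support. -/
theorem exists_contact_flow (hα : IsContactForm α) {h : ℝ × X → ℝ}
    (hh : ContMDiff (𝓘(ℝ, ℝ).prod (𝓡 d)) 𝓘(ℝ, ℝ) ∞ h) {K : Set X} (hK : IsCompact K)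
    (hhK : ∀ t, ∀ x ∉ K, h (t, x) = 0) {T : ℝ} (hhT : ∀ t x, T < |t| → h (t, x) = 0) :
    ∃ φ : ℝ → Diffeomorph (𝓡 d) (𝓡 d) X X ∞,
      ContMDiff (𝓘(ℝ, ℝ).prod (𝓡 d)) (𝓡 d) ∞ (fun p : ℝ × X => φ p.1 p.2) ∧
      (∀ x, φ 0 x = x) ∧ (∀ t, ∀ x ∉ K, φ t x = x) ∧ (∀ t, IsContacto α (φ t)) ∧
      ∀ {a b t₀ : ℝ} {c : ℝ → X} {x : X}, t₀ ∈ Ioo a b →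
        (∀ t ∈ Ioo a b, ∃ v, HasVelocity (𝓡 d) c v t ∧ IsContactVector α α 0 h (t, c t) v) →
          c t₀ = φ t₀ x → ∀ t ∈ Ioo a b, c t = φ t x := by
  -- With `τ = 0` the family of forms is constant; the second `α` only fills the slot of `δ`.
  have hpair : ∀ p : ℝ × X, ContactPair (contactCov α α 0 p) (contactExt α α 0 p) := by
    intro p
    rw [contactCov_zero, contactExt_zero]
    exact hα.isContactAt p.2
  have hτ : ContDiff ℝ ∞ (0 : ℝ → ℝ) := contDiff_const
  have hspec := fun p => (contactField_spec hτ hh (hpair p)).self_of_nhds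
  -- Zero solves the equations there and solutions are unique. Vanishing near `x`, not only at `x`,
  -- enters because the equations involve `dh`.
  have hzero : ∀ t x, (∀ᶠ z in 𝓝 x, h (t, z) = 0) → contactField α α 0 h t x = 0 := by
    intro t x hx
    refine (((hspec (t, x)).2 0).1 (isContactVector_zero_iff.2 ⟨?_, fun w _ => ?_⟩)).symm
    · exact (map_zero _).trans hx.self_of_nhds.symm
    · have h1 : mD (𝓡 d) 𝓘(ℝ, ℝ) (fun x => h (t, x)) x = 0 := by
        rw [mD_congr hx]; exact mfderiv_const
      change α.extL x 0 w = -mD (𝓡 d) 𝓘(ℝ, ℝ) (fun x => h (t, x)) x w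
      rw [h1, map_zero]; exact neg_zero.symm
  have hVK : ∀ t, ∀ x ∉ K, contactField α α 0 h t x = 0 := fun t x hx =>
    hzero t x (Filter.mem_of_superset (hK.isClosed.isOpen_compl.mem_nhds hx) fun z hz => hhK t z hz)
  obtain ⟨φ, hφ, h0, hvel, huniq⟩ := exists_flow_of_compact_support (contactField α α 0 h)
    (fun p => (hspec p).1) hK hVK (T := T)
    fun t x ht => hzero t x (Filter.Eventually.of_forall fun z => hhT t z ht)
  have huniq' : ∀ {a b t₀ : ℝ} {c : ℝ → X} {x : X}, t₀ ∈ Ioo a b →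
        (∀ t ∈ Ioo a b, ∃ v, HasVelocity (𝓡 d) c v t ∧ IsContactVector α α 0 h (t, c t) v) →
          c t₀ = φ t₀ x → ∀ t ∈ Ioo a b, c t = φ t x := by
    intro a b t₀ c x ht₀ hc hc₀
    refine huniq ht₀ (fun t ht => ?_) hc₀
    obtain ⟨v, hv, hv'⟩ := hc t ht
    rwa [((hspec (t, c t)).2 v).1 hv'] at hv
  refine ⟨φ, hφ, h0, fun t x hx => ?_, fun t => ?_, huniq'⟩
  · exact (huniq (a := -(|t| + 1)) (b := |t| + 1) (t₀ := 0) (c := fun _ => x) (x := x)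
      ⟨by linarith [abs_nonneg t], by linarith [abs_nonneg t]⟩
      (fun s _ => by
        have h1 := hVK s x hx
        change HasVelocity (𝓡 d) (fun _ => x) (contactField α α 0 h s x : ℰ d) s
        rw [h1]; exact hasVelocity_const x s) (h0 x).symm t
      ⟨by linarith [neg_abs_le t], by linarith [le_abs_self t]⟩).symm
  · have hm : ∀ s, s ∈ Ioo (-(|t| + 1)) (|t| + 1) → ∀ x v,
        α.cov (φ s x) (mD (𝓡 d) (𝓡 d) (φ s) x v) = 0 → ∀ r ∈ Ioo (-(|t| + 1)) (|t| + 1),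
          α.cov (φ r x) (mD (𝓡 d) (𝓡 d) (φ r) x v) = 0 := by
      intro s hs x v hv r hr
      have := contact_transport (α := α) (δ := α) (τ := 0) hτ hh hφ hs (x := x) (v := v)
        (fun t _ => Filter.Eventually.of_forall fun p =>
          ⟨_, hvel p.2 p.1, ((hspec (p.1, φ p.1 p.2)).2 _).2 rfl⟩)
        (fun t _ => by rw [contactCov_zero]; exact (hα.isContactAt _).1)
        (fun t _ w => ⟨_, (φ t).mD_apply_symm x w⟩)
        (by rw [contactCov_zero]; exact hv) r hr
      rwa [contactCov_zero] at this
    have hid : ∀ x v, mD (𝓡 d) (𝓡 d) (φ 0) x v = v := fun x v => by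
      rw [mD_congr (Filter.Eventually.of_forall h0), mD_id]; rfl
    have h0m : (0 : ℝ) ∈ Ioo (-(|t| + 1)) (|t| + 1) :=
      ⟨by linarith [abs_nonneg t], by linarith [abs_nonneg t]⟩
    have htm : t ∈ Ioo (-(|t| + 1)) (|t| + 1) :=
      ⟨by linarith [neg_abs_le t], by linarith [le_abs_self t]⟩
    intro x v
    constructor
    · intro h1
      have h2 := hm t htm x v h1 0 h0m
      rw [h0] at h2
      exact (congrArg (α.cov x) (hid x v)).symm.trans h2
    · intro h1
      refine hm 0 h0m x v ?_ t htm
      rw [h0]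
      exact (congrArg (α.cov x) (hid x v)).trans h1

end ContactFlow

/-! ### Cutoff functions -/

section Cutoff

/-- There are cutoff functions for compact subsets of open sets. -/
theorem exists_contMDiff_cutoff {E : Type*} [NormedAddCommGroup E] [NormedSpace ℝ E]
    [FiniteDimensional ℝ E] {H : Type*} [TopologicalSpace H] {I : ModelWithCorners ℝ E H}
    {X : Type*} [TopologicalSpace X] [ChartedSpace H X] [IsManifold I ∞ X] [T2Space X]
    [LocallyCompactSpace X] [SigmaCompactSpace X] {C U : Set X} (hC : IsCompact C) (hU : IsOpen U)
    (hCU : C ⊆ U) : ∃ (χ : X → ℝ) (K : Set X), ContMDiff I 𝓘(ℝ, ℝ) ∞ χ ∧ IsCompact K ∧ K ⊆ U ∧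
      (∀ x ∈ C, ∀ᶠ z in 𝓝 x, χ z = 1) ∧
      (∀ x ∉ K, χ x = 0) ∧ ∀ x, 0 ≤ χ x := by
  obtain ⟨K, hK, hCK, hKU⟩ := exists_compact_between hC hU hCU
  obtain ⟨χ, h1, h0, h⟩ := exists_contMDiffMap_one_nhds_of_subset_interior (n := (⊤ : ℕ∞)) I hC.isClosed hCK
  exact ⟨χ, K, χ.contMDiff, hK, hKU, fun x hx => h1.filter_mono (nhds_le_nhdsSet hx), h0,
    fun x => (h x).1⟩

theorem ContMDiff.smul_cutoff {E : Type*} [NormedAddCommGroup E] [NormedSpace ℝ E]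
    {H : Type*} [TopologicalSpace H] {I : ModelWithCorners ℝ E H}
    {X : Type*} [TopologicalSpace X] [ChartedSpace H X] [T2Space X] {K : Set X} {χ f : X → ℝ}
    (hχ : ContMDiff I 𝓘(ℝ, ℝ) ∞ χ) (hK : IsCompact K) (h0 : ∀ x ∉ K, χ x = 0)
    (hf : ∀ x ∈ K, ContMDiffAt I 𝓘(ℝ, ℝ) ∞ f x) : ContMDiff I 𝓘(ℝ, ℝ) ∞ fun x => χ x * f x := by
  intro x
  by_cases hx : x ∈ K
  · exact (hχ x).mul (hf x hx)
  · refine (contMDiffAt_const (c := (0 : ℝ))).congr_of_eventuallyEq ?_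
    filter_upwards [hK.isClosed.isOpen_compl.mem_nhds hx] with z hz
    rw [h0 z hz, zero_mul]

end Cutoff

/-! ### From isotopies of `Y` to contact isotopies -/

namespace StandardNbhd

variable {n d k : ℕ}
  {M : Type*} [TopologicalSpace M] [T2Space M] [ChartedSpace (ℰ d) M]
  [IsManifold (𝓡 d) ∞ M]
  {Y : Type*} [TopologicalSpace Y] [CompactSpace Y] [T2Space Y]
  [ChartedSpace (ℰ k) Y]
  [IsManifold (𝓡 k) ∞ Y] [Nonempty M]
  {α : OneForm d M} {ι : ContMDiffMap (𝓡 k) (𝓡 d) Y M ∞} {L : PlaneField k Y}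
  {R : Y → ℰ k} (𝒩 : StandardNbhd α ι L)
  {φ : ℝ → Diffeomorph (𝓡 k) (𝓡 k) Y Y ∞}

/-- The Hamiltonian of the lift of an isotopy. -/
def liftHam (R : Y → ℰ k) (φ : ℝ → Diffeomorph (𝓡 k) (𝓡 k) Y Y ∞)
    (p : ℝ × M) : ℝ :=
  α.cov p.2 (mD 𝓘(ℝ, ℝ) (𝓡 d) (fun s => 𝒩.lift R (φ s) (𝒩.lift R (φ p.1).symm p.2)) p.1 1)

variable {𝒩}

theorem LiftsAt.lift_lift_symm {f : Diffeomorph (𝓡 k) (𝓡 k) Y Y ∞} {z : M}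
    (hR : IsTransverseSection (α.pullback ι) L R) (h : 𝒩.LiftsAt R f.symm z) :
    𝒩.LiftsAt R f (𝒩.lift R f.symm z) ∧ 𝒩.lift R f (𝒩.lift R f.symm z) = z :=
  ⟨h.symm hR, h.lift_symm_lift hR⟩

/-- The velocity of the lifted family is taken along the curve through `w` at time `t`, found by the
inverse lift. Velocity and inverse lift both depend smoothly on time and point. -/
theorem LiftsAt.contMDiffAt_liftHam (hR : IsTransverseSection (α.pullback ι) L R)
    (hdk : d + 1 = k + k)
    (hφ : ContMDiff (𝓘(ℝ, ℝ).prod (𝓡 k)) (𝓡 k) ∞ (fun p : ℝ × Y => φ p.1 p.2)) {t : ℝ} {w : M}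
    (h : 𝒩.LiftsAt R (φ t).symm w) :
    ContMDiffAt (𝓘(ℝ, ℝ).prod (𝓡 d)) 𝓘(ℝ, ℝ) ∞ (𝒩.liftHam R φ) (t, w) := by
  have hφ' := contMDiff_symm_family hφ
  have h1 := (h.lift_lift_symm hR).1.contMDiffAt hR hdk hφ
  have h2 := LiftsAt.contMDiffAt (φ := fun t => (φ t).symm) hR hdk hφ' h
  have h3 := ContMDiffAt.comp (f := fun p : ℝ × M => (p.1, 𝒩.lift R (φ p.1).symm p.2)) (t, w)
    (contMDiffAt_velocity h1) (contMDiffAt_fst.prodMk h2)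
  refine ContMDiffAt.cov_apply (y := fun p : ℝ × M => p.2) (c := fun p => α.cov p.2)
    (v := fun p : ℝ × M =>
      mD 𝓘(ℝ, ℝ) (𝓡 d) (fun s => 𝒩.lift R (φ s) (𝒩.lift R (φ p.1).symm p.2)) p.1 1) le_rfl
    ((α.contMDiffAt_mkCot _).comp (t, w) contMDiffAt_snd) (h3.congr_of_eventuallyEq ?_)
  filter_upwards [LiftsAt.eventually (φ := fun t => (φ t).symm) hR hφ' h] with p hp
  exact congrArg (fun x => mkTan (𝓡 d) x _) (hp.lift_lift_symm hR).2.symm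

/-- The lifts preserve the contact planes, so `extL_generator` applies to their velocity. Only the
germ of `H` at the moving point matters, which leaves room for a cutoff elsewhere. -/
theorem LiftsAt.isContactVector (hR : IsTransverseSection (α.pullback ι) L R)
    (hdk : d + 1 = k + k)
    (hφ : ContMDiff (𝓘(ℝ, ℝ).prod (𝓡 k)) (𝓡 k) ∞ (fun p : ℝ × Y => φ p.1 p.2)) {t : ℝ} {z : M}
    (h : 𝒩.LiftsAt R (φ t) z) {H : ℝ × M → ℝ}
    (hH : ∀ᶠ p in 𝓝 (t, 𝒩.lift R (φ t) z), H p = 𝒩.liftHam R φ p) :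
    IsContactVector α α 0 H (t, 𝒩.lift R (φ t) z)
      (mD 𝓘(ℝ, ℝ) (𝓡 d) (fun s => 𝒩.lift R (φ s) z) t 1) := by
  have hg := h.contMDiffAt hR hdk hφ
  have hval : ∀ᶠ x in 𝓝 z, 𝒩.LiftsAt R (φ t) x := h.eventually_liftsAt hR
  have hval' : ∀ x, 𝒩.LiftsAt R (φ t) x → 𝒩.liftHam R φ (t, 𝒩.lift R (φ t) x) =
      α.cov (𝒩.lift R (φ t) x) (mD 𝓘(ℝ, ℝ) (𝓡 d) (fun s => 𝒩.lift R (φ s) x) t 1) := by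
    intro x hx
    rw [liftHam]
    simp only [hx.lift_symm_lift hR]
  have hH' : ∀ᶠ x in 𝓝 (𝒩.lift R (φ t) z), H (t, x) = 𝒩.liftHam R φ (t, x) := by
    have hc : ContinuousAt (fun x : M => (t, x)) (𝒩.lift R (φ t) z) := by fun_prop
    exact hc.eventually hH
  refine isContactVector_zero_iff.2 ⟨(hval' z h).symm.trans hH.self_of_nhds.symm, fun w hw => ?_⟩
  have hs := h.symm hR
  set v := mD (𝓡 d) (𝓡 d) (𝒩.lift R (φ t).symm) (𝒩.lift R (φ t) z) w with hv
  have hvw : mD (𝓡 d) (𝓡 d) (𝒩.lift R (φ t)) z v = w := by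
    have h1 := hs.mD_lift_symm hR hdk w
    rw [h.lift_symm_lift hR] at h1
    exact h1
  have hv0 : α.cov z v = 0 := by
    rw [← h.cov_mD_lift hR hdk, hvw]; exact hw
  have hham : MDifferentiableAt (𝓡 d) 𝓘(ℝ, ℝ) (fun x => 𝒩.liftHam R φ (t, x))
      (𝒩.lift R (φ t) z) :=
    (ContMDiffAt.comp (f := fun x : M => (t, x)) (𝒩.lift R (φ t) z)
      (LiftsAt.contMDiffAt_liftHam hR hdk hφ hs)
      (contMDiffAt_const.prodMk contMDiffAt_id)).mdiff
  have key := extL_generator (α := α) (g := fun p : ℝ × M => 𝒩.lift R (φ p.1) p.2) (t := t) (x := z)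
    hg (h := fun x => 𝒩.liftHam R φ (t, x)) hham (w := v)
    (by
      have hc : ContinuousAt (fun s : ℝ => (s, z)) t := by fun_prop
      filter_upwards [hc.eventually (h.eventually hR hφ)] with s hs
      exact (hs.cov_mD_lift hR hdk v).2 hv0)
    (hval.mono fun x hx => (hval' x hx).symm)
  have h4 : mD (𝓡 d) (𝓡 d) (fun x => 𝒩.lift R (φ t) x) z v = w := hvw
  beta_reduce at key
  rw [h4] at key
  change α.extL (𝒩.lift R (φ t) z) _ w = -mD (𝓡 d) 𝓘(ℝ, ℝ) (fun x => H (t, x)) (𝒩.lift R (φ t) z) w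
  rw [mD_congr hH']
  exact key

/-- The lift of the isotopy moves the graphs as required but is defined only near them. Its
Hamiltonian, multiplied by a cutoff that is one near the trace of the moving graphs, generates a
contact isotopy supported in the standard neighbourhood. Uniqueness of integral curves shows that on
the initial graph this isotopy coincides with the lift. -/
theorem FoliationMove.coisotropicMove [SecondCountableTopology M] (hd : d = 2 * n + 1)
    (hk : k = n + 1) (hα : IsContactForm α) (hR : IsTransverseSection (α.pullback ι) L R)
    (hdk : d + 1 = k + k) {e : 𝒩.coisotropics ≃ 𝒩.foliations}
    (he : ∀ (S : 𝒩.coisotropics) (s : OneForm k Y), 𝒩.IsSection s → S.1 = 𝒩.graph s →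
          (e S).1 = (α.pullback ι - s).kerField)
    {S₀ S₁ : 𝒩.coisotropics} (hm : 𝒩.FoliationMove univ (e S₀).1 (e S₁).1) :
    𝒩.CoisotropicMove univ S₀.1 S₁.1 := by
  obtain ⟨ψ, hψ, hG, hψ1⟩ := hm
  obtain ⟨⟨s₀, hs₀, hS₀⟩, -⟩ := S₀.2
  obtain ⟨⟨s₁, hs₁, hS₁⟩, -⟩ := S₁.2
  rw [he S₀ s₀ hs₀ hS₀] at hG hψ1
  rw [he S₁ s₁ hs₁ hS₁] at hψ1
  have hφ := hψ.contMDiff_reparam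
  have hψ0 : ∀ y, ψ (Real.smoothTransition 0) y = y := by
    rw [Real.smoothTransition.zero]; exact hψ.2
  have hψ1' : CarriesTo (ψ (Real.smoothTransition 1)) (α.pullback ι - s₀).kerField
      (α.pullback ι - s₁).kerField := by rwa [Real.smoothTransition.one]
  obtain ⟨φ, hφdef⟩ : ∃ φ : ℝ → Diffeomorph (𝓡 k) (𝓡 k) Y Y ∞,
      ∀ t, φ t = ψ (Real.smoothTransition t) := ⟨_, fun _ => rfl⟩
  simp only [← hφdef] at hφ hψ0 hψ1'
  have hsec : ∀ t, ∃ s, 𝒩.IsSection s ∧ IsFoliation (α.pullback ι - s).kerField ∧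
      CarriesTo (φ t) (α.pullback ι - s₀).kerField (α.pullback ι - s).kerField := by
    intro t
    obtain ⟨-, G, ⟨hGf, s, hs, rfl⟩, hc⟩ := hG _ (smoothTransition_mem_Icc t)
    exact ⟨s, hs, hGf, by rwa [hφdef]⟩
  choose s hs hsf hsc using hsec
  have hlift := fun t y => liftsAt_embed hR hs₀ (hs t) (hsc t) y
  have hφ' := contMDiff_symm_family hφ
  have : LocallyCompactSpace M := ChartedSpace.locallyCompactSpace (ℰ d) M
  -- The Hamiltonian is smooth where the inverse lift is defined. The time windows `[0, 1]`, `[-1,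
  -- 2]` and `(-2, 3)` leave room for an open interval of uniqueness and for the cutoff.
  let U : Set (ℝ × M) := {p | 𝒩.LiftsAt R (φ p.1).symm p.2 ∧ p.1 ∈ Ioo (-2) 3}
  have hU : IsOpen U := isOpen_iff_mem_nhds.2 fun p hp =>
    Filter.inter_mem (LiftsAt.eventually (φ := fun t => (φ t).symm) (t := p.1) (z := p.2) hR hφ' hp.1)
      (continuous_fst.continuousAt.preimage_mem_nhds (Ioo_mem_nhds hp.2.1 hp.2.2))
  let c : ℝ × Y → ℝ × M := fun q => (q.1, 𝒩.lift R (φ q.1) (𝒩.embed s₀ q.2))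
  have hgc : ∀ q : ℝ × Y, ContMDiffAt (𝓘(ℝ, ℝ).prod (𝓡 k)) (𝓡 d) ∞
      (fun q : ℝ × Y => 𝒩.lift R (φ q.1) (𝒩.embed s₀ q.2)) q := fun q =>
    ContMDiffAt.comp (f := fun q : ℝ × Y => (q.1, 𝒩.embed s₀ q.2)) q
      ((hlift q.1 q.2).1.contMDiffAt hR hdk hφ)
      (contMDiffAt_fst.prodMk ((hs₀.contMDiff_embed hR hdk _).comp q contMDiffAt_snd))
  have hcc : Continuous c := continuous_fst.prodMk
    (continuous_iff_continuousAt.2 fun q => (hgc q).continuousAt)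
  have hC : IsCompact (c '' (Icc (-1) 2 ×ˢ univ)) := (isCompact_Icc.prod isCompact_univ).image hcc
  have hCU : c '' (Icc (-1) 2 ×ˢ univ) ⊆ U := by
    rintro _ ⟨⟨t, y⟩, ⟨ht, -⟩, rfl⟩
    exact ⟨(hlift t y).1.symm hR, by
      change t ∈ Ioo (-2 : ℝ) 3
      constructor <;> linarith [ht.1, ht.2]⟩
  obtain ⟨χ, K, hχ, hK, hKU, hχ1, hχ0, -⟩ :=
    exists_contMDiff_cutoff (I := 𝓘(ℝ, ℝ).prod (𝓡 d)) hC hU hCU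
  have hH := hχ.smul_cutoff (f := 𝒩.liftHam R φ) hK hχ0
    fun p hp => LiftsAt.contMDiffAt_liftHam (t := p.1) (w := p.2) hR hdk hφ (hKU hp).1
  obtain ⟨Φ, hΦ, hΦ0, hΦK, hΦc, huniq⟩ := exists_contact_flow hα hH (hK.image continuous_snd)
    (fun t x hx => by
      rw [hχ0 (t, x) fun h => hx ⟨_, h, rfl⟩, zero_mul]) (T := 3)
    (fun t x ht => by
      rw [hχ0 (t, x) fun h => ?_, zero_mul]
      have h1 : t ∈ Ioo (-2 : ℝ) 3 := (hKU h).2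
      have : |t| ≤ 3 := abs_le.2 ⟨by linarith [h1.1], h1.2.le⟩
      linarith)
  have hcurve : ∀ t ∈ Icc (0 : ℝ) 1, ∀ y, Φ t (𝒩.embed s₀ y) = 𝒩.embed (s t) (φ t y) := by
    intro t ht y
    -- The lifted curve is an integral curve of the cut-off field, since the cutoff is one near each
    -- of its points for times in `(-1, 2)`.
    have h1 := huniq (a := -1) (b := 2) (t₀ := 0) (c := fun t => 𝒩.lift R (φ t) (𝒩.embed s₀ y))
      (x := 𝒩.embed s₀ y) (by norm_num)
      (fun t ht => ⟨mD 𝓘(ℝ, ℝ) (𝓡 d) (fun s => 𝒩.lift R (φ s) (𝒩.embed s₀ y)) t 1, ?_, ?_⟩) ?_ t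
      ⟨by linarith [ht.1], by linarith [ht.2]⟩
    · rw [← h1, (hlift t y).2]
    · have hdiff : MDifferentiableAt 𝓘(ℝ, ℝ) (𝓡 d)
          (fun s => 𝒩.lift R (φ s) (𝒩.embed s₀ y)) t :=
        (ContMDiffAt.comp (f := fun s : ℝ => (s, y)) t (hgc (t, y))
          (contMDiffAt_id.prodMk contMDiffAt_const)).mdiff
      exact ⟨hdiff, rfl⟩
    · refine LiftsAt.isContactVector hR hdk hφ (hlift t y).1 ?_
      filter_upwards [hχ1 (t, 𝒩.lift R (φ t) (𝒩.embed s₀ y))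
        ⟨(t, y), ⟨Ioo_subset_Icc_self ht, mem_univ y⟩, rfl⟩] with p hp
      rw [hp, one_mul]
    · have h2 := (liftsAt_embed hR hs₀ hs₀ (f := φ 0) (carriesTo_of_eq_id hψ0 _) y).2
      rw [hψ0] at h2
      rw [hΦ0]
      exact h2
  have himage : ∀ t ∈ Icc (0 : ℝ) 1, Φ t '' S₀.1 = 𝒩.graph (s t) := by
    intro t ht
    rw [hS₀, ← hs₀.range_embed, ← (hs t).range_embed, ← range_comp]
    have : ⇑(Φ t) ∘ 𝒩.embed s₀ = 𝒩.embed (s t) ∘ φ t := funext fun y => hcurve t ht y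
    rw [this]
    exact (φ t).surjective.range_comp _
  refine ⟨Φ, ⟨hΦ.contMDiffOn, hΦ0⟩, ⟨_, ?_, hK.image continuous_snd, fun t _ => hΦK t⟩,
    fun t ht => ⟨hΦc t, mem_univ _, ?_⟩, ?_⟩
  · rintro _ ⟨p, hp, rfl⟩
    exact (hKU hp).1.mem
  · rw [himage t ht]
    exact ((hs t).graph_mem_coisotropics_iff hd hk hα hR hdk).2 (hsf t)
  · rw [himage 1 ⟨zero_le_one, le_rfl⟩, hS₁]
    refine congrArg 𝒩.graph (eq_of_kerField_eq hR (hs 1) hs₁ fun y v hv => ?_)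
    have h1 := (hsc 1).unique hψ1'
    have h2 : v ∈ (α.pullback ι - s 1).kerField y := hv
    rw [h1] at h2
    exact h2

end StandardNbhd

/-! ### Differentials and pulled back covectors as one-forms -/

section Differential

variable {d : ℕ} {X : Type*} [TopologicalSpace X] [ChartedSpace (ℰ d) X]
  [IsManifold (𝓡 d) ∞ X] {k : ℕ}
  {Y : Type*} [TopologicalSpace Y] [ChartedSpace (ℰ k) Y]
  [IsManifold (𝓡 k) ∞ Y]

/-- The pullback of a covector along a map depends smoothly on the point. -/
theorem contMDiffAt_mkCot_comp_mD {f : X → Y} {c : X → ℰ* k} {x : X}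
    (hf : ContMDiffAt (𝓡 d) (𝓡 k) ∞ f x)
    (hc : ContMDiffAt (𝓡 d) (cotangentModel k) ∞ (fun x => mkCot (f x) (c x)) x) :
    ContMDiffAt (𝓡 d) (cotangentModel d) ∞
      (fun x => mkCot x ((c x).comp (mD (𝓡 d) (𝓡 k) f x))) x := by
  have h1 := contMDiffAt_chartMD_family (J := 𝓡 d) (I := 𝓡 d) (I' := 𝓡 k) (a := x)
    (f := fun _ => f) (g := fun z => z) (ContMDiffAt.comp (x, x) hf contMDiffAt_snd) contMDiffAt_id
  have h2 := (contMDiffAt_mkCot_iff le_rfl (mem_chart_source _ (f x))).1 hc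
  refine (contMDiffAt_mkCot_iff (y := fun z : X => z) le_rfl (mem_chart_source _ x)).2
    ⟨contMDiffAt_id, (h2.2.clm_comp h1).congr_of_eventuallyEq ?_⟩
  filter_upwards [hf.continuousAt.preimage_mem_nhds
    (chart_source_nhds (mem_chart_source (ℰ k) (f x)))] with z hz
  ext v
  simp only [chartMD, ContinuousLinearMap.comp_apply]
  rw [chartDInv_chartD_apply hz]

/-- The differential of a function. -/
theorem exists_differential {f : X → ℝ} (hf : ContMDiff (𝓡 d) 𝓘(ℝ, ℝ) ∞ f) :
    ∃ δ : OneForm d X, ∀ x, δ.cov x = mD (𝓡 d) 𝓘(ℝ, ℝ) f x := by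
  have h : ContMDiff (𝓡 d) (cotangentModel d) ∞
      (fun x : X => mkCot x (mD (𝓡 d) 𝓘(ℝ, ℝ) f x)) := by
    intro x
    have h1 := contMDiffAt_chartMD_family (J := 𝓡 d) (I := 𝓡 d) (I' := 𝓘(ℝ, ℝ)) (a := x)
      (f := fun _ => f) (g := fun z => z) (ContMDiffAt.comp (x, x) (hf x) contMDiffAt_snd)
      contMDiffAt_id
    refine (contMDiffAt_mkCot_iff (y := fun z : X => z) le_rfl (mem_chart_source _ x)).2
      ⟨contMDiffAt_id, h1.congr_of_eventuallyEq (.of_forall fun z => ?_)⟩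
    ext v
    have : chartD 𝓘(ℝ, ℝ) (f x) (f z) = ContinuousLinearMap.id ℝ ℝ :=
      chartD_self (I := 𝓘(ℝ, ℝ)) (f z)
    simp only [chartMD, ContinuousLinearMap.comp_apply]
    rw [this]
    rfl
  exact ⟨OneForm.ofMap _ h fun x => rfl, fun x => rfl⟩

end Differential

/-! ### Decomposition of covectors of `Y` by forms on `M` -/

section Frame

variable {d k : ℕ}
  {M : Type*} [TopologicalSpace M] [T2Space M] [ChartedSpace (ℰ d) M]
  [IsManifold (𝓡 d) ∞ M]
  {Y : Type*} [TopologicalSpace Y] [ChartedSpace (ℰ k) Y]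
  [IsManifold (𝓡 k) ∞ Y]

/-- A finite family of pairs `(δ, V)` of a one-form with compact support on `M` and a vector field
on `Y`, such that `∑ s(V) ι^*δ = ρ s` for the covectors `s` of `Y`. -/
structure IsWeightedFrame (ι : Y → M) (l : List (OneForm d M × (Y → ℰ k)))
    (ρ : Y → ℝ) : Prop where
  compact : ∀ p ∈ l, ∃ K : Set M, IsCompact K ∧ ∀ x ∉ K, p.1.cov x = 0
  smooth : ∀ p ∈ l, ContMDiff (𝓡 k) (𝓡 k).tangent ∞ (fun y => mkTan (𝓡 k) y (p.2 y))
  smooth_weight : ContMDiff (𝓡 k) 𝓘(ℝ, ℝ) ∞ ρ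
  nonneg : ∀ y, 0 ≤ ρ y
  sum_eq : ∀ (y : Y) (s : ℰ* k) (u : ℰ k),
    (l.map fun p => s (p.2 y) * p.1.cov (ι y) (mD (𝓡 k) (𝓡 d) ι y u)).sum = ρ y * s u

theorem IsWeightedFrame.append {ι : Y → M}
    {l l' : List (OneForm d M × (Y → ℰ k))} {ρ ρ' : Y → ℝ}
    (h : IsWeightedFrame ι l ρ) (h' : IsWeightedFrame ι l' ρ') :
    IsWeightedFrame ι (l ++ l') (ρ + ρ') where
  compact p hp := (List.mem_append.1 hp).elim (h.compact p) (h'.compact p)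
  smooth p hp := (List.mem_append.1 hp).elim (h.smooth p) (h'.smooth p)
  smooth_weight := h.smooth_weight.add h'.smooth_weight
  nonneg y := add_nonneg (h.nonneg y) (h'.nonneg y)
  sum_eq y s u := by
    rw [List.map_append, List.sum_append, h.sum_eq, h'.sum_eq, Pi.add_apply, add_mul]

theorem IsWeightedFrame.normalize {ι : Y → M}
    {l : List (OneForm d M × (Y → ℰ k))} {ρ : Y → ℝ}
    (h : IsWeightedFrame ι l ρ) (hρ : ∀ y, 0 < ρ y) :
    IsWeightedFrame ι (l.map fun p => (p.1, fun y => (ρ y)⁻¹ • p.2 y)) fun _ => 1 where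
  compact p hp := by
    obtain ⟨q, hq, rfl⟩ := List.mem_map.1 hp
    exact h.compact q hq
  smooth p hp := by
    obtain ⟨q, hq, rfl⟩ := List.mem_map.1 hp
    exact fun y => ((h.smooth_weight y).inv₀ (hρ y).ne').mkTan_smul le_rfl (h.smooth q hq y)
  smooth_weight := contMDiff_const
  nonneg y := zero_le_one
  sum_eq y s u := by
    have h1 := congrArg (fun r => (ρ y)⁻¹ * r) (h.sum_eq y s u)
    beta_reduce at h1
    rw [← mul_assoc, inv_mul_cancel₀ (hρ y).ne'] at h1
    rw [← h1, ← List.sum_map_mul_left, List.map_map]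
    refine congrArg List.sum (List.map_congr_left fun p _ => ?_)
    change s ((ρ y)⁻¹ • p.2 y) * _ = _
    rw [map_smul, smul_eq_mul, mul_assoc]

/-- In a chart of `Y` a covector is `s = ∑ s(∂ᵢ) dxᵢ`. The coordinates are extended to `M` by a
local left inverse of `ι` and a cutoff, and the weight `ρ` is put on the fields `∂ᵢ`. -/
theorem exists_isWeightedFrame_near [T2Space Y] [LocallyCompactSpace M] [SigmaCompactSpace M]
    [LocallyCompactSpace Y] [SigmaCompactSpace Y]
    {ι : Y → M} (hι : Manifold.IsImmersion (𝓡 k) (𝓡 d) ∞ ι) (y₀ : Y) :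
    ∃ l ρ, IsWeightedFrame (d := d) (k := k) ι l ρ ∧ ∀ᶠ y in 𝓝 y₀, 0 < ρ y := by
  obtain ⟨r, hr, hrι⟩ := hι.exists_leftInverse y₀
  set φ := extChartAt (𝓡 k) y₀ with hφ
  have hy₀ := mem_chart_source (ℰ k) y₀
  have hιs := hι.contMDiff
  have hrc : r (ι y₀) = y₀ := hrι.self_of_nhds
  have hD : ∀ᶠ x in 𝓝 (ι y₀), ContMDiffAt (𝓡 d) (𝓡 k) ∞ r x ∧
      r x ∈ (chartAt (ℰ k) y₀).source :=
    hr.and (hr.self_of_nhds.continuousAt.preimage_mem_nhds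
      (by rw [hrc]; exact chart_source_nhds hy₀))
  obtain ⟨U, hUD, hU, hU0⟩ := eventually_nhds_iff.1 hD
  obtain ⟨χ, K, hχ, hK, hKU, hχ1, hχ0, -⟩ := exists_contMDiff_cutoff (I := 𝓡 d)
    (isCompact_singleton (x := ι y₀)) hU (singleton_subset_iff.2 hU0)
  have hcoord : ∀ i, ∀ x ∈ U, ContMDiffAt (𝓡 d) 𝓘(ℝ, ℝ) ∞ (fun x => φ (r x) i) x := by
    intro i x hx
    have h1 : ContMDiffAt (𝓡 d) 𝓘(ℝ, ℰ k) ∞ (fun x => φ (r x)) x :=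
      ContMDiffAt.comp x (contMDiffAt_extChartAt' (hUD x hx).2) (hUD x hx).1
    exact ContMDiffAt.comp x ((EuclideanSpace.proj i).contDiff.contMDiff _) h1
  have hfs : ∀ i, ContMDiff (𝓡 d) 𝓘(ℝ, ℝ) ∞ (fun x => χ x * φ (r x) i) := fun i =>
    hχ.smul_cutoff hK hχ0 fun x hx => hcoord i x (hKU hx)
  choose δ hδ using fun i => exists_differential (hfs i)
  have hV : ∀ᶠ y in 𝓝 y₀, y ∈ (chartAt (ℰ k) y₀).source ∧
      ∀ᶠ z in 𝓝 y, χ (ι z) = 1 ∧ r (ι z) = z := by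
    refine Filter.Eventually.and (chart_source_nhds hy₀) (eventually_eventually_nhds.2 ?_)
    exact (hιs.continuous.continuousAt.eventually (hχ1 _ rfl)).and hrι
  obtain ⟨W, hWV, hW, hW0⟩ := eventually_nhds_iff.1 hV
  obtain ⟨ρ, K', hρ, hK', hKW, hρ1, hρ0, hρn⟩ := exists_contMDiff_cutoff (I := 𝓡 k)
    (isCompact_singleton (x := y₀)) hW (singleton_subset_iff.2 hW0)
  have hδι : ∀ i, ∀ y ∈ W, ∀ u, (δ i).cov (ι y) (mD (𝓡 k) (𝓡 d) ι y u) =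
      chartD (𝓡 k) y₀ y u i := by
    intro i y hy u
    have h1 := mD_comp (g := fun x => χ x * φ (r x) i) ((hfs i).mdifferentiable (by simp) (ι y))
      (hιs.mdifferentiable (by simp) y) rfl
    have h2 : (fun z => χ (ι z) * φ (r (ι z)) i) =ᶠ[𝓝 y] fun z => φ z i := by
      filter_upwards [(hWV y hy).2] with z hz
      rw [hz.1, hz.2, one_mul]
    have h3 := mD_comp (g := fun e : ℰ k => e i) (f := φ) (x := y)
      (I' := 𝓘(ℝ, ℰ k)) (I'' := 𝓘(ℝ, ℝ))
      ((EuclideanSpace.proj (𝕜 := ℝ) i).differentiableAt.mdifferentiableAt)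
      ((contMDiffAt_extChartAt' (hWV y hy).1 (n := ∞)).mdiff) rfl
    have h4 : mD 𝓘(ℝ, ℰ k) 𝓘(ℝ, ℝ) (fun e : ℰ k => e i)
        (φ y) = EuclideanSpace.proj (𝕜 := ℝ) i := by
      rw [mD_eq_fderiv]
      exact (EuclideanSpace.proj (𝕜 := ℝ) i : ℰ* k).fderiv
    rw [mD_congr h2, h3, h4] at h1
    rw [hδ]
    exact (DFunLike.congr_fun h1 u).symm
  have hE : ∀ i, ContMDiff (𝓡 k) (𝓡 k).tangent ∞ (fun y => mkTan (𝓡 k) y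
      (ρ y • chartDInv (𝓡 k) y₀ y (EuclideanSpace.single i (1 : ℝ)))) := by
    intro i y
    by_cases hy : y ∈ K'
    · refine (hρ y).mkTan_smul (y := fun y => y) le_rfl ?_
      have hys := (hWV y (hKW hy)).1
      refine (contMDiffAt_tangent_iff le_rfl (x₀ := y₀) hys).2 ⟨contMDiffAt_id, ?_⟩
      refine (contMDiffAt_const (c := EuclideanSpace.single i (1 : ℝ))).congr_of_eventuallyEq ?_
      filter_upwards [chart_source_nhds hys] with z hz
      exact chartD_chartDInv_apply hz _
    · refine (contMDiffAt_tangent_iff le_rfl (x₀ := y) (mem_chart_source _ y)).2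
        ⟨contMDiffAt_id, ?_⟩
      refine (contMDiffAt_const (c := 0)).congr_of_eventuallyEq ?_
      filter_upwards [hK'.isClosed.isOpen_compl.mem_nhds hy] with z hz
      change chartD (𝓡 k) y z (ρ z • chartDInv (𝓡 k) y₀ z (EuclideanSpace.single i (1 : ℝ))) = 0
      rw [hρ0 z hz, zero_smul, map_zero]
  refine ⟨List.ofFn fun i => (δ i, fun y => ρ y • chartDInv (𝓡 k) y₀ y
    (EuclideanSpace.single i (1 : ℝ))), ρ, ⟨?_, ?_, hρ, hρn, ?_⟩,
    (hρ1 _ rfl).mono fun y hy => by rw [hy]; exact one_pos⟩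
  · intro p hp
    obtain ⟨i, rfl⟩ := (List.mem_ofFn' _ _).1 hp
    refine ⟨K, hK, fun x hx => ?_⟩
    rw [hδ]
    have : (fun x => χ x * φ (r x) i) =ᶠ[𝓝 x] fun _ => (0 : ℝ) := by
      filter_upwards [hK.isClosed.isOpen_compl.mem_nhds hx] with z hz
      rw [hχ0 z hz, zero_mul]
    rw [mD_congr this]
    exact mfderiv_const
  · intro p hp
    obtain ⟨i, rfl⟩ := (List.mem_ofFn' _ _).1 hp
    exact hE i
  · intro y s u
    rw [List.map_ofFn, List.sum_ofFn]
    by_cases hy : y ∈ K'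
    · have h1 : ∑ i, chartD (𝓡 k) y₀ y u i • (EuclideanSpace.single i (1 : ℝ)) =
          chartD (𝓡 k) y₀ y u := by
        simpa only [EuclideanSpace.basisFun_repr, EuclideanSpace.basisFun_apply] using
          (EuclideanSpace.basisFun (Fin k) ℝ).sum_repr (chartD (𝓡 k) y₀ y u)
      have h2 : s u = s (chartDInv (𝓡 k) y₀ y (chartD (𝓡 k) y₀ y u)) := by
        rw [chartDInv_chartD_apply (hWV y (hKW hy)).1]
      rw [h2]
      conv_rhs => rw [← h1]
      rw [map_sum, map_sum, Finset.mul_sum]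
      refine Finset.sum_congr rfl fun i _ => ?_
      simp only [Function.comp_apply]
      rw [hδι i y (hKW hy), map_smul, map_smul, map_smul, smul_eq_mul, smul_eq_mul]
      ring
    · rw [hρ0 y hy, zero_mul]
      refine Finset.sum_eq_zero fun i _ => ?_
      simp only [Function.comp_apply]
      rw [hρ0 y hy, zero_smul, map_zero, zero_mul]

/-- Concatenation of local frames adds their weights. By compactness finitely many have a positive
total weight, by which the vector fields are divided. -/
theorem exists_isWeightedFrame [CompactSpace Y] [T2Space Y] [LocallyCompactSpace M]
    [SigmaCompactSpace M] {ι : Y → M} (hι : Manifold.IsImmersion (𝓡 k) (𝓡 d) ∞ ι) :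
    ∃ l, IsWeightedFrame (d := d) (k := k) ι l fun _ => 1 := by
  have key : ∃ l ρ, IsWeightedFrame (d := d) (k := k) ι l ρ ∧ ∀ y ∈ (univ : Set Y), 0 < ρ y := by
    refine isCompact_univ.induction_on (p := fun S => ∃ l ρ,
      IsWeightedFrame (d := d) (k := k) ι l ρ ∧ ∀ y ∈ S, 0 < ρ y) ?_ ?_ ?_ fun y _ => ?_
    · exact ⟨[], 0, ⟨by simp, by simp, contMDiff_const, fun _ => le_rfl, by simp⟩, by simp⟩
    · rintro S T hST ⟨l, ρ, h, hT⟩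
      exact ⟨l, ρ, h, fun y hy => hT y (hST hy)⟩
    · rintro S T ⟨l, ρ, h, hS⟩ ⟨l', ρ', h', hT⟩
      refine ⟨_, _, h.append h', ?_⟩
      rintro y (hy | hy)
      · exact add_pos_of_pos_of_nonneg (hS y hy) (h'.nonneg y)
      · exact add_pos_of_nonneg_of_pos (h.nonneg y) (hT y hy)
    · obtain ⟨l, ρ, h, hρ⟩ := exists_isWeightedFrame_near hι y
      exact ⟨_, mem_nhdsWithin_of_mem_nhds hρ, l, ρ, h, fun z hz => hz⟩
  obtain ⟨l, ρ, h, hρ⟩ := key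
  exact ⟨_, h.normalize fun y => hρ y (mem_univ y)⟩

end Frame

/-! ### Vector fields in the contact planes dual to one-forms -/

section ContactDual

variable {d : ℕ} {X : Type*} [TopologicalSpace X] [T2Space X]
  [ChartedSpace (ℰ d) X] [IsManifold (𝓡 d) ∞ X] {α : OneForm d X}

/-- A vector field with compact support generates a smooth family of maps. -/
theorem exists_family_of_compact_support {V : X → ℰ d}
    (hV : ContMDiff (𝓡 d) (𝓡 d).tangent ∞ (fun x => mkTan (𝓡 d) x (V x))) {K : Set X}
    (hK : IsCompact K) (hVK : ∀ x ∉ K, V x = 0) :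
    ∃ Φ : ℝ × X → X, ContMDiff (𝓘(ℝ, ℝ).prod (𝓡 d)) (𝓡 d) ∞ Φ ∧ (∀ x, Φ (0, x) = x) ∧
      ∀ x a v, mD (𝓘(ℝ, ℝ).prod (𝓡 d)) (𝓡 d) Φ (0, x) (a, v) = a • V x + v := by
  -- The cutoff in time provides the compact support required of time-dependent fields; only the
  -- derivative at time 0 is used.
  obtain ⟨χ, K', hχ, hK', hKU, hχ1, hχ0, -⟩ := exists_contMDiff_cutoff (I := 𝓘(ℝ, ℝ))
    (isCompact_singleton (x := (0 : ℝ))) (isOpen_Ioo (a := -1) (b := 1)) (by norm_num)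
  obtain ⟨φ, hφ, h0, hvel, -⟩ := exists_flow_of_compact_support (I := 𝓡 d)
    (fun t x => (χ t • V x : ℰ d))
    (fun p => ((hχ p.1).comp p contMDiffAt_fst).mkTan_smul (y := fun p : ℝ × X => p.2)
      (v := fun p => V p.2) le_rfl ((hV p.2).comp p contMDiffAt_snd)) hK
    (fun t x hx => by
      rw [hVK x hx]; exact smul_zero (A := ℰ d) (χ t)) (T := 1) (fun t x ht => by
      rw [hχ0 t fun h => ?_]
      · exact zero_smul ℝ (V x)
      · exact (abs_lt.2 (hKU h)).not_gt ht)
  refine ⟨_, hφ, h0, fun x a v => ?_⟩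
  have hd := hφ.mdifferentiable (by simp) (0, x)
  have h1 := mD_comp (f := fun s : ℝ => (s, x)) (I := 𝓘(ℝ, ℝ)) (x := (0 : ℝ)) hd
    (mdifferentiableAt_id.prodMk mdifferentiableAt_const) rfl
  have h2 := mD_comp (f := fun x : X => ((0 : ℝ), x)) (I := 𝓡 d) (x := x) hd
    (mdifferentiableAt_const.prodMk mdifferentiableAt_id) rfl
  have e1 : mD 𝓘(ℝ, ℝ) (𝓘(ℝ, ℝ).prod (𝓡 d)) (fun s : ℝ => (s, x)) 0 a = (a, 0) :=
    DFunLike.congr_fun (mfderiv_prod_left (I := 𝓘(ℝ, ℝ)) (I' := 𝓡 d) (x₀ := (0 : ℝ)) (y₀ := x)) a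
  have e2 : mD (𝓡 d) (𝓘(ℝ, ℝ).prod (𝓡 d)) (fun x : X => ((0 : ℝ), x)) x v = (0, v) :=
    DFunLike.congr_fun (mfderiv_prod_right (I := 𝓘(ℝ, ℝ)) (I' := 𝓡 d) (x₀ := (0 : ℝ)) (y₀ := x)) v
  have e3 : mD 𝓘(ℝ, ℝ) (𝓡 d) (fun s => φ s x) 0 1 = V x := by
    refine (hvel x 0).2.trans ?_
    have : χ 0 = 1 := (hχ1 0 rfl).self_of_nhds
    change χ 0 • V (φ 0 x) = V x
    rw [this, h0, one_smul]
  have e4 : mD (𝓡 d) (𝓡 d) (fun x => φ 0 x) x v = v := by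
    rw [mD_congr (Filter.Eventually.of_forall h0), mD_id]; rfl
  have e5 : mD 𝓘(ℝ, ℝ) (𝓡 d) (fun s => φ s x) 0 a = a • V x := by
    rw [← e3, ← map_smul, smul_eq_mul, mul_one]
  have e6 : ((a, v) : ℝ × ℰ d) = (a, 0) + (0, v) := by simp
  rw [e6, map_add, ← e1, ← e2]
  refine congrArg₂ (· + ·) ?_ ?_
  · exact (DFunLike.congr_fun h1 a).symm.trans e5
  · exact (DFunLike.congr_fun h2 v).symm.trans e4

/-- The vector field in the contact planes which is dual to a one-form. -/
theorem exists_contact_dual (hα : IsContactForm α) {δ : OneForm d X} {K : Set X}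
    (hδ : ∀ x ∉ K, δ.cov x = 0) :
    ∃ V : X → ℰ d,
      ContMDiff (𝓡 d) (𝓡 d).tangent ∞ (fun x => mkTan (𝓡 d) x (V x)) ∧ (∀ x ∉ K, V x = 0) ∧
      ∀ x, α.cov x (V x) = 0 ∧ ∀ w, α.cov x w = 0 → α.extL x (V x) w = -δ.cov x w := by
  -- For the family `α + t δ` at `t = 0` with zero Hamiltonian, the equations of a contact vector
  -- are those of the dual field, so `contactField_spec` provides existence and smoothness.
  have hcov : ∀ x, contactCov α δ id (0, x) = α.cov x := fun x => by
    simp only [contactCov, id_eq, zero_smul, add_zero]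
  have hext : ∀ x, contactExt α δ id (0, x) = α.extL x := fun x => by
    ext1 a
    ext1 b
    change α.extL x a b + (0 : ℝ) * δ.extL x a b = _
    rw [zero_mul, add_zero]
  have hrhs : ∀ x, contactRhs δ id (fun _ => 0) (0, x) = -δ.cov x := fun x => by
    have h1 : mD (𝓡 d) 𝓘(ℝ, ℝ) (fun _ : X => (0 : ℝ)) x = 0 := mfderiv_const
    have h2 : deriv (id : ℝ → ℝ) 0 = 1 := deriv_id 0
    simp only [contactRhs, h1, h2, neg_zero, one_smul, zero_sub]
  have hspec := fun x => (contactField_spec (α := α) (δ := δ) (p₀ := (0, x)) contDiff_id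
    (contMDiff_const (c := (0 : ℝ))) (by rw [hcov, hext]; exact hα.isContactAt x)).self_of_nhds
  have hiff : ∀ x v, IsContactVector α δ id (fun _ => 0) (0, x) v ↔
      α.cov x v = 0 ∧ ∀ w, α.cov x w = 0 → α.extL x v w = -δ.cov x w := fun x v => by
    rw [IsContactVector, hcov, hext, hrhs]
    rfl
  refine ⟨fun x => contactField α δ id (fun _ => 0) 0 x, fun x => ?_, fun x hx => ?_, fun x => ?_⟩
  · exact ContMDiffAt.comp (f := fun x : X => ((0 : ℝ), x)) x (hspec x).1
      (contMDiffAt_const.prodMk contMDiffAt_id)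
  · refine (((hspec x).2 0).1 ((hiff x 0).2 ⟨map_zero _, fun w _ => ?_⟩)).symm
    rw [hδ x hx, map_zero]
    exact neg_zero.symm
  · exact (hiff x _).1 (((hspec x).2 _).2 rfl)

end ContactDual

/-! ### A map from `T*Y` to `M` adapted to the contact structure -/

section FiberExp

variable {d k : ℕ}
  {M : Type*} [TopologicalSpace M] [T2Space M] [ChartedSpace (ℰ d) M]
  [IsManifold (𝓡 d) ∞ M]
  {Y : Type*} [TopologicalSpace Y] [ChartedSpace (ℰ k) Y]
  [IsManifold (𝓡 k) ∞ Y] {α : OneForm d M}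

/-- Each pair `(δ, V)` contributes the flow of the field dual to `δ`, run for the time `s(V y)`. The
composition is `ι` on the zero section, and its derivative along a fibre there is the sum of the
contributions. -/
theorem exists_fiberExp_of_list (hα : IsContactForm α) {ι : Y → M}
    (hι : ContMDiff (𝓡 k) (𝓡 d) ∞ ι) (l : List (OneForm d M × (Y → ℰ k)))
    (hc : ∀ p ∈ l, ∃ K : Set M, IsCompact K ∧ ∀ x ∉ K, p.1.cov x = 0)
    (hs : ∀ p ∈ l, ContMDiff (𝓡 k) (𝓡 k).tangent ∞ (fun y => mkTan (𝓡 k) y (p.2 y))) :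
    ∃ Ex : CotangentTotal k Y → M, ContMDiff (cotangentModel k) (𝓡 d) ∞ Ex ∧
      (∀ y, Ex (mkCot y 0) = ι y) ∧ ∀ (y : Y) (s : ℰ* k), ∃ v,
        HasVelocity (𝓡 d) (fun r : ℝ => Ex (mkCot y (r • s))) v 0 ∧ α.cov (ι y) v = 0 ∧
        ∀ w, α.cov (ι y) w = 0 →
          α.extL (ι y) v w = -(l.map fun p => s (p.2 y) * p.1.cov (ι y) w).sum := by
  induction l with
  | nil =>
    refine ⟨fun p => ι p.proj, fun p => (hι _).comp p (contMDiffAt_proj le_rfl contMDiffAt_id),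
      fun y => rfl, fun y s => ⟨0, hasVelocity_const (I := 𝓡 d) (ι y) 0, map_zero _, fun w _ => ?_⟩⟩
    rw [map_zero, List.map_nil, List.sum_nil, neg_zero]
    rfl
  | cons p l ih =>
    obtain ⟨Ex, hEx, h0, hv⟩ := ih (fun q hq => hc q (List.mem_cons_of_mem _ hq))
      fun q hq => hs q (List.mem_cons_of_mem _ hq)
    obtain ⟨K, hK, hδ⟩ := hc p List.mem_cons_self
    obtain ⟨V, hV, hVK, hVα⟩ := exists_contact_dual hα hδ
    obtain ⟨Φ, hΦ, hΦ0, hΦD⟩ := exists_family_of_compact_support hV hK hVK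
    have hpair : ContMDiff (cotangentModel k) 𝓘(ℝ, ℝ) ∞
        (fun q : CotangentTotal k Y => q.cov (p.2 q.proj)) := fun q =>
      ContMDiffAt.cov_apply (y := fun q : CotangentTotal k Y => q.proj) (c := fun q => q.cov)
        (v := fun q => p.2 q.proj) le_rfl contMDiffAt_id
        ((hs p List.mem_cons_self _).comp q (contMDiffAt_proj le_rfl contMDiffAt_id))
    refine ⟨fun q => Φ (q.cov (p.2 q.proj), Ex q), hΦ.comp (hpair.prodMk hEx), fun y => ?_,
      fun y s => ?_⟩
    · change Φ (0, Ex (mkCot y 0)) = ι y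
      rw [hΦ0, h0]
    · obtain ⟨v, hv1, hv2, hv3⟩ := hv y s
      have hz : Ex (mkCot y ((0 : ℝ) • s)) = ι y := by rw [zero_smul, h0]
      refine ⟨s (p.2 y) • V (ι y) + v, ?_, ?_, fun w hw => ?_⟩
      · have h1 : HasDerivAt (fun r : ℝ => r * s (p.2 y)) (s (p.2 y)) 0 := by
          simpa using (hasDerivAt_id (0 : ℝ)).mul_const (s (p.2 y))
        have h2 := (HasVelocity.prodMk h1 hv1).comp (f := Φ) (I' := 𝓡 d)
          (hΦ.mdifferentiable (by simp) _)
        rw [zero_mul, hz, hΦD] at h2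
        exact h2
      · rw [map_add, map_smul, (hVα _).1, hv2, smul_zero, add_zero]
      · rw [map_add, map_smul, add_apply, smul_apply, (hVα _).2 w hw, hv3 w hw, List.map_cons,
          List.sum_cons, neg_add, smul_eq_mul, mul_neg]

/-- There is a smooth map on the cotangent bundle that maps the zero section to the submanifold and
has the derivative dual to the canonical pairing in the direction of the fibres. -/
theorem exists_fiberExp [CompactSpace Y] [T2Space Y] [LocallyCompactSpace M] [SigmaCompactSpace M]
    (hα : IsContactForm α) {ι : Y → M} (hι : Manifold.IsImmersion (𝓡 k) (𝓡 d) ∞ ι) :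
    ∃ Ex : CotangentTotal k Y → M, ContMDiff (cotangentModel k) (𝓡 d) ∞ Ex ∧
      (∀ y, Ex (mkCot y 0) = ι y) ∧ ∀ (y : Y) (s : ℰ* k), ∃ v,
        HasVelocity (𝓡 d) (fun r : ℝ => Ex (mkCot y (r • s))) v 0 ∧ α.cov (ι y) v = 0 ∧
        ∀ u, α.cov (ι y) (mD (𝓡 k) (𝓡 d) ι y u) = 0 →
          α.extL (ι y) v (mD (𝓡 k) (𝓡 d) ι y u) = -s u := by
  obtain ⟨l, hl⟩ := exists_isWeightedFrame hι
  obtain ⟨Ex, h1, h2, h3⟩ := exists_fiberExp_of_list hα hι.contMDiff l hl.compact hl.smooth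
  refine ⟨Ex, h1, h2, fun y s => ?_⟩
  obtain ⟨v, hv, hv', hv''⟩ := h3 y s
  refine ⟨v, hv, hv', fun u hu => ?_⟩
  rw [hv'' _ hu, hl.sum_eq, one_mul]

end FiberExp

/-! ### The tangent spaces of `T*Y` along the zero section -/

section ZeroSection

variable {k : ℕ} {Y : Type*} [TopologicalSpace Y] [ChartedSpace (ℰ k) Y]
  [IsManifold (𝓡 k) ∞ Y]

theorem contMDiff_zeroSection : ContMDiff (𝓡 k) (cotangentModel k) ∞
    (fun y : Y => (mkCot y 0 : CotangentTotal k Y)) := fun y =>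
  (contMDiffAt_mkCot_iff (y := fun y : Y => y) le_rfl (mem_chart_source _ y)).2
    ⟨contMDiffAt_id, by simp only [ContinuousLinearMap.zero_comp]; exact contMDiffAt_const⟩

theorem contMDiff_fiber (y : Y) :
    ContMDiff 𝓘(ℝ, ℰ* k) (cotangentModel k) ∞
      (fun s => (mkCot y s : CotangentTotal k Y)) := fun _ =>
  (contMDiffAt_mkCot_iff (y := fun _ => y) le_rfl (mem_chart_source _ y)).2
    ⟨contMDiffAt_const, (contDiff_id.clm_comp contDiff_const).contMDiff _⟩

/-- The tangent spaces of the cotangent bundle at the zero section are spanned by the tangent spaces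
of the zero section and of the fibre. -/
theorem exists_tangent_decomp (y : Y)
    (X : ℰ k × ℰ* k) :
    ∃ u s, X = mD (𝓡 k) (cotangentModel k) (fun y : Y => (mkCot y 0 : CotangentTotal k Y)) y u +
      mD 𝓘(ℝ, ℰ* k) (cotangentModel k)
        (fun s => (mkCot y s : CotangentTotal k Y)) 0 s := by
  set A := mD (𝓡 k) (cotangentModel k) (fun y : Y => (mkCot y 0 : CotangentTotal k Y)) y with hA
  set B := mD 𝓘(ℝ, ℰ* k) (cotangentModel k)
    (fun s => (mkCot y s : CotangentTotal k Y)) 0 with hB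
  have hp : MDifferentiableAt (cotangentModel k) (𝓡 k)
      (fun p : CotangentTotal k Y => p.proj) (mkCot y 0 : CotangentTotal k Y) :=
    (contMDiffAt_proj (n := ∞) (g := fun p : CotangentTotal k Y => p)
      (a := (mkCot y 0 : CotangentTotal k Y)) le_rfl contMDiffAt_id).mdiff
  have hzd := (contMDiff_zeroSection (k := k) (Y := Y)).mdifferentiable (by simp) y
  have hfd := (contMDiff_fiber (k := k) y).mdifferentiable (by simp) 0
  have h1 := mD_comp hp hzd rfl
  have h2 := mD_comp hp hfd rfl
  have h3 : mD (𝓡 k) (𝓡 k) (fun y : Y => (mkCot y 0 : CotangentTotal k Y).proj) y =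
      ContinuousLinearMap.id ℝ _ := mD_id y
  have h4 : mD 𝓘(ℝ, ℰ* k) (𝓡 k)
      (fun s => (mkCot y s : CotangentTotal k Y).proj) 0 = 0 := mfderiv_const
  have hq : MDifferentiableAt (cotangentModel k) 𝓘(ℝ, ℰ* k)
      (fun p : CotangentTotal k Y => cotCoord y p) (mkCot y 0) :=
    ((contMDiffAt_cotangent_iff (n := ∞) (g := fun p : CotangentTotal k Y => p)
      (a := (mkCot y 0 : CotangentTotal k Y)) le_rfl (x₀ := y)
      (mem_chart_source _ y)).1 contMDiffAt_id).2.mdiff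
  have h5 := mD_comp hq hfd rfl
  have h6 : mD 𝓘(ℝ, ℰ* k) 𝓘(ℝ, ℰ* k)
      (fun s => cotCoord y (mkCot y s : CotangentTotal k Y)) 0 = ContinuousLinearMap.id ℝ _ := by
    have : (fun s => cotCoord y (mkCot y s : CotangentTotal k Y)) = fun s => s :=
      funext fun s => cotCoord_self (mkCot y s)
    rw [this]
    exact mD_id (I := 𝓘(ℝ, ℰ* k)) 0
  -- The projection detects the first summand and the fibre coordinate the second; surjectivity
  -- follows by equality of dimensions.
  have hinj : Function.Injective (A.coprod B) := by
    rw [injective_iff_map_eq_zero]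
    rintro ⟨u, s⟩ h
    rw [ContinuousLinearMap.coprod_apply] at h
    have hu : u = 0 := by
      have e1 := congrArg (mD (cotangentModel k) (𝓡 k) (fun p : CotangentTotal k Y => p.proj)
        (mkCot y 0)) h
      rw [map_add, map_zero] at e1
      have e2 := (DFunLike.congr_fun (h1.symm.trans h3) u)
      have e3 := (DFunLike.congr_fun (h2.symm.trans h4) s)
      rw [ContinuousLinearMap.comp_apply] at e2 e3
      rw [← hA] at e2
      rw [← hB] at e3
      rw [e2, e3] at e1
      simpa using e1
    subst hu
    rw [map_zero, zero_add] at h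
    have e2 := (DFunLike.congr_fun (h5.symm.trans h6) s)
    rw [ContinuousLinearMap.comp_apply, ← hB, h, map_zero] at e2
    rw [← show (0 : ℰ* k) = s from e2]
    rfl
  have hdim : Module.finrank ℝ (ℰ k × ℰ* k) =
      Module.finrank ℝ (ℰ k × ℰ* k) := rfl
  obtain ⟨⟨u, s⟩, h⟩ := (LinearMap.injective_iff_surjective_of_finrank_eq_finrank hdim
    (f := (A.coprod B).toLinearMap)).1 hinj X
  exact ⟨u, s, h.symm⟩

end ZeroSection

/-! ### Tubular neighbourhoods modelled on the annihilator of `R` -/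

section Tube

variable {d k : ℕ}
  {M : Type*} [TopologicalSpace M] [T2Space M] [ChartedSpace (ℰ d) M]
  [IsManifold (𝓡 d) ∞ M]
  {Y : Type*} [TopologicalSpace Y] [ChartedSpace (ℰ k) Y]
  [IsManifold (𝓡 k) ∞ Y] {α : OneForm d M} {ι : ContMDiffMap (𝓡 k) (𝓡 d) Y M ∞}
  {L : PlaneField k Y} {R : Y → ℰ k}
  {Ex : CotangentTotal k Y → M} {v : Y → ℰ* k → ℰ d}

/-- A map on the cotangent bundle that maps the zero section to the submanifold `ι` and has the
derivatives `v` in the direction of the fibres, which are dual to the canonical pairing. -/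
structure IsFiberExp (α : OneForm d M) (ι : ContMDiffMap (𝓡 k) (𝓡 d) Y M ∞)
    (Ex : CotangentTotal k Y → M)
    (v : Y → ℰ* k → ℰ d) : Prop where
  contMDiff : ContMDiff (cotangentModel k) (𝓡 d) ∞ Ex
  zero : ∀ y, Ex (mkCot y 0) = ι y
  hasVelocity : ∀ y s, HasVelocity (𝓡 d) (fun r : ℝ => Ex (mkCot y (r • s))) (v y s) 0
  cov_eq_zero : ∀ y s, α.cov (ι y) (v y s) = 0
  extL_eq : ∀ y s u, (α.pullback ι).cov y u = 0 →
    α.extL (ι y) (v y s) (mD (𝓡 k) (𝓡 d) ι y u) = -s u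

theorem IsFiberExp.mD_zero (h : IsFiberExp α ι Ex v) (y : Y) (u : ℰ k) :
    mD (cotangentModel k) (𝓡 d) Ex (mkCot y 0)
      (mD (𝓡 k) (cotangentModel k) (fun y : Y => (mkCot y 0 : CotangentTotal k Y)) y u) =
    mD (𝓡 k) (𝓡 d) ι y u := by
  have h1 := mD_comp (h.contMDiff.mdifferentiable (by simp) _)
    ((contMDiff_zeroSection (k := k) (Y := Y)).mdifferentiable (by simp) y) rfl
  rw [mD_congr (Filter.Eventually.of_forall h.zero)] at h1
  exact (DFunLike.congr_fun h1 u).symm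

theorem hasVelocity_fiber_line (y : Y) (s : ℰ* k) :
    HasVelocity (cotangentModel k) (fun r : ℝ => (mkCot y (r • s) : CotangentTotal k Y))
      (mD 𝓘(ℝ, ℰ* k) (cotangentModel k)
        (fun s => (mkCot y s : CotangentTotal k Y)) 0 s) 0 := by
  have h1 : HasVelocity 𝓘(ℝ, ℰ* k) (fun r : ℝ => r • s) s 0 :=
    hasVelocity_iff_hasDerivAt.2 (by simpa using (hasDerivAt_id (0 : ℝ)).smul_const s)
  have h2 := h1.comp (f := fun s => (mkCot y s : CotangentTotal k Y)) (I' := cotangentModel k)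
    ((contMDiff_fiber (k := k) y).mdifferentiable (by simp) _)
  rw [zero_smul] at h2
  exact h2

theorem IsFiberExp.mD_fiber (h : IsFiberExp α ι Ex v) (y : Y)
    (s : ℰ* k) :
    mD (cotangentModel k) (𝓡 d) Ex (mkCot y 0)
      (mD 𝓘(ℝ, ℰ* k) (cotangentModel k)
        (fun s => (mkCot y s : CotangentTotal k Y)) 0 s) = v y s := by
  have h1 := (hasVelocity_fiber_line y s).comp (f := Ex) (I' := 𝓡 d)
    (h.contMDiff.mdifferentiable (by simp) _)
  rw [zero_smul] at h1
  exact h1.unique (h.hasVelocity y s)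

theorem IsTransverseSection.mD_fiberPairing (hR : IsTransverseSection (α.pullback ι) L R) (y : Y)
    (u : ℰ k) (s : ℰ* k) :
    mD (cotangentModel k) 𝓘(ℝ, ℝ) (fiberPairing R) (mkCot y 0)
      (mD (𝓡 k) (cotangentModel k) (fun y : Y => (mkCot y 0 : CotangentTotal k Y)) y u +
      mD 𝓘(ℝ, ℰ* k) (cotangentModel k)
        (fun s => (mkCot y s : CotangentTotal k Y)) 0 s) = s (R y) := by
  have hf : MDifferentiable (cotangentModel k) 𝓘(ℝ, ℝ) (fiberPairing R) := fun p =>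
    (hR.contMDiffAt_fiberPairing (g := fun p => p) contMDiffAt_id).mdiff
  have h1 := mD_comp (hf _)
    ((contMDiff_zeroSection (k := k) (Y := Y)).mdifferentiable (by simp) y) rfl
  have h2 : mD (𝓡 k) 𝓘(ℝ, ℝ) (fun y : Y => fiberPairing R (mkCot y 0 : CotangentTotal k Y)) y = 0 :=
    (mD_congr (Filter.Eventually.of_forall fun y => rfl)).trans (mfderiv_const (c := (0 : ℝ)))
  have h3 := (hasVelocity_fiber_line y s).comp (f := fiberPairing R) (I' := 𝓘(ℝ, ℝ)) (hf _)
  have h4 : HasVelocity 𝓘(ℝ, ℝ) (fun r : ℝ => fiberPairing R (mkCot y (r • s))) (s (R y)) 0 :=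
    hasVelocity_iff_hasDerivAt.2 (by
      have := (hasDerivAt_id (0 : ℝ)).mul_const (s (R y))
      rw [one_mul] at this
      exact this)
  rw [zero_smul] at h3
  rw [map_add]
  have e1 := DFunLike.congr_fun (h1.symm.trans h2) u
  rw [ContinuousLinearMap.comp_apply] at e1
  rw [e1, h3.unique h4]
  exact zero_add _

theorem IsFiberExp.contMDiff_thicken (h : IsFiberExp α ι Ex v)
    (hR : IsTransverseSection (α.pullback ι) L R) :
    ContMDiff (cotangentModel k) ((𝓡 d).prod 𝓘(ℝ, ℝ)) ∞ (fun p => (Ex p, fiberPairing R p)) :=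
  h.contMDiff.prodMk fun _ => hR.contMDiffAt_fiberPairing (g := fun p => p) contMDiffAt_id

theorem IsFiberExp.mD_thicken (h : IsFiberExp α ι Ex v)
    (hR : IsTransverseSection (α.pullback ι) L R) (y : Y) (u : ℰ k)
    (s : ℰ* k) :
    mD (cotangentModel k) ((𝓡 d).prod 𝓘(ℝ, ℝ)) (fun p => (Ex p, fiberPairing R p)) (mkCot y 0)
      (mD (𝓡 k) (cotangentModel k) (fun y : Y => (mkCot y 0 : CotangentTotal k Y)) y u +
      mD 𝓘(ℝ, ℰ* k) (cotangentModel k)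
        (fun s => (mkCot y s : CotangentTotal k Y)) 0 s) =
    (mD (𝓡 k) (𝓡 d) ι y u + v y s, s (R y)) := by
  have h1 := mfderiv_prodMk (h.contMDiff.mdifferentiable (by simp) (mkCot y 0))
    ((hR.contMDiffAt_fiberPairing (g := fun p : CotangentTotal k Y => p) (a := mkCot y 0)
      contMDiffAt_id).mdiff)
  refine (DFunLike.congr_fun h1 _).trans (Prod.ext ?_ ?_)
  · refine (map_add (mD (cotangentModel k) (𝓡 d) Ex (mkCot y 0)) _ _).trans ?_
    rw [h.mD_zero, h.mD_fiber]
  · exact hR.mD_fiberPairing y u s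

/-- A vector `ι_* u + v s` with `s R = 0` vanishes only if `u` and `s` vanish. -/
theorem IsFiberExp.eq_zero (h : IsFiberExp α ι Ex v) (hR : IsTransverseSection (α.pullback ι) L R)
    (hiso : (α.pullback ι).Involutive) (hinj : ∀ y, Function.Injective (mD (𝓡 k) (𝓡 d) ι y))
    {y : Y} {u : ℰ k} {s : ℰ* k}
    (hs : s (R y) = 0) (h0 : mD (𝓡 k) (𝓡 d) ι y u + v y s = 0) : u = 0 ∧ s = 0 := by
  -- Applying `α` gives `λ u = 0`. After pairing by `dα` with `ι_* w` for `w` in `ker λ`, the term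
  -- with `u` vanishes by integrability and `s w = 0` remains. As `s` also vanishes on `R`, it is
  -- zero.
  have hu : (α.pullback ι).cov y u = 0 := by
    have h1 := congrArg (α.cov (ι y)) h0
    rw [map_add, h.cov_eq_zero, add_zero, map_zero] at h1
    exact h1
  have hker : ∀ w, (α.pullback ι).cov y w = 0 → s w = 0 := by
    intro w hw
    have h1 := DFunLike.congr_fun (congrArg (α.extL (ι y)) h0) (mD (𝓡 k) (𝓡 d) ι y w)
    rw [map_add, add_apply, h.extL_eq y s w hw, ← OneForm.extL_pullback, hiso y u w hu hw, map_zero,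
      zero_add] at h1
    exact neg_eq_zero.1 h1
  have hs0 : s = 0 := by
    ext w
    have h1 := hker (w - (α.pullback ι).cov y w • R y) (by
      rw [map_sub, map_smul, hR.apply_eq_one, smul_eq_mul, mul_one, sub_self])
    rw [map_sub, map_smul, hs, smul_zero, sub_zero] at h1
    exact h1
  refine ⟨(injective_iff_map_eq_zero _).1 (hinj y) u ?_, hs0⟩
  have hv : v y 0 = 0 := by
    have h1 := h.hasVelocity y 0
    simp only [smul_zero] at h1
    exact h1.unique (hasVelocity_const _ _)
  rwa [hs0, hv, add_zero] at h0

theorem IsFiberExp.bijective_mD_thicken (h : IsFiberExp α ι Ex v)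
    (hR : IsTransverseSection (α.pullback ι) L R)
    (hiso : (α.pullback ι).Involutive) (hinj : ∀ y, Function.Injective (mD (𝓡 k) (𝓡 d) ι y))
    (hdk : d + 1 = k + k) (y : Y) :
    Function.Bijective (mD (cotangentModel k) ((𝓡 d).prod 𝓘(ℝ, ℝ))
      (fun p => (Ex p, fiberPairing R p)) (mkCot y 0)) := by
  have hinj' : Function.Injective (mD (cotangentModel k) ((𝓡 d).prod 𝓘(ℝ, ℝ))
      (fun p => (Ex p, fiberPairing R p)) (mkCot y 0)) := by
    rw [injective_iff_map_eq_zero]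
    intro X hX
    obtain ⟨u, s, rfl⟩ := exists_tangent_decomp y X
    rw [h.mD_thicken hR] at hX
    obtain ⟨h1, h2⟩ := Prod.mk.inj hX
    obtain ⟨rfl, rfl⟩ := h.eq_zero hR hiso hinj h2 h1
    rw [map_zero, map_zero, add_zero]
  have hdim : Module.finrank ℝ (ℰ k × ℰ* k) =
      Module.finrank ℝ (ℰ d × ℝ) := by
    rw [Module.finrank_prod, Module.finrank_prod, finrank_clm_real, finrank_euclideanSpace_fin,
      finrank_euclideanSpace_fin, Module.finrank_self, hdk]
  exact ⟨hinj', (LinearMap.injective_iff_surjective_of_finrank_eq_finrank hdim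
    (f := (mD (cotangentModel k) ((𝓡 d).prod 𝓘(ℝ, ℝ))
      (fun p => (Ex p, fiberPairing R p)) (mkCot y 0)).toLinearMap)).1 hinj'⟩

theorem IsFiberExp.exists_decomp (h : IsFiberExp α ι Ex v)
    (hR : IsTransverseSection (α.pullback ι) L R)
    (hiso : (α.pullback ι).Involutive) (hinj : ∀ y, Function.Injective (mD (𝓡 k) (𝓡 d) ι y))
    (hdk : d + 1 = k + k) (y : Y) (w : ℰ d) :
    ∃ u s, s (R y) = 0 ∧ w = mD (𝓡 k) (𝓡 d) ι y u + v y s := by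
  obtain ⟨X, hX⟩ := (h.bijective_mD_thicken hR hiso hinj hdk y).2 (w, 0)
  obtain ⟨u, s, rfl⟩ := exists_tangent_decomp y X
  rw [h.mD_thicken hR] at hX
  obtain ⟨h1, h2⟩ := Prod.mk.inj hX
  exact ⟨u, s, h2, h1.symm⟩

/-- `Θ` is inverse, on the open set `N`, to the restriction of `Ex` to the annihilator of `R`. -/
structure IsTube (ι : Y → M) (R : Y → ℰ k) (Ex : CotangentTotal k Y → M)
    (Θ : M → CotangentTotal k Y) (U : Set (CotangentTotal k Y)) (N : Set M) : Prop where
  isOpen_U : IsOpen U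
  isOpen_N : IsOpen N
  contMDiffAt : ∀ z ∈ N, ContMDiffAt (𝓡 d) (cotangentModel k) ∞ Θ z
  mem_U : ∀ z ∈ N, Θ z ∈ U
  fiberPairing_eq : ∀ z ∈ N, fiberPairing R (Θ z) = 0
  Ex_Θ : ∀ z ∈ N, Ex (Θ z) = z
  mem_N : ∀ p ∈ U, fiberPairing R p = 0 → Ex p ∈ N
  Θ_Ex : ∀ p ∈ U, fiberPairing R p = 0 → Θ (Ex p) = p
  zero_mem : ∀ y, mkCot y 0 ∈ U

/-- The map `p ↦ (Ex p, p(R))` is a local diffeomorphism along the zero section and injective on it,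
hence injective on a neighbourhood of this compact set. The tube is its restriction to the level
`p(R) = 0`. -/
theorem IsFiberExp.exists_isTube [CompactSpace Y] [T2Space Y] [Nonempty Y]
    (h : IsFiberExp α ι Ex v) (hR : IsTransverseSection (α.pullback ι) L R)
    (hιi : Function.Injective ι) (hiso : (α.pullback ι).Involutive)
    (hinj : ∀ y, Function.Injective (mD (𝓡 k) (𝓡 d) ι y)) (hdk : d + 1 = k + k) :
    ∃ Θ U N, IsTube (d := d) (k := k) ι R Ex Θ U N := by
  classical
  have : Nonempty (CotangentTotal k Y) := ⟨mkCot (Classical.arbitrary Y) 0⟩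
  set T : CotangentTotal k Y → M × ℝ := fun p => (Ex p, fiberPairing R p) with hTdef
  have hT : ContMDiff (cotangentModel k) ((𝓡 d).prod 𝓘(ℝ, ℝ)) ∞ T := h.contMDiff_thicken hR
  have hloc : ∀ y, ∃ g : M × ℝ → CotangentTotal k Y, (∀ᶠ p in 𝓝 (mkCot y 0), g (T p) = p) ∧
      ∀ᶠ w in 𝓝 (T (mkCot y 0)), T (g w) = w ∧
        ContMDiffAt ((𝓡 d).prod 𝓘(ℝ, ℝ)) (cotangentModel k) ∞ g w := fun y => by
    obtain ⟨g, -, h1, h2⟩ := exists_local_inverse (Filter.Eventually.of_forall fun p => hT p)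
      (h.bijective_mD_thicken hR hiso hinj hdk y)
    exact ⟨g, h1, h2⟩
  choose g hg1 hg2 using hloc
  set Z : Set (CotangentTotal k Y) := range fun y => mkCot y 0 with hZ
  have hZc : IsCompact Z := isCompact_range contMDiff_zeroSection.continuous
  obtain ⟨U₁, hU₁, hZU₁, hU₁inj⟩ := InjOn.exists_isOpen_superset (f := T) (s := Z) (by
    rintro _ ⟨y, rfl⟩ _ ⟨y', rfl⟩ h1
    have h2 := (Prod.mk.inj h1).1
    rw [h.zero, h.zero] at h2
    rw [hιi h2]) hZc (fun p _ => hT.continuous.continuousAt) (by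
    rintro _ ⟨y, rfl⟩
    exact ⟨_, hg1 y, fun p hp q hq hpq => by
      have hp' : g y (T p) = p := hp
      have hq' : g y (T q) = q := hq
      rw [← hp', hpq, hq']⟩)
  let good : Y → CotangentTotal k Y → Prop := fun y p => (∀ᶠ w in 𝓝 (T p), T (g y w) = w ∧
    ContMDiffAt ((𝓡 d).prod 𝓘(ℝ, ℝ)) (cotangentModel k) ∞ (g y) w) ∧ ∀ᶠ q in 𝓝 p, g y (T q) = q
  have hgood : ∀ y, ∀ᶠ p in 𝓝 (mkCot y 0), good y p := fun y =>
    (hT.continuous.continuousAt.eventually (eventually_eventually_nhds.2 (hg2 y))).and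
      (eventually_eventually_nhds.2 (hg1 y))
  let U : Set (CotangentTotal k Y) := {p | p ∈ U₁ ∧ ∃ y, ∀ᶠ q in 𝓝 p, good y q}
  have hU : IsOpen U := isOpen_iff_mem_nhds.2 fun p hp => by
    obtain ⟨hp1, y, hp2⟩ := hp
    filter_upwards [hU₁.mem_nhds hp1, eventually_eventually_nhds.2 hp2] with q hq hq'
    exact ⟨hq, y, hq'⟩
  let G : M × ℝ → CotangentTotal k Y := Function.invFunOn T U
  have hGT : ∀ p ∈ U, G (T p) = p := fun p hp =>
    hU₁inj (Function.invFunOn_mem ⟨p, hp, rfl⟩ : G (T p) ∈ U).1 hp.1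
      (Function.invFunOn_eq ⟨p, hp, rfl⟩)
  -- Near `T p` the global inverse `G` agrees with a smooth local inverse, by injectivity of `T` on
  -- `U`, and inherits its smoothness.
  have hGs : ∀ p ∈ U, ∀ᶠ w in 𝓝 (T p), w ∈ T '' U ∧
      ContMDiffAt ((𝓡 d).prod 𝓘(ℝ, ℝ)) (cotangentModel k) ∞ G w := by
    intro p hp
    obtain ⟨hp1, y, hp2⟩ := hp
    have h1 := hp2.self_of_nhds.1
    have h2 : g y (T p) = p := hp2.self_of_nhds.2.self_of_nhds
    have h3 : ∀ᶠ w in 𝓝 (T p), g y w ∈ U := by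
      have := h1.self_of_nhds.2.continuousAt
      refine this.eventually (p := fun q => q ∈ U) ?_
      rw [h2]
      exact hU.mem_nhds ⟨hp1, y, hp2⟩
    have h4 : ∀ᶠ w in 𝓝 (T p), T (g y w) = w ∧ g y w ∈ U ∧
        ContMDiffAt ((𝓡 d).prod 𝓘(ℝ, ℝ)) (cotangentModel k) ∞ (g y) w := by
      filter_upwards [h1, h3] with w hw hw'
      exact ⟨hw.1, hw', hw.2⟩
    filter_upwards [eventually_eventually_nhds.2 h4] with w hw
    refine ⟨⟨_, hw.self_of_nhds.2.1, hw.self_of_nhds.1⟩,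
      hw.self_of_nhds.2.2.congr_of_eventuallyEq ?_⟩
    filter_upwards [hw] with x hx
    have := hGT _ hx.2.1
    rwa [hx.1] at this
  have hTU : IsOpen (T '' U) := isOpen_iff_mem_nhds.2 fun w hw => by
    obtain ⟨p, hp, rfl⟩ := hw
    exact (hGs p hp).mono fun w hw => hw.1
  have hpr : ∀ z ∈ (fun z : M => (z, (0 : ℝ))) ⁻¹' (T '' U), ∃ p ∈ U, Ex p = z ∧
      fiberPairing R p = 0 ∧ G (z, 0) = p := by
    rintro z ⟨p, hp, hpz⟩
    obtain ⟨h1, h2⟩ := Prod.mk.inj hpz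
    exact ⟨p, hp, h1, h2, (congrArg G hpz.symm).trans (hGT p hp)⟩
  have hTp : ∀ p, fiberPairing R p = 0 → T p = (Ex p, 0) := fun p hp => by
    simp only [hTdef, hp]
  refine ⟨fun z => G (z, 0), U, (fun z : M => (z, (0 : ℝ))) ⁻¹' (T '' U), hU,
    hTU.preimage (by fun_prop), fun z hz => ?_, fun z hz => ?_, fun z hz => ?_, fun z hz => ?_,
    fun p hp hp0 => ⟨p, hp, hTp p hp0⟩, fun p hp hp0 => ?_, fun y => ⟨hZU₁ ⟨y, rfl⟩, y, ?_⟩⟩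
  · obtain ⟨p, hp, hpz⟩ := hz
    have := (hGs p hp).self_of_nhds.2
    rw [hpz] at this
    exact this.comp z (contMDiffAt_id.prodMk contMDiffAt_const)
  · obtain ⟨p, hp, h1, h2, h3⟩ := hpr z hz
    rw [h3]; exact hp
  · obtain ⟨p, hp, h1, h2, h3⟩ := hpr z hz
    rw [h3]; exact h2
  · obtain ⟨p, hp, h1, h2, h3⟩ := hpr z hz
    rw [h3]; exact h1
  · exact (congrArg G (hTp p hp0).symm).trans (hGT p hp)
  · exact hgood y

end Tube

/-! ### Exterior derivatives of forms factoring through a projection -/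

section ExteriorDerivative

variable {d k : ℕ}
  {M : Type*} [TopologicalSpace M] [ChartedSpace (ℰ d) M]
  [IsManifold (𝓡 d) ∞ M]
  {Y : Type*} [TopologicalSpace Y] [ChartedSpace (ℰ k) Y]
  [IsManifold (𝓡 k) ∞ Y]

theorem OneForm.extL_antisymm (μ : OneForm d M) (x : M) (v w : ℰ d) :
    μ.extL x v w = -μ.extL x w v := by
  rw [OneForm.extL, dextL_apply, dextL_apply, dext, dext, neg_sub]

theorem OneForm.extL_sub (μ ν : OneForm d M) (x : M) : (μ - ν).extL x = μ.extL x - ν.extL x := by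
  have hx := mem_chart_source (ℰ d) x
  have hd : ∀ μ : OneForm d M, DifferentiableAt ℝ (pb μ (extChartAt (𝓡 d) x).symm)
      (extChartAt (𝓡 d) x x) := fun μ =>
    (contDiffAt_pb μ (contMDiffAt_extChartAt_symm hx)).differentiableAt (by simp)
  have h1 : pb (μ - ν) (extChartAt (𝓡 d) x).symm = fun e =>
      pb μ (extChartAt (𝓡 d) x).symm e - pb ν (extChartAt (𝓡 d) x).symm e := by
    funext e
    rw [pb, OneForm.cov_sub, ContinuousLinearMap.sub_comp]
    rfl
  have h2 := fderiv_fun_sub (hd μ) (hd ν)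
  ext v w
  simp only [OneForm.extL, dextL_apply, dext, h1, h2, sub_apply]
  ring

/-- The exterior derivative of the one-form `c ∘ Dq`. -/
theorem OneForm.extL_of_eventually_eq {β : OneForm d M} {x : M} {q : M → Y}
    {c : M → ℰ* k} (hq : ContMDiffAt (𝓡 d) (𝓡 k) ∞ q x)
    (hc : ContMDiffAt (𝓡 d) (cotangentModel k) ∞ (fun z => mkCot (q z) (c z)) x)
    (hβ : ∀ᶠ z in 𝓝 x, β.cov z = (c z).comp (mD (𝓡 d) (𝓡 k) q z))
    (a b : ℰ d) :
    β.extL x a b =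
      mD (𝓡 d) 𝓘(ℝ, ℰ* k)
        (fun z => (c z).comp (chartDInv (𝓡 k) (q x) (q z))) x a (mD (𝓡 d) (𝓡 k) q x b) -
      mD (𝓡 d) 𝓘(ℝ, ℰ* k)
        (fun z => (c z).comp (chartDInv (𝓡 k) (q x) (q z))) x b (mD (𝓡 d) (𝓡 k) q x a) := by
  have hx := mem_chart_source (ℰ d) x
  have hqx := mem_chart_source (ℰ k) (q x)
  set ψ := extChartAt (𝓡 d) x with hψ
  set m : M → ℰ k →L[ℝ] ℝ :=
    fun z => (c z).comp (chartDInv (𝓡 k) (q x) (q z)) with hm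
  have hψx : ψ.symm (ψ x) = x := extChartAt_symm_apply_self hx
  have hs : ContMDiffAt 𝓘(ℝ, ℰ d) (𝓡 d) ∞ ψ.symm (ψ x) :=
    contMDiffAt_extChartAt_symm hx
  have hsD : mD 𝓘(ℝ, ℰ d) (𝓡 d) ψ.symm (ψ x) = ContinuousLinearMap.id ℝ _ :=
    chartDInv_self (I := 𝓡 d) x
  have hms : ContMDiffAt (𝓡 d) 𝓘(ℝ, ℰ* k) ∞ m x :=
    ((contMDiffAt_mkCot_iff le_rfl hqx).1 hc).2
  have hqs : ContMDiffAt 𝓘(ℝ, ℰ d) (𝓡 k) ∞ (fun e => q (ψ.symm e)) (ψ x) :=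
    ContMDiffAt.comp (ψ x) (by rw [hψx]; exact hq) hs
  have hmψ : ContDiffAt ℝ ∞ (fun e => m (ψ.symm e)) (ψ x) :=
    (ContMDiffAt.comp (g := m) (ψ x) (by rw [hψx]; exact hms) hs).contDiffAt
  have hqxs : q (ψ.symm (ψ x)) ∈ (chartAt (ℰ k) (q x)).source := by
    rw [hψx]; exact hqx
  have hp := contDiffAt_extChartAt_comp le_rfl hqs hqxs
  have h1 : pb β ψ.symm =ᶠ[𝓝 (ψ x)] fun e => (m (ψ.symm e)).comp
      (fderiv ℝ (fun e => extChartAt (𝓡 k) (q x) (q (ψ.symm e))) e) := by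
    have hev : ∀ {P : M → Prop}, (∀ᶠ z in 𝓝 x, P z) → ∀ᶠ e in 𝓝 (ψ x), P (ψ.symm e) :=
      fun {P} hP => hs.continuousAt.eventually (p := P) (by rw [hψx]; exact hP)
    filter_upwards [hev hβ, hev (contMDiffAt_eventually_top hq), contMDiffAt_eventually_top hs,
      hev (hq.continuousAt.preimage_mem_nhds (chart_source_nhds hqx))] with e h1 h2 h3 h4
    have h5 := mD_comp h2 h3 rfl
    rw [mD_extChartAt_comp (g := fun e => q (ψ.symm e)) (h2.comp e h3) h4, h5, pb, h1]
    ext v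
    simp only [hm, ContinuousLinearMap.comp_apply]
    rw [chartDInv_chartD_apply h4]
  have h2 : fderiv ℝ (fun e => m (ψ.symm e)) (ψ x) =
      mD (𝓡 d) 𝓘(ℝ, ℰ* k) m x := by
    rw [← mD_eq_fderiv, mD_comp (hms.mdiff) (hs.mdiff) hψx,
      hsD]
    exact ContinuousLinearMap.comp_id _
  have h3 : fderiv ℝ (fun e => extChartAt (𝓡 k) (q x) (q (ψ.symm e))) (ψ x) =
      mD (𝓡 d) (𝓡 k) q x := by
    rw [mD_extChartAt_comp (g := fun e => q (ψ.symm e)) (hqs.mdiff) hqxs,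
      mD_comp (hq.mdiff) (hs.mdiff) hψx, hsD, hψx,
      chartD_self]
    rfl
  rw [OneForm.extL, dextL_apply, dext_congr h1,
    dext_comp_fderiv (m := fun e => m (ψ.symm e)) (hmψ.differentiableAt (by simp)) (hp.of_le two_le_infty), h2, h3]

end ExteriorDerivative

/-! ### Comparison of the model form with `α` along `Y` -/

section Tube

variable {d k : ℕ}
  {M : Type*} [TopologicalSpace M] [T2Space M] [ChartedSpace (ℰ d) M]
  [IsManifold (𝓡 d) ∞ M]
  {Y : Type*} [TopologicalSpace Y] [ChartedSpace (ℰ k) Y]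
  [IsManifold (𝓡 k) ∞ Y] {α β : OneForm d M} {ι : ContMDiffMap (𝓡 k) (𝓡 d) Y M ∞}
  {L : PlaneField k Y} {R : Y → ℰ k}
  {Ex : CotangentTotal k Y → M} {v : Y → ℰ* k → ℰ d}
  {Θ : M → CotangentTotal k Y} {U : Set (CotangentTotal k Y)} {N : Set M}

/-- The pullback of the form `λ - η` under the tube, extended by a cutoff function. -/
theorem IsTube.exists_form (hT : IsTube (d := d) (k := k) ι R Ex Θ U N) (μ : OneForm k Y) {χ : M → ℝ}
    (hχ : ContMDiff (𝓡 d) 𝓘(ℝ, ℝ) ∞ χ) {K : Set M} (hK : IsCompact K) (hKN : K ⊆ N)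
    (h0 : ∀ x ∉ K, χ x = 0) : ∃ β : OneForm d M, ∀ z, β.cov z =
      χ z • (μ.cov (Θ z).proj - (Θ z).cov).comp (mD (𝓡 d) (𝓡 k) (fun z => (Θ z).proj) z) := by
  have hg : ContMDiff (𝓡 d) (cotangentModel d) ∞ (fun z : M => mkCot z
      (χ z • (μ.cov (Θ z).proj - (Θ z).cov).comp (mD (𝓡 d) (𝓡 k) (fun z => (Θ z).proj) z))) := by
    intro z
    by_cases hz : z ∈ K
    · have hΘ := hT.contMDiffAt z (hKN hz)
      have hq := contMDiffAt_proj le_rfl hΘ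
      exact ContMDiffAt.mkCot_smul (y := fun z : M => z) le_rfl (hχ z) (contMDiffAt_mkCot_comp_mD hq
        (ContMDiffAt.mkCot_sub (y := fun z => (Θ z).proj) (c := fun z => μ.cov (Θ z).proj)
          (c' := fun z => (Θ z).cov) le_rfl ((μ.contMDiff _).comp z hq) hΘ))
    · refine (contMDiff_zeroSection z).congr_of_eventuallyEq ?_
      filter_upwards [hK.isClosed.isOpen_compl.mem_nhds hz] with x hx
      rw [h0 x hx, zero_smul]
  exact ⟨OneForm.ofMap _ hg fun x => rfl, fun x => rfl⟩

namespace IsTube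

theorem Θ_ι (hT : IsTube (d := d) (k := k) ι R Ex Θ U N) (h : IsFiberExp α ι Ex v) (y : Y) :
    Θ (ι y) = mkCot y 0 := by
  rw [← h.zero]
  exact hT.Θ_Ex _ (hT.zero_mem y) rfl

theorem ι_mem (hT : IsTube (d := d) (k := k) ι R Ex Θ U N) (h : IsFiberExp α ι Ex v) (y : Y) :
    ι y ∈ N := by
  rw [← h.zero]
  exact hT.mem_N _ (hT.zero_mem y) rfl

theorem mdifferentiableAt_proj (hT : IsTube (d := d) (k := k) ι R Ex Θ U N) {z : M} (hz : z ∈ N) :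
    MDifferentiableAt (𝓡 d) (𝓡 k) (fun z => (Θ z).proj) z :=
  (contMDiffAt_proj le_rfl (hT.contMDiffAt z hz)).mdiff

theorem mD_proj_ι (hT : IsTube (d := d) (k := k) ι R Ex Θ U N) (h : IsFiberExp α ι Ex v) (y : Y)
    (u : ℰ k) :
    mD (𝓡 d) (𝓡 k) (fun z => (Θ z).proj) (ι y) (mD (𝓡 k) (𝓡 d) ι y u) = u := by
  have h1 := mD_comp (hT.mdifferentiableAt_proj (hT.ι_mem h y))
    ((ι.contMDiff y).mdiff) rfl
  have h2 : (fun y => (Θ (ι y)).proj) = fun y => y := funext fun y => by rw [hT.Θ_ι h y]; rfl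
  rw [h2, mD_id] at h1
  exact (DFunLike.congr_fun h1 u).symm

theorem eventually_Θ_Ex (hT : IsTube (d := d) (k := k) ι R Ex Θ U N) (y : Y)
    {s : ℰ* k} (hs : s (R y) = 0) :
    ∀ᶠ r in 𝓝 (0 : ℝ), Θ (Ex (mkCot y (r • s))) = mkCot y (r • s) := by
  have hc : Continuous fun r : ℝ => (mkCot y (r • s) : CotangentTotal k Y) :=
    (contMDiff_fiber y).continuous.comp (by fun_prop)
  filter_upwards [hc.continuousAt.preimage_mem_nhds (hT.isOpen_U.mem_nhds (by
    rw [zero_smul]; exact hT.zero_mem y))] with r hr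
  refine hT.Θ_Ex _ hr ?_
  change (r • s) (R y) = 0
  rw [smul_apply, hs, smul_zero]

theorem mD_proj_fiber (hT : IsTube (d := d) (k := k) ι R Ex Θ U N) (h : IsFiberExp α ι Ex v) (y : Y)
    {s : ℰ* k} (hs : s (R y) = 0) :
    mD (𝓡 d) (𝓡 k) (fun z => (Θ z).proj) (ι y) (v y s) = 0 := by
  have hz : Ex (mkCot y ((0 : ℝ) • s)) = ι y := by rw [zero_smul, h.zero]
  have h1 := (h.hasVelocity y s).comp (f := fun z => (Θ z).proj) (I' := 𝓡 k)
    (by rw [hz]; exact hT.mdifferentiableAt_proj (hT.ι_mem h y))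
  rw [hz] at h1
  exact (h1.congr (c' := fun _ => y) ((hT.eventually_Θ_Ex y hs).mono fun r hr =>
    (congrArg (·.proj) hr).symm)).unique (hasVelocity_const _ _)

/-- `β` is the pullback of the form `λ - η` near the zero section. -/
def IsModelForm (β : OneForm d M) (μ : OneForm k Y) (Θ : M → CotangentTotal k Y) (z : M) : Prop :=
  ∀ᶠ z in 𝓝 z, β.cov z =
    (μ.cov (Θ z).proj - (Θ z).cov).comp (mD (𝓡 d) (𝓡 k) (fun z => (Θ z).proj) z)

/-- Vectors at `ι y` split into `ι_* u` and a fibre direction `v y s`. On the first both forms are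
`λ u`; on the second both vanish. -/
theorem cov_eq (hT : IsTube (d := d) (k := k) ι R Ex Θ U N) (h : IsFiberExp α ι Ex v)
    (hR : IsTransverseSection (α.pullback ι) L R)
    (hiso : (α.pullback ι).Involutive) (hinj : ∀ y, Function.Injective (mD (𝓡 k) (𝓡 d) ι y))
    (hdk : d + 1 = k + k) {y : Y} (hβ : IsModelForm β (α.pullback ι) Θ (ι y)) :
    β.cov (ι y) = α.cov (ι y) := by
  ext w
  obtain ⟨u, s, hs, rfl⟩ := h.exists_decomp hR hiso hinj hdk y w
  have h1 := DFunLike.congr_fun hβ.self_of_nhds (mD (𝓡 k) (𝓡 d) ι y u + v y s)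
  rw [ContinuousLinearMap.comp_apply, map_add (mD (𝓡 d) (𝓡 k) (fun z => (Θ z).proj) (ι y)),
    hT.mD_proj_ι h, hT.mD_proj_fiber h y hs, add_zero, hT.Θ_ι h] at h1
  rw [h1, map_add, h.cov_eq_zero, add_zero]
  exact congrArg (fun c => c u) (sub_zero ((α.pullback ι).cov y))

/-- Along a fibre the projection is constant and the covector `λ - r s` has the derivative `-s`. For
`u` in `ker λ` this is also the value of `dα`, by the choice of the fibre derivatives. -/
theorem extL_fiber (hT : IsTube (d := d) (k := k) ι R Ex Θ U N) (h : IsFiberExp α ι Ex v)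
    {y : Y} (hβ : IsModelForm β (α.pullback ι) Θ (ι y)) {s : ℰ* k}
    (hs : s (R y) = 0) (u : ℰ k) :
    β.extL (ι y) (v y s) (mD (𝓡 k) (𝓡 d) ι y u) = -s u := by
  have hΘ := hT.contMDiffAt _ (hT.ι_mem h y)
  have hq := contMDiffAt_proj le_rfl hΘ
  have hc : ContMDiffAt (𝓡 d) (cotangentModel k) ∞
      (fun z => mkCot (Θ z).proj ((α.pullback ι).cov (Θ z).proj - (Θ z).cov)) (ι y) :=
    ContMDiffAt.mkCot_sub (y := fun z => (Θ z).proj) (c := fun z => (α.pullback ι).cov (Θ z).proj)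
      (c' := fun z => (Θ z).cov) le_rfl (((α.pullback ι).contMDiff _).comp (ι y) hq) hΘ
  rw [OneForm.extL_of_eventually_eq hq hc hβ, hT.mD_proj_fiber h y hs, map_zero, sub_zero,
    hT.mD_proj_ι h]
  have hm := (((contMDiffAt_mkCot_iff le_rfl (mem_chart_source _ _)).1 hc).2).mdiff
  have hz : Ex (mkCot y ((0 : ℝ) • s)) = ι y := by rw [zero_smul, h.zero]
  have h1 := (h.hasVelocity y s).comp (f := fun z => ((α.pullback ι).cov (Θ z).proj -
    (Θ z).cov).comp (chartDInv (𝓡 k) (Θ (ι y)).proj (Θ z).proj))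
    (I' := 𝓘(ℝ, ℰ* k)) (by rw [hz]; exact hm)
  rw [hz] at h1
  have h2 : HasVelocity 𝓘(ℝ, ℰ* k)
      (fun r : ℝ => (α.pullback ι).cov y - r • s) (-s) 0 :=
    hasVelocity_iff_hasDerivAt.2 (by
      simpa using ((hasDerivAt_id (0 : ℝ)).smul_const s).const_sub ((α.pullback ι).cov y))
  rw [(h1.congr (c' := fun r : ℝ => (α.pullback ι).cov y - r • s)
    ((hT.eventually_Θ_Ex y hs).mono fun r hr => ?_)).unique h2, neg_apply]
  beta_reduce
  rw [hr, hT.Θ_ι h]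
  change _ = ((α.pullback ι).cov y - r • s).comp (chartDInv (𝓡 k) y y)
  rw [chartDInv_self, ContinuousLinearMap.comp_id]

/-- The forms `α + t (β - α)` are contact forms along the submanifold. -/
theorem contactPair (hT : IsTube (d := d) (k := k) ι R Ex Θ U N) (h : IsFiberExp α ι Ex v)
    (hα : IsContactForm α) (hι : IsCoisotropicEmbedding α ι)
    (hR : IsTransverseSection (α.pullback ι) L R)
    (hiso : (α.pullback ι).Involutive) (hinj : ∀ y, Function.Injective (mD (𝓡 k) (𝓡 d) ι y))
    (hdk : d + 1 = k + k) (hβ : ∀ y, IsModelForm β (α.pullback ι) Θ (ι y)) (τ : ℝ → ℝ) (t : ℝ)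
    (y : Y) : ContactPair (contactCov α (β - α) τ (t, ι y)) (contactExt α (β - α) τ (t, ι y)) := by
  have hcov : ∀ y, β.cov (ι y) = α.cov (ι y) := fun y => hT.cov_eq h hR hiso hinj hdk (hβ y)
  have hpull : β.pullback ι = α.pullback ι := OneForm.ext_cov fun y => by
    rw [OneForm.cov_pullback, OneForm.cov_pullback, hcov]
  -- `dα` and `dβ` agree as soon as one argument is tangent to the foliation. Nothing is known about
  -- pairs of fibre directions, and nondegeneracy does not need them: coisotropy makes a degenerate
  -- vector tangent to the foliation, and the fibre directions then show that it is zero.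
  have hext : ∀ w u, (α.pullback ι).cov y u = 0 →
      contactExt α (β - α) τ (t, ι y) w (mD (𝓡 k) (𝓡 d) ι y u) =
      α.extL (ι y) w (mD (𝓡 k) (𝓡 d) ι y u) := by
    intro w u hu
    have h1 : (β - α).extL (ι y) w (mD (𝓡 k) (𝓡 d) ι y u) = 0 := by
      rw [OneForm.extL_sub, sub_apply, sub_apply, sub_eq_zero]
      obtain ⟨u', s, hs, rfl⟩ := h.exists_decomp hR hiso hinj hdk y w
      rw [map_add, map_add, add_apply, add_apply, hT.extL_fiber h (hβ y) hs, h.extL_eq y s u hu,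
        ← OneForm.extL_pullback, ← OneForm.extL_pullback, hpull]
    change α.extL (ι y) w _ + τ t * (β - α).extL (ι y) w _ = _
    rw [h1, mul_zero, add_zero]
  have hext' : ∀ w u, (α.pullback ι).cov y u = 0 →
      contactExt α (β - α) τ (t, ι y) (mD (𝓡 k) (𝓡 d) ι y u) w =
      -α.extL (ι y) w (mD (𝓡 k) (𝓡 d) ι y u) := by
    intro w u hu
    rw [← hext w u hu]
    change α.extL (ι y) _ w + τ t * (β - α).extL (ι y) _ w =
      -(α.extL (ι y) w _ + τ t * (β - α).extL (ι y) w _)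
    rw [OneForm.extL_antisymm α _ _ w, OneForm.extL_antisymm (β - α) _ _ w]
    ring
  have hc : contactCov α (β - α) τ (t, ι y) = α.cov (ι y) := by
    simp only [contactCov, OneForm.cov_sub, hcov, sub_self, smul_zero, add_zero]
  rw [hc]
  refine ⟨(hα.isContactAt (ι y)).1, fun w hw hw' => ?_⟩
  obtain ⟨u, hu⟩ := hι.2 y w hw fun u hu => by
    have h1 := hw' (mD (𝓡 k) (𝓡 d) ι y u) hu
    rwa [hext w u hu] at h1
  have hu' : mD (𝓡 k) (𝓡 d) ι y u = w := hu
  have hu0 : (α.pullback ι).cov y u = 0 := (congrArg (α.cov (ι y)) hu').trans hw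
  have hs : ∀ s : ℰ* k, s u = 0 := by
    intro s
    have h1 := hw' (v y s) (h.cov_eq_zero y s)
    rwa [← hu', hext' _ _ hu0, h.extL_eq y s u hu0, neg_neg] at h1
  have : ∀ u : ℰ k,
      (∀ s : ℰ* k, s u = 0) → u = 0 := fun u hs => by
    by_contra hne
    obtain ⟨s, hs'⟩ := SeparatingDual.exists_ne_zero (R := ℝ) hne
    exact hs' (hs s)
  rw [← hu', this u hs]
  exact (mD (𝓡 k) (𝓡 d) ι y).map_zero

end IsTube

end Tube

/-! ### Moser's method for contact planes -/

section Moser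

variable {d : ℕ} {M : Type*} [TopologicalSpace M] [T2Space M]
  [ChartedSpace (ℰ d) M] [IsManifold (𝓡 d) ∞ M]

theorem eventually_contactCov_ne_zero {α δ : OneForm d M} {τ : ℝ → ℝ} (hτ : ContDiff ℝ ∞ τ)
    {p : ℝ × M} (hp : contactCov α δ τ p ≠ 0) : ∀ᶠ q in 𝓝 p, contactCov α δ τ q ≠ 0 := by
  have hx := mem_chart_source (ℰ d) p.2
  have h1 : ContMDiffAt (𝓘(ℝ, ℝ).prod (𝓡 d)) (cotangentModel d) ∞
      (fun q : ℝ × M => mkCot q.2 (contactCov α δ τ q)) p :=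
    ContMDiffAt.mkCot_add (y := fun q : ℝ × M => q.2) (c := fun q => α.cov q.2) le_rfl
      ((α.contMDiff _).comp p contMDiffAt_snd)
      (ContMDiffAt.mkCot_smul (y := fun q : ℝ × M => q.2) (c := fun q => δ.cov q.2) le_rfl
        (hτ.contMDiff.contMDiffAt.comp p contMDiffAt_fst) ((δ.contMDiff _).comp p contMDiffAt_snd))
  have h2 := ((contMDiffAt_mkCot_iff le_rfl hx).1 h1).2.continuousAt
  have h3 := h2.eventually_ne (y := 0) (by
    rw [chartDInv_self, ContinuousLinearMap.comp_id]; exact hp)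
  filter_upwards [h3] with q hq h0
  exact hq (by rw [h0, ContinuousLinearMap.zero_comp])

/-- Moser's method: contact forms that agree on a compact set, with contact forms as convex
combinations, have the same kernel near this set up to a diffeomorphism. -/
theorem exists_diffeomorph_of_contactPair [LocallyCompactSpace M] [SigmaCompactSpace M]
    {α β : OneForm d M} {C : Set M} (hC : IsCompact C) (hcov : ∀ x ∈ C, β.cov x = α.cov x)
    (hpair : ∀ t, ∀ x ∈ C, ContactPair (contactCov α (β - α) Real.smoothTransition (t, x))
      (contactExt α (β - α) Real.smoothTransition (t, x))) :
    ∃ Φ : Diffeomorph (𝓡 d) (𝓡 d) M M ∞, (∀ x ∈ C, Φ x = x) ∧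
      ∀ x ∈ C, ∀ᶠ z in 𝓝 x, ∀ v, α.cov z v = 0 ↔ β.cov (Φ z) (mD (𝓡 d) (𝓡 d) Φ z v) = 0 := by
  set τ := Real.smoothTransition with hτdef
  set δ := β - α with hδ
  have hτ : ContDiff ℝ ∞ τ := Real.smoothTransition.contDiff
  have hh : ContMDiff (𝓘(ℝ, ℝ).prod (𝓡 d)) 𝓘(ℝ, ℝ) ∞ (fun _ : ℝ × M => (0 : ℝ)) := contMDiff_const
  -- The Hamiltonian is zero, so the field lies in the kernels of the interpolating forms.
  let F := contactField α δ τ (fun _ => 0)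
  let good : ℝ × M → Prop := fun p => (ContMDiffAt (𝓘(ℝ, ℝ).prod (𝓡 d)) (𝓡 d).tangent ∞
      (fun p : ℝ × M => mkTan (𝓡 d) p.2 (F p.1 p.2)) p ∧
      ∀ v, IsContactVector α δ τ (fun _ => 0) p v ↔ v = F p.1 p.2) ∧ contactCov α δ τ p ≠ 0
  have hgood : ∀ t, ∀ x ∈ C, ∀ᶠ p in 𝓝 (t, x), good p := fun t x hx =>
    (contactField_spec hτ hh (hpair t x hx)).and (eventually_contactCov_ne_zero hτ (hpair t x hx).1)
  let G : Set (ℝ × M) := {p | ∀ᶠ q in 𝓝 p, good q}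
  have hG : IsOpen G := isOpen_iff_mem_nhds.2 fun p hp => eventually_eventually_nhds.2 hp
  obtain ⟨χ, K, hχ, hK, hKG, hχ1, hχ0, -⟩ := exists_contMDiff_cutoff (I := 𝓘(ℝ, ℝ).prod (𝓡 d))
    (C := Icc (-1 : ℝ) 2 ×ˢ C) (U := G) (isCompact_Icc.prod hC) hG fun p hp => hgood p.1 p.2 hp.2
  let V : ℝ → ∀ x : M, TangentSpace (𝓡 d) x := fun t x => χ (t, x) • F t x
  have hV : ContMDiff (𝓘(ℝ, ℝ).prod (𝓡 d)) (𝓡 d).tangent ∞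
      (fun p : ℝ × M => mkTan (𝓡 d) p.2 (V p.1 p.2)) := by
    intro p
    by_cases hp : p ∈ K
    · exact ContMDiffAt.mkTan_smul (y := fun p : ℝ × M => p.2) le_rfl (hχ p)
        (hKG hp).self_of_nhds.1.1
    · have h0 : ContMDiffAt (𝓘(ℝ, ℝ).prod (𝓡 d)) (𝓡 d).tangent ∞
          (fun p : ℝ × M => mkTan (𝓡 d) p.2 (0 : ℰ d)) p :=
        ((Bundle.contMDiff_zeroSection ℝ (fun x : M => TangentSpace (𝓡 d) x)) p.2).comp p
          contMDiffAt_snd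
      refine h0.congr_of_eventuallyEq ?_
      filter_upwards [hK.isClosed.isOpen_compl.mem_nhds hp] with q hq
      refine congrArg (mkTan (𝓡 d) q.2) ?_
      change χ q • F q.1 q.2 = 0
      rw [hχ0 q hq, zero_smul]
  have hVK : ∀ t x, (t, x) ∉ K → V t x = 0 := fun t x hx => by
    change χ (t, x) • F t x = 0
    rw [hχ0 _ hx, zero_smul]
  obtain ⟨T, hT⟩ := ((hK.image continuous_fst).isBounded).exists_norm_le
  obtain ⟨φ, hφ, hφ0, hφv, hφu⟩ := exists_flow_of_compact_support V hV (hK.image continuous_snd)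
    (fun t x hx => hVK t x fun h => hx ⟨_, h, rfl⟩) (T := T)
    (fun t x ht => hVK t x fun h => (hT t ⟨_, h, rfl⟩).not_gt ht)
  -- On `C` the two forms agree, so zero solves the equations and the flow fixes `C`.
  have hVC : ∀ t, ∀ x ∈ C, V t x = 0 := by
    intro t x hx
    by_cases hp : (t, x) ∈ K
    · have h1 : IsContactVector α δ τ (fun _ => 0) (t, x) 0 := by
        refine ⟨map_zero _, fun w _ => ?_⟩
        have h2 : mD (𝓡 d) 𝓘(ℝ, ℝ) (fun _ : M => (0 : ℝ)) x = 0 := mfderiv_const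
        rw [map_zero, contactRhs, h2, hδ, OneForm.cov_sub, hcov x hx, sub_self, smul_zero, neg_zero,
          sub_zero]
      have h2 := ((hKG hp).self_of_nhds.1.2 0).1 h1
      change χ (t, x) • F t x = 0
      rw [← show (0 : ℰ d) = F t x from h2]
      exact smul_zero (A := ℰ d) _
    · exact hVK t x hp
  have hfix : ∀ x ∈ C, ∀ t, φ t x = x := by
    intro x hx t
    exact (hφu (a := -(|t| + 1)) (b := |t| + 1) (t₀ := 0) (c := fun _ => x) (x := x)
      ⟨by linarith [abs_nonneg t], by linarith [abs_nonneg t]⟩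
      (fun s _ => by
        have h1 := hVC s x hx
        change HasVelocity (𝓡 d) (fun _ => x) (V s x : ℰ d) s
        rw [h1]; exact hasVelocity_const x s) (hφ0 x).symm t
      ⟨by linarith [neg_abs_le t], by linarith [le_abs_self t]⟩).symm
  have hid : ∀ x v, mD (𝓡 d) (𝓡 d) (φ 0) x v = v := fun x v => by
    rw [mD_congr (Filter.Eventually.of_forall hφ0), mD_id]; rfl
  have hc0 : ∀ x, contactCov α δ τ (0, x) = α.cov x := fun x => by
    simp only [contactCov, hτdef, Real.smoothTransition.zero, zero_smul, add_zero]
  have hc1 : ∀ x, contactCov α δ τ (1, x) = β.cov x := fun x => by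
    simp only [contactCov, hτdef, Real.smoothTransition.one, one_smul, hδ, OneForm.cov_sub,
      add_sub_cancel]
  refine ⟨φ 1, fun x hx => hfix x hx 1, fun x hx => ?_⟩
  -- Because `x` is fixed, nearby points remain, for all times of a compact interval, in the region
  -- where the field is not cut off.
  have hev : ∀ᶠ z in 𝓝 x, ∀ t ∈ Icc (-1 : ℝ) 2, ∀ᶠ p in 𝓝 (t, z),
      χ (p.1, φ p.1 p.2) = 1 ∧ good (p.1, φ p.1 p.2) := by
    refine eventually_forall_of_isCompact isCompact_Icc (P := fun z t => ∀ᶠ p in 𝓝 (t, z),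
      χ (p.1, φ p.1 p.2) = 1 ∧ good (p.1, φ p.1 p.2)) fun t ht => ?_
    have h1 : ∀ᶠ p in 𝓝 (t, x), χ (p.1, φ p.1 p.2) = 1 ∧ good (p.1, φ p.1 p.2) := by
      have h2 : ContinuousAt (fun p : ℝ × M => (p.1, φ p.1 p.2)) (t, x) :=
        (continuous_fst.prodMk hφ.continuous).continuousAt
      refine h2.eventually (p := fun q => χ q = 1 ∧ good q) ?_
      simp only [hfix x hx]
      exact (hχ1 _ ⟨ht, hx⟩).and (hgood t x hx)
    rw [← nhds_prod_eq]
    exact (continuous_swap.tendsto (x, t)).eventually (eventually_eventually_nhds.2 h1)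
  filter_upwards [hev] with z hz
  have key : ∀ s ∈ Ioo (-1 : ℝ) 2, ∀ v, contactCov α δ τ (s, φ s z)
      (mD (𝓡 d) (𝓡 d) (φ s) z v) = 0 → ∀ r ∈ Ioo (-1 : ℝ) 2, contactCov α δ τ (r, φ r z)
      (mD (𝓡 d) (𝓡 d) (φ r) z v) = 0 := by
    intro s hs v hv
    refine contact_transport (α := α) (δ := δ) hτ hh hφ hs (x := z) (v := v) (fun t ht => ?_)
      (fun t ht => (hz t (Ioo_subset_Icc_self ht)).self_of_nhds.2.2)
      (fun t _ w => ⟨_, (φ t).mD_apply_symm z w⟩) hv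
    filter_upwards [hz t (Ioo_subset_Icc_self ht)] with p hp
    refine ⟨_, hφv p.2 p.1, (hp.2.1.2 _).2 ?_⟩
    change χ (p.1, φ p.1 p.2) • F p.1 (φ p.1 p.2) = F p.1 (φ p.1 p.2)
    rw [hp.1, one_smul]
  have h0m : (0 : ℝ) ∈ Ioo (-1 : ℝ) 2 := by constructor <;> norm_num
  have h1m : (1 : ℝ) ∈ Ioo (-1 : ℝ) 2 := by constructor <;> norm_num
  intro v
  constructor
  · intro h1
    have h2 := key 0 h0m v (by
      rw [hc0, hφ0]; exact (congrArg (α.cov z) (hid z v)).trans h1) 1 h1m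
    rwa [hc1] at h2
  · intro h1
    have h2 := key 1 h1m v (by rw [hc1]; exact h1) 0 h0m
    rw [hc0, hφ0] at h2
    exact (congrArg (α.cov z) (hid z v)).symm.trans h2

end Moser

/-! ### Existence of standard neighbourhoods -/

section Existence

variable {d k : ℕ}
  {M : Type*} [TopologicalSpace M] [T2Space M] [ChartedSpace (ℰ d) M]
  [IsManifold (𝓡 d) ∞ M]
  {Y : Type*} [TopologicalSpace Y] [CompactSpace Y] [ChartedSpace (ℰ k) Y]
  [IsManifold (𝓡 k) ∞ Y] {α β : OneForm d M} {ι : ContMDiffMap (𝓡 k) (𝓡 d) Y M ∞}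
  {L : PlaneField k Y} {R : Y → ℰ k}
  {Ex : CotangentTotal k Y → M} {v : Y → ℰ* k → ℰ d}
  {Θ : M → CotangentTotal k Y} {U : Set (CotangentTotal k Y)} {N : Set M}

/-- The required map is `Θ ∘ Φ`, where `Φ` corrects the contact planes of the tube. Passing to the
interior of a compact neighbourhood of `ι(Y)`, inside the set where everything holds, gives relative
compactness. -/
theorem IsTube.exists_standardNbhd [LocallyCompactSpace M]
    (hT : IsTube (d := d) (k := k) ι R Ex Θ U N)
    (h : IsFiberExp α ι Ex v) (hR : IsTransverseSection (α.pullback ι) L R)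
    (hβ : ∀ y, IsModelForm β (α.pullback ι) Θ (ι y)) {Φ : Diffeomorph (𝓡 d) (𝓡 d) M M ∞}
    (hΦι : ∀ y, Φ (ι y) = ι y)
    (hΦ : ∀ y, ∀ᶠ z in 𝓝 (ι y), ∀ v, α.cov z v = 0 ↔
      β.cov (Φ z) (mD (𝓡 d) (𝓡 d) Φ z v) = 0) {O : Set M} (hO : IsOpen O) (hιO : range ι ⊆ O) :
    ∃ 𝒩 : StandardNbhd α ι L, 𝒩.N ⊆ O := by
  let P : M → Prop := fun z => z ∈ O ∧ Φ z ∈ N ∧ (∀ v, α.cov z v = 0 ↔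
    ((α.pullback ι).cov (Θ (Φ z)).proj - (Θ (Φ z)).cov) (mD (𝓡 d) (𝓡 k) (fun z => (Θ z).proj) (Φ z)
      (mD (𝓡 d) (𝓡 d) Φ z v)) = 0)
  have hP : ∀ y, ∀ᶠ z in 𝓝 (ι y), P z := by
    intro y
    have hc : ContinuousAt Φ (ι y) := Φ.continuous.continuousAt
    filter_upwards [hO.mem_nhds (hιO ⟨y, rfl⟩), hc.eventually (p := fun z => z ∈ N) (by
      rw [hΦι]; exact hT.isOpen_N.mem_nhds (hT.ι_mem h y)), hΦ y,
      hc.eventually (p := fun z => β.cov z = _) (by rw [hΦι]; exact hβ y)] with z h1 h2 h3 h4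
    refine ⟨h1, h2, fun v => ?_⟩
    rw [h3, h4]; rfl
  obtain ⟨K, hK, hιK, hKP⟩ := exists_compact_between (isCompact_range ι.contMDiff.continuous)
    (U := {z | ∀ᶠ x in 𝓝 z, P x})
    (isOpen_iff_mem_nhds.2 fun z hz => eventually_eventually_nhds.2 hz)
    (by rintro _ ⟨y, rfl⟩; exact hP y)
  have hKP' : ∀ z ∈ interior K, P z := fun z hz => (hKP (interior_subset hz)).self_of_nhds
  have hsm : ∀ z ∈ interior K, ContMDiffAt (𝓡 d) (cotangentModel k) ∞ (fun z => Θ (Φ z)) z :=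
    fun z hz => (hT.contMDiffAt _ (hKP' z hz).2.1).comp z (Φ.contMDiff z)
  -- The smooth left inverse `Φ⁻¹ ∘ Ex` yields both injectivity and the immersion property.
  have hEx : ∀ z ∈ interior K, Φ.symm (Ex (Θ (Φ z))) = z := fun z hz => by
    rw [hT.Ex_Θ _ (hKP' z hz).2.1]; exact Φ.symm_apply_apply z
  have hL : ∀ p : CotangentTotal k Y, (∀ v ∈ L p.proj, p.snd v = 0) ↔ fiberPairing R p = 0 :=
    fun p => hR.annihilator_iff p.proj p.cov
  refine ⟨{
    N := interior K
    isOpen_N := isOpen_interior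
    isCompact_closure_N := hK.of_isClosed_subset isClosed_closure
      (hK.isClosed.closure_subset_iff.2 interior_subset)
    Θ := fun z => Θ (Φ z)
    contMDiffOn_Θ := fun z hz => (hsm z hz).contMDiffWithinAt
    injOn_Θ := fun z hz z' hz' hzz => by
      have h1 : Θ (Φ z) = Θ (Φ z') := hzz
      rw [← hEx z hz, h1, hEx z' hz']
    immersion_Θ := fun z hz => ?_
    image_Θ := ⟨U ∩ (fun p => Φ.symm (Ex p)) ⁻¹' interior K, hT.isOpen_U.inter
      (isOpen_interior.preimage (Φ.symm.continuous.comp h.contMDiff.continuous)), ?_⟩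
    mem_N := fun y => hιK ⟨y, rfl⟩
    Θ_zero := fun y => by
      rw [hΦι]; exact hT.Θ_ι h y
    contact_Θ := fun z hz v => ?_ }, fun z hz => (hKP' z hz).1⟩
  · have h1 := mD_comp (Φ.symm.mdifferentiable (by simp) _ |>.comp _
      (h.contMDiff.mdifferentiable (by simp) (Θ (Φ z)))) ((hsm z hz).mdiff) rfl
    have h2 : (fun z => (Φ.symm ∘ Ex) (Θ (Φ z))) =ᶠ[𝓝 z] fun z => z :=
      Filter.mem_of_superset (isOpen_interior.mem_nhds hz) hEx
    rw [mD_congr h2, mD_id] at h1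
    refine Function.LeftInverse.injective (g := mD (cotangentModel k) (𝓡 d) (Φ.symm ∘ Ex) (Θ (Φ z)))
      fun w => ?_
    exact (DFunLike.congr_fun h1 w).symm
  · ext p
    refine Iff.trans ?_ (and_congr_right' (hL p)).symm
    constructor
    · rintro ⟨z, hz, rfl⟩
      have h1 := (hKP' z hz).2.1
      exact ⟨⟨hT.mem_U _ h1, by rw [mem_preimage]; beta_reduce; rwa [hEx z hz]⟩,
        hT.fiberPairing_eq _ h1⟩
    · rintro ⟨⟨h1, h2⟩, h3⟩
      refine ⟨Φ.symm (Ex p), h2, ?_⟩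
      beta_reduce
      rw [show Φ (Φ.symm (Ex p)) = Ex p from Φ.apply_symm_apply _]
      exact hT.Θ_Ex p h1 h3
  · have h1 := mD_comp (hT.mdifferentiableAt_proj (hKP' z hz).2.1)
      ((Φ.contMDiff z).mdiff) rfl
    refine ((hKP' z hz).2.2 v).trans (Iff.of_eq (congrArg (· = 0) ?_))
    exact congrArg ((α.pullback ι).cov (Θ (Φ z)).proj - (Θ (Φ z)).cov) (DFunLike.congr_fun h1 v).symm

end Existence

/-- Coisotropic submanifolds with nonsingular Legendrian foliation have standard neighbourhoods. -/
theorem exists_standardNbhd {n : ℕ}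
    {M : Type*} [TopologicalSpace M] [T2Space M] [SecondCountableTopology M]
    [ChartedSpace (ℰ (2 * n + 1)) M] [IsManifold (𝓡 (2 * n + 1)) ∞ M]
    {Y : Type*} [TopologicalSpace Y] [CompactSpace Y] [T2Space Y] [Nonempty Y]
    [ChartedSpace (ℰ (n + 1)) Y] [IsManifold (𝓡 (n + 1)) ∞ Y]
    {α : OneForm (2 * n + 1) M} (hα : IsContactForm α)
    {ι : ContMDiffMap (𝓡 (n + 1)) (𝓡 (2 * n + 1)) Y M ∞} (hι : IsCoisotropicEmbedding α ι)
    (hns : ∀ y, (α.pullback ι) y ≠ 0)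
    {L : PlaneField (n + 1) Y} {R : Y → EuclideanSpace ℝ (Fin (n + 1))}
    (hR : IsTransverseSection (α.pullback ι) L R) {O : Set M} (hO : IsOpen O) (hιO : range ι ⊆ O) :
    ∃ 𝒩 : StandardNbhd α ι L, 𝒩.N ⊆ O := by
  have : LocallyCompactSpace M :=
    ChartedSpace.locallyCompactSpace (ℰ (2 * n + 1)) M
  have hdk : 2 * n + 1 + 1 = n + 1 + (n + 1) := by omega
  have hiso := (isCoisotropicEmbedding_iff_involutive rfl rfl hα hι.1 hns).1 hι
  have hinj := hι.1.isImmersion.injective_mD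
  obtain ⟨Ex, hE1, hE2, hE3⟩ := exists_fiberExp hα hι.1.isImmersion
  choose v hv1 hv2 hv3 using hE3
  have h : IsFiberExp α ι Ex v := ⟨hE1, hE2, hv1, hv2, hv3⟩
  obtain ⟨Θ, U, N, hT⟩ := h.exists_isTube hR hι.1.isEmbedding.injective hiso hinj hdk
  have hιc := isCompact_range ι.contMDiff.continuous
  obtain ⟨χ, K, hχ, hK, hKN, hχ1, hχ0, -⟩ := exists_contMDiff_cutoff (I := 𝓡 (2 * n + 1)) hιc
    hT.isOpen_N (by rintro _ ⟨y, rfl⟩; exact hT.ι_mem h y)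
  obtain ⟨β, hβ⟩ := hT.exists_form (α.pullback ι) hχ hK hKN hχ0
  have hβ' : ∀ y, IsTube.IsModelForm β (α.pullback ι) Θ (ι y) := fun y =>
    (hχ1 _ ⟨y, rfl⟩).mono fun z hz => by rw [hβ, hz, one_smul]
  obtain ⟨Φ, hΦ1, hΦ2⟩ := exists_diffeomorph_of_contactPair (α := α) (β := β) hιc
    (by rintro _ ⟨y, rfl⟩; exact hT.cov_eq h hR hiso hinj hdk (hβ' y))
    (by rintro t _ ⟨y, rfl⟩; exact hT.contactPair h hα hι hR hiso hinj hdk hβ' _ t y)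
  exact hT.exists_standardNbhd h hR hβ' (fun y => hΦ1 _ ⟨y, rfl⟩) (fun y => hΦ2 _ ⟨y, rfl⟩) hO hιO

/-! ### Assembly of the theorem -/

theorem mainTheorem1 (n : ℕ)
    {M : Type*} [TopologicalSpace M] [T2Space M] [SecondCountableTopology M]
    [ChartedSpace (EuclideanSpace ℝ (Fin (2 * n + 1))) M] [IsManifold (𝓡 (2 * n + 1)) ∞ M]
    {Y : Type*} [TopologicalSpace Y] [CompactSpace Y] [T2Space Y] [Nonempty Y]
    [ChartedSpace (EuclideanSpace ℝ (Fin (n + 1))) Y] [IsManifold (𝓡 (n + 1)) ∞ Y]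
    (α : OneForm (2 * n + 1) M) (hα : IsContactForm α)
    (ι : ContMDiffMap (𝓡 (n + 1)) (𝓡 (2 * n + 1)) Y M ∞) (hι : IsCoisotropicEmbedding α ι)
    (hns : ∀ y, (α.pullback ι) y ≠ 0)
    (L : PlaneField (n + 1) Y) (hL : IsLineField L)
    (hLF : ∀ y, IsCompl (L y) ((α.pullback ι).kerField y)) :
    (∀ O : Set M, IsOpen O → range ι ⊆ O → ∃ 𝒩 : StandardNbhd α ι L, 𝒩.N ⊆ O) ∧
    ∀ 𝒩 : StandardNbhd α ι L,
      ContainsC1CloseCoisotropics α ι 𝒩.coisotropics ∧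
      ContainsC1CloseFoliations (α.pullback ι) 𝒩.foliations ∧
      (∀ᶠ p in c1Nhds ι ×ˢ
          c1Nhds (ContMDiffMap.id : ContMDiffMap (𝓡 (2 * n + 1)) (𝓡 (2 * n + 1)) M M ∞),
        ∀ f : Diffeomorph (𝓡 (2 * n + 1)) (𝓡 (2 * n + 1)) M M ∞,
          IsCoisotropicEmbedding α p.1 →
            (f : ContMDiffMap (𝓡 (2 * n + 1)) (𝓡 (2 * n + 1)) M M ∞) = p.2 → IsContacto α f →
            f '' range p.1 ∈ 𝒩.coisotropics) ∧
      (∀ᶠ p in (α.pullback ι).c1Nhds ×ˢ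
          c1Nhds (ContMDiffMap.id : ContMDiffMap (𝓡 (n + 1)) (𝓡 (n + 1)) Y Y ∞),
        ∀ f : Diffeomorph (𝓡 (n + 1)) (𝓡 (n + 1)) Y Y ∞,
          IsFoliation p.1.kerField →
            (f : ContMDiffMap (𝓡 (n + 1)) (𝓡 (n + 1)) Y Y ∞) = p.2 →
            ∃ G ∈ 𝒩.foliations, CarriesTo f p.1.kerField G) ∧
      ∃ e : 𝒩.coisotropics ≃ 𝒩.foliations,
        (∀ (S : 𝒩.coisotropics) (s : OneForm (n + 1) Y), 𝒩.IsSection s → S.1 = 𝒩.graph s →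
          (e S).1 = (α.pullback ι - s).kerField) ∧
        ∀ 𝒰 : Set 𝒩.coisotropics,
          (ContainsC1CloseCoisotropics α ι (Subtype.val '' 𝒰) ↔
            ContainsC1CloseFoliations (α.pullback ι) (Subtype.val '' (e '' 𝒰))) ∧
          ∀ 𝒲 ∈ c1Nhds (ContMDiffMap.id : ContMDiffMap (𝓡 (2 * n + 1)) (𝓡 (2 * n + 1)) M M ∞),
          ∀ 𝒲' ∈ c1Nhds (ContMDiffMap.id : ContMDiffMap (𝓡 (n + 1)) (𝓡 (n + 1)) Y Y ∞),
            ∃ ē : Quotient ((𝒩.coisotropicGauge 𝒲).comap (Subtype.val : 𝒰 → 𝒩.coisotropics)) ≃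
                Quotient ((𝒩.foliationGauge 𝒲').comap
                  (Subtype.val : (e '' 𝒰 : Set 𝒩.foliations) → 𝒩.foliations)),
              ∀ (S : 𝒩.coisotropics) (hS : S ∈ 𝒰),
                ē (Quotient.mk _ ⟨S, hS⟩) = Quotient.mk _ ⟨e S, mem_image_of_mem e hS⟩ := by
  have hdk : 2 * n + 1 + 1 = n + 1 + (n + 1) := by omega
  obtain ⟨R, hR⟩ := exists_isTransverseSection hL hLF
  have : Nonempty M := (inferInstance : Nonempty Y).map ι
  refine ⟨fun O hO hιO => exists_standardNbhd hα hι hns hR hO hιO, fun 𝒩 => ?_⟩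
  obtain ⟨e, he⟩ := 𝒩.exists_equiv rfl rfl hα hR hdk
  refine ⟨𝒩.containsC1CloseCoisotropics hR, 𝒩.containsC1CloseFoliations hR,
    𝒩.eventually_contacto_image_mem hα hR, 𝒩.eventually_diffeomorph_carries hR, e, he,
    fun 𝒰 => ⟨𝒩.containsC1Close_iff rfl rfl hα hR hdk he 𝒰, fun 𝒲 h𝒲 𝒲' h𝒲' =>
      StandardNbhd.exists_quotient_equiv (fun S₀ S₁ =>
        ⟨fun h => h.foliationMove hR hdk he, fun h => h.coisotropicMove rfl rfl hα hR hdk he⟩)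
        𝒰 h𝒲 h𝒲'⟩⟩
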